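/- **Conventions.** For a self-adjoint, possibly unbounded operator $D$ on a complex Hilbert space $\mathcal H$, a bounded self-adjoint operator $\mathcal K$ and $\beta>0$, put $$F_{\pm}=\frac{\mp1}{1+e^{\pm\beta D}},\qquad \mathcal K_{iu}=e^{-uD}\mathcal K e^{uD},$$ where the factors $e^{\pm uD}$ are always composed with the adjacent Fermi factors $F_\pm$, so that only bounded operators occur. Let $\sigma(s)\in\{+,-\}$ be the sign of $s$. The relative entropy series is $$\mathscr S_{0,\mathcal K}=\mathrm{Tr}\Big(\beta\mathcal K\sum_{n>0}\frac{(-1)^n}{n+1}\int_{(0,\beta)^n}F_-\Big(\prod_{j=1}^{n-1}\mathcal K_{iu_j}F_{\sigma(u_j-u_{j+1})}\Big)\mathcal K_{iu_n}F_+\,du_1\cdots du_n\Big),$$ and $$\mathfrak S_1=\beta\mathcal K\int_0^1\Big(\frac{e^{-\beta D}}{1+e^{-\beta D}}-\frac{e^{-\beta(D+u\mathcal K)}}{1+e^{-\beta(D+u\mathcal K)}}\Big)du .$$ Operator-valued integrals are taken in the strong sense. **Dirac setting.** Let $m>0$, $\varepsilon>0$, $\mathcal H=L^2(\mathbb R^3,\mathbb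 C^4)$, and let $D=-i\vec\alpha\cdot\vec\partial+m\gamma^0$ be the free Dirac operator. Let $A=(A^0,\vec A)$ be a real, smooth potential on $\mathbb R\times\mathbb R^3$, of compact spatial support, vanishing for $t<-\varepsilon$ and constant in time for $t>0$. Let $\mathsf A(t)$ be multiplication by $A^0(t,\cdot)+\vec\alpha\cdot\vec A(t,\cdot)$, let $V_t(A)$ be the unitary operator $$V_t(A)=\sum_{n\ge0}i^n\int_{t_1<\dots<t_n<t}e^{iDt_1}\mathsf A(t_1)e^{iD(t_2-t_1)}\cdots\mathsf A(t_n)e^{-iDt_n}\,dt_1\cdots dt_n,$$ and let $$\mathcal K=\int_{-\varepsilon}^0V_s(A)\,e^{isD}\,\partial_s\mathsf A(s)\,e^{-isD}\,V_s(A)^{-1}\,ds .$$ **Theorem.** 1. *Let $D$ be self-adjoint and $\mathcal K$ bounded self-adjoint on a complex Hilbert space, $\beta>0$ and $\|\mathcal K\|<\beta^{-1}$. Then the series over $n$ in $\mathscr S_{0,\mathcal K}$ converges absolutely in operator norm, the operator under the trace in $\mathscr S_{0,\mathcal K}$ equals $\mathfrak S_1$, and hence $\mathscr S_{0,\mathcal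 K}=\mathrm{Tr}(\mathfrak S_1)$ (one trace exists if and only if the other does). In particular all of this holds in the Dirac setting if $\|\mathcal K\|<\beta^{-1}$.* 2. *In the Dirac setting, let $\beta>0$ and suppose that $\mathcal K$ has in momentum space an integral kernel $\hat{\mathcal K}(p,q)$ (that is, $\widehat{\mathcal Kf}(p)=\int\hat{\mathcal K}(p,q)\hat f(q)\,dq$, with the unitary Fourier transform in which $-i\vec\partial$ becomes $p$) with $|\hat{\mathcal K}(p,q)|\le H(p-q)$ for almost all $p,q$, where $H\in L^1(\mathbb R^3)\cap L^2(\mathbb R^3)$, $\|H\|_1<\beta^{-1}$ and $\|H\|_2<\beta^{-1}$. Then $\mathfrak S_1$ is trace class, and $\sum_i\langle b_i,\mathfrak S_1b_i\rangle$ converges to the finite number $\mathscr S_{0,\mathcal K}$ for every orthonormal basis $(b_i)$ of $\mathcal H$.* 3. *Let $D$ and $\mathcal K$ be self-adjoint operators on a finite-dimensional Hilbert space, $\beta>0$, $A=(1+e^{-\beta D})^{-1}$ and $B=(1+e^{-\beta(D+\mathcal K)})^{-1}$. Then* $$\begin{aligned}\mathrm{Tr}(\mathfrak S_1)&=\mathrm{Tr}\Big(\beta\mathcal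 K\frac1{1+e^{\beta D}}+\log\big(1+e^{-\beta(D+\mathcal K)}\big)-\log\big(1+e^{-\beta D}\big)\Big)\\&=\mathrm{Tr}\big(A(\log A-\log B)+(1-A)(\log(1-A)-\log(1-B))\big).\end{aligned}$$ -/

import Mathlib

open MeasureTheory Set
open scoped FourierTransform InnerProductSpace ENNReal ContDiff

noncomputable section

namespace DiracEntropy

section Hilbert

variable {H : Type*} [NormedAddCommGroup H] [InnerProductSpace ℂ H] [CompleteSpace H]

/-! ### Functional calculus of an unbounded self-adjoint operator -/

/-- `Z` is the bounded transform `S (1 + S²)^(-1/2)` of the unbounded operator `S`: a self-adjoint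
contraction such that the graph of `S` is `{(√(1 - Z²) v, Z v) | v ∈ H}`
(note that `√(1 - Z²) = (1 + S²)^(-1/2)`). Every self-adjoint `S` has exactly one. -/
def IsBoundedTransform (S : H →ₗ.[ℂ] H) (Z : H →L[ℂ] H) : Prop :=
  IsSelfAdjoint Z ∧ ‖Z‖ ≤ 1 ∧
    ∀ x y : H, (x, y) ∈ S.graph ↔
      ∃ v : H, x = cfc (fun z : ℝ => √(1 - z ^ 2)) Z v ∧ y = Z v

open Classical in
/-- The bounded transform of a self-adjoint operator. -/
def boundedTransform (S : H →ₗ.[ℂ] H) : H →L[ℂ] H :=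
  if h : ∃ Z, IsBoundedTransform S Z then h.choose else 0

/-- The operator `g(S)`, for `S` self-adjoint (possibly unbounded) and `g : ℝ → ℝ` continuous with
finite limits at `±∞`. The map `z ↦ z / √(1 - z²)` inverts `x ↦ x / √(1 + x²)`, and `extendFrom`
puts the limits of `g` at `±∞` at the points `z = ±1`. -/
def fc (S : H →ₗ.[ℂ] H) (g : ℝ → ℝ) : H →L[ℂ] H :=
  cfc (extendFrom (Ioo (-1 : ℝ) 1) (fun z => g (z / √(1 - z ^ 2)))) (boundedTransform S)

/-! ### Operator-valued integrals, trace class operators, trace -/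

open Classical in
/-- The integral `∫ F(t) dμ(t)` of a family of bounded operators in the strong sense: the bounded
operator `T` with `T v = ∫ F(t) v dμ(t)` for all `v` (and `0` if there is no such operator). -/
def strongIntegral {ι : Type*} [MeasurableSpace ι] (μ : Measure ι) (F : ι → H →L[ℂ] H) :
    H →L[ℂ] H :=
  if h : ∃ T : H →L[ℂ] H, ∀ v, Integrable (fun t => F t v) μ ∧ T v = ∫ t, F t v ∂μ
  then h.choose else 0

theorem strongIntegral_eq {ι : Type*} [MeasurableSpace ι] {μ : Measure ι}
    {F : ι → H →L[ℂ] H} {T : H →L[ℂ] H}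
    (h : ∀ v, Integrable (fun t => F t v) μ ∧ T v = ∫ t, F t v ∂μ) : strongIntegral μ F = T := by
  have h' : ∃ T : H →L[ℂ] H, ∀ v, Integrable (fun t => F t v) μ ∧ T v = ∫ t, F t v ∂μ := ⟨T, h⟩
  rw [strongIntegral, dif_pos h']
  ext v
  rw [(h'.choose_spec v).2, (h v).2]

/-- `T` is trace class: `∑ᵢ ⟨bᵢ, |T| bᵢ⟩ < ∞` for an orthonormal basis `b`
(equivalently for all of them). -/
def IsTraceClass (T : H →L[ℂ] H) : Prop :=
  ∃ (w : Set H) (b : HilbertBasis w ℂ H), Summable fun i => (⟪b i, CFC.abs T (b i)⟫_ℂ).re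

/-- `Tr T = ∑ᵢ ⟨bᵢ, T bᵢ⟩`, for an arbitrarily chosen orthonormal basis `b`. -/
def trace (T : H →L[ℂ] H) : ℂ :=
  let b := (exists_hilbertBasis ℂ H).choose_spec.choose
  ∑' i, ⟪b i, T (b i)⟫_ℂ

/-! ### The relative entropy series and the operator `𝔖₁` -/

/-- The scalar Fermi factor `F₊(x) = -1 / (1 + e^{βx})`. -/
def fermiPlus (β x : ℝ) : ℝ := -1 / (1 + Real.exp (β * x))

/-- The scalar Fermi factor `F₋(x) = 1 / (1 + e^{-βx})`. -/
def fermiMinus (β x : ℝ) : ℝ := 1 / (1 + Real.exp (-β * x))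

/-- The bounded operator `e^{sD} F_{σ(s)}(D)`, with `σ(s)` the sign of `s`. -/
def propagator (β : ℝ) (D : H →ₗ.[ℂ] H) (s : ℝ) : H →L[ℂ] H :=
  fc D (fun x => Real.exp (s * x) * (if 0 < s then fermiPlus β x else fermiMinus β x))

/-- The integrand
`F₋ (∏_{j=1}^{n-1} K_{iu_j} F_{σ(u_j - u_{j+1})}) K_{iu_n} F₊` with `n = k + 1` and
`K_{iu} = e^{-uD} K e^{uD}`, the factors `e^{±uD}` being joined to the adjacent Fermi factors, so
that it is a product of bounded operators
`(F₋ e^{-u_1 D}) (∏_{j=1}^{n-1} K (e^{(u_j - u_{j+1}) D} F_{σ(u_j - u_{j+1})})) K (e^{u_n D} F₊)`. -/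
def seriesIntegrand (β : ℝ) (D : H →ₗ.[ℂ] H) (K : H →L[ℂ] H) (k : ℕ) (u : Fin (k + 1) → ℝ) :
    H →L[ℂ] H :=
  fc D (fun x => fermiMinus β x * Real.exp (-u 0 * x))
    * (List.ofFn fun j : Fin k => K * propagator β D (u j.castSucc - u j.succ)).prod
    * K * fc D (fun x => Real.exp (u (Fin.last k) * x) * fermiPlus β x)

/-- The term of order `n = k + 1` of the series:
`(-1)^n / (n + 1) ∫_{(0,β)^n} F₋ (∏_{j=1}^{n-1} K_{iu_j} F_{σ(u_j - u_{j+1})}) K_{iu_n} F₊ dU`. -/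
def seriesTerm (β : ℝ) (D : H →ₗ.[ℂ] H) (K : H →L[ℂ] H) (k : ℕ) : H →L[ℂ] H :=
  (((-1 : ℝ) ^ (k + 1) / ((k : ℝ) + 2) : ℝ) : ℂ) •
    strongIntegral (volume.restrict (Set.univ.pi fun _ : Fin (k + 1) => Ioo (0 : ℝ) β))
      (seriesIntegrand β D K k)

/-- The relative entropy
`Tr (β K ∑_{n>0} (-1)^n/(n+1) ∫_{(0,β)^n} F₋ (∏ K_{iu_j} F_{σ(u_j - u_{j+1})}) K_{iu_n} F₊ dU)`. -/
def relativeEntropy (β : ℝ) (D : H →ₗ.[ℂ] H) (K : H →L[ℂ] H) : ℂ :=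
  trace ((β : ℂ) • (K * ∑' k, seriesTerm β D K k))

/-- The operator `e^{-βS} / (1 + e^{-βS})`. -/
def fermiOp (β : ℝ) (S : H →ₗ.[ℂ] H) : H →L[ℂ] H :=
  fc S (fun x => Real.exp (-β * x) / (1 + Real.exp (-β * x)))

/-- `D + K`, on the domain of `D`, for a bounded everywhere defined operator `K`. -/
def perturb (D : H →ₗ.[ℂ] H) (K : H →L[ℂ] H) : H →ₗ.[ℂ] H :=
  D + K.toLinearMap.toPMap ⊤

/-- `𝔖₁ = β K ∫₀¹ (e^{-βD}/(1 + e^{-βD}) - e^{-β(D+uK)}/(1 + e^{-β(D+uK)})) du`. -/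
def entropyOp (β : ℝ) (D : H →ₗ.[ℂ] H) (K : H →L[ℂ] H) : H →L[ℂ] H :=
  (β : ℂ) • (K * strongIntegral (volume.restrict (Ioo (0 : ℝ) 1))
    (fun u => fermiOp β D - fermiOp β (perturb D ((u : ℂ) • K))))

end Hilbert

/-! ### The Dirac operator on `L²(ℝ³, ℂ⁴)` -/

/-- Three-dimensional space (positions or momenta). -/
abbrev Space := EuclideanSpace ℝ (Fin 3)

/-- The space `ℂ⁴` of spinors. -/
abbrev Spinor := EuclideanSpace ℂ (Fin 4)

/-- The one-particle Hilbert space `L²(ℝ³, ℂ⁴)`. -/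
abbrev OneParticle := Lp Spinor 2 (volume : Measure Space)

/-- The matrices `α¹, α², α³` (Dirac representation). -/
def diracAlpha : Fin 3 → Matrix (Fin 4) (Fin 4) ℂ :=
  ![!![0, 0, 0, 1; 0, 0, 1, 0; 0, 1, 0, 0; 1, 0, 0, 0],
    !![0, 0, 0, -Complex.I; 0, 0, Complex.I, 0; 0, -Complex.I, 0, 0; Complex.I, 0, 0, 0],
    !![0, 0, 1, 0; 0, 0, 0, -1; 1, 0, 0, 0; 0, -1, 0, 0]]

/-- The matrix `γ⁰` (Dirac representation). -/
def diracGamma0 : Matrix (Fin 4) (Fin 4) ℂ :=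
  !![1, 0, 0, 0; 0, 1, 0, 0; 0, 0, -1, 0; 0, 0, 0, -1]

/-- A complex `4 × 4` matrix as an operator on spinors. -/
def spinorOp (M : Matrix (Fin 4) (Fin 4) ℂ) : Spinor →L[ℂ] Spinor :=
  Matrix.toEuclideanCLM (n := Fin 4) (𝕜 := ℂ) M

/-- The symbol `α·p + m γ⁰` of the free Dirac operator `-i α·∂ + m γ⁰`. -/
def diracSymbol (m : ℝ) (p : Space) : Spinor →L[ℂ] Spinor :=
  spinorOp ((∑ j, ((p j : ℝ) : ℂ) • diracAlpha j) + (m : ℂ) • diracGamma0)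

/-- The graph of the free Dirac operator `-i α·∂ + m γ⁰` on its maximal domain: `f ∈ L²` is mapped
to `g ∈ L²` when `𝓕 g = (α·p + m γ⁰) 𝓕 f`, the momentum being `p = 2πξ` because Mathlib's Fourier
transform is taken with respect to `e^{-2πi⟨x,ξ⟩}`. -/
def diracGraph (m : ℝ) : Submodule ℂ (OneParticle × OneParticle) where
  carrier := {fg | ∀ᵐ ξ, (𝓕 fg.2 : OneParticle) ξ =
    diracSymbol m ((2 * Real.pi) • ξ) ((𝓕 fg.1 : OneParticle) ξ)}
  add_mem' := by
    intro a b ha hb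
    simp only [Set.mem_ofPred_eq, Prod.fst_add, Prod.snd_add, FourierTransform.fourier_add] at *
    filter_upwards [ha, hb, Lp.coeFn_add (𝓕 a.1 : OneParticle) (𝓕 b.1),
      Lp.coeFn_add (𝓕 a.2 : OneParticle) (𝓕 b.2)] with ξ h1 h2 h3 h4
    rw [h3, h4, Pi.add_apply, Pi.add_apply, map_add, h1, h2]
  zero_mem' := by
    have h0 : (𝓕 (0 : OneParticle) : OneParticle) = 0 := (Lp.fourierTransformₗᵢ Space Spinor).map_zero
    simp only [Set.mem_ofPred_eq, Prod.fst_zero, Prod.snd_zero, h0]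
    filter_upwards [Lp.coeFn_zero Spinor 2 (volume : Measure Space)] with ξ h
    rw [h, Pi.zero_apply, map_zero]
  smul_mem' := by
    intro c a ha
    simp only [Set.mem_ofPred_eq, Prod.smul_fst, Prod.smul_snd, FourierTransform.fourier_smul] at *
    filter_upwards [ha, Lp.coeFn_smul c (𝓕 a.1 : OneParticle),
      Lp.coeFn_smul c (𝓕 a.2 : OneParticle)] with ξ h1 h2 h3
    rw [h2, h3, Pi.smul_apply, Pi.smul_apply, map_smul, h1]

/-- The free Dirac operator `D = -i α·∂ + m γ⁰`. -/
def diracOp (m : ℝ) : OneParticle →ₗ.[ℂ] OneParticle := (diracGraph m).toLinearPMap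

theorem graph_diracOp (m : ℝ) : (diracOp m).graph = diracGraph m := by
  refine Submodule.toLinearPMap_graph_eq _ ?_
  rintro ⟨f, g⟩ hfg (rfl : f = 0)
  have hfg' : ∀ᵐ ξ, (𝓕 g : OneParticle) ξ =
      diracSymbol m ((2 * Real.pi) • ξ) ((𝓕 (0 : OneParticle) : OneParticle) ξ) := hfg
  have h0 : (𝓕 (0 : OneParticle) : OneParticle) = 0 := (Lp.fourierTransformₗᵢ Space Spinor).map_zero
  rw [h0] at hfg'
  have hg : (𝓕 g : OneParticle) = 0 := by
    refine Lp.ext ?_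
    filter_upwards [hfg', Lp.coeFn_zero Spinor 2 (volume : Measure Space)] with ξ h1 h2
    rw [h1, h2, Pi.zero_apply, map_zero]
  exact (Lp.fourierTransformₗᵢ Space Spinor).injective (hg.trans h0.symm)

open Classical in
/-- Multiplication by an essentially bounded matrix-valued function. -/
def mulOp (M : Space → Spinor →L[ℂ] Spinor) : OneParticle →L[ℂ] OneParticle :=
  if h : MemLp M ∞ (volume : Measure Space) then
    (ContinuousLinearMap.id ℂ (Spinor →L[ℂ] Spinor)).holderL volume ∞ 2 2 (h.toLp M)
  else 0

/-- The unitary `e^{itD}`, i.e. multiplication by `e^{it(α·p + mγ⁰)}` in momentum space. -/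
def diracUnitary (m t : ℝ) : OneParticle →L[ℂ] OneParticle :=
  let F : OneParticle ≃L[ℂ] OneParticle :=
    (Lp.fourierTransformₗᵢ Space Spinor).toContinuousLinearEquiv
  (F.symm : OneParticle →L[ℂ] OneParticle) ∘L
    mulOp (fun ξ => NormedSpace.exp
      ((Complex.I * (t : ℂ)) • diracSymbol m ((2 * Real.pi) • ξ))) ∘L
    (F : OneParticle →L[ℂ] OneParticle)

/-! ### The external potential and the interaction operator -/

/-- A smooth electromagnetic potential `A = (A⁰, A¹, A², A³)` on `ℝ × ℝ³`, of compact spatial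
support, vanishing for `t < -ε` and constant in time for `t > 0`. -/
structure IsPotential (ε : ℝ) (A : ℝ → Space → Fin 4 → ℝ) : Prop where
  smooth : ContDiff ℝ ∞ (fun z : ℝ × Space => A z.1 z.2)
  compact_support : ∃ C : Set Space, IsCompact C ∧ ∀ t, ∀ x ∉ C, A t x = 0
  past : ∀ t < -ε, ∀ x, A t x = 0
  future : ∀ s > 0, ∀ t > 0, ∀ x, A s x = A t x

/-- Multiplication by the matrix-valued function `a⁰ + α·a`. -/
def slashed (a : Space → Fin 4 → ℝ) : OneParticle →L[ℂ] OneParticle :=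
  mulOp fun x =>
    spinorOp ((((a x 0 : ℝ) : ℂ)) • 1 + ∑ j : Fin 3, ((a x j.succ : ℝ) : ℂ) • diracAlpha j)

/-- The term of order `n` of the Dyson series,
`iⁿ ∫_{t₁ < ⋯ < tₙ < t} e^{iDt₁} A̸(t₁) e^{iD(t₂-t₁)} ⋯ A̸(tₙ) e^{-iDtₙ} dt₁ ⋯ dtₙ`,
as an iterated integral over `tₙ < t`, `tₙ₋₁ < tₙ`, and so on. -/
def dysonTerm (m : ℝ) (A : ℝ → Space → Fin 4 → ℝ) : ℕ → ℝ → OneParticle →L[ℂ] OneParticle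
  | 0, _ => 1
  | n + 1, t => Complex.I • strongIntegral (volume.restrict (Iio t)) (fun s =>
      dysonTerm m A n s * (diracUnitary m s * slashed (A s) * diracUnitary m (-s)))

/-- The unitary `V_t(A)`, the sum of the Dyson series. -/
def dyson (m : ℝ) (A : ℝ → Space → Fin 4 → ℝ) (t : ℝ) : OneParticle →L[ℂ] OneParticle :=
  ∑' n, dysonTerm m A n t

/-- The interaction operator
`𝒦 = ∫_{-ε}^0 V_s(A) e^{isD} (∂_t A̸)(s) e^{-isD} V_s(A)⁻¹ ds`, where `V_s(A)⁻¹ = V_s(A)*`. -/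
def interaction (m ε : ℝ) (A : ℝ → Space → Fin 4 → ℝ) : OneParticle →L[ℂ] OneParticle :=
  strongIntegral (volume.restrict (Ioo (-ε) 0)) (fun s =>
    dyson m A s * (diracUnitary m s * slashed (fun x => deriv (fun t => A t x) s)
      * diracUnitary m (-s)) * star (dyson m A s))

/-- `k(p, q)` is the integral kernel of `T` in momentum space,
`(T f)^(p) = ∫ k(p, q) f^(q) dq`; in Mathlib's variables, `p = 2πξ` and `q = 2πη`. -/
def IsMomentumKernel (T : OneParticle →L[ℂ] OneParticle)
    (k : Space → Space → Spinor →L[ℂ] Spinor) : Prop :=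
  AEStronglyMeasurable (Function.uncurry k) ((volume : Measure Space).prod volume) ∧
  ∀ f : OneParticle, ∀ᵐ ξ, (𝓕 (T f) : OneParticle) ξ =
    ∫ η, ((2 * Real.pi) ^ 3 : ℝ) •
      k ((2 * Real.pi) • ξ) ((2 * Real.pi) • η) ((𝓕 f : OneParticle) η)

end DiracEntropy

end

open DiracEntropy

noncomputable section

namespace DiracEntropy

open Filter Topology

/-! ### Functional calculus through the bounded transform -/

/-! Write p(t, x) = e^{-tx} / (1 + e^{-βx}) for 0 ≤ t ≤ β, so that p(0, x) + p(β, x) = 1 and p(β, ·)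
is the Fermi factor occurring in 𝔖₁.

The identity is perturbation theory in imaginary time. For S = D + uK, Duhamel's formula
(`Intertwines.duhamel`) on both sides of a time s, combined with p(0) + p(β) = 1, gives the integral
equation p(β - s, S) = p(β - s, D) - u ∫₀^β G(s - t) K p(β - t, S) dt, where G is the antiperiodic
Green function s ↦ e^{sD} F_{σ(s)} (`dyson_equation`). Since ‖G‖ ≤ 1, iteration gives a Neumann
series dominated by the powers of β‖K‖ < 1 (`hasSum_dyson`). At s = 0 it expands the Fermi factor of
D + uK in powers of u, and ∫₀¹ uⁿ du = 1/(n + 1) produces the coefficients of the entropy series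
(`series_identity`). Unbounded operators enter only through their bounded transforms: identities are
proved between the regularizers (1 + D²)⁻¹ and (1 + S²)⁻¹, where all families are norm
differentiable, and the regularizers, being injective with dense range, are cancelled.

For finiteness of the trace, 𝔖₁ is written as X* Y with X = (1 + D²)⁻¹ K and Y both Hilbert–Schmidt.
The difference of Fermi factors is ∫₀^β p(t, D) uK p(β - t, S) dt, but p(t, D) has no decay in D
that is uniform in t. Repeated integration by parts replaces p(t, ·) by iterated antiperiodic
primitives φₙ, which decay like (1 + |x|)⁻ⁿ, and K by commutators; the boundary terms φₙ(0, D) decay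
exponentially. After five steps a factor (1 + D²)⁻¹ splits off on each side of φ₅(t, D). It then
suffices that all iterated commutators of K with D are bounded, and Hilbert–Schmidt after
multiplication by (1 + D²)⁻¹ (`exists_entropyOp_eq_adjoint_comp`).

In the Dirac setting the commutator of D with the potential need not be bounded, because the
α-matrices do not commute. In the interaction picture, however, conjugation by e^{ihD} together with
a time shift by h moves only the time argument of the potential, so the commutator is traded for a
time derivative (`IsSource.picture_flowDeriv`). The families generated by sums, products and
primitives from V_t e^{itD} (∂_t^{j+1} A)(t) e^{-itD} V_t* are closed under this derivation. The
operator 𝒦 is the final value of one of them, constant once the potential is constant, so the time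
shift drops out (`exists_smooth_sequence`). The Hilbert–Schmidt bounds come from the compact support
of the potential and the square integrability of (1 + |p|² + m²)⁻¹ on ℝ³
(`hsBound_mulOp_dampingOp`), and Grönwall's inequality carries them to V_t. The kernel bound gives
‖𝒦‖ < β⁻¹ by Young's inequality, so that the entropy is the trace of X* Y, which does not depend on
the basis by polarization.

In finite dimension, Klein's inequality squeezes the difference quotients of u ↦ Tr log(1 + e^{-β(D
+ uK)}); the derivative is -β times the trace of K against the Fermi factor of D + uK, and
integrating over u gives the free energy formula. -/

/-- A continuous function with finite limits at `±∞`. -/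
structure HasEndLimits (g : ℝ → ℝ) : Prop where
  continuous : Continuous g
  atTop : ∃ a, Tendsto g atTop (𝓝 a)
  atBot : ∃ a, Tendsto g atBot (𝓝 a)

namespace HasEndLimits

theorem mul {f g : ℝ → ℝ} (hf : HasEndLimits f) (hg : HasEndLimits g) :
    HasEndLimits fun x => f x * g x := by
  obtain ⟨cf, ⟨a, ha⟩, b, hb⟩ := hf
  obtain ⟨cg, ⟨a', ha'⟩, b', hb'⟩ := hg
  exact ⟨cf.mul cg, ⟨_, ha.mul ha'⟩, _, hb.mul hb'⟩

theorem add {f g : ℝ → ℝ} (hf : HasEndLimits f) (hg : HasEndLimits g) :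
    HasEndLimits fun x => f x + g x := by
  obtain ⟨cf, ⟨a, ha⟩, b, hb⟩ := hf
  obtain ⟨cg, ⟨a', ha'⟩, b', hb'⟩ := hg
  exact ⟨cf.add cg, ⟨_, ha.add ha'⟩, _, hb.add hb'⟩

theorem neg {f : ℝ → ℝ} (hf : HasEndLimits f) : HasEndLimits fun x => -f x := by
  obtain ⟨cf, ⟨a, ha⟩, b, hb⟩ := hf
  exact ⟨cf.neg, ⟨_, ha.neg⟩, _, hb.neg⟩

theorem sub {f g : ℝ → ℝ} (hf : HasEndLimits f) (hg : HasEndLimits g) :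
    HasEndLimits fun x => f x - g x := by
  obtain ⟨cf, ⟨a, ha⟩, b, hb⟩ := hf
  obtain ⟨cg, ⟨a', ha'⟩, b', hb'⟩ := hg
  exact ⟨cf.sub cg, ⟨_, ha.sub ha'⟩, _, hb.sub hb'⟩

theorem const (c : ℝ) : HasEndLimits fun _ => c :=
  ⟨continuous_const, ⟨c, tendsto_const_nhds⟩, c, tendsto_const_nhds⟩

theorem const_mul {f : ℝ → ℝ} (c : ℝ) (hf : HasEndLimits f) : HasEndLimits fun x => c * f x :=
  (const c).mul hf

/-- The limits are 0, by comparison with C/|x|. One spare power of |x| in an estimate is therefore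
what admits a function to the functional calculus. -/
theorem of_decay {f : ℝ → ℝ} {C : ℝ} (hf : Continuous f) (h : ∀ x, |x| * |f x| ≤ C) :
    HasEndLimits f := by
  have key : ∀ l : Filter ℝ, Tendsto (fun x : ℝ => |x|) l Filter.atTop → Tendsto f l (𝓝 0) := by
    intro l hl
    have h1 : Tendsto (fun x : ℝ => C / |x|) l (𝓝 0) := hl.const_div_atTop C
    refine squeeze_zero_norm' ?_ h1
    filter_upwards [hl.eventually_gt_atTop 0] with x hx
    rw [Real.norm_eq_abs, le_div_iff₀ hx, mul_comm]
    exact h x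
  exact ⟨hf, ⟨0, key _ tendsto_abs_atTop_atTop⟩, 0, key _ tendsto_abs_atBot_atTop⟩

end HasEndLimits

/-! ### The change of variables between the real line and (-1, 1) -/

theorem one_sub_sq_pos_of_mem_Ioo {z : ℝ} (hz : z ∈ Ioo (-1 : ℝ) 1) : 0 < 1 - z ^ 2 := by
  nlinarith [hz.1, hz.2]

theorem continuousOn_div_sqrt_one_sub_sq :
    ContinuousOn (fun z : ℝ => z / √(1 - z ^ 2)) (Ioo (-1) 1) := by
  apply ContinuousOn.div continuousOn_id (by fun_prop)
  intro z hz
  exact (Real.sqrt_pos.2 (one_sub_sq_pos_of_mem_Ioo hz)).ne'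

theorem one_add_sq_div_sqrt {z : ℝ} (hz : z ∈ Ioo (-1 : ℝ) 1) :
    1 + (z / √(1 - z ^ 2)) ^ 2 = (1 - z ^ 2)⁻¹ := by
  have h := one_sub_sq_pos_of_mem_Ioo hz
  rw [div_pow, Real.sq_sqrt h.le]
  field_simp
  ring

theorem tendsto_sqrt_one_sub_sq (a : ℝ) (ha : a ^ 2 = 1) :
    Tendsto (fun z : ℝ => √(1 - z ^ 2)) (𝓝[Ioo (-1) 1] a) (𝓝[>] 0) := by
  refine tendsto_nhdsWithin_iff.2 ⟨?_, ?_⟩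
  · have : Tendsto (fun z : ℝ => √(1 - z ^ 2)) (𝓝 a) (𝓝 (√(1 - a ^ 2))) :=
      (Continuous.tendsto (by fun_prop) a)
    rw [ha, sub_self, Real.sqrt_zero] at this
    exact this.mono_left nhdsWithin_le_nhds
  · filter_upwards [self_mem_nhdsWithin] with z hz
    exact Real.sqrt_pos.2 (one_sub_sq_pos_of_mem_Ioo hz)

theorem tendsto_div_sqrt_one :
    Tendsto (fun z : ℝ => z / √(1 - z ^ 2)) (𝓝[Ioo (-1) 1] 1) atTop := by
  simp only [div_eq_mul_inv]
  refine Tendsto.pos_mul_atTop (C := (1 : ℝ)) one_pos ?_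
    ((tendsto_sqrt_one_sub_sq 1 (by norm_num)).inv_tendsto_nhdsGT_zero)
  exact tendsto_id.mono_left nhdsWithin_le_nhds

theorem tendsto_div_sqrt_neg_one :
    Tendsto (fun z : ℝ => z / √(1 - z ^ 2)) (𝓝[Ioo (-1) 1] (-1)) atBot := by
  simp only [div_eq_mul_inv]
  refine Tendsto.neg_mul_atTop (C := (-1 : ℝ)) (by norm_num) ?_
    ((tendsto_sqrt_one_sub_sq (-1) (by norm_num)).inv_tendsto_nhdsGT_zero)
  exact tendsto_id.mono_left nhdsWithin_le_nhds

theorem closure_Ioo_neg_one_one : closure (Ioo (-1 : ℝ) 1) = Icc (-1) 1 :=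
  closure_Ioo (by norm_num)

theorem HasEndLimits.tendsto_extend {g : ℝ → ℝ} (hg : HasEndLimits g) {x : ℝ}
    (hx : x ∈ Icc (-1 : ℝ) 1) :
    ∃ y, Tendsto (fun z => g (z / √(1 - z ^ 2))) (𝓝[Ioo (-1) 1] x) (𝓝 y) := by
  obtain ⟨cg, ⟨a, ha⟩, b, hb⟩ := hg
  rcases eq_or_lt_of_le hx.1 with h | h
  · exact ⟨b, by subst h; exact hb.comp tendsto_div_sqrt_neg_one⟩
  rcases eq_or_lt_of_le hx.2 with h' | h'
  · exact ⟨a, by subst h'; exact ha.comp tendsto_div_sqrt_one⟩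
  · exact ⟨_, (cg.comp_continuousOn continuousOn_div_sqrt_one_sub_sq) x ⟨h, h'⟩⟩

theorem HasEndLimits.continuousOn_extend {g : ℝ → ℝ} (hg : HasEndLimits g) :
    ContinuousOn (extendFrom (Ioo (-1 : ℝ) 1) fun z => g (z / √(1 - z ^ 2))) (Icc (-1) 1) :=
  continuousOn_extendFrom closure_Ioo_neg_one_one.ge fun _ hx => hg.tendsto_extend hx

theorem HasEndLimits.extend_apply {g : ℝ → ℝ} (hg : HasEndLimits g) {z : ℝ}
    (hz : z ∈ Ioo (-1 : ℝ) 1) :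
    extendFrom (Ioo (-1 : ℝ) 1) (fun z => g (z / √(1 - z ^ 2))) z = g (z / √(1 - z ^ 2)) :=
  extendFrom_eq (subset_closure hz)
    ((hg.continuous.comp_continuousOn continuousOn_div_sqrt_one_sub_sq) z hz)

theorem extendFrom_eqOn {g φ : ℝ → ℝ} (hφ : ContinuousOn φ (Icc (-1) 1))
    (h : ∀ z ∈ Ioo (-1 : ℝ) 1, φ z = g (z / √(1 - z ^ 2))) :
    EqOn (extendFrom (Ioo (-1 : ℝ) 1) fun z => g (z / √(1 - z ^ 2))) φ (Icc (-1) 1) := by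
  intro x hx
  refine extendFrom_eq (by rwa [closure_Ioo_neg_one_one]) ?_
  refine ((hφ x hx).mono Ioo_subset_Icc_self).tendsto.congr' ?_
  filter_upwards [self_mem_nhdsWithin] with z hz using h z hz

section Hilbert

variable {H : Type*} [NormedAddCommGroup H] [InnerProductSpace ℂ H] [CompleteSpace H]

/-- The bounded transform of `S` exists. -/
def HasBoundedTransform (S : H →ₗ.[ℂ] H) : Prop := ∃ Z, IsBoundedTransform S Z

theorem HasBoundedTransform.spec {S : H →ₗ.[ℂ] H} (hS : HasBoundedTransform S) :
    IsBoundedTransform S (boundedTransform S) := by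
  have h : ∃ Z, IsBoundedTransform S Z := hS
  rw [boundedTransform, dif_pos h]
  exact h.choose_spec

/-- The default value 0 is self-adjoint too, so the rules of the functional calculus below need no
hypothesis on S. -/
theorem isSelfAdjoint_boundedTransform (S : H →ₗ.[ℂ] H) : IsSelfAdjoint (boundedTransform S) := by
  by_cases h : HasBoundedTransform S
  · exact h.spec.1
  · have h' : ¬∃ Z, IsBoundedTransform S Z := h
    rw [boundedTransform, dif_neg h']
    exact IsSelfAdjoint.zero _

theorem norm_boundedTransform_le (S : H →ₗ.[ℂ] H) : ‖boundedTransform S‖ ≤ 1 := by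
  by_cases h : HasBoundedTransform S
  · exact h.spec.2.1
  · have h' : ¬∃ Z, IsBoundedTransform S Z := h
    rw [boundedTransform, dif_neg h']
    simp

theorem spectrum_boundedTransform_subset (S : H →ₗ.[ℂ] H) :
    spectrum ℝ (boundedTransform S) ⊆ Icc (-1) 1 := by
  intro x hx
  have h := (IsometricContinuousFunctionalCalculus.norm_spectrum_le (boundedTransform S) hx
    (isSelfAdjoint_boundedTransform S)).trans (norm_boundedTransform_le S)
  rwa [Real.norm_eq_abs, abs_le] at h

/-- Continuity forces the values of the symbol at z = ±1, so any representative that is continuous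
on [-1, 1] computes `fc`. The algebraic rules follow by choosing the sum or product of two
representatives. -/
theorem fc_eq_cfc (S : H →ₗ.[ℂ] H) {g φ : ℝ → ℝ} (hφ : ContinuousOn φ (Icc (-1) 1))
    (h : ∀ z ∈ Ioo (-1 : ℝ) 1, φ z = g (z / √(1 - z ^ 2))) :
    fc S g = cfc φ (boundedTransform S) :=
  cfc_congr ((extendFrom_eqOn hφ h).mono (spectrum_boundedTransform_subset S))

theorem isSelfAdjoint_fc (S : H →ₗ.[ℂ] H) (g : ℝ → ℝ) : IsSelfAdjoint (fc S g) :=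
  cfc_predicate _ _

theorem fc_commute (S : H →ₗ.[ℂ] H) (f g : ℝ → ℝ) : Commute (fc S f) (fc S g) :=
  cfc_commute_cfc _ _ _

theorem fc_mul (S : H →ₗ.[ℂ] H) {f g : ℝ → ℝ} (hf : HasEndLimits f) (hg : HasEndLimits g) :
    fc S (fun x => f x * g x) = fc S f * fc S g := by
  rw [fc_eq_cfc S (hf.continuousOn_extend.mul hg.continuousOn_extend) (fun z hz => by
    rw [Pi.mul_apply, hf.extend_apply hz, hg.extend_apply hz])]
  exact cfc_mul _ _ _ (hf.continuousOn_extend.mono (spectrum_boundedTransform_subset S))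
    (hg.continuousOn_extend.mono (spectrum_boundedTransform_subset S))

theorem fc_add (S : H →ₗ.[ℂ] H) {f g : ℝ → ℝ} (hf : HasEndLimits f) (hg : HasEndLimits g) :
    fc S (fun x => f x + g x) = fc S f + fc S g := by
  rw [fc_eq_cfc S (hf.continuousOn_extend.add hg.continuousOn_extend) (fun z hz => by
    rw [Pi.add_apply, hf.extend_apply hz, hg.extend_apply hz])]
  exact cfc_add _ _ _ (hf.continuousOn_extend.mono (spectrum_boundedTransform_subset S))
    (hg.continuousOn_extend.mono (spectrum_boundedTransform_subset S))

theorem fc_sub (S : H →ₗ.[ℂ] H) {f g : ℝ → ℝ} (hf : HasEndLimits f) (hg : HasEndLimits g) :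
    fc S (fun x => f x - g x) = fc S f - fc S g := by
  rw [fc_eq_cfc S (hf.continuousOn_extend.sub hg.continuousOn_extend) (fun z hz => by
    rw [Pi.sub_apply, hf.extend_apply hz, hg.extend_apply hz])]
  exact cfc_sub _ _ _ (hf.continuousOn_extend.mono (spectrum_boundedTransform_subset S))
    (hg.continuousOn_extend.mono (spectrum_boundedTransform_subset S))

theorem fc_const (S : H →ₗ.[ℂ] H) (c : ℝ) : fc S (fun _ => c) = c • (1 : H →L[ℂ] H) := by
  rw [fc_eq_cfc S (φ := fun _ => c) continuousOn_const (fun z hz => rfl),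
    cfc_const c _ (isSelfAdjoint_boundedTransform S), Algebra.algebraMap_eq_smul_one]

theorem fc_one (S : H →ₗ.[ℂ] H) : fc S (fun _ => 1) = 1 := by
  rw [fc_const, one_smul]

theorem fc_const_mul (S : H →ₗ.[ℂ] H) (c : ℝ) {f : ℝ → ℝ} (hf : HasEndLimits f) :
    fc S (fun x => c * f x) = c • fc S f := by
  rw [fc_mul S (HasEndLimits.const c) hf, fc_const, smul_mul_assoc, one_mul]

theorem fc_neg (S : H →ₗ.[ℂ] H) {f : ℝ → ℝ} (hf : HasEndLimits f) :
    fc S (fun x => -f x) = -fc S f := by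
  have := fc_const_mul S (-1) hf
  simpa using this

theorem norm_fc_le (S : H →ₗ.[ℂ] H) {f : ℝ → ℝ} (hf : HasEndLimits f) {C : ℝ} (hC : 0 ≤ C)
    (h : ∀ x, |f x| ≤ C) : ‖fc S f‖ ≤ C := by
  refine norm_cfc_le hC fun x hx => ?_
  have hx' := spectrum_boundedTransform_subset S hx
  have : x ∈ closure (Ioo (-1 : ℝ) 1) := by rwa [closure_Ioo_neg_one_one]
  obtain ⟨y, hy⟩ := hf.tendsto_extend hx'
  -- At a spectral point ±1 the symbol is a limit of values of f, so the bound survives there.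
  rw [extendFrom_eq this hy]
  have : (𝓝[Ioo (-1 : ℝ) 1] x).NeBot := mem_closure_iff_nhdsWithin_neBot.1 this
  exact le_of_tendsto hy.norm (Eventually.of_forall fun z => h _)

/-! ### The regularizers (1 + S²)^(-1/2) and (1 + S²)⁻¹, and the graph of S -/

/-- `(1 + S²)^(-1/2)`. -/
def rootResolvent (S : H →ₗ.[ℂ] H) : H →L[ℂ] H := cfc (fun z : ℝ => √(1 - z ^ 2)) (boundedTransform S)

/-- `(1 + x²)⁻¹`, the function whose value at `S` regularizes and weights. -/
def lorentz (x : ℝ) : ℝ := (1 + x ^ 2)⁻¹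

theorem lorentz_pos (x : ℝ) : 0 < lorentz x := by unfold lorentz; positivity

theorem continuous_lorentz : Continuous lorentz := by
  unfold lorentz
  exact Continuous.inv₀ (by fun_prop) fun x => by positivity

theorem lorentz_le_one (x : ℝ) : lorentz x ≤ 1 := by
  unfold lorentz
  exact inv_le_one_of_one_le₀ (by nlinarith [sq_nonneg x])

theorem abs_mul_lorentz_le (x : ℝ) : |x| * lorentz x ≤ 1 := by
  unfold lorentz
  rw [← div_eq_mul_inv, div_le_one (by positivity)]
  nlinarith [sq_nonneg (|x| - 1), sq_abs x, abs_nonneg x]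

theorem sq_mul_lorentz_le (x : ℝ) : x ^ 2 * lorentz x ≤ 1 := by
  unfold lorentz
  rw [← div_eq_mul_inv, div_le_one (by positivity)]
  linarith

theorem hasEndLimits_lorentz : HasEndLimits lorentz :=
  HasEndLimits.of_decay (C := 1) continuous_lorentz fun x => by
    rw [abs_of_pos (lorentz_pos x)]; exact abs_mul_lorentz_le x

theorem hasEndLimits_mul_lorentz : HasEndLimits fun x => x * lorentz x :=
  HasEndLimits.of_decay (C := 1) (continuous_id.mul continuous_lorentz) fun x => by
    rw [abs_mul, abs_of_pos (lorentz_pos x), ← mul_assoc, ← sq, sq_abs]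
    exact sq_mul_lorentz_le x

theorem cfc_mul_self_rootResolvent (S : H →ₗ.[ℂ] H) :
    rootResolvent S * rootResolvent S = fc S lorentz := by
  rw [fc_eq_cfc S (φ := fun z => √(1 - z ^ 2) * √(1 - z ^ 2)) (by fun_prop) (fun z hz => by
    rw [lorentz, one_add_sq_div_sqrt hz, inv_inv,
      Real.mul_self_sqrt (one_sub_sq_pos_of_mem_Ioo hz).le])]
  exact (cfc_mul _ _ _ (by fun_prop) (by fun_prop)).symm

theorem rootResolvent_mul_boundedTransform (S : H →ₗ.[ℂ] H) :
    rootResolvent S * boundedTransform S = fc S (fun x => x * lorentz x) := by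
  rw [fc_eq_cfc S (φ := fun z => √(1 - z ^ 2) * z) (by fun_prop) (fun z hz => by
    have h := one_sub_sq_pos_of_mem_Ioo hz
    rw [lorentz, one_add_sq_div_sqrt hz, inv_inv, div_mul_eq_mul_div, eq_div_iff
      (Real.sqrt_pos.2 h).ne', mul_right_comm, Real.mul_self_sqrt h.le, mul_comm])]
  have hZ := isSelfAdjoint_boundedTransform S
  rw [cfc_mul (fun z : ℝ => √(1 - z ^ 2)) (fun z => z) _ (by fun_prop) (by fun_prop),
    cfc_id' ℝ (boundedTransform S) hZ]
  rfl

theorem boundedTransform_commute_rootResolvent (S : H →ₗ.[ℂ] H) :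
    boundedTransform S * rootResolvent S = rootResolvent S * boundedTransform S := by
  have h := cfc_commute_cfc (fun z : ℝ => z) (fun z => √(1 - z ^ 2)) (boundedTransform S)
  rw [cfc_id' ℝ (boundedTransform S) (isSelfAdjoint_boundedTransform S)] at h
  exact h

theorem rootResolvent_sq_add (S : H →ₗ.[ℂ] H) :
    rootResolvent S * rootResolvent S + boundedTransform S * boundedTransform S = 1 := by
  have hZ := isSelfAdjoint_boundedTransform S
  have h1 : rootResolvent S * rootResolvent S =
      cfc (fun z : ℝ => 1 - z ^ 2) (boundedTransform S) := by
    rw [rootResolvent, ← cfc_mul _ _ _ (by fun_prop) (by fun_prop)]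
    refine cfc_congr fun z hz => ?_
    have := spectrum_boundedTransform_subset S hz
    exact Real.mul_self_sqrt (by nlinarith [this.1, this.2])
  rw [h1, cfc_sub (fun _ : ℝ => 1) (fun z => z ^ 2) _ (by fun_prop) (by fun_prop),
    cfc_const_one ℝ _ hZ, cfc_pow_id _ _ hZ, pow_two, sub_add_cancel]

theorem isSelfAdjoint_rootResolvent (S : H →ₗ.[ℂ] H) : IsSelfAdjoint (rootResolvent S) :=
  cfc_predicate _ _

namespace HasBoundedTransform

variable {S : H →ₗ.[ℂ] H} (hS : HasBoundedTransform S)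
include hS

theorem mem_graph_iff (x y : H) : (x, y) ∈ S.graph ↔
    ∃ v : H, x = rootResolvent S v ∧ y = boundedTransform S v := hS.spec.2.2 x y

/-- Let w be the root resolvent and Z the bounded transform. If w v = 0, then (0, Z v) lies in the
graph of an operator, so Z v = 0, and w² + Z² = 1 leaves v = 0. -/
theorem rootResolvent_injective {v : H} (hv : rootResolvent S v = 0) : v = 0 := by
  have h1 : boundedTransform S v = 0 :=
    S.mem_graph_snd_inj' ((hS.mem_graph_iff 0 _).2 ⟨v, hv.symm, rfl⟩) S.graph.zero_mem rfl
  have h2 := congrArg (fun T : H →L[ℂ] H => T v) (rootResolvent_sq_add S)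
  simpa [hv, h1] using h2.symm

theorem denseRange_rootResolvent : DenseRange (rootResolvent S) := by
  have h := ContinuousLinearMap.orthogonal_range (rootResolvent S)
  have hk : LinearMap.ker (rootResolvent S : H →ₗ[ℂ] H) = ⊥ :=
    LinearMap.ker_eq_bot'.2 fun v hv => hS.rootResolvent_injective hv
  rw [← ContinuousLinearMap.star_eq_adjoint, (isSelfAdjoint_rootResolvent S).star_eq, hk,
    ← Submodule.topologicalClosure_eq_top_iff] at h
  exact Submodule.dense_iff_topologicalClosure_eq_top.2 h

/-- Because w and Z commute and w² + Z² = 1, the map v ↦ (w v, Z v) parametrizes exactly the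
solutions of Z x = w y; the parameter is recovered as v = w x + Z y. Membership in the graph thus
becomes one bounded equation. -/
theorem mem_graph_iff_eq (x y : H) : (x, y) ∈ S.graph ↔
    boundedTransform S x = rootResolvent S y := by
  rw [hS.mem_graph_iff]
  constructor
  · rintro ⟨v, rfl, rfl⟩
    exact congrArg (fun T : H →L[ℂ] H => T v) (boundedTransform_commute_rootResolvent S)
  · intro h
    have e := rootResolvent_sq_add S
    have c := boundedTransform_commute_rootResolvent S
    refine ⟨rootResolvent S x + boundedTransform S y, ?_, ?_⟩
    · have e' := congrArg (fun T : H →L[ℂ] H => T x) e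
      have c' := congrArg (fun T : H →L[ℂ] H => T y) c
      simp only [add_apply, mul_apply_eq_comp,
        one_apply_eq_self] at e' c'
      rw [map_add, ← c', ← h, e']
    · have e' := congrArg (fun T : H →L[ℂ] H => T y) e
      have c' := congrArg (fun T : H →L[ℂ] H => T x) c
      simp only [add_apply, mul_apply_eq_comp,
        one_apply_eq_self] at e' c'
      rw [map_add, c', h, e']

/-- In the variable z = x/√(1 + x²) the graph equation says that z·g and √(1 - z²)·(x g) are the
same symbol. This is clear for |z| < 1 and passes to z = ±1 by continuity. -/
theorem fc_mem_graph {g : ℝ → ℝ} (hg : HasEndLimits g) (hg' : HasEndLimits fun x => x * g x)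
    (v : H) : (fc S g v, fc S (fun x => x * g x) v) ∈ S.graph := by
  rw [hS.mem_graph_iff_eq]
  suffices h : boundedTransform S * fc S g = rootResolvent S * fc S (fun x => x * g x) from
    congrArg (fun T : H →L[ℂ] H => T v) h
  have h1 : boundedTransform S = cfc (fun z : ℝ => z) (boundedTransform S) :=
    (cfc_id' ℝ (boundedTransform S) (isSelfAdjoint_boundedTransform S)).symm
  have hs := spectrum_boundedTransform_subset S
  have key : boundedTransform S * fc S g = cfc (fun z => z *
      extendFrom (Ioo (-1 : ℝ) 1) (fun z => g (z / √(1 - z ^ 2))) z) (boundedTransform S) := by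
    rw [cfc_mul _ _ _ (by fun_prop) (hg.continuousOn_extend.mono hs), ← h1]
    rfl
  rw [key, rootResolvent, fc, ← cfc_mul _ _ _ (by fun_prop) (hg'.continuousOn_extend.mono hs)]
  refine cfc_congr (Set.EqOn.mono hs ?_)
  have : EqOn (fun z => z * extendFrom (Ioo (-1 : ℝ) 1) (fun z => g (z / √(1 - z ^ 2))) z)
      (fun z => √(1 - z ^ 2) *
        extendFrom (Ioo (-1 : ℝ) 1) (fun z => z / √(1 - z ^ 2) * g (z / √(1 - z ^ 2))) z)
      (Ioo (-1) 1) := by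
    intro z hz
    have h := Real.sqrt_pos.2 (one_sub_sq_pos_of_mem_Ioo hz)
    simp only [hg.extend_apply hz, hg'.extend_apply hz]
    field_simp
  exact this.of_subset_closure (continuousOn_id.mul hg.continuousOn_extend)
    (ContinuousOn.mul (by fun_prop) hg'.continuousOn_extend) Ioo_subset_Icc_self
    closure_Ioo_neg_one_one.ge

theorem fc_apply_of_mem_graph {g : ℝ → ℝ} (hg : HasEndLimits g)
    (hg' : HasEndLimits fun x => x * g x) {y y' : H} (h : (y, y') ∈ S.graph) :
    fc S g y' = fc S (fun x => x * g x) y := by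
  obtain ⟨v, rfl, rfl⟩ := (hS.mem_graph_iff y y').1 h
  have h1 := (hS.mem_graph_iff_eq _ _).1 (hS.fc_mem_graph hg hg' v)
  have c1 : fc S g * boundedTransform S = boundedTransform S * fc S g := by
    have h := cfc_commute_cfc (fun z : ℝ => z)
      (extendFrom (Ioo (-1 : ℝ) 1) fun z => g (z / √(1 - z ^ 2))) (boundedTransform S)
    rw [cfc_id' ℝ (boundedTransform S) (isSelfAdjoint_boundedTransform S)] at h
    exact h.symm
  have c2 : fc S (fun x => x * g x) * rootResolvent S = rootResolvent S * fc S (fun x => x * g x) :=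
    (cfc_commute_cfc _ _ _)
  calc fc S g (boundedTransform S v) = (fc S g * boundedTransform S) v := rfl
    _ = boundedTransform S (fc S g v) := by rw [c1]; rfl
    _ = (rootResolvent S * fc S (fun x => x * g x)) v := h1
    _ = _ := by rw [← c2]; rfl

theorem fc_lorentz_injective {v : H} (hv : fc S lorentz v = 0) : v = 0 := by
  rw [← cfc_mul_self_rootResolvent] at hv
  exact hS.rootResolvent_injective (hS.rootResolvent_injective hv)

theorem denseRange_fc_lorentz : DenseRange (fc S lorentz) := by
  rw [← cfc_mul_self_rootResolvent]
  exact hS.denseRange_rootResolvent.comp hS.denseRange_rootResolvent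
    (rootResolvent S).continuous

end HasBoundedTransform

/-- The right regularizer has dense range and the left one is injective. Identities between bounded
operators may therefore be checked after sandwiching, where the families involved are differentiable
in norm. -/
theorem eq_of_lorentz_mul_mul_lorentz {D S : H →ₗ.[ℂ] H} (hD : HasBoundedTransform D)
    (hS : HasBoundedTransform S) {X Y : H →L[ℂ] H}
    (h : fc D lorentz * X * fc S lorentz = fc D lorentz * Y * fc S lorentz) : X = Y := by
  have h1 : ⇑(fc D lorentz * X) = ⇑(fc D lorentz * Y) :=
    hS.denseRange_fc_lorentz.equalizer (ContinuousLinearMap.continuous _)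
      (ContinuousLinearMap.continuous _) (funext fun v => congrArg (fun T : H →L[ℂ] H => T v) h)
  ext v
  have h2 := congrFun h1 v
  rw [← sub_eq_zero]
  apply hD.fc_lorentz_injective
  rw [map_sub, sub_eq_zero]
  exact h2

/-! ### Intertwining relations -/

/-- `X` maps the domain of `S` to that of `D`, and `D X - X S = X'` there. -/
def Intertwines (D S : H →ₗ.[ℂ] H) (X X' : H →L[ℂ] H) : Prop :=
  ∀ y y' : H, (y, y') ∈ S.graph → (X y, X y' + X' y) ∈ D.graph

theorem Intertwines.mul {D E S : H →ₗ.[ℂ] H} {X X' Y Y' : H →L[ℂ] H} (hX : Intertwines D E X X')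
    (hY : Intertwines E S Y Y') : Intertwines D S (X * Y) (X' * Y + X * Y') := by
  intro y y' h
  have := hX _ _ (hY _ _ h)
  have e : (X * Y) y' + (X' * Y + X * Y') y = X (Y y' + Y' y) + X' (Y y) := by
    simp only [add_apply, mul_apply_eq_comp, map_add]
    abel
  rw [e]
  exact this

theorem Intertwines.add {D S : H →ₗ.[ℂ] H} {X X' Y Y' : H →L[ℂ] H} (hX : Intertwines D S X X')
    (hY : Intertwines D S Y Y') : Intertwines D S (X + Y) (X' + Y') := by
  intro y y' h
  have := D.graph.add_mem (hX _ _ h) (hY _ _ h)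
  convert this using 1
  simp only [add_apply, Prod.mk_add_mk]
  rw [add_add_add_comm]

theorem Intertwines.smul {D S : H →ₗ.[ℂ] H} {X X' : H →L[ℂ] H} (c : ℂ)
    (hX : Intertwines D S X X') : Intertwines D S (c • X) (c • X') := by
  intro y y' h
  have := D.graph.smul_mem c (hX _ _ h)
  simpa using this

/-- The algebraic core of the Duhamel formula. -/
theorem Intertwines.fc_mul_sub {D S : H →ₗ.[ℂ] H} {X X' : H →L[ℂ] H} (hD : HasBoundedTransform D)
    (hS : HasBoundedTransform S) (hX : Intertwines D S X X') {f g : ℝ → ℝ}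
    (hf : HasEndLimits f) (hf' : HasEndLimits fun x => x * f x)
    (hg : HasEndLimits g) (hg' : HasEndLimits fun x => x * g x) :
    fc D (fun x => x * f x) * X * fc S g - fc D f * X * fc S (fun x => x * g x) =
      fc D f * X' * fc S g := by
  ext v
  have h1 := hD.fc_apply_of_mem_graph hf hf' (hX _ _ (hS.fc_mem_graph hg hg' v))
  simp only [map_add] at h1
  simp only [sub_apply, mul_apply_eq_comp]
  rw [← h1, add_sub_cancel_left]

theorem intertwines_of_regularized {D : H →ₗ.[ℂ] H} (hD : HasBoundedTransform D)
    {X X' : H →L[ℂ] H}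
    (h : fc D (fun x => x * lorentz x) * X * fc D lorentz
      - fc D lorentz * X * fc D (fun x => x * lorentz x) = fc D lorentz * X' * fc D lorentz) :
    Intertwines D D X X' := by
  set w := rootResolvent D
  set Z := boundedTransform D
  have hw : fc D lorentz = w * w := (cfc_mul_self_rootResolvent D).symm
  have hwZ : fc D (fun x => x * lorentz x) = w * Z := (rootResolvent_mul_boundedTransform D).symm
  have hZw : Z * w = w * Z := boundedTransform_commute_rootResolvent D
  -- Since (1 + D²)⁻¹ = w² and D(1 + D²)⁻¹ = wZ = Zw, a factor w can be pulled out on each side and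
  -- cancelled; the remaining equation is the graph criterion evaluated at y = w v.
  have h1 : w * (Z * X * w - w * X * Z - w * X' * w) * w = 0 := by
    rw [hw, hwZ] at h
    nth_rewrite 2 [← hZw] at h
    rw [← sub_eq_zero] at h
    rw [← h]
    noncomm_ring
  have h2 : Z * X * w - w * X * Z - w * X' * w = 0 := by
    have h3 : ⇑(w * (Z * X * w - w * X * Z - w * X' * w)) = ⇑(0 : H →L[ℂ] H) :=
      hD.denseRange_rootResolvent.equalizer (ContinuousLinearMap.continuous _)
        (ContinuousLinearMap.continuous _) (funext fun v => congrArg (fun T : H →L[ℂ] H => T v) h1)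
    ext v
    exact hD.rootResolvent_injective (congrFun h3 v)
  intro y y' hy
  obtain ⟨v, rfl, rfl⟩ := (hD.mem_graph_iff y y').1 hy
  rw [hD.mem_graph_iff_eq]
  have h3 := congrArg (fun T : H →L[ℂ] H => T v) h2
  simp only [sub_apply, mul_apply_eq_comp,
    zero_apply] at h3
  rw [map_add, ← sub_eq_zero, ← h3]
  abel

end Hilbert

end DiracEntropy

end

noncomputable section

namespace DiracEntropy

open Filter Topology

section Hilbert

variable {H : Type*} [NormedAddCommGroup H] [InnerProductSpace ℂ H] [CompleteSpace H]

/-! ### Existence of the bounded transform -/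

/-- `S` is symmetric, in terms of its graph. -/
def IsSymmetricGraph (S : H →ₗ.[ℂ] H) : Prop :=
  ∀ x x' y y' : H, (x, x') ∈ S.graph → (y, y') ∈ S.graph → ⟪x', y⟫_ℂ = ⟪x, y'⟫_ℂ

-- The cross term Re(c⟨x', x⟩) vanishes, since c is imaginary and ⟨x', x⟩ is real. Hence S + c is
-- injective and bounded below, which gives uniqueness and boundedness of the resolvents at ±i.
omit [CompleteSpace H] in
theorem IsSymmetricGraph.norm_sq_le {S : H →ₗ.[ℂ] H} (hS : IsSymmetricGraph S) {c : ℂ}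
    (hc : c.re = 0) (hc' : ‖c‖ = 1) {x x' : H} (h : (x, x') ∈ S.graph) :
    ‖x' + c • x‖ ^ 2 = ‖x'‖ ^ 2 + ‖x‖ ^ 2 := by
  have h1 := hS x x' x x' h h
  have h2 : (⟪x', x⟫_ℂ).im = 0 := by
    have := inner_conj_symm (𝕜 := ℂ) x' x
    rw [← h1] at this
    exact Complex.conj_eq_iff_im.1 this
  have h3 : RCLike.re (⟪x', c • x⟫_ℂ) = 0 := by
    rw [inner_smul_right]
    simp [hc, h2]
  rw [norm_add_sq (𝕜 := ℂ), h3, norm_smul, hc']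
  ring

omit [CompleteSpace H] in
theorem IsSymmetricGraph.eq_of_add_smul_eq {S : H →ₗ.[ℂ] H} (hS : IsSymmetricGraph S) {c : ℂ}
    (hc : c.re = 0) (hc' : ‖c‖ = 1) {x x' y y' : H} (h : (x, x') ∈ S.graph)
    (h' : (y, y') ∈ S.graph) (e : x' + c • x = y' + c • y) : x = y := by
  have h1 := hS.norm_sq_le hc hc' (S.graph.sub_mem h h')
  have e' : x' - y' + c • (x - y) = 0 := by
    rw [smul_sub, sub_add_sub_comm, e, sub_self]
  rw [e'] at h1
  have : ‖x - y‖ = 0 := by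
    have := sq_nonneg ‖x' - y'‖
    simp only [norm_zero] at h1
    nlinarith [norm_nonneg (x - y)]
  exact sub_eq_zero.1 (norm_eq_zero.1 this)

omit [CompleteSpace H] in
theorem IsSymmetricGraph.exists_resolvent {S : H →ₗ.[ℂ] H} (hS : IsSymmetricGraph S) {c : ℂ}
    (hc : c.re = 0) (hc' : ‖c‖ = 1) (hsurj : ∀ v, ∃ x x', (x, x') ∈ S.graph ∧ x' + c • x = v) :
    ∃ R : H →L[ℂ] H, ∀ v, (R v, v - c • R v) ∈ S.graph := by
  choose r r' hr hv using hsurj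
  have hr' : ∀ v, (r v, v - c • r v) ∈ S.graph := fun v => by
    have := hr v
    rwa [← eq_sub_iff_add_eq.2 (hv v)]
  refine ⟨LinearMap.mkContinuous { toFun := r, map_add' := ?_, map_smul' := ?_ } 1 ?_, hr'⟩
  · intro v w
    refine hS.eq_of_add_smul_eq hc hc' (hr' _) (S.graph.add_mem (hr' v) (hr' w)) ?_
    simp only [smul_add]
    abel
  · intro a v
    refine hS.eq_of_add_smul_eq hc hc' (hr' _) (S.graph.smul_mem a (hr' v)) ?_
    simp only [RingHom.id_apply, smul_sub, sub_add_cancel, smul_comm a c]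
  · intro v
    have := hS.norm_sq_le hc hc' (hr v)
    rw [hv] at this
    simp only [LinearMap.coe_mk, AddHom.coe_mk, one_mul]
    exact le_of_sq_le_sq (by nlinarith [sq_nonneg ‖r' v‖]) (norm_nonneg _)

omit [CompleteSpace H] in
theorem eq_of_mul_mul_eq {s X Y : H →L[ℂ] H} (hinj : ∀ v, s v = 0 → v = 0) (hd : DenseRange s)
    (h : s * X * s = s * Y * s) : X = Y := by
  have h1 : ⇑(s * X) = ⇑(s * Y) :=
    hd.equalizer (ContinuousLinearMap.continuous _) (ContinuousLinearMap.continuous _)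
      (funext fun v => congrArg (fun T : H →L[ℂ] H => T v) h)
  ext v
  have h2 := congrFun h1 v
  rw [← sub_eq_zero]
  apply hinj
  rw [map_sub, sub_eq_zero]
  exact h2

theorem denseRange_of_isSelfAdjoint {s : H →L[ℂ] H} (hs : IsSelfAdjoint s)
    (hinj : ∀ v, s v = 0 → v = 0) : DenseRange s := by
  have h := ContinuousLinearMap.orthogonal_range s
  have hk : LinearMap.ker (s : H →ₗ[ℂ] H) = ⊥ := LinearMap.ker_eq_bot'.2 hinj
  rw [← ContinuousLinearMap.star_eq_adjoint, hs.star_eq, hk,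
    ← Submodule.topologicalClosure_eq_top_iff] at h
  exact Submodule.dense_iff_topologicalClosure_eq_top.2 h

/-- With P = (S + i)⁻¹ and M = (S - i)⁻¹, the bounded operators T = PM and B = (P + M)/2 play the
roles of (1 + S²)⁻¹ and S(1 + S²)⁻¹. The bounded transform Z must satisfy Z √T = B. Since B² = T -
T² ≤ T, the prescription √T v ↦ B v is a contraction on the dense range of √T and extends to all of
H. -/
theorem hasBoundedTransform_of_resolvents {S : H →ₗ.[ℂ] H} (hS : IsSymmetricGraph S)
    {P M : H →L[ℂ] H} (hP : ∀ v, (P v, v - Complex.I • P v) ∈ S.graph)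
    (hM : ∀ v, (M v, v - (-Complex.I) • M v) ∈ S.graph) : HasBoundedTransform S := by
  have hstar : star P = M := by
    rw [ContinuousLinearMap.star_eq_adjoint, eq_comm, ContinuousLinearMap.eq_adjoint_iff]
    intro w v
    have := hS _ _ _ _ (hP v) (hM w)
    simp only [inner_sub_left, inner_sub_right, inner_smul_left, inner_smul_right, neg_mul,
      Complex.conj_I, sub_neg_eq_add, add_left_inj] at this
    rw [← inner_conj_symm, this, inner_conj_symm]
  -- This is the resolvent identity; it follows from uniqueness of solutions of (S + i)x = v.
  have hPM : P * M = (Complex.I / 2) • (P - M) := by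
    ext v
    have h1 : P ((-2 * Complex.I) • M v) = P v - M v := by
      refine hS.eq_of_add_smul_eq (c := Complex.I) (by simp) (by simp) (hP _)
        (S.graph.sub_mem (hP v) (hM v)) ?_
      module
    rw [map_smul] at h1
    simp only [mul_apply_eq_comp, smul_apply, sub_apply, ← h1, smul_smul]
    have : Complex.I / 2 * (-2 * Complex.I) = 1 := by
      linear_combination -Complex.I_mul_I
    rw [this, one_smul]
  have hMP : M * P = (Complex.I / 2) • (P - M) := by
    ext v
    have h1 : M ((-2 * Complex.I) • P v) = P v - M v := by
      refine hS.eq_of_add_smul_eq (c := -Complex.I) (by simp) (by simp) (hM _)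
        (S.graph.sub_mem (hP v) (hM v)) ?_
      module
    rw [map_smul] at h1
    simp only [mul_apply_eq_comp, smul_apply, sub_apply, ← h1, smul_smul]
    have : Complex.I / 2 * (-2 * Complex.I) = 1 := by
      linear_combination -Complex.I_mul_I
    rw [this, one_smul]
  set T := P * M with hT
  set B := (1 / 2 : ℂ) • (P + M) with hB
  have hcomm : M * P = P * M := by rw [hMP, ← hPM]
  have hBsa : IsSelfAdjoint B := by
    rw [IsSelfAdjoint, hB, star_smul, star_add, hstar, ← hstar, star_star, hstar, add_comm]
    simp
  have hTpos : 0 ≤ T := by rw [hT, ← hstar]; exact mul_star_self_nonneg P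
  have hTsa : IsSelfAdjoint T := .of_nonneg hTpos
  have hBB : B * B = T - T * T := by
    have hTT : T * T = (-(1 / 4) : ℂ) • ((P - M) * (P - M)) := by
      rw [hPM, smul_mul_smul_comm]
      congr 1
      linear_combination (1 / 4) * Complex.I_mul_I
    rw [hTT, hB, smul_mul_smul_comm, hT, sub_mul, add_mul, mul_sub, mul_sub, mul_add, mul_add,
      hcomm]
    module
  have hBT : Commute T B := by
    rw [Commute, SemiconjBy, hB, hT, mul_smul_comm, smul_mul_assoc, mul_add, add_mul, mul_assoc,
      mul_assoc, hcomm, ← mul_assoc M P M, hcomm, mul_assoc P M M]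
  have hP_eq : P = B - Complex.I • T := by
    rw [hB, hPM, smul_smul]
    have : Complex.I * (Complex.I / 2) = -(1 / 2) := by linear_combination (1/2) * Complex.I_mul_I
    rw [this]
    module
  have hinjP : ∀ v, P v = 0 → v = 0 := by
    intro v hv
    have h1 := hP v
    rw [hv, smul_zero, sub_zero] at h1
    exact S.graph_fst_eq_zero_snd h1 rfl
  have hinjM : ∀ v, M v = 0 → v = 0 := by
    intro v hv
    have h1 := hM v
    rw [hv, smul_zero, sub_zero] at h1
    exact S.graph_fst_eq_zero_snd h1 rfl
  set s : H →L[ℂ] H := cfc Real.sqrt T with hs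
  have hTspec : ∀ x ∈ spectrum ℝ T, 0 ≤ x := fun x hx => spectrum_nonneg_of_nonneg hTpos hx
  have hss : s * s = T := by
    rw [hs, ← cfc_mul _ _ _ (by fun_prop) (by fun_prop)]
    conv_rhs => rw [← cfc_id' ℝ T hTsa]
    exact cfc_congr fun x hx => Real.mul_self_sqrt (hTspec x hx)
  have hssa : IsSelfAdjoint s := cfc_predicate _ _
  have hsB : s * B = B * s := (hBT.cfc_real Real.sqrt)
  have hinjs : ∀ v, s v = 0 → v = 0 := by
    intro v hv
    apply hinjM
    apply hinjP
    have : (s * s) v = 0 := by rw [mul_apply_eq_comp, hv, map_zero]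
    rwa [hss] at this
  have hds : DenseRange s := denseRange_of_isSelfAdjoint hssa hinjs
  have hnorm : ∀ v, ‖B v‖ ≤ 1 * ‖s v‖ := by
    intro v
    rw [one_mul]
    refine le_of_sq_le_sq ?_ (norm_nonneg _)
    have key : ∀ A : H →L[ℂ] H, IsSelfAdjoint A → (‖A v‖ ^ 2 : ℝ) = RCLike.re ⟪v, (A * A) v⟫_ℂ := by
      intro A hA
      rw [mul_apply_eq_comp, ← ContinuousLinearMap.adjoint_inner_left,
        ← ContinuousLinearMap.star_eq_adjoint, hA.star_eq, inner_self_eq_norm_sq]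
    rw [key B hBsa, key s hssa, hss, hBB, sub_apply, inner_sub_right, map_sub, ← key T hTsa]
    nlinarith [sq_nonneg ‖T v‖]
  set Z : H →L[ℂ] H := (B : H →ₗ[ℂ] H).extendOfNorm (s : H →ₗ[ℂ] H) with hZ
  have hZs : Z * s = B := by
    ext v
    exact LinearMap.extendOfNorm_eq (f := (B : H →ₗ[ℂ] H)) (e := (s : H →ₗ[ℂ] H)) hds
      ⟨1, hnorm⟩ v
  have hZnorm : ‖Z‖ ≤ 1 := LinearMap.opNorm_extendOfNorm_le (f := (B : H →ₗ[ℂ] H))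
    (e := (s : H →ₗ[ℂ] H)) hds zero_le_one hnorm
  have hZsa : IsSelfAdjoint Z := by
    refine eq_of_mul_mul_eq hinjs hds ?_
    rw [mul_assoc s Z s, hZs]
    have : s * star Z * s = star (s * (Z * s)) := by
      rw [star_mul, star_mul, hssa.star_eq]
    rw [this, hZs, star_mul, hssa.star_eq, hBsa.star_eq, hsB]
  have hsZ : s * Z = B := by
    have := congrArg star hZs
    rwa [star_mul, hZsa.star_eq, hssa.star_eq, hBsa.star_eq] at this
  have hZZ : Z * Z = 1 - s * s := by
    refine eq_of_mul_mul_eq hinjs hds ?_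
    calc s * (Z * Z) * s = (s * Z) * (Z * s) := by noncomm_ring
      _ = T - T * T := by rw [hsZ, hZs, hBB]
      _ = s * (1 - s * s) * s := by rw [← hss]; noncomm_ring
  refine ⟨Z, hZsa, hZnorm, fun x y => ?_⟩
  have hroot : cfc (fun z : ℝ => √(1 - z ^ 2)) Z = s := by
    have h1 : cfc (fun z : ℝ => 1 - z ^ 2) Z = T := by
      rw [cfc_sub (fun _ : ℝ => 1) (fun z => z ^ 2) _ (by fun_prop) (by fun_prop),
        cfc_const_one ℝ _ hZsa, cfc_pow_id _ _ hZsa, pow_two, hZZ, hss, sub_sub_cancel]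
    rw [cfc_comp' Real.sqrt (fun z : ℝ => 1 - z ^ 2) Z (by fun_prop) (by fun_prop) hZsa, h1]
  rw [hroot]
  have hfact : P * (Z + Complex.I • s) = s := by
    calc P * (Z + Complex.I • s) = (s * Z - Complex.I • (s * s)) * (Z + Complex.I • s) := by
          rw [hsZ, hss, ← hP_eq]
      _ = s * (Z * Z) + Complex.I • (s * (Z * s)) - Complex.I • (s * (s * Z))
          - (Complex.I * Complex.I) • (s * s * s) := by
          simp only [mul_add, sub_mul, smul_mul_assoc, mul_smul_comm, mul_assoc, smul_sub,
            smul_smul]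
          abel
      _ = s := by
          rw [hZs, hsZ, hZZ, Complex.I_mul_I]
          simp only [mul_sub, mul_one, mul_assoc, neg_smul, one_smul]
          abel
  have hfact' : s * (Z - Complex.I • s) = P := by
    rw [mul_sub, mul_smul_comm, hsZ, hss, ← hP_eq]
  -- Apply the graph relation of P to the vector (Z + i s)v: since P(Z + i s) = s, its second entry
  -- is Z v + i s v - i s v = Z v.
  have hmem : ∀ v, (s v, Z v) ∈ S.graph := by
    intro v
    have h1 := hP ((Z + Complex.I • s) v)
    have h2 : P ((Z + Complex.I • s) v) = s v := congrArg (fun T : H →L[ℂ] H => T v) hfact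
    rw [h2] at h1
    simpa using h1
  constructor
  · intro hxy
    have h1 : x = s ((Z - Complex.I • s) (y + Complex.I • x)) := by
      have h2 : s ((Z - Complex.I • s) (y + Complex.I • x)) = P (y + Complex.I • x) :=
        congrArg (fun T : H →L[ℂ] H => T (y + Complex.I • x)) hfact'
      rw [h2]
      refine hS.eq_of_add_smul_eq (c := Complex.I) (by simp) (by simp) hxy (hP _) ?_
      rw [sub_add_cancel]
    exact ⟨_, h1, S.mem_graph_snd_inj' hxy (hmem _) h1⟩
  · rintro ⟨v, rfl, rfl⟩
    exact hmem v

theorem hasBoundedTransform_of_surjective {S : H →ₗ.[ℂ] H} (hS : IsSymmetricGraph S)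
    (h1 : ∀ v, ∃ x x', (x, x') ∈ S.graph ∧ x' + Complex.I • x = v)
    (h2 : ∀ v, ∃ x x', (x, x') ∈ S.graph ∧ x' + (-Complex.I) • x = v) :
    HasBoundedTransform S := by
  obtain ⟨P, hP⟩ := hS.exists_resolvent (by simp) (by simp) h1
  obtain ⟨M, hM⟩ := hS.exists_resolvent (by simp) (by simp) h2
  exact hasBoundedTransform_of_resolvents hS hP hM

/-! ### Self-adjoint operators -/

theorem isSelfAdjoint_iff_graph {S : H →ₗ.[ℂ] H} (hd : Dense (S.domain : Set H)) :
    IsSelfAdjoint S ↔ ∀ y y' : H, (y, y') ∈ S.graph ↔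
      ∀ x x' : H, (x, x') ∈ S.graph → ⟪x', y⟫_ℂ = ⟪x, y'⟫_ℂ := by
  have h1 := LinearPMap.adjoint_graph_eq_graph_adjoint hd
  rw [LinearPMap.isSelfAdjoint_def]
  constructor
  · intro h y y'
    rw [h] at h1
    conv_lhs => rw [h1, Submodule.mem_adjoint_iff]
    simp only [sub_eq_zero]
  · intro h
    apply LinearPMap.eq_of_eq_graph
    rw [h1]
    ext ⟨y, y'⟩
    rw [Submodule.mem_adjoint_iff, h]
    simp only [sub_eq_zero]

theorem isSymmetricGraph_of_isSelfAdjoint {S : H →ₗ.[ℂ] H} (hS : IsSelfAdjoint S) :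
    IsSymmetricGraph S := fun x x' y y' hx hy =>
  ((isSelfAdjoint_iff_graph hS.dense_domain).1 hS y y').1 hy x x' hx

/-- On the complete graph, S + c is bounded below, so its range is closed. A vector z orthogonal to
the range satisfies S z = c z by self-adjointness, and the norm identity for S - c then forces z =
0. -/
theorem surjective_of_isSelfAdjoint {S : H →ₗ.[ℂ] H} (hS : IsSelfAdjoint S) {c : ℂ}
    (hc : c.re = 0) (hc' : ‖c‖ = 1) (v : H) : ∃ x x', (x, x') ∈ S.graph ∧ x' + c • x = v := by
  have hsym := isSymmetricGraph_of_isSelfAdjoint hS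
  have hcl : IsClosed (S.graph : Set (H × H)) := hS.isClosed
  have : CompleteSpace S.graph := hcl.completeSpace_coe
  let L : S.graph →L[ℂ] H :=
    (ContinuousLinearMap.snd ℂ H H + c • ContinuousLinearMap.fst ℂ H H) ∘L S.graph.subtypeL
  have hL : ∀ p : S.graph, ‖L p‖ ^ 2 = ‖(p : H × H).2‖ ^ 2 + ‖(p : H × H).1‖ ^ 2 := fun p =>
    hsym.norm_sq_le hc hc' p.2
  have hanti : AntilipschitzWith 1 L := by
    refine ContinuousLinearMap.antilipschitz_of_bound _ fun p => ?_
    rw [NNReal.coe_one, one_mul]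
    have h := hL p
    have h1 : ‖(p : H × H).2‖ ≤ ‖L p‖ :=
      le_of_sq_le_sq (by nlinarith [sq_nonneg ‖(p : H × H).1‖]) (norm_nonneg _)
    have h2 : ‖(p : H × H).1‖ ≤ ‖L p‖ :=
      le_of_sq_le_sq (by nlinarith [sq_nonneg ‖(p : H × H).2‖]) (norm_nonneg _)
    exact max_le h2 h1
  have hclr : IsClosed (LinearMap.range (L : S.graph →ₗ[ℂ] H) : Set H) :=
    hanti.isClosed_range L.uniformContinuous
  have htop : LinearMap.range (L : S.graph →ₗ[ℂ] H) = ⊤ := by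
    have : CompleteSpace (LinearMap.range (L : S.graph →ₗ[ℂ] H)) := hclr.completeSpace_coe
    rw [← Submodule.orthogonal_eq_bot_iff, Submodule.eq_bot_iff]
    intro z hz
    have h1 : ∀ x x', (x, x') ∈ S.graph → ⟪x' + c • x, z⟫_ℂ = 0 := fun x x' hx =>
      (Submodule.mem_orthogonal _ _).1 hz _ ⟨⟨(x, x'), hx⟩, rfl⟩
    have hconj : (starRingEnd ℂ) c = -c := by
      apply Complex.ext <;> simp [hc]
    have h2 : (z, c • z) ∈ S.graph := by
      refine ((isSelfAdjoint_iff_graph hS.dense_domain).1 hS _ _).2 fun x x' hx => ?_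
      have := h1 x x' hx
      rw [inner_add_left, inner_smul_left, hconj] at this
      rw [inner_smul_right]
      linear_combination this
    have h3 := hsym.norm_sq_le (c := -c) (by simp [hc]) (by simp [hc']) h2
    rw [neg_smul, add_neg_cancel, norm_zero] at h3
    have : ‖z‖ = 0 := by nlinarith [sq_nonneg ‖c • z‖, norm_nonneg z]
    exact norm_eq_zero.1 this
  obtain ⟨p, hp⟩ := (LinearMap.range_eq_top.1 htop) v
  exact ⟨_, _, p.2, hp⟩

theorem hasBoundedTransform_of_isSelfAdjoint {S : H →ₗ.[ℂ] H} (hS : IsSelfAdjoint S) :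
    HasBoundedTransform S :=
  hasBoundedTransform_of_surjective (isSymmetricGraph_of_isSelfAdjoint hS)
    (surjective_of_isSelfAdjoint hS (by simp) (by simp))
    (surjective_of_isSelfAdjoint hS (by simp) (by simp))

/-- The basic criterion of self-adjointness. -/
theorem isSelfAdjoint_of_surjective {S : H →ₗ.[ℂ] H} (hS : IsSymmetricGraph S)
    (h1 : ∀ v, ∃ x x', (x, x') ∈ S.graph ∧ x' + Complex.I • x = v)
    (h2 : ∀ v, ∃ x x', (x, x') ∈ S.graph ∧ x' + (-Complex.I) • x = v) :
    IsSelfAdjoint S := by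
  have key : ∀ y, (∀ x x', (x, x') ∈ S.graph → ⟪x' + Complex.I • x, y⟫_ℂ = 0) → y = 0 := by
    intro y hy
    obtain ⟨x, x', hx, e⟩ := h1 y
    have := hy x x' hx
    rw [e] at this
    exact inner_self_eq_zero.1 this
  have hd : Dense (S.domain : Set H) := by
    rw [Submodule.dense_iff_topologicalClosure_eq_top, Submodule.topologicalClosure_eq_top_iff,
      Submodule.eq_bot_iff]
    intro z hz
    obtain ⟨y, y', hy, rfl⟩ := h2 z
    have hy0 : y = 0 := by
      apply key
      intro x x' hx
      have hxd : x ∈ S.domain := by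
        obtain ⟨a, ha, _⟩ := S.mem_graph_iff.1 hx
        rw [← show (a : H) = x from ha]
        exact a.2
      have := (Submodule.mem_orthogonal _ _).1 hz x hxd
      rw [inner_add_right, ← hS x x' y y' hx hy, inner_smul_right] at this
      rw [inner_add_left, inner_smul_left, Complex.conj_I]
      exact this
    subst hy0
    rw [S.graph_fst_eq_zero_snd hy rfl, smul_zero, add_zero]
  rw [isSelfAdjoint_iff_graph hd]
  intro y y'
  constructor
  · exact fun hy x x' hx => hS x x' y y' hx hy
  · intro h
    -- For (y, y') in the adjoint graph, solve (S - i)z = y' - i y; the difference y - z is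
    -- orthogonal to the range of S + i, which is everything.
    obtain ⟨z, z', hz, e⟩ := h2 (y' + (-Complex.I) • y)
    have hyz : y - z = 0 := by
      apply key
      intro x x' hx
      have e1 := h x x' hx
      have e2 := hS x x' z z' hx hz
      have e3 := congrArg (fun w => ⟪x, w⟫_ℂ) e
      simp only [inner_add_right, inner_smul_right] at e3
      simp only [inner_add_left, inner_smul_left, inner_sub_right, Complex.conj_I]
      linear_combination e1 - e2 - e3
    rw [sub_eq_zero] at hyz
    subst hyz
    rw [add_left_inj] at e
    rwa [← e]

/-! ### Bounded perturbations -/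

theorem mem_graph_perturb_iff {D : H →ₗ.[ℂ] H} {K : H →L[ℂ] H} {x y : H} :
    (x, y) ∈ (perturb D K).graph ↔ (x, y - K x) ∈ D.graph := by
  simp only [LinearPMap.mem_graph_iff, perturb]
  constructor
  · rintro ⟨a, h1, h2⟩
    refine ⟨⟨a, a.2.1⟩, h1, ?_⟩
    rw [← h2, ← h1, LinearPMap.add_apply]
    simp
  · rintro ⟨a, h1, h2⟩
    refine ⟨⟨a, a.2, trivial⟩, h1, ?_⟩
    rw [LinearPMap.add_apply, ← h1] at *
    simp [h2]

theorem domain_perturb (D : H →ₗ.[ℂ] H) (K : H →L[ℂ] H) : (perturb D K).domain = D.domain := by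
  simp [perturb, LinearPMap.add_domain, LinearMap.toPMap]

theorem isSelfAdjoint_perturb {D : H →ₗ.[ℂ] H} {K : H →L[ℂ] H} (hD : IsSelfAdjoint D)
    (hK : IsSelfAdjoint K) : IsSelfAdjoint (perturb D K) := by
  have hKs : ∀ x y : H, ⟪K x, y⟫_ℂ = ⟪x, K y⟫_ℂ := fun x y => by
    conv_lhs => rw [← hK.star_eq, ContinuousLinearMap.star_eq_adjoint,
      ContinuousLinearMap.adjoint_inner_left]
  rw [isSelfAdjoint_iff_graph (by rw [domain_perturb]; exact hD.dense_domain)]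
  intro y y'
  rw [mem_graph_perturb_iff, (isSelfAdjoint_iff_graph hD.dense_domain).1 hD]
  constructor
  · intro h x x' hx
    have := h _ _ (mem_graph_perturb_iff.1 hx)
    rw [inner_sub_left, inner_sub_right, hKs] at this
    linear_combination this
  · intro h x x' hx
    have := h x (x' + K x) (mem_graph_perturb_iff.2 (by rwa [add_sub_cancel_right]))
    rw [inner_add_left, hKs] at this
    rw [inner_sub_right]
    linear_combination this

/-- D·1 - 1·(D + K) = -K. Taking X = 1 in the Duhamel formula then compares functions of D with
functions of D + K. -/
theorem intertwines_one_perturb (D : H →ₗ.[ℂ] H) (K : H →L[ℂ] H) :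
    Intertwines D (perturb D K) 1 (-K) := by
  intro y y' h
  have := mem_graph_perturb_iff.1 h
  simpa [sub_eq_add_neg] using this

theorem Intertwines.perturb_right {D : H →ₗ.[ℂ] H} {X X' : H →L[ℂ] H} (hX : Intertwines D D X X')
    (K : H →L[ℂ] H) : Intertwines D (perturb D K) X (X' - X * K) := by
  have := hX.mul (intertwines_one_perturb D K)
  simpa [sub_eq_add_neg] using this

end Hilbert

end DiracEntropy

end

noncomputable section

namespace DiracEntropy

open Filter Topology

/-! ### The thermal functions -/

/-- `e^{-tx} / (1 + e^{-βx})`. -/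
def thermal (β t x : ℝ) : ℝ := Real.exp (-t * x) / (1 + Real.exp (-β * x))

theorem thermal_pos (β t x : ℝ) : 0 < thermal β t x := by unfold thermal; positivity

theorem continuous_thermal_uncurry (β : ℝ) : Continuous fun z : ℝ × ℝ => thermal β z.1 z.2 := by
  unfold thermal
  exact Continuous.div (by fun_prop) (by fun_prop) fun z => by positivity

theorem continuous_thermal (β t : ℝ) : Continuous (thermal β t) :=
  (continuous_thermal_uncurry β).comp (by fun_prop : Continuous fun x : ℝ => (t, x))

/-- Reflecting both t ↦ β - t and x ↦ -x exchanges the two ends of the real line, so estimates for x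
≥ 0 transfer to x ≤ 0. -/
theorem thermal_symm (β t x : ℝ) : thermal β (β - t) (-x) = thermal β t x := by
  unfold thermal
  rw [div_eq_div_iff (by positivity) (by positivity), mul_add, mul_add, ← Real.exp_add,
    ← Real.exp_add, mul_one, mul_one, add_comm]
  congr 2 <;> ring_nf

theorem thermal_le_one {β t : ℝ} (h0 : 0 ≤ t) (h1 : t ≤ β) (x : ℝ) : thermal β t x ≤ 1 := by
  unfold thermal
  rw [div_le_one (by positivity)]
  rcases le_total 0 x with hx | hx
  · have : Real.exp (-t * x) ≤ 1 := Real.exp_le_one_iff.2 (by nlinarith)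
    linarith [Real.exp_pos (-β * x)]
  · have : Real.exp (-t * x) ≤ Real.exp (-β * x) := Real.exp_le_exp.2 (by nlinarith)
    linarith

theorem abs_thermal_le_one {β t : ℝ} (ht : t ∈ Icc 0 β) (x : ℝ) : |thermal β t x| ≤ 1 := by
  rw [abs_of_pos (thermal_pos β t x)]
  exact thermal_le_one ht.1 ht.2 x

theorem tendsto_thermal_atTop {β t : ℝ} (hβ : 0 < β) (h0 : 0 ≤ t) :
    ∃ a, Tendsto (thermal β t) atTop (𝓝 a) := by
  have key : ∀ c : ℝ, 0 < c → Tendsto (fun x : ℝ => Real.exp (-c * x)) atTop (𝓝 0) := fun c hc =>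
    Real.tendsto_exp_atBot.comp (tendsto_id.const_mul_atTop_of_neg (neg_lt_zero.2 hc))
  have h1 : Tendsto (fun x : ℝ => 1 + Real.exp (-β * x)) atTop (𝓝 (1 + 0)) :=
    (key β hβ).const_add 1
  rcases h0.eq_or_lt with rfl | h
  · refine ⟨1 / (1 + 0), Tendsto.div ?_ h1 (by norm_num)⟩
    simp
  · exact ⟨0 / (1 + 0), (key t h).div h1 (by norm_num)⟩

theorem hasEndLimits_thermal {β t : ℝ} (hβ : 0 < β) (ht : t ∈ Icc 0 β) :
    HasEndLimits (thermal β t) := by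
  refine ⟨continuous_thermal β t, tendsto_thermal_atTop hβ ht.1, ?_⟩
  obtain ⟨a, ha⟩ := tendsto_thermal_atTop (t := β - t) hβ (sub_nonneg.2 ht.2)
  refine ⟨a, (ha.comp tendsto_neg_atBot_atTop).congr fun x => ?_⟩
  exact thermal_symm β t x

theorem mul_thermal_le {β t : ℝ} (ht : t ∈ Ioo 0 β) {x : ℝ} (hx : 0 ≤ x) :
    x * thermal β t x ≤ t⁻¹ := by
  have h1 : thermal β t x ≤ Real.exp (-(t * x)) := by
    unfold thermal
    rw [neg_mul]
    exact div_le_self (Real.exp_pos _).le (by linarith [Real.exp_pos (-β * x)])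
  have h2 : t * x * Real.exp (-(t * x)) ≤ 1 := by
    rw [Real.exp_neg, ← div_eq_mul_inv, div_le_one (Real.exp_pos _)]
    linarith [Real.add_one_le_exp (t * x)]
  rw [← one_div, le_div_iff₀ ht.1]
  calc x * thermal β t x * t ≤ x * Real.exp (-(t * x)) * t := by
        have := ht.1.le
        gcongr
    _ ≤ 1 := by linarith

/-- The exponential decay has rate t towards +∞ and β - t towards -∞. The constant blows up at both
ends of [0, β], so this estimate yields norm continuity only on the open interval. -/
theorem abs_mul_thermal_le {β t : ℝ} (ht : t ∈ Ioo 0 β) (x : ℝ) :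
    |x| * |thermal β t x| ≤ t⁻¹ + (β - t)⁻¹ := by
  have h1 := inv_pos.2 ht.1
  have h2 := inv_pos.2 (sub_pos.2 ht.2)
  rw [abs_of_pos (thermal_pos β t x)]
  rcases le_total 0 x with hx | hx
  · rw [abs_of_nonneg hx]
    linarith [mul_thermal_le ht hx]
  · have := mul_thermal_le (β := β) (t := β - t) ⟨by linarith [ht.2], by linarith [ht.1]⟩
      (neg_nonneg.2 hx)
    rw [thermal_symm] at this
    rw [abs_of_nonpos hx]
    linarith

theorem hasDerivAt_thermal (β t x : ℝ) :
    HasDerivAt (fun t => thermal β t x) (-(x * thermal β t x)) t := by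
  unfold thermal
  have h1 : HasDerivAt (fun t : ℝ => -t * x) (-1 * x) t := ((hasDerivAt_id t).neg).mul_const x
  exact (h1.exp.div_const (1 + Real.exp (-β * x))).congr_deriv (by ring)

section Hilbert

variable {H : Type*} [NormedAddCommGroup H] [InnerProductSpace ℂ H] [CompleteSpace H]

/-! ### Differentiable families in the functional calculus -/

theorem norm_fc_sub_le (S : H →ₗ.[ℂ] H) {φ ψ : ℝ → ℝ → ℝ} {a b C : ℝ} (hC : 0 ≤ C)
    (hφ : ∀ t ∈ Icc a b, HasEndLimits (φ t))
    (hφψ : ∀ t ∈ Icc a b, ∀ x, HasDerivAt (fun t => φ t x) (ψ t x) t)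
    (hb : ∀ t ∈ Icc a b, ∀ x, |ψ t x| ≤ C) {s t : ℝ} (hs : s ∈ Icc a b) (ht : t ∈ Icc a b) :
    ‖fc S (φ t) - fc S (φ s)‖ ≤ C * |t - s| := by
  rw [← fc_sub S (hφ t ht) (hφ s hs)]
  refine norm_fc_le S ((hφ t ht).sub (hφ s hs)) (by positivity) fun x => ?_
  exact (convex_Icc a b).norm_image_sub_le_of_norm_hasDerivWithin_le
    (fun r hr => (hφψ r hr x).hasDerivWithinAt) (fun r hr => hb r hr x) hs ht

theorem continuousOn_fc (S : H →ₗ.[ℂ] H) {φ ψ : ℝ → ℝ → ℝ} {a b C : ℝ} (hC : 0 ≤ C)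
    (hφ : ∀ t ∈ Icc a b, HasEndLimits (φ t))
    (hφψ : ∀ t ∈ Icc a b, ∀ x, HasDerivAt (fun t => φ t x) (ψ t x) t)
    (hb : ∀ t ∈ Icc a b, ∀ x, |ψ t x| ≤ C) : ContinuousOn (fun t => fc S (φ t)) (Icc a b) := by
  refine LipschitzOnWith.continuousOn (K := C.toNNReal) (LipschitzOnWith.of_dist_le_mul ?_)
  intro t ht s hs
  rw [dist_eq_norm, Real.dist_eq, Real.coe_toNNReal C hC]
  exact norm_fc_sub_le S hC hφ hφψ hb hs ht

/-- A bound on the second t-derivative uniform in x makes the Taylor remainder O(|t - s|²) uniformly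
in x, and `norm_fc_le` turns this into a bound in operator norm. -/
theorem hasDerivWithinAt_fc (S : H →ₗ.[ℂ] H) {φ ψ χ : ℝ → ℝ → ℝ} {a b C : ℝ} (hC : 0 ≤ C)
    (hφ : ∀ t ∈ Icc a b, HasEndLimits (φ t)) (hψ : ∀ t ∈ Icc a b, HasEndLimits (ψ t))
    (hφψ : ∀ t ∈ Icc a b, ∀ x, HasDerivAt (fun t => φ t x) (ψ t x) t)
    (hψχ : ∀ t ∈ Icc a b, ∀ x, HasDerivAt (fun t => ψ t x) (χ t x) t)
    (hb : ∀ t ∈ Icc a b, ∀ x, |χ t x| ≤ C) {s : ℝ} (hs : s ∈ Icc a b) :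
    HasDerivWithinAt (fun t => fc S (φ t)) (fc S (ψ s)) (Icc a b) s := by
  have key : ∀ t ∈ Icc a b, ‖fc S (φ t) - fc S (φ s) - (t - s) • fc S (ψ s)‖ ≤
      C * |t - s| * |t - s| := by
    intro t ht
    rw [← fc_sub S (hφ t ht) (hφ s hs), ← fc_const_mul S _ (hψ s hs),
      ← fc_sub S ((hφ t ht).sub (hφ s hs)) ((hψ s hs).const_mul _)]
    refine norm_fc_le S (((hφ t ht).sub (hφ s hs)).sub ((hψ s hs).const_mul _)) (by positivity)
      fun x => ?_
    have hsub : uIcc s t ⊆ Icc a b := uIcc_subset_Icc hs ht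
    have h1 : ∀ r ∈ uIcc s t, HasDerivWithinAt (fun r => φ r x - (r - s) * ψ s x)
        (ψ r x - ψ s x) (uIcc s t) r := by
      intro r hr
      have := (hφψ r (hsub hr) x).sub (((hasDerivAt_id r).sub_const s).mul_const (ψ s x))
      rw [one_mul] at this
      exact this.hasDerivWithinAt
    have h2 : ∀ r ∈ uIcc s t, ‖ψ r x - ψ s x‖ ≤ C * |t - s| := by
      intro r hr
      refine ((convex_Icc a b).norm_image_sub_le_of_norm_hasDerivWithin_le
        (fun r hr => (hψχ r hr x).hasDerivWithinAt) (fun r hr => hb r hr x) hs (hsub hr)).trans ?_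
      rw [Real.norm_eq_abs]
      exact mul_le_mul_of_nonneg_left (abs_sub_left_of_mem_uIcc hr) hC
    have h3 := (convex_uIcc s t).norm_image_sub_le_of_norm_hasDerivWithin_le h1 h2
      left_mem_uIcc right_mem_uIcc
    rw [Real.norm_eq_abs, Real.norm_eq_abs, sub_self, zero_mul, sub_zero, sub_right_comm] at h3
    exact h3
  rw [hasDerivWithinAt_iff_isLittleO]
  refine Asymptotics.IsBigO.trans_isLittleO (g := fun t => ‖t - s‖ ^ 2) ?_ ?_
  · refine Asymptotics.IsBigO.of_bound C ?_
    filter_upwards [self_mem_nhdsWithin] with t ht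
    refine (key t ht).trans (le_of_eq ?_)
    rw [Real.norm_eq_abs, abs_pow, Real.norm_eq_abs, abs_abs, pow_two, mul_assoc]
  · have : (fun t : ℝ => ‖t - s‖ ^ 2) =o[𝓝 s] fun t => t - s :=
      Asymptotics.isLittleO_pow_sub_sub s one_lt_two
    exact this.mono nhdsWithin_le_nhds

/-! ### The thermal operators and the Duhamel formula -/

/-- `e^{-tS} / (1 + e^{-βS})`. -/
def thermalOp (β : ℝ) (S : H →ₗ.[ℂ] H) (t : ℝ) : H →L[ℂ] H := fc S (thermal β t)

theorem norm_thermalOp_le {β t : ℝ} (hβ : 0 < β) (S : H →ₗ.[ℂ] H) (ht : t ∈ Icc 0 β) :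
    ‖thermalOp β S t‖ ≤ 1 :=
  norm_fc_le S (hasEndLimits_thermal hβ ht) zero_le_one (abs_thermal_le_one ht)

/-- The complementary Fermi factors add up to 1. This relation collapses the boundary terms in the
Dyson equation and in the integrations by parts. -/
theorem thermalOp_zero_add {β : ℝ} (hβ : 0 < β) (S : H →ₗ.[ℂ] H) :
    thermalOp β S 0 + thermalOp β S β = 1 := by
  rw [thermalOp, thermalOp, ← fc_add S (hasEndLimits_thermal hβ ⟨le_rfl, hβ.le⟩)
    (hasEndLimits_thermal hβ ⟨hβ.le, le_rfl⟩), ← fc_one S]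
  congr 1
  funext x
  unfold thermal
  rw [← add_div, neg_zero, zero_mul, Real.exp_zero, div_self (by positivity)]

theorem fermiOp_eq_thermalOp (β : ℝ) (S : H →ₗ.[ℂ] H) : fermiOp β S = thermalOp β S β := rfl

theorem continuousOn_thermalOp (β : ℝ) (S : H →ₗ.[ℂ] H) :
    ContinuousOn (thermalOp β S) (Ioo 0 β) := by
  intro t ht
  have hβ : 0 < β := ht.1.trans ht.2
  obtain ⟨a, ha0, hat⟩ := exists_between ht.1
  obtain ⟨b, htb, hbβ⟩ := exists_between ht.2
  have hI : ∀ r ∈ Icc a b, r ∈ Ioo 0 β := fun r hr => ⟨ha0.trans_le hr.1, hr.2.trans_lt hbβ⟩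
  have h := continuousOn_fc S (φ := thermal β) (ψ := fun t x => -(x * thermal β t x))
    (a := a) (b := b) (C := a⁻¹ + (β - b)⁻¹)
    (by have := inv_pos.2 ha0; have := inv_pos.2 (sub_pos.2 hbβ); positivity)
    (fun r hr => hasEndLimits_thermal hβ (Ioo_subset_Icc_self (hI r hr)))
    (fun r _ x => hasDerivAt_thermal β r x)
    (fun r hr x => by
      rw [abs_neg, abs_mul]
      refine (abs_mul_thermal_le (hI r hr) x).trans (add_le_add ?_ ?_)
      · exact inv_anti₀ ha0 hr.1
      · exact inv_anti₀ (sub_pos.2 hbβ) (by linarith [hr.2]))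
  exact (h.continuousAt (Icc_mem_nhds hat htb)).continuousWithinAt

/-- The function `e^{-tx} / ((1 + x²)(1 + e^{-βx}))`. -/
def regThermal (β t x : ℝ) : ℝ := lorentz x * thermal β t x

theorem hasEndLimits_regThermal {β t : ℝ} (hβ : 0 < β) (ht : t ∈ Icc 0 β) :
    HasEndLimits (regThermal β t) :=
  hasEndLimits_lorentz.mul (hasEndLimits_thermal hβ ht)

theorem hasEndLimits_mul_regThermal {β t : ℝ} (hβ : 0 < β) (ht : t ∈ Icc 0 β) :
    HasEndLimits fun x => x * regThermal β t x := by
  have := hasEndLimits_mul_lorentz.mul (hasEndLimits_thermal hβ ht)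
  simpa only [regThermal, mul_assoc] using this

/-- The weight (1 + x²)⁻¹ pays for the factor x² produced by two t-derivatives, uniformly up to the
endpoints of [0, β]. -/
theorem abs_sq_mul_regThermal_le {β t : ℝ} (ht : t ∈ Icc 0 β) (x : ℝ) :
    |x * (x * regThermal β t x)| ≤ 1 := by
  rw [← mul_assoc, ← pow_two, regThermal, ← mul_assoc, abs_mul,
    abs_of_nonneg (mul_nonneg (sq_nonneg x) (lorentz_pos x).le)]
  exact mul_le_one₀ (sq_mul_lorentz_le x) (abs_nonneg _) (abs_thermal_le_one ht x)

theorem hasDerivAt_regThermal (β t x : ℝ) :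
    HasDerivAt (fun t => regThermal β t x) (-(x * regThermal β t x)) t := by
  exact ((hasDerivAt_thermal β t x).const_mul (lorentz x)).congr_deriv (by unfold regThermal; ring)

theorem hasDerivWithinAt_fc_regThermal {β t : ℝ} (hβ : 0 < β) (S : H →ₗ.[ℂ] H)
    (ht : t ∈ Icc 0 β) : HasDerivWithinAt (fun t => fc S (regThermal β t))
      (-fc S (fun x => x * regThermal β t x)) (Icc 0 β) t := by
  rw [← fc_neg S (hasEndLimits_mul_regThermal hβ ht)]
  refine hasDerivWithinAt_fc S (φ := regThermal β) (ψ := fun t x => -(x * regThermal β t x))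
    (χ := fun t x => x * (x * regThermal β t x)) zero_le_one
    (fun t ht => hasEndLimits_regThermal hβ ht)
    (fun t ht => (hasEndLimits_mul_regThermal hβ ht).neg)
    (fun t _ x => hasDerivAt_regThermal β t x) (fun t _ x => ?_)
    (fun t ht x => abs_sq_mul_regThermal_le ht x) ht
  exact ((hasDerivAt_regThermal β t x).const_mul x).neg.congr_deriv (by ring)

theorem fc_regThermal {β t : ℝ} (hβ : 0 < β) (S : H →ₗ.[ℂ] H) (ht : t ∈ Icc 0 β) :
    fc S (regThermal β t) = fc S lorentz * thermalOp β S t :=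
  fc_mul S hasEndLimits_lorentz (hasEndLimits_thermal hβ ht)

theorem fc_regThermal' {β t : ℝ} (hβ : 0 < β) (S : H →ₗ.[ℂ] H) (ht : t ∈ Icc 0 β) :
    fc S (regThermal β t) = thermalOp β S t * fc S lorentz := by
  rw [fc_regThermal hβ S ht]
  exact fc_commute S _ _

theorem continuousOn_thermalOp_mul_mul (β : ℝ) (D S : H →ₗ.[ℂ] H) (X : H →L[ℂ] H) {a b l : ℝ}
    (ha : 0 ≤ a) (hal : a + l ≤ β) (hbl : 0 ≤ b - l) (hb : b ≤ β) :
    ContinuousOn (fun t => thermalOp β D (a + t) * X * thermalOp β S (b - t)) (Ioo 0 l) := by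
  refine ContinuousOn.mul (ContinuousOn.mul ?_ continuousOn_const) ?_
  · refine (continuousOn_thermalOp β D).comp (by fun_prop) fun t ht => ?_
    exact ⟨by linarith [ht.1], by linarith [ht.2]⟩
  · refine (continuousOn_thermalOp β S).comp (by fun_prop) fun t ht => ?_
    exact ⟨by linarith [ht.2], by linarith [ht.1]⟩

theorem intervalIntegrable_of_norm_le {E : Type*} [NormedAddCommGroup E] {f : ℝ → E} {a b C : ℝ}
    (hab : a ≤ b) (hf : ContinuousOn f (Ioo a b)) (hC : ∀ t ∈ Ioo a b, ‖f t‖ ≤ C) :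
    IntervalIntegrable f volume a b := by
  rw [intervalIntegrable_iff_integrableOn_Ioo_of_le hab]
  exact Integrable.of_bound (hf.aestronglyMeasurable measurableSet_Ioo) C
    (ae_restrict_of_forall_mem measurableSet_Ioo hC)

theorem norm_thermalOp_mul_mul_le {β : ℝ} (hβ : 0 < β) (D S : H →ₗ.[ℂ] H) (X : H →L[ℂ] H)
    {s t : ℝ} (hs : s ∈ Icc 0 β) (ht : t ∈ Icc 0 β) :
    ‖thermalOp β D s * X * thermalOp β S t‖ ≤ ‖X‖ := by
  calc ‖thermalOp β D s * X * thermalOp β S t‖ ≤ ‖thermalOp β D s‖ * ‖X‖ * ‖thermalOp β S t‖ :=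
        (norm_mul_le _ _).trans (mul_le_mul_of_nonneg_right (norm_mul_le _ _) (norm_nonneg _))
    _ ≤ 1 * ‖X‖ * 1 := by
        gcongr
        · exact norm_thermalOp_le hβ D hs
        · exact norm_thermalOp_le hβ S ht
    _ = ‖X‖ := by ring

theorem intervalIntegrable_thermalOp_mul_mul {β : ℝ} (hβ : 0 < β) (D S : H →ₗ.[ℂ] H)
    (X : H →L[ℂ] H) {a b l : ℝ} (hl : 0 ≤ l)
    (ha : 0 ≤ a) (hal : a + l ≤ β) (hbl : 0 ≤ b - l) (hb : b ≤ β) :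
    IntervalIntegrable (fun t => thermalOp β D (a + t) * X * thermalOp β S (b - t)) volume 0 l := by
  refine intervalIntegrable_of_norm_le (C := ‖X‖) hl
    (continuousOn_thermalOp_mul_mul β D S X ha hal hbl hb) fun t ht => ?_
  exact norm_thermalOp_mul_mul_le hβ D S X ⟨by linarith [ht.1], by linarith [ht.2]⟩
    ⟨by linarith [ht.2], by linarith [ht.1]⟩

/-- The Duhamel formula. -/
theorem Intertwines.duhamel {β : ℝ} (hβ : 0 < β) {D S : H →ₗ.[ℂ] H} {X X' : H →L[ℂ] H}
    (hD : HasBoundedTransform D) (hS : HasBoundedTransform S) (hX : Intertwines D S X X')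
    {a b l : ℝ} (hl : 0 ≤ l) (ha : 0 ≤ a) (hal : a + l ≤ β) (hbl : 0 ≤ b - l) (hb : b ≤ β) :
    thermalOp β D (a + l) * X * thermalOp β S (b - l) - thermalOp β D a * X * thermalOp β S b =
      -∫ t in 0..l, thermalOp β D (a + t) * X' * thermalOp β S (b - t) := by
  -- Between regularizers the product A(t) X B(t) is norm differentiable on the closed interval,
  -- with derivative -A(t) X' B(t) by `fc_mul_sub`; the fundamental theorem of calculus applies and
  -- the regularizers are cancelled.
  apply eq_of_lorentz_mul_mul_lorentz hD hS
  have m1 : ∀ t ∈ Icc 0 l, a + t ∈ Icc 0 β := fun t ht =>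
    ⟨by linarith [ht.1], by linarith [ht.2]⟩
  have m2 : ∀ t ∈ Icc 0 l, b - t ∈ Icc 0 β := fun t ht =>
    ⟨by linarith [ht.2], by linarith [ht.1]⟩
  set A := fun t => fc D (regThermal β (a + t))
  set B := fun t => fc S (regThermal β (b - t))
  have hA : ∀ t ∈ Icc 0 l, HasDerivWithinAt A (-fc D (fun x => x * regThermal β (a + t) x))
      (Icc 0 l) t := by
    intro t ht
    have := (hasDerivWithinAt_fc_regThermal hβ D (m1 t ht)).scomp t
      ((hasDerivAt_id t).const_add a).hasDerivWithinAt (fun r hr => m1 r hr)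
    simpa [Function.comp_def] using this
  have hB : ∀ t ∈ Icc 0 l, HasDerivWithinAt B (fc S (fun x => x * regThermal β (b - t) x))
      (Icc 0 l) t := by
    intro t ht
    have := (hasDerivWithinAt_fc_regThermal hβ S (m2 t ht)).scomp t
      ((hasDerivAt_id t).const_sub b).hasDerivWithinAt (fun r hr => m2 r hr)
    simpa [Function.comp_def] using this
  have hAB : ∀ t ∈ Icc 0 l, HasDerivWithinAt (fun t => A t * X * B t)
      (-(A t * X' * B t)) (Icc 0 l) t := by
    intro t ht
    refine (((hA t ht).mul_const X).mul (hB t ht)).congr_deriv ?_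
    simp only [A, B]
    rw [← hX.fc_mul_sub hD hS (hasEndLimits_regThermal hβ (m1 t ht))
      (hasEndLimits_mul_regThermal hβ (m1 t ht)) (hasEndLimits_regThermal hβ (m2 t ht))
      (hasEndLimits_mul_regThermal hβ (m2 t ht)), neg_sub]
    noncomm_ring
  have hcA : ContinuousOn A (Icc 0 l) := fun t ht => (hA t ht).continuousWithinAt
  have hcB : ContinuousOn B (Icc 0 l) := fun t ht => (hB t ht).continuousWithinAt
  have ftc := intervalIntegral.integral_eq_sub_of_hasDerivAt_of_le hl
    (f := fun t => A t * X * B t) (f' := fun t => -(A t * X' * B t))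
    (fun t ht => (hAB t ht).continuousWithinAt)
    (fun t ht => (hAB t (Ioo_subset_Icc_self ht)).hasDerivAt (Icc_mem_nhds ht.1 ht.2))
    (ContinuousOn.intervalIntegrable (by
      rw [uIcc_of_le hl]; exact ((hcA.mul continuousOn_const).mul hcB).neg))
  have hcomm : ∀ s ∈ Icc 0 l, ∀ Y : H →L[ℂ] H, A s * Y * B s =
      fc D lorentz * (thermalOp β D (a + s) * Y * thermalOp β S (b - s)) * fc S lorentz := by
    intro s hs Y
    simp only [A, B]
    rw [fc_regThermal hβ D (m1 s hs), fc_regThermal' hβ S (m2 s hs)]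
    noncomm_ring
  have hint := intervalIntegrable_thermalOp_mul_mul hβ D S X' hl ha hal hbl hb
  let L : (H →L[ℂ] H) →L[ℂ] (H →L[ℂ] H) :=
    (ContinuousLinearMap.mul ℂ (H →L[ℂ] H)).flip (fc S lorentz) ∘L
      ContinuousLinearMap.mul ℂ (H →L[ℂ] H) (fc D lorentz)
  have hL : ∀ Y, L Y = fc D lorentz * Y * fc S lorentz := fun Y => rfl
  rw [mul_neg, neg_mul, ← hL (∫ t in 0..l, _), ← L.intervalIntegral_comp_comm hint,
    ← intervalIntegral.integral_neg, mul_sub, sub_mul, ← hcomm l ⟨hl, le_rfl⟩]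
  have h0 := hcomm 0 ⟨le_rfl, hl⟩ X
  rw [add_zero, sub_zero] at h0
  rw [← h0, ← ftc]
  refine intervalIntegral.integral_congr fun t ht => ?_
  rw [uIcc_of_le hl] at ht
  simp only [hL]
  rw [hcomm t ht]

/-- Take the full interval [0, β] in the Duhamel formula. Replacing p(0) by 1 - p(β) on both sides
reduces the boundary terms p(β, D) X p(0, S) - p(0, D) X p(β, S) to the difference on the left. -/
theorem Intertwines.fermi_commutator {β : ℝ} (hβ : 0 < β) {D S : H →ₗ.[ℂ] H} {X X' : H →L[ℂ] H}
    (hD : HasBoundedTransform D) (hS : HasBoundedTransform S) (hX : Intertwines D S X X') :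
    fermiOp β D * X - X * fermiOp β S =
      -∫ t in 0..β, thermalOp β D t * X' * thermalOp β S (β - t) := by
  have h := hX.duhamel hβ hD hS (a := 0) (b := β) (l := β) hβ.le le_rfl (by linarith)
    (by linarith) le_rfl
  simp only [zero_add, sub_self] at h
  rw [← h, fermiOp_eq_thermalOp, fermiOp_eq_thermalOp,
    eq_sub_of_add_eq (thermalOp_zero_add hβ S), eq_sub_of_add_eq (thermalOp_zero_add hβ D)]
  noncomm_ring

theorem intertwines_perturb_perturb (D : H →ₗ.[ℂ] H) (K L : H →L[ℂ] H) :
    Intertwines (perturb D K) (perturb D L) 1 (K - L) := by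
  intro y y' h
  rw [mem_graph_perturb_iff] at *
  have e : (1 : H →L[ℂ] H) y' + (K - L) y - K ((1 : H →L[ℂ] H) y) = y' - L y := by
    simp only [one_apply_eq_self, sub_apply]
    abel
  rw [e]
  exact h

theorem norm_thermalOp_sub_le {β : ℝ} (hβ : 0 < β) {D : H →ₗ.[ℂ] H} (hD : IsSelfAdjoint D)
    {K L : H →L[ℂ] H} (hK : IsSelfAdjoint K) (hL : IsSelfAdjoint L) :
    ‖fermiOp β (perturb D K) - fermiOp β (perturb D L)‖ ≤ β * ‖K - L‖ := by
  have h := (intertwines_perturb_perturb D K L).fermi_commutator hβ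
    (hasBoundedTransform_of_isSelfAdjoint (isSelfAdjoint_perturb hD hK))
    (hasBoundedTransform_of_isSelfAdjoint (isSelfAdjoint_perturb hD hL))
  rw [mul_one, one_mul] at h
  rw [h, norm_neg]
  refine (intervalIntegral.norm_integral_le_of_norm_le_const (C := ‖K - L‖) fun t ht => ?_).trans
    (le_of_eq ?_)
  · rw [uIoc_of_le hβ.le] at ht
    exact norm_thermalOp_mul_mul_le hβ _ _ _ ⟨ht.1.le, ht.2⟩ ⟨by linarith [ht.2], by linarith [ht.1]⟩
  · rw [sub_zero, abs_of_pos hβ, mul_comm]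

end Hilbert

end DiracEntropy

end

noncomputable section

namespace DiracEntropy

open Filter Topology

section Hilbert

variable {H : Type*} [NormedAddCommGroup H] [InnerProductSpace ℂ H] [CompleteSpace H]

/-! ### The Green function and the Dyson equation -/

/-- The thermal operator, extended by zero. -/
def cutThermal (β : ℝ) (S : H →ₗ.[ℂ] H) : ℝ → H →L[ℂ] H := (Ico 0 β).indicator (thermalOp β S)

/-- The Green function `e^{sS} F_{σ(s)}`, extended by zero outside of `(-β, β)`. -/
def green (β : ℝ) (S : H →ₗ.[ℂ] H) (s : ℝ) : H →L[ℂ] H :=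
  cutThermal β S (-s) - cutThermal β S (β - s)

theorem stronglyMeasurable_cutThermal (β : ℝ) (S : H →ₗ.[ℂ] H) :
    StronglyMeasurable (cutThermal β S) := by
  refine ContinuousOn.stronglyMeasurable_of_countable_compl (s := {0, β}ᶜ) ?_
    (by rw [compl_compl]; exact (Set.toFinite _).countable)
  intro t ht
  simp only [mem_compl_iff, mem_insert_iff, mem_singleton_iff, not_or] at ht
  refine ContinuousAt.continuousWithinAt ?_
  rcases lt_or_gt_of_ne ht.1 with h | h
  · refine continuousAt_const.congr (f := fun _ => (0 : H →L[ℂ] H)) ?_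
    filter_upwards [Iio_mem_nhds h] with r hr
    exact (indicator_of_notMem (fun hr' => not_lt.2 hr'.1 hr) _).symm
  rcases lt_or_gt_of_ne ht.2 with h' | h'
  · refine ((continuousOn_thermalOp β S).continuousAt (Ioo_mem_nhds h h')).congr ?_
    filter_upwards [Ioo_mem_nhds h h'] with r hr
    exact (indicator_of_mem (Ioo_subset_Ico_self hr) _).symm
  · refine continuousAt_const.congr (f := fun _ => (0 : H →L[ℂ] H)) ?_
    filter_upwards [Ioi_mem_nhds h'] with r hr
    exact (indicator_of_notMem (fun hr' => not_lt.2 hr'.2.le hr) _).symm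

theorem norm_cutThermal_le {β : ℝ} (hβ : 0 < β) (S : H →ₗ.[ℂ] H) (t : ℝ) :
    ‖cutThermal β S t‖ ≤ 1 := by
  by_cases ht : t ∈ Ico 0 β
  · rw [cutThermal, indicator_of_mem ht]
    exact norm_thermalOp_le hβ S (Ico_subset_Icc_self ht)
  · rw [cutThermal, indicator_of_notMem ht, norm_zero]
    exact zero_le_one

theorem cutThermal_of_mem {β : ℝ} (S : H →ₗ.[ℂ] H) {t : ℝ} (ht : t ∈ Ico 0 β) :
    cutThermal β S t = thermalOp β S t := indicator_of_mem ht _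

theorem green_of_pos {β : ℝ} (S : H →ₗ.[ℂ] H) {s : ℝ} (h0 : 0 < s) (h1 : s ≤ β) :
    green β S s = -thermalOp β S (β - s) := by
  rw [green, cutThermal_of_mem S ⟨sub_nonneg.2 h1, sub_lt_self _ h0⟩, cutThermal,
    indicator_of_notMem fun h => by linarith [h.1], zero_sub]

theorem green_of_nonpos {β : ℝ} (S : H →ₗ.[ℂ] H) {s : ℝ} (h0 : s ≤ 0) (h1 : -β < s) :
    green β S s = thermalOp β S (-s) := by
  rw [green, cutThermal_of_mem S ⟨neg_nonneg.2 h0, by linarith⟩]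
  rw [cutThermal, indicator_of_notMem fun h => by linarith [h.2], sub_zero]

theorem norm_green_le {β : ℝ} (hβ : 0 < β) (S : H →ₗ.[ℂ] H) (s : ℝ) : ‖green β S s‖ ≤ 1 := by
  rcases lt_or_ge 0 s with h | h
  · rw [green, cutThermal, indicator_of_notMem fun h' => by linarith [h'.1], zero_sub, norm_neg]
    exact norm_cutThermal_le hβ S _
  · have : cutThermal β S (β - s) = 0 := indicator_of_notMem (fun h' => by linarith [h'.2]) _
    rw [green, this, sub_zero]
    exact norm_cutThermal_le hβ S _

theorem stronglyMeasurable_green (β : ℝ) (S : H →ₗ.[ℂ] H) : StronglyMeasurable (green β S) :=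
  ((stronglyMeasurable_cutThermal β S).comp_measurable measurable_neg).sub
    ((stronglyMeasurable_cutThermal β S).comp_measurable (measurable_const.sub measurable_id))

theorem green_eq_propagator {β : ℝ} (hβ : 0 < β) (S : H →ₗ.[ℂ] H) {s : ℝ} (hs : s ∈ Ioo (-β) β) :
    green β S s = propagator β S s := by
  rcases lt_or_ge 0 s with h | h
  · rw [green_of_pos S h hs.2.le, propagator, thermalOp, ← fc_neg S
      (hasEndLimits_thermal hβ ⟨by linarith [hs.2], by linarith⟩)]
    congr 1
    funext x
    rw [if_pos h, thermal, fermiPlus, ← neg_div, mul_div_assoc', div_eq_div_iff (by positivity)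
      (by positivity)]
    have h1 : Real.exp (s * x) = Real.exp (-(β - s) * x) * Real.exp (β * x) := by
      rw [← Real.exp_add]; ring_nf
    have h2 : Real.exp (β * x) * Real.exp (-β * x) = 1 := by
      rw [← Real.exp_add]; simp
    rw [h1]
    linear_combination Real.exp (-(β - s) * x) * h2
  · rw [green_of_nonpos S h hs.1, propagator, thermalOp]
    congr 1
    funext x
    rw [if_neg (not_lt.2 h), thermal, fermiMinus, neg_neg, mul_one_div]

/-- The convolution with the Green function and multiplication by `K`. -/
def greenConv (β : ℝ) (D : H →ₗ.[ℂ] H) (K : H →L[ℂ] H) (g : ℝ → H →L[ℂ] H) (s : ℝ) : H →L[ℂ] H :=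
  ∫ t in Ioo 0 β, green β D (s - t) * K * g t

/-- A strongly measurable function bounded by `C`. -/
structure IsBoundedMeasurable {α E : Type*} [MeasurableSpace α] [NormedAddCommGroup E] (g : α → E)
    (C : ℝ) : Prop where
  meas : StronglyMeasurable g
  bound : ∀ t, ‖g t‖ ≤ C

theorem IsBoundedMeasurable.integrable {α E : Type*} [MeasurableSpace α] [NormedAddCommGroup E]
    {g : α → E} {C : ℝ} (hg : IsBoundedMeasurable g C) (μ : Measure α) [IsFiniteMeasure μ] :
    Integrable g μ :=
  Integrable.of_bound hg.meas.aestronglyMeasurable C (Eventually.of_forall hg.bound)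

theorem IsBoundedMeasurable.green_mul {β : ℝ} (hβ : 0 < β) (D : H →ₗ.[ℂ] H) (K : H →L[ℂ] H)
    {α : Type*} [MeasurableSpace α] {r : α → ℝ} (hr : Measurable r) {g : α → H →L[ℂ] H} {C : ℝ}
    (hg : IsBoundedMeasurable g C) :
    IsBoundedMeasurable (fun a => green β D (r a) * K * g a) (‖K‖ * C) := by
  refine ⟨(((stronglyMeasurable_green β D).comp_measurable hr).mul_const K).mul hg.meas,
    fun a => ?_⟩
  calc ‖green β D (r a) * K * g a‖ ≤ ‖green β D (r a)‖ * ‖K‖ * ‖g a‖ :=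
        (norm_mul_le _ _).trans (mul_le_mul_of_nonneg_right (norm_mul_le _ _) (norm_nonneg _))
    _ ≤ 1 * ‖K‖ * C := by
        gcongr
        · exact norm_green_le hβ D _
        · exact hg.bound a
    _ = ‖K‖ * C := by ring

theorem IsBoundedMeasurable.greenConv {β : ℝ} (hβ : 0 < β) (D : H →ₗ.[ℂ] H) (K : H →L[ℂ] H)
    {g : ℝ → H →L[ℂ] H} {C : ℝ} (hg : IsBoundedMeasurable g C) :
    IsBoundedMeasurable (greenConv β D K g) (β * ‖K‖ * C) := by
  refine ⟨?_, fun s => ?_⟩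
  · refine StronglyMeasurable.integral_prod_right
      (f := fun s t => green β D (s - t) * K * g t) ?_
    exact (((stronglyMeasurable_green β D).comp_measurable
      (measurable_fst.sub measurable_snd)).mul_const K).mul
      (hg.meas.comp_measurable measurable_snd)
  · have := norm_setIntegral_le_of_norm_le_const (μ := volume) (s := Ioo 0 β) (C := ‖K‖ * C)
      (f := fun t => green β D (s - t) * K * g t) (by simp)
      (fun t _ => (hg.green_mul hβ D K (measurable_const.sub measurable_id)).bound t)
    refine this.trans (le_of_eq ?_)
    rw [Measure.real, Real.volume_Ioo, sub_zero, ENNReal.toReal_ofReal hβ.le]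
    ring

theorem greenConv_sub {β : ℝ} (hβ : 0 < β) (D : H →ₗ.[ℂ] H) (K : H →L[ℂ] H)
    {f g : ℝ → H →L[ℂ] H} {C C' : ℝ} (hf : IsBoundedMeasurable f C)
    (hg : IsBoundedMeasurable g C') (c : ℝ) (s : ℝ) :
    greenConv β D K (fun t => f t - c • g t) s =
      greenConv β D K f s - c • greenConv β D K g s := by
  have h1 := (hf.green_mul hβ D K (r := fun t => s - t)
    (measurable_const.sub measurable_id)).integrable (volume.restrict (Ioo 0 β))
  have h2 := (hg.green_mul hβ D K (r := fun t => s - t)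
    (measurable_const.sub measurable_id)).integrable (volume.restrict (Ioo 0 β))
  have h3 := integral_sub h1 (h2.smul c)
  simp only [Pi.smul_apply, integral_smul] at h3
  unfold greenConv
  rw [← h3]
  refine integral_congr_ae (Eventually.of_forall fun t => ?_)
  simp only [mul_sub, mul_smul_comm]

/-- Two Duhamel formulas, with time lengths s and β - s, give the parts t < s and t > s of the Green
convolution. In their difference the boundary terms are (p(0, D) + p(β, D)) p(β - s, S) - p(β - s,
D)(p(0, S) + p(β, S)), where both brackets are 1. -/
theorem dyson_equation {β : ℝ} (hβ : 0 < β) {D : H →ₗ.[ℂ] H} {K : H →L[ℂ] H}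
    (hD : IsSelfAdjoint D) (hK : IsSelfAdjoint K) (u : ℝ) {s : ℝ} (hs : s ∈ Ico 0 β) :
    thermalOp β (perturb D ((u : ℂ) • K)) (β - s) = thermalOp β D (β - s)
      - u • greenConv β D K (fun t => cutThermal β (perturb D ((u : ℂ) • K)) (β - t)) s := by
  have huK : IsSelfAdjoint ((u : ℂ) • K) := by
    rw [IsSelfAdjoint, star_smul, hK.star_eq]; simp
  set S := perturb D ((u : ℂ) • K) with hSdef
  have hDt := hasBoundedTransform_of_isSelfAdjoint hD
  have hSt : HasBoundedTransform S :=
    hasBoundedTransform_of_isSelfAdjoint (isSelfAdjoint_perturb hD huK)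
  have hI : Intertwines D S 1 (-((u : ℂ) • K)) := intertwines_one_perturb D _
  have h1 := hI.duhamel hβ hDt hSt (a := β - s) (b := β) (l := s) hs.1 (by linarith [hs.2])
    (by linarith) (by linarith [hs.2]) le_rfl
  have h2 := hI.duhamel hβ hDt hSt (a := 0) (b := β - s) (l := β - s) (by linarith [hs.2]) le_rfl
    (by linarith [hs.1]) (by linarith) (by linarith [hs.1])
  simp only [sub_add_cancel, mul_one, zero_add, sub_self, mul_neg, neg_mul,
    intervalIntegral.integral_neg, neg_neg, mul_smul_comm, smul_mul_assoc,
    intervalIntegral.integral_smul] at h1 h2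
  have e1 : ∫ t in Ioo 0 s, green β D (s - t) * K * cutThermal β S (β - t) =
      ∫ t in (0 : ℝ)..s, -(thermalOp β D (β - s + t) * K * thermalOp β S (β - t)) := by
    rw [intervalIntegral.integral_of_le hs.1, integral_Ioc_eq_integral_Ioo]
    refine setIntegral_congr_fun measurableSet_Ioo fun t ht => ?_
    rw [green_of_pos D (sub_pos.2 ht.2) (by linarith [ht.1, hs.2]),
      cutThermal_of_mem S ⟨by linarith [ht.2, hs.2], by linarith [ht.1]⟩, neg_mul, neg_mul]
    congr 4
    ring
  have e2 : ∫ t in Ioo s β, green β D (s - t) * K * cutThermal β S (β - t) =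
      ∫ t in (0 : ℝ)..(β - s), thermalOp β D t * K * thermalOp β S (β - s - t) := by
    have := intervalIntegral.integral_comp_sub_right
      (fun t => thermalOp β D t * K * thermalOp β S (β - s - t)) s (a := s) (b := β)
    rw [sub_self] at this
    rw [← this, intervalIntegral.integral_of_le hs.2.le, integral_Ioc_eq_integral_Ioo]
    refine setIntegral_congr_fun measurableSet_Ioo fun t ht => ?_
    rw [green_of_nonpos D (by linarith [ht.1]) (by linarith [ht.2, hs.1]),
      cutThermal_of_mem S ⟨by linarith [ht.2, hs.2], by linarith [ht.1, hs.1]⟩, neg_sub]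
    congr 2
    ring
  have hmeas : IsBoundedMeasurable (fun t => cutThermal β S (β - t)) 1 :=
    ⟨(stronglyMeasurable_cutThermal β S).comp_measurable (measurable_const.sub measurable_id),
      fun t => norm_cutThermal_le hβ S _⟩
  have hint := hmeas.green_mul hβ D K (r := fun t => s - t) (measurable_const.sub measurable_id)
  have hsplit : greenConv β D K (fun t => cutThermal β S (β - t)) s =
      (∫ t in Ioo 0 s, green β D (s - t) * K * cutThermal β S (β - t)) +
      ∫ t in Ioo s β, green β D (s - t) * K * cutThermal β S (β - t) := by
    rw [greenConv, ← integral_Ioc_eq_integral_Ioo, ← integral_Ioc_eq_integral_Ioo,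
      ← integral_Ioc_eq_integral_Ioo, ← Ioc_union_Ioc_eq_Ioc hs.1 hs.2.le]
    exact setIntegral_union (by
      rw [Set.disjoint_left]; exact fun t h h' => not_lt.2 h.2 h'.1) measurableSet_Ioc
      (hint.integrable _) (hint.integrable _)
  rw [hsplit, e1, e2, intervalIntegral.integral_neg]
  have z1 := eq_sub_of_add_eq (thermalOp_zero_add hβ D)
  have z2 := eq_sub_of_add_eq (thermalOp_zero_add hβ S)
  rw [z1, z2] at h2
  have h3 : thermalOp β S (β - s) - thermalOp β D (β - s) =
      (u : ℂ) • (∫ t in (0 : ℝ)..s, thermalOp β D (β - s + t) * K * thermalOp β S (β - t))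
      - (u : ℂ) • ∫ t in (0 : ℝ)..(β - s), thermalOp β D t * K * thermalOp β S (β - s - t) := by
    rw [← h1, ← h2]
    noncomm_ring
  rw [eq_add_of_sub_eq h3, ← Complex.coe_smul]
  module

/-! ### The iterates -/

/-- The iterated convolution with the Green function. -/
def greenIter (β : ℝ) (D : H →ₗ.[ℂ] H) (K : H →L[ℂ] H) (g : ℝ → H →L[ℂ] H) (n : ℕ) :
    ℝ → H →L[ℂ] H := (greenConv β D K)^[n] g

theorem greenIter_succ (β : ℝ) (D : H →ₗ.[ℂ] H) (K : H →L[ℂ] H) (g : ℝ → H →L[ℂ] H) (n : ℕ) :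
    greenIter β D K g (n + 1) = greenConv β D K (greenIter β D K g n) :=
  Function.iterate_succ_apply' _ _ _

theorem isBoundedMeasurable_greenIter {β : ℝ} (hβ : 0 < β) (D : H →ₗ.[ℂ] H) (K : H →L[ℂ] H)
    {g : ℝ → H →L[ℂ] H} (hg : IsBoundedMeasurable g 1) (n : ℕ) :
    IsBoundedMeasurable (greenIter β D K g n) ((β * ‖K‖) ^ n) := by
  induction n with
  | zero => simpa [greenIter] using hg
  | succ n ih =>
    rw [greenIter_succ, pow_succ']
    exact ih.greenConv hβ D K

theorem greenConv_congr {β : ℝ} (D : H →ₗ.[ℂ] H) (K : H →L[ℂ] H) {f g : ℝ → H →L[ℂ] H}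
    (h : ∀ t ∈ Ico 0 β, f t = g t) (s : ℝ) : greenConv β D K f s = greenConv β D K g s := by
  refine setIntegral_congr_fun measurableSet_Ioo fun t ht => ?_
  rw [h t (Ioo_subset_Ico_self ht)]

/-- The free and the perturbed functions in the Dyson equation. -/
def thermalRev (β : ℝ) (S : H →ₗ.[ℂ] H) (t : ℝ) : H →L[ℂ] H :=
  (Ico 0 β).indicator (fun t => thermalOp β S (β - t)) t

theorem isBoundedMeasurable_thermalRev {β : ℝ} (hβ : 0 < β) (S : H →ₗ.[ℂ] H) :
    IsBoundedMeasurable (thermalRev β S) 1 := by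
  refine ⟨?_, fun t => ?_⟩
  · have h1 : StronglyMeasurable ((Ioo 0 β).indicator fun t => cutThermal β S (β - t)) :=
      ((stronglyMeasurable_cutThermal β S).comp_measurable
        (measurable_const.sub measurable_id)).indicator measurableSet_Ioo
    have h2 : StronglyMeasurable (({0} : Set ℝ).indicator fun _ => thermalOp β S β) :=
      stronglyMeasurable_const.indicator (measurableSet_singleton 0)
    -- At t = 0 the argument β - t equals β, where `cutThermal` is cut off to 0, so this value is
    -- added separately. It must be kept, since it is the Fermi factor.
    have e : thermalRev β S = (Ioo 0 β).indicator (fun t => cutThermal β S (β - t)) +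
        ({0} : Set ℝ).indicator fun _ => thermalOp β S β := ?_
    · rw [e]; exact h1.add h2
    funext t
    rw [Pi.add_apply, thermalRev]
    rcases eq_or_ne t 0 with rfl | h0
    · rw [indicator_of_mem (show (0 : ℝ) ∈ Ico 0 β from ⟨le_rfl, hβ⟩), indicator_of_notMem (by simp),
        indicator_of_mem (mem_singleton (0 : ℝ)),
        zero_add, sub_zero]
    · rw [indicator_of_notMem (s := {0}) h0, add_zero]
      by_cases ht : t ∈ Ioo 0 β
      · rw [indicator_of_mem ht, indicator_of_mem (Ioo_subset_Ico_self ht),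
          cutThermal_of_mem S ⟨by linarith [ht.2], by linarith [ht.1]⟩]
      · rw [indicator_of_notMem ht, indicator_of_notMem]
        exact fun h => ht ⟨lt_of_le_of_ne h.1 h0.symm, h.2⟩
  · by_cases ht : t ∈ Ico 0 β
    · rw [thermalRev, indicator_of_mem ht]
      exact norm_thermalOp_le hβ S ⟨by linarith [ht.2], by linarith [ht.1]⟩
    · rw [thermalRev, indicator_of_notMem ht, norm_zero]
      exact zero_le_one

theorem dyson_equation_thermalRev {β : ℝ} (hβ : 0 < β) {D : H →ₗ.[ℂ] H} {K : H →L[ℂ] H}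
    (hD : IsSelfAdjoint D) (hK : IsSelfAdjoint K) (u : ℝ) {s : ℝ} (hs : s ∈ Ico 0 β) :
    thermalRev β (perturb D ((u : ℂ) • K)) s = thermalRev β D s
      - u • greenConv β D K (thermalRev β (perturb D ((u : ℂ) • K))) s := by
  rw [thermalRev, thermalRev, indicator_of_mem hs, indicator_of_mem hs,
    dyson_equation hβ hD hK u hs]
  congr 2
  refine setIntegral_congr_fun measurableSet_Ioo fun t ht => ?_
  beta_reduce
  rw [thermalRev, indicator_of_mem (Ioo_subset_Ico_self ht),
    cutThermal_of_mem _ ⟨by linarith [ht.2], by linarith [ht.1]⟩]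

theorem dyson_expansion {β : ℝ} (hβ : 0 < β) {D : H →ₗ.[ℂ] H} {K : H →L[ℂ] H}
    (hD : IsSelfAdjoint D) (hK : IsSelfAdjoint K) (u : ℝ) {s : ℝ} (hs : s ∈ Ico 0 β) (N : ℕ) :
    thermalRev β (perturb D ((u : ℂ) • K)) s =
      (∑ n ∈ Finset.range N, (-u) ^ n • greenIter β D K (thermalRev β D) n s) +
        (-u) ^ N • greenIter β D K (thermalRev β (perturb D ((u : ℂ) • K))) N s := by
  set S := perturb D ((u : ℂ) • K)
  have hm := isBoundedMeasurable_thermalRev hβ S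
  have hm' := isBoundedMeasurable_thermalRev hβ D
  -- This is the Dyson equation convolved n times with the Green function; summing it telescopes
  -- into the expansion with remainder.
  have key : ∀ n : ℕ, ∀ s ∈ Ico 0 β, greenIter β D K (thermalRev β S) n s =
      greenIter β D K (thermalRev β D) n s - u • greenIter β D K (thermalRev β S) (n + 1) s := by
    intro n
    induction n with
    | zero => exact fun s hs => dyson_equation_thermalRev hβ hD hK u hs
    | succ n ih =>
      intro s _
      rw [greenIter_succ, greenIter_succ, greenIter_succ _ _ _ _ (n + 1), greenConv_congr D K ih,
        greenConv_sub hβ D K (isBoundedMeasurable_greenIter hβ D K hm' n)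
          (isBoundedMeasurable_greenIter hβ D K hm (n + 1))]
  induction N with
  | zero => simp [greenIter]
  | succ N ih =>
    rw [Finset.sum_range_succ, ih, key N s hs, smul_sub, smul_smul, add_assoc, pow_succ]
    congr 1
    rw [sub_eq_add_neg, ← neg_smul, mul_neg]

/-- The remainder after N terms is an N-fold Green convolution of the perturbed thermal family,
itself a contraction, so it is at most (β‖K‖)^N. -/
theorem hasSum_dyson {β : ℝ} (hβ : 0 < β) {D : H →ₗ.[ℂ] H} {K : H →L[ℂ] H}
    (hD : IsSelfAdjoint D) (hK : IsSelfAdjoint K) (hKβ : β * ‖K‖ < 1) {u : ℝ} (hu : |u| ≤ 1) :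
    HasSum (fun n : ℕ => (-u) ^ n • greenIter β D K (thermalRev β D) n 0)
      (fermiOp β (perturb D ((u : ℂ) • K))) := by
  have h0 : (0 : ℝ) ∈ Ico 0 β := ⟨le_rfl, hβ⟩
  have hpos : 0 ≤ β * ‖K‖ := by positivity
  have hbd : ∀ (S : H →ₗ.[ℂ] H) (n : ℕ),
      ‖(-u) ^ n • greenIter β D K (thermalRev β S) n 0‖ ≤ (β * ‖K‖) ^ n := by
    intro S n
    have h1 := (isBoundedMeasurable_greenIter hβ D K (isBoundedMeasurable_thermalRev hβ S) n).bound 0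
    rw [norm_smul, norm_pow, norm_neg, Real.norm_eq_abs]
    calc |u| ^ n * _ ≤ 1 * (β * ‖K‖) ^ n := by
          gcongr
          exact pow_le_one₀ (abs_nonneg u) hu
      _ = _ := one_mul _
  have hsum : Summable fun n : ℕ => (-u) ^ n • greenIter β D K (thermalRev β D) n 0 :=
    Summable.of_norm_bounded (summable_geometric_of_lt_one hpos hKβ) (hbd D)
  rw [hsum.hasSum_iff_tendsto_nat]
  have hS : fermiOp β (perturb D ((u : ℂ) • K)) = thermalRev β (perturb D ((u : ℂ) • K)) 0 := by
    rw [thermalRev, indicator_of_mem h0, sub_zero]; rfl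
  rw [hS, tendsto_iff_norm_sub_tendsto_zero]
  refine squeeze_zero (fun _ => norm_nonneg _) (fun N => ?_)
    (tendsto_pow_atTop_nhds_zero_of_lt_one hpos hKβ)
  rw [dyson_expansion hβ hD hK u h0 N, ← norm_neg, neg_sub, add_sub_cancel_left]
  exact hbd _ N

/-! ### The terms of the series as iterates -/

/-- The integrand of the iterated convolution. -/
def greenChain (β : ℝ) (D : H →ₗ.[ℂ] H) (K : H →L[ℂ] H) (g : ℝ → H →L[ℂ] H) :
    (n : ℕ) → (Fin n → ℝ) → ℝ → H →L[ℂ] H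
  | 0, _, s => g s
  | n + 1, u, s => green β D (s - u 0) * K * greenChain β D K g n (fun j => u j.succ) (u 0)

theorem isBoundedMeasurable_greenChain {β : ℝ} (hβ : 0 < β) (D : H →ₗ.[ℂ] H) (K : H →L[ℂ] H)
    {g : ℝ → H →L[ℂ] H} {C : ℝ} (hg : IsBoundedMeasurable g C) (n : ℕ) :
    ∃ C', IsBoundedMeasurable (fun z : (Fin n → ℝ) × ℝ => greenChain β D K g n z.1 z.2) C' := by
  induction n with
  | zero => exact ⟨C, hg.meas.comp_measurable measurable_snd, fun z => hg.bound z.2⟩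
  | succ n ih =>
    obtain ⟨C', hC'⟩ := ih
    have m0 : Measurable fun z : (Fin (n + 1) → ℝ) × ℝ => z.1 0 :=
      (measurable_pi_apply 0).comp measurable_fst
    have m1 : Measurable fun z : (Fin (n + 1) → ℝ) × ℝ =>
        ((fun j => z.1 j.succ : Fin n → ℝ), z.1 0) :=
      (measurable_pi_lambda _ fun j => (measurable_pi_apply j.succ).comp measurable_fst).prodMk m0
    have h1 : IsBoundedMeasurable (fun z : (Fin (n + 1) → ℝ) × ℝ =>
        greenChain β D K g n (fun j => z.1 j.succ) (z.1 0)) C' :=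
      ⟨hC'.meas.comp_measurable m1, fun z => hC'.bound ((fun j => z.1 j.succ), z.1 0)⟩
    have m2 : Measurable fun z : (Fin (n + 1) → ℝ) × ℝ => z.2 - z.1 0 :=
      Measurable.sub measurable_snd m0
    have h2 := h1.green_mul hβ D K m2
    exact ⟨_, h2.meas, h2.bound⟩

/-- Fubini, peeling off the first time variable: the chain integrand is bounded and the time box has
finite measure. -/
theorem integral_greenChain {β : ℝ} (hβ : 0 < β) (D : H →ₗ.[ℂ] H) (K : H →L[ℂ] H)
    {g : ℝ → H →L[ℂ] H} {C : ℝ} (hg : IsBoundedMeasurable g C) (n : ℕ) (s : ℝ) :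
    ∫ u, greenChain β D K g n u s ∂(Measure.pi fun _ : Fin n => volume.restrict (Ioo (0 : ℝ) β)) =
      greenIter β D K g n s := by
  induction n generalizing s with
  | zero => simp [greenChain, greenIter, Measure.real]
  | succ n ih =>
    have hmp := measurePreserving_piFinSuccAbove
      (fun _ : Fin (n + 1) => volume.restrict (Ioo (0 : ℝ) β)) 0
    obtain ⟨C', hC'⟩ := isBoundedMeasurable_greenChain hβ D K hg n
    have hb : IsBoundedMeasurable (fun z : ℝ × (Fin n → ℝ) =>
        green β D (s - z.1) * K * greenChain β D K g n z.2 z.1) (‖K‖ * C') := by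
      have h1 : IsBoundedMeasurable (fun z : ℝ × (Fin n → ℝ) => greenChain β D K g n z.2 z.1) C' :=
        ⟨hC'.meas.comp_measurable measurable_swap, fun z => hC'.bound (z.2, z.1)⟩
      have m2 : Measurable fun z : ℝ × (Fin n → ℝ) => s - z.1 :=
        Measurable.sub measurable_const measurable_fst
      have h2 := h1.green_mul hβ D K m2
      exact ⟨h2.meas, h2.bound⟩
    have h1 := hmp.integral_comp (MeasurableEquiv.measurableEmbedding _)
      (fun z : ℝ × (Fin n → ℝ) => green β D (s - z.1) * K * greenChain β D K g n z.2 z.1)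
    rw [greenIter_succ, greenConv]
    have h2 : ∀ u : Fin (n + 1) → ℝ, greenChain β D K g (n + 1) u s =
        (fun z : ℝ × (Fin n → ℝ) => green β D (s - z.1) * K * greenChain β D K g n z.2 z.1)
          (MeasurableEquiv.piFinSuccAbove (fun _ => ℝ) 0 u) := by
      intro u
      rfl
    simp only [h2]
    refine h1.trans ?_
    rw [integral_prod _ (hb.integrable _)]
    refine integral_congr_ae (Eventually.of_forall fun t => ?_)
    simp only
    rw [← ih t]
    have hint : Integrable (fun u : Fin n → ℝ => greenChain β D K g n u t)
        (Measure.pi fun _ : Fin n => volume.restrict (Ioo (0 : ℝ) β)) :=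
      IsBoundedMeasurable.integrable (C := C')
        ⟨hC'.meas.comp_measurable (measurable_id.prodMk measurable_const), fun z => hC'.bound (z, t)⟩ _
    exact (ContinuousLinearMap.mul ℂ (H →L[ℂ] H) (green β D (s - t) * K)).integral_comp_comm hint

theorem greenChain_eq (β : ℝ) (D : H →ₗ.[ℂ] H) (K : H →L[ℂ] H)
    (g : ℝ → H →L[ℂ] H) (k : ℕ) (u : Fin (k + 1) → ℝ) (s : ℝ) :
    greenChain β D K g (k + 1) u s = green β D (s - u 0)
      * (List.ofFn fun j : Fin k => K * green β D (u j.castSucc - u j.succ)).prod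
      * K * g (u (Fin.last k)) := by
  induction k generalizing s with
  | zero => simp [greenChain]
  | succ k ih =>
    rw [greenChain, ih, List.ofFn_succ, List.prod_cons]
    simp only [mul_assoc, Fin.castSucc_zero, Fin.succ_last, Fin.succ_castSucc]

/-- All factors are Green functions except the last: e^{uD} F₊ equals -p(β - u, D), and this is the
source of the minus sign. -/
theorem seriesIntegrand_eq {β : ℝ} (hβ : 0 < β) (D : H →ₗ.[ℂ] H) (K : H →L[ℂ] H) (k : ℕ)
    {u : Fin (k + 1) → ℝ} (hu : ∀ j, u j ∈ Ioo 0 β) :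
    seriesIntegrand β D K k u = -greenChain β D K (thermalRev β D) (k + 1) u 0 := by
  rw [greenChain_eq, seriesIntegrand]
  have e1 : fc D (fun x => fermiMinus β x * Real.exp (-u 0 * x)) = green β D (0 - u 0) := by
    rw [green_of_nonpos D (by linarith [(hu 0).1]) (by linarith [(hu 0).2]), thermalOp]
    congr 1
    funext x
    rw [thermal, fermiMinus, zero_sub, neg_neg, one_div_mul_eq_div]
  have e2 : fc D (fun x => Real.exp (u (Fin.last k) * x) * fermiPlus β x) =
      -thermalRev β D (u (Fin.last k)) := by
    have h := hu (Fin.last k)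
    have h3 := green_eq_propagator hβ D (s := u (Fin.last k)) ⟨by linarith [h.1], h.2⟩
    rw [green_of_pos D h.1 h.2.le, propagator] at h3
    rw [thermalRev, indicator_of_mem (Ioo_subset_Ico_self h), h3]
    simp only [if_pos h.1]
  have e3 : (fun j : Fin k => K * propagator β D (u j.castSucc - u j.succ)) =
      fun j : Fin k => K * green β D (u j.castSucc - u j.succ) := by
    funext j
    rw [green_eq_propagator hβ D ⟨by linarith [(hu j.castSucc).1, (hu j.succ).2],
      by linarith [(hu j.castSucc).2, (hu j.succ).1]⟩]
  rw [e1, e2, e3, mul_neg]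

theorem strongIntegral_eq_integral {ι : Type*} [MeasurableSpace ι] {μ : Measure ι}
    {F : ι → H →L[ℂ] H} (hF : Integrable F μ) : strongIntegral μ F = ∫ t, F t ∂μ :=
  strongIntegral_eq fun v => ⟨hF.apply_continuousLinearMap v,
    ContinuousLinearMap.integral_apply hF v⟩

theorem seriesTerm_eq {β : ℝ} (hβ : 0 < β) (D : H →ₗ.[ℂ] H) (K : H →L[ℂ] H) (k : ℕ) :
    seriesTerm β D K k = (-((-1 : ℝ) ^ (k + 1) / ((k : ℝ) + 2))) •
      greenIter β D K (thermalRev β D) (k + 1) 0 := by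
  have hg := isBoundedMeasurable_thermalRev hβ D
  obtain ⟨C, hC⟩ := isBoundedMeasurable_greenChain hβ D K hg (k + 1)
  have hμ : (volume.restrict (Set.univ.pi fun _ : Fin (k + 1) => Ioo (0 : ℝ) β)) =
      Measure.pi fun _ : Fin (k + 1) => volume.restrict (Ioo (0 : ℝ) β) :=
    Measure.restrict_pi_pi _ _
  have hae : seriesIntegrand β D K k =ᵐ[volume.restrict
      (Set.univ.pi fun _ : Fin (k + 1) => Ioo (0 : ℝ) β)]
      fun u => -greenChain β D K (thermalRev β D) (k + 1) u 0 :=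
    ae_restrict_of_forall_mem (MeasurableSet.univ_pi fun _ => measurableSet_Ioo) fun u hu =>
      seriesIntegrand_eq hβ D K k fun j => hu j trivial
  have hint : Integrable (fun u => -greenChain β D K (thermalRev β D) (k + 1) u 0)
      (volume.restrict (Set.univ.pi fun _ : Fin (k + 1) => Ioo (0 : ℝ) β)) := by
    rw [hμ]
    refine Integrable.neg (IsBoundedMeasurable.integrable (C := C) ⟨?_, fun u => hC.bound (u, 0)⟩ _)
    exact hC.meas.comp_measurable (measurable_id.prodMk measurable_const)
  rw [seriesTerm, strongIntegral_eq_integral (hint.congr hae.symm), integral_congr_ae hae,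
    integral_neg, hμ, integral_greenChain hβ D K hg, Complex.coe_smul, smul_neg, neg_smul]

theorem isSelfAdjoint_real_smul {K : H →L[ℂ] H} (hK : IsSelfAdjoint K) (u : ℝ) :
    IsSelfAdjoint ((u : ℂ) • K) := by
  rw [IsSelfAdjoint, star_smul, hK.star_eq]; simp

theorem continuous_fermiOp_perturb {β : ℝ} (hβ : 0 < β) {D : H →ₗ.[ℂ] H} {K : H →L[ℂ] H}
    (hD : IsSelfAdjoint D) (hK : IsSelfAdjoint K) :
    Continuous fun u : ℝ => fermiOp β (perturb D ((u : ℂ) • K)) := by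
  refine LipschitzWith.continuous (K := (β * ‖K‖).toNNReal) (LipschitzWith.of_dist_le_mul ?_)
  intro u v
  rw [dist_eq_norm, Real.dist_eq, Real.coe_toNNReal _ (by positivity)]
  refine (norm_thermalOp_sub_le hβ hD (isSelfAdjoint_real_smul hK u)
    (isSelfAdjoint_real_smul hK v)).trans (le_of_eq ?_)
  rw [← sub_smul, norm_smul, ← Complex.ofReal_sub, Complex.norm_real, Real.norm_eq_abs]
  ring

theorem entropyOp_eq {β : ℝ} (hβ : 0 < β) {D : H →ₗ.[ℂ] H} {K : H →L[ℂ] H}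
    (hD : IsSelfAdjoint D) (hK : IsSelfAdjoint K) : entropyOp β D K = (β : ℂ) • (K *
      ∫ u in (0 : ℝ)..1, (fermiOp β D - fermiOp β (perturb D ((u : ℂ) • K)))) := by
  rw [entropyOp, strongIntegral_eq_integral, intervalIntegral.integral_of_le zero_le_one,
    integral_Ioc_eq_integral_Ioo]
  have h := (continuous_const.sub (continuous_fermiOp_perturb hβ hD hK) :
    Continuous fun u : ℝ => fermiOp β D - fermiOp β (perturb D ((u : ℂ) • K)))
  exact (h.integrableOn_Icc (a := 0) (b := 1)).mono_set Ioo_subset_Icc_self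

/-- The difference of Fermi factors is the Dyson series without its zeroth term, negated. It is
integrated over 0 < u < 1 term by term, with the geometric series as majorant. -/
theorem series_identity {β : ℝ} (hβ : 0 < β) {D : H →ₗ.[ℂ] H} {K : H →L[ℂ] H}
    (hD : IsSelfAdjoint D) (hK : IsSelfAdjoint K) (hKβ : ‖K‖ < β⁻¹) :
    (Summable fun k => ‖seriesTerm β D K k‖) ∧
      (β : ℂ) • (K * ∑' k, seriesTerm β D K k) = entropyOp β D K ∧
      relativeEntropy β D K = trace (entropyOp β D K) := by
  have hKβ' : β * ‖K‖ < 1 := by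
    rwa [← lt_div_iff₀' hβ, one_div]
  have hpos : 0 ≤ β * ‖K‖ := by positivity
  set J : ℕ → H →L[ℂ] H := fun n => greenIter β D K (thermalRev β D) n 0 with hJ
  have hJn : ∀ n, ‖J n‖ ≤ (β * ‖K‖) ^ n := fun n =>
    (isBoundedMeasurable_greenIter hβ D K (isBoundedMeasurable_thermalRev hβ D) n).bound 0
  have hgeom := (summable_nat_add_iff 1).2 (summable_geometric_of_lt_one hpos hKβ')
  have hsum : Summable fun k => ‖seriesTerm β D K k‖ := by
    refine Summable.of_nonneg_of_le (fun _ => norm_nonneg _) (fun k => ?_) hgeom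
    rw [seriesTerm_eq hβ, norm_smul, norm_neg, norm_div, norm_pow, norm_neg, norm_one, one_pow,
      Real.norm_eq_abs, abs_of_pos (by positivity : (0 : ℝ) < k + 2)]
    calc 1 / ((k : ℝ) + 2) * ‖J (k + 1)‖ ≤ 1 * (β * ‖K‖) ^ (k + 1) := by
          gcongr
          · rw [div_le_one (by positivity)]
            have : (0 : ℝ) ≤ k := k.cast_nonneg
            linarith
          · exact hJn _
      _ = _ := one_mul _
  have hop : (β : ℂ) • (K * ∑' k, seriesTerm β D K k) = entropyOp β D K := by
    rw [entropyOp_eq hβ hD hK]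
    congr 2
    rw [intervalIntegral.integral_of_le zero_le_one, integral_Ioc_eq_integral_Ioo]
    have h0 : fermiOp β D = J 0 := by
      simp only [J, greenIter, Function.iterate_zero, id, thermalRev]
      rw [indicator_of_mem (show (0 : ℝ) ∈ Ico 0 β from ⟨le_rfl, hβ⟩), sub_zero]
      rfl
    have hpt : ∀ u ∈ Ioo (0 : ℝ) 1, fermiOp β D - fermiOp β (perturb D ((u : ℂ) • K)) =
        ∑' k : ℕ, -((-u) ^ (k + 1)) • J (k + 1) := by
      intro u hu
      have h := hasSum_dyson hβ hD hK hKβ' (u := u) (by rw [abs_of_pos hu.1]; exact hu.2.le)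
      have h' := ((hasSum_nat_add_iff' 1).2 h).neg
      rw [Finset.sum_range_one, pow_zero, one_smul, neg_sub] at h'
      rw [h0]
      refine (h'.tsum_eq.symm.trans (tsum_congr fun k => ?_))
      rw [neg_smul]
    rw [setIntegral_congr_fun measurableSet_Ioo hpt]
    have hcont : ∀ k : ℕ, Continuous fun u : ℝ => -((-u) ^ (k + 1)) • J (k + 1) := fun k => by
      fun_prop
    have hint : ∀ k : ℕ, Integrable (fun u : ℝ => -((-u) ^ (k + 1)) • J (k + 1))
        (volume.restrict (Ioo (0 : ℝ) 1)) := fun k =>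
      ((hcont k).integrableOn_Icc (a := 0) (b := 1)).mono_set Ioo_subset_Icc_self
    have key := hasSum_integral_of_summable_integral_norm hint (by
      refine Summable.of_nonneg_of_le (fun k => integral_nonneg fun _ => norm_nonneg _)
        (fun k => ?_) hgeom
      have := norm_setIntegral_le_of_norm_le_const (μ := volume) (s := Ioo (0 : ℝ) 1)
        (C := (β * ‖K‖) ^ (k + 1)) (f := fun u : ℝ => ‖-((-u) ^ (k + 1)) • J (k + 1)‖) (by simp)
        (fun u hu => by
          rw [norm_norm, norm_smul, norm_neg, norm_pow, norm_neg, Real.norm_eq_abs,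
            abs_of_pos hu.1]
          calc u ^ (k + 1) * ‖J (k + 1)‖ ≤ 1 * (β * ‖K‖) ^ (k + 1) := by
                gcongr
                · exact pow_le_one₀ hu.1.le hu.2.le
                · exact hJn _
            _ = _ := one_mul _)
      refine (le_abs_self _).trans (this.trans (le_of_eq ?_))
      simp [Measure.real])
    rw [← key.tsum_eq]
    refine tsum_congr fun k => ?_
    rw [seriesTerm_eq hβ, integral_smul_const]
    congr 1
    rw [← integral_Ioc_eq_integral_Ioo, ← intervalIntegral.integral_of_le zero_le_one]
    -- The integral over u is -(-1)^{k+1}/(k + 2), which is the coefficient in `seriesTerm_eq`.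
    have e : (fun u : ℝ => -(-u) ^ (k + 1)) = fun u => (-(-1) ^ (k + 1)) * u ^ (k + 1) := by
      funext u
      rw [neg_pow u, neg_mul]
    rw [e, intervalIntegral.integral_const_mul, integral_pow]
    push_cast
    field_simp
    ring
  exact ⟨hsum, hop, by rw [relativeEntropy, hop]⟩

end Hilbert

end DiracEntropy

end

noncomputable section

namespace DiracEntropy

open Filter Topology

section HilbertSchmidt

variable {E F G : Type*} [NormedAddCommGroup E] [InnerProductSpace ℂ E]
  [NormedAddCommGroup F] [InnerProductSpace ℂ F]
  [NormedAddCommGroup G] [InnerProductSpace ℂ G]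

/-! ### Hilbert–Schmidt operators -/

/-- The Hilbert–Schmidt norm of `T` is at most `C`. -/
def HSBound (T : E →L[ℂ] F) (C : ℝ) : Prop :=
  ∀ (n : ℕ) (v : Fin n → E), Orthonormal ℂ v →
    ‖(WithLp.toLp 2 fun i => T (v i) : PiLp 2 fun _ : Fin n => F)‖ ≤ C

theorem HSBound.nonneg {T : E →L[ℂ] F} {C : ℝ} (h : HSBound T C) : 0 ≤ C :=
  (norm_nonneg _).trans (h 0 (fun i => i.elim0) ⟨fun i => i.elim0, fun i => i.elim0⟩)

theorem HSBound.mono {T : E →L[ℂ] F} {C C' : ℝ} (h : HSBound T C) (hC : C ≤ C') : HSBound T C' :=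
  fun n v hv => (h n v hv).trans hC

theorem HSBound.add {T T' : E →L[ℂ] F} {C C' : ℝ} (h : HSBound T C) (h' : HSBound T' C') :
    HSBound (T + T') (C + C') := fun n v hv =>
  (norm_add_le (WithLp.toLp 2 fun i => T (v i) : PiLp 2 fun _ : Fin n => F)
    (WithLp.toLp 2 fun i => T' (v i))).trans (add_le_add (h n v hv) (h' n v hv))

theorem hsBound_iff {T : E →L[ℂ] F} {C : ℝ} (hC : 0 ≤ C) : HSBound T C ↔
    ∀ (n : ℕ) (v : Fin n → E), Orthonormal ℂ v → ∑ i, ‖T (v i)‖ ^ 2 ≤ C ^ 2 := by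
  refine forall_congr' fun n => forall_congr' fun v => imp_congr_right fun _ => ?_
  rw [PiLp.norm_eq_of_L2, Real.sqrt_le_left hC]

theorem HSBound.comp_left {T : E →L[ℂ] F} {C : ℝ} (h : HSBound T C) (A : F →L[ℂ] G) :
    HSBound (A ∘L T) (‖A‖ * C) := by
  rw [hsBound_iff (mul_nonneg (norm_nonneg _) h.nonneg)]
  intro n v hv
  have h1 := (hsBound_iff h.nonneg).1 h n v hv
  calc ∑ i, ‖(A ∘L T) (v i)‖ ^ 2 ≤ ∑ i, ‖A‖ ^ 2 * ‖T (v i)‖ ^ 2 := by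
        refine Finset.sum_le_sum fun i _ => ?_
        rw [← mul_pow]
        exact pow_le_pow_left₀ (norm_nonneg _) (A.le_opNorm _) 2
    _ = ‖A‖ ^ 2 * ∑ i, ‖T (v i)‖ ^ 2 := by rw [Finset.mul_sum]
    _ ≤ (‖A‖ * C) ^ 2 := by rw [mul_pow]; gcongr

theorem HSBound.smul {T : E →L[ℂ] F} {C : ℝ} (h : HSBound T C) (c : ℂ) :
    HSBound (c • T) (‖c‖ * C) := by
  have h1 := h.comp_left (c • ContinuousLinearMap.id ℂ F)
  have e : (c • ContinuousLinearMap.id ℂ F) ∘L T = c • T := by ext v; simp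
  rw [e] at h1
  refine h1.mono (mul_le_mul_of_nonneg_right ?_ h.nonneg)
  exact (norm_smul_le _ _).trans (mul_le_of_le_one_right (norm_nonneg _)
    (ContinuousLinearMap.norm_id_le (𝕜 := ℂ) (E := F)))

theorem HSBound.neg {T : E →L[ℂ] F} {C : ℝ} (h : HSBound T C) : HSBound (-T) C := by
  have := h.smul (-1)
  rwa [neg_one_smul, norm_neg, norm_one, one_mul] at this

theorem HSBound.sum_sq_le {T : E →L[ℂ] F} {C : ℝ} (h : HSBound T C) {ι : Type*} {v : ι → E}
    (hv : Orthonormal ℂ v) (s : Finset ι) : ∑ i ∈ s, ‖T (v i)‖ ^ 2 ≤ C ^ 2 := by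
  have h1 := (hsBound_iff h.nonneg).1 h s.card (fun j => v (s.equivFin.symm j))
    (hv.comp _ (Subtype.val_injective.comp s.equivFin.symm.injective))
  rw [← Finset.sum_coe_sort s]
  refine le_trans (le_of_eq ?_) h1
  exact (Equiv.sum_comp s.equivFin.symm fun i : s => ‖T (v i)‖ ^ 2).symm

theorem HSBound.summable_sq {T : E →L[ℂ] F} {C : ℝ} (h : HSBound T C) {ι : Type*} {v : ι → E}
    (hv : Orthonormal ℂ v) : Summable fun i => ‖T (v i)‖ ^ 2 :=
  summable_of_sum_le (fun _ => sq_nonneg _) (h.sum_sq_le hv)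

/-- For a fixed finite orthonormal family, T ↦ (T vᵢ)ᵢ is a bounded linear map into an ℓ² sum, so
the norm of the integral is at most the integral of the norms. The formulation of `HSBound` through
finite families makes this immediate. -/
theorem HSBound.integral [CompleteSpace F] {α : Type*} [MeasurableSpace α] {μ : Measure α}
    [IsFiniteMeasure μ]
    {T : α → E →L[ℂ] F} {C : ℝ} (hT : Integrable T μ) (h : ∀ᵐ a ∂μ, HSBound (T a) C) :
    HSBound (∫ a, T a ∂μ) (C * μ.real univ) := by
  intro n v hv
  set e : (E →L[ℂ] F) →L[ℂ] PiLp 2 fun _ : Fin n => F :=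
    ((PiLp.continuousLinearEquiv 2 ℂ fun _ : Fin n => F).symm : _ →L[ℂ] _) ∘L
      ContinuousLinearMap.pi fun i => ContinuousLinearMap.apply ℂ F (v i) with he
  have h1 := e.integral_comp_comm hT
  have h2 : (WithLp.toLp 2 fun i => (∫ a, T a ∂μ) (v i) : PiLp 2 fun _ : Fin n => F) =
      e (∫ a, T a ∂μ) := rfl
  rw [h2, ← h1]
  exact norm_integral_le_of_norm_le_const (h.mono fun a ha => ha n v hv)

theorem hasSum_norm_inner_sq [CompleteSpace E] {ι : Type*} (b : HilbertBasis ι ℂ E) (x : E) :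
    HasSum (fun i => ‖⟪b i, x⟫_ℂ‖ ^ 2) (‖x‖ ^ 2) := by
  have h2 := Complex.hasSum_re (b.hasSum_inner_mul_inner x x)
  have e : (⟪x, x⟫_ℂ).re = ‖x‖ ^ 2 := inner_self_eq_norm_sq (𝕜 := ℂ) x
  rw [e] at h2
  have e2 : (fun i => ‖⟪b i, x⟫_ℂ‖ ^ 2) = fun i => (⟪x, b i⟫_ℂ * ⟪b i, x⟫_ℂ).re := by
    funext i
    rw [← inner_conj_symm x (b i), ← Complex.normSq_eq_conj_mul_self, Complex.ofReal_re,
      Complex.normSq_eq_norm_sq]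
  rwa [e2]

section Complete

variable [CompleteSpace E] [CompleteSpace F] [CompleteSpace G]

/-- The double sum of |⟨T bᵢ, vⱼ⟩|² is evaluated by Parseval in i for fixed j and estimated by
Bessel in j for fixed i. -/
theorem HSBound.adjoint {T : E →L[ℂ] F} {C : ℝ} (h : HSBound T C) :
    HSBound (ContinuousLinearMap.adjoint T) C := by
  obtain ⟨w, b, -⟩ := exists_hilbertBasis ℂ E
  rw [hsBound_iff h.nonneg]
  intro n v hv
  have h1 : HasSum (fun i => ∑ j, ‖⟪b i, ContinuousLinearMap.adjoint T (v j)⟫_ℂ‖ ^ 2)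
      (∑ j, ‖ContinuousLinearMap.adjoint T (v j)‖ ^ 2) :=
    hasSum_sum fun j _ => hasSum_norm_inner_sq b _
  refine hasSum_le_of_sum_le h1 fun s => le_trans (Finset.sum_le_sum fun i _ => ?_)
    (h.sum_sq_le b.orthonormal s)
  simp only [ContinuousLinearMap.adjoint_inner_right]
  simp only [norm_inner_symm (T (b i))]
  exact hv.sum_inner_products_le (T (b i)) (s := Finset.univ)

theorem HSBound.comp_right {T : F →L[ℂ] G} {C : ℝ} (h : HSBound T C) (A : E →L[ℂ] F) :
    HSBound (T ∘L A) (‖A‖ * C) := by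
  have h1 := (h.adjoint.comp_left (ContinuousLinearMap.adjoint A)).adjoint
  rwa [ContinuousLinearMap.adjoint_comp, ContinuousLinearMap.adjoint_adjoint,
    ContinuousLinearMap.adjoint_adjoint, LinearIsometryEquiv.norm_map] at h1

theorem HSBound.tsum_norm_sq_eq {T : E →L[ℂ] F} {C : ℝ} (h : HSBound T C) {ι κ : Type*}
    (b : HilbertBasis ι ℂ E) (c : HilbertBasis κ ℂ F) :
    ∑' i, ‖T (b i)‖ ^ 2 = ∑' j, ‖ContinuousLinearMap.adjoint T (c j)‖ ^ 2 := by
  have h1 : ∀ i, HasSum (fun j => ‖⟪c j, T (b i)⟫_ℂ‖ ^ 2) (‖T (b i)‖ ^ 2) := fun i =>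
    hasSum_norm_inner_sq c _
  have h2 : ∀ j, HasSum (fun i => ‖⟪c j, T (b i)⟫_ℂ‖ ^ 2)
      (‖ContinuousLinearMap.adjoint T (c j)‖ ^ 2) := fun j => by
    have := hasSum_norm_inner_sq b (ContinuousLinearMap.adjoint T (c j))
    simp only [ContinuousLinearMap.adjoint_inner_right] at this
    simpa only [norm_inner_symm (c j)] using this
  have hs : Summable (Function.uncurry fun i j => ‖⟪c j, T (b i)⟫_ℂ‖ ^ 2) := by
    refine (summable_prod_of_nonneg fun _ => sq_nonneg _).2 ⟨fun i => (h1 i).summable, ?_⟩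
    simp only [(h1 _).tsum_eq]
    exact h.summable_sq b.orthonormal
  calc _ = ∑' i, ∑' j, ‖⟪c j, T (b i)⟫_ℂ‖ ^ 2 := tsum_congr fun i => (h1 i).tsum_eq.symm
    _ = ∑' j, ∑' i, ‖⟪c j, T (b i)⟫_ℂ‖ ^ 2 := hs.tsum_comm.symm
    _ = _ := tsum_congr fun j => (h2 j).tsum_eq

theorem HSBound.tsum_norm_sq_eq_of_basis {T : E →L[ℂ] F} {C : ℝ} (h : HSBound T C) {ι κ : Type*}
    (b : HilbertBasis ι ℂ E) (c : HilbertBasis κ ℂ E) :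
    ∑' i, ‖T (b i)‖ ^ 2 = ∑' j, ‖T (c j)‖ ^ 2 := by
  obtain ⟨w, d, -⟩ := exists_hilbertBasis ℂ F
  rw [h.tsum_norm_sq_eq b d, h.tsum_norm_sq_eq c d]

theorem HSBound.summable_inner {X Y : E →L[ℂ] F} {C C' : ℝ} (hX : HSBound X C)
    (hY : HSBound Y C') {ι : Type*} {v : ι → E} (hv : Orthonormal ℂ v) :
    Summable fun i => ⟪X (v i), Y (v i)⟫_ℂ := by
  refine Summable.of_norm_bounded ((hX.summable_sq hv).add (hY.summable_sq hv)) fun i => ?_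
  refine (norm_inner_le_norm _ _).trans ?_
  nlinarith [sq_nonneg (‖X (v i)‖ - ‖Y (v i)‖), sq_nonneg (‖X (v i)‖), sq_nonneg (‖Y (v i)‖)]

/-- Polarization expresses the trace of X* Y through four squared Hilbert–Schmidt norms. These do
not depend on the basis, hence neither does the trace. -/
theorem HSBound.tsum_inner_eq {X Y : E →L[ℂ] F} {C C' : ℝ} (hX : HSBound X C)
    (hY : HSBound Y C') {ι : Type*} (b : HilbertBasis ι ℂ E) :
    ∑' i, ⟪X (b i), Y (b i)⟫_ℂ = (((∑' i, ‖(X + Y) (b i)‖ ^ 2 : ℝ) : ℂ)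
      - ((∑' i, ‖(X + -Y) (b i)‖ ^ 2 : ℝ) : ℂ)
      + (((∑' i, ‖(X + (-Complex.I) • Y) (b i)‖ ^ 2 : ℝ) : ℂ)
      - ((∑' i, ‖(X + Complex.I • Y) (b i)‖ ^ 2 : ℝ) : ℂ)) * Complex.I) / 4 := by
  have h : ∀ {Z : E →L[ℂ] F} {C : ℝ}, HSBound Z C →
      HasSum (fun i => ((‖Z (b i)‖ ^ 2 : ℝ) : ℂ)) ((∑' i, ‖Z (b i)‖ ^ 2 : ℝ) : ℂ) := fun hZ =>
    Complex.hasSum_ofReal.2 (hZ.summable_sq b.orthonormal).hasSum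
  have h1 := ((h (hX.add hY)).sub (h (hX.add hY.neg))).add
    (((h (hX.add (hY.smul (-Complex.I)))).sub (h (hX.add (hY.smul Complex.I)))).mul_right
      Complex.I)
  rw [← (h1.div_const 4).tsum_eq]
  refine tsum_congr fun i => ?_
  rw [inner_eq_sum_norm_sq_div_four]
  simp [sub_eq_add_neg]

theorem HSBound.tsum_inner_eq_of_basis {X Y : E →L[ℂ] F} {C C' : ℝ} (hX : HSBound X C)
    (hY : HSBound Y C') {ι κ : Type*} (b : HilbertBasis ι ℂ E) (c : HilbertBasis κ ℂ E) :
    ∑' i, ⟪X (b i), Y (b i)⟫_ℂ = ∑' j, ⟪X (c j), Y (c j)⟫_ℂ := by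
  rw [hX.tsum_inner_eq hY b, hX.tsum_inner_eq hY c, (hX.add hY).tsum_norm_sq_eq_of_basis b c,
    (hX.add hY.neg).tsum_norm_sq_eq_of_basis b c,
    (hX.add (hY.smul (-Complex.I))).tsum_norm_sq_eq_of_basis b c,
    (hX.add (hY.smul Complex.I)).tsum_norm_sq_eq_of_basis b c]

end Complete

end HilbertSchmidt

/-! ### Products of two Hilbert–Schmidt operators are trace class -/

section TraceClass

variable {H F : Type*} [NormedAddCommGroup H] [InnerProductSpace ℂ H] [CompleteSpace H]
  [NormedAddCommGroup F] [InnerProductSpace ℂ F] [CompleteSpace F]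

theorem HSBound.hasSum_trace {X Y : H →L[ℂ] F} {C C' : ℝ} (hX : HSBound X C) (hY : HSBound Y C')
    {ι : Type*} (b : HilbertBasis ι ℂ H) :
    HasSum (fun i => ⟪b i, (ContinuousLinearMap.adjoint X ∘L Y) (b i)⟫_ℂ)
      (trace (ContinuousLinearMap.adjoint X ∘L Y)) := by
  simp only [trace, ContinuousLinearMap.comp_apply, ContinuousLinearMap.adjoint_inner_right]
  rw [← hX.tsum_inner_eq_of_basis hY b]
  exact (hX.summable_inner hY b.orthonormal).hasSum

theorem norm_cfcAbs_apply (T : H →L[ℂ] H) (v : H) : ‖CFC.abs T v‖ = ‖T v‖ := by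
  have h1 : IsSelfAdjoint (CFC.abs T) := (CFC.abs_nonneg T).isSelfAdjoint
  have h2 : CFC.abs T * CFC.abs T = star T * T := CFC.abs_mul_abs T
  have h3 : ⟪CFC.abs T v, CFC.abs T v⟫_ℂ = ⟪T v, T v⟫_ℂ := by
    rw [← ContinuousLinearMap.adjoint_inner_right, ← ContinuousLinearMap.adjoint_inner_right,
      ← ContinuousLinearMap.star_eq_adjoint, ← ContinuousLinearMap.star_eq_adjoint, h1.star_eq]
    exact congrArg (fun A : H →L[ℂ] H => ⟪v, A v⟫_ℂ) h2
  rw [inner_self_eq_norm_sq_to_K, inner_self_eq_norm_sq_to_K] at h3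
  have h4 : ‖CFC.abs T v‖ ^ 2 = ‖T v‖ ^ 2 := by exact_mod_cast h3
  exact (pow_left_inj₀ (norm_nonneg _) (norm_nonneg _) two_ne_zero).1 h4

/-- With P = |T| and R = (P + ε)⁻¹, the operator TR is a contraction replacing the partial isometry
of the polar decomposition. Then P = R P² + O(ε), and P² = T* X* Y gives ⟨b, R P² b⟩ = ⟨X T R b, Y
b⟩, so Cauchy–Schwarz bounds every finite sum by C C' plus a multiple of ε. -/
theorem HSBound.isTraceClass {X Y : H →L[ℂ] F} {C C' : ℝ} (hX : HSBound X C) (hY : HSBound Y C') :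
    IsTraceClass (ContinuousLinearMap.adjoint X ∘L Y) := by
  set T := ContinuousLinearMap.adjoint X ∘L Y with hT
  set P := CFC.abs T with hP
  have hP0 : 0 ≤ P := CFC.abs_nonneg T
  have hPs : IsSelfAdjoint P := hP0.isSelfAdjoint
  have hspec : ∀ x ∈ spectrum ℝ P, 0 ≤ x := fun x hx => spectrum_nonneg_of_nonneg hP0 hx
  obtain ⟨w, b, -⟩ := exists_hilbertBasis ℂ H
  refine ⟨w, b, summable_of_sum_le (c := C * C') (fun i => ?_) fun s => ?_⟩
  · exact ((ContinuousLinearMap.nonneg_iff_isPositive _).1 hP0).re_inner_nonneg_right _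
  have key : ∀ ε > 0, ∑ i ∈ s, (⟪b i, P (b i)⟫_ℂ).re ≤ C * C' + s.card * ε := by
    intro ε hε
    set g : ℝ → ℝ := fun x => (|x| + ε)⁻¹ with hg
    have hgc : Continuous g := by
      refine Continuous.inv₀ (by fun_prop) fun x => ?_
      positivity
    set R := cfc g P with hR
    have hRs : IsSelfAdjoint R := cfc_predicate g P
    have e1 : P * R = cfc (fun x => x * g x) P := by
      conv_lhs => rw [← cfc_id' ℝ P, hR]
      rw [← cfc_mul _ _ _ (by fun_prop) (by fun_prop)]
    have hPR : ‖P * R‖ ≤ 1 := by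
      rw [e1]
      refine norm_cfc_le zero_le_one fun x hx => ?_
      rw [Real.norm_eq_abs, hg, abs_mul, abs_inv, abs_of_pos (by positivity : 0 < |x| + ε),
        ← div_eq_mul_inv, div_le_one (by positivity)]
      linarith
    have e2 : P - R * (P * P) = cfc (fun x => x - g x * (x * x)) P := by
      rw [cfc_sub _ _ _ (by fun_prop) (by fun_prop), cfc_mul _ _ _ (by fun_prop) (by fun_prop),
        cfc_mul _ _ _ (by fun_prop) (by fun_prop), cfc_id' ℝ P]
    have hPRP : ‖P - R * (P * P)‖ ≤ ε := by
      rw [e2]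
      refine norm_cfc_le hε.le fun x hx => ?_
      have hx := hspec x hx
      have : x - g x * (x * x) = ε * (x / (x + ε)) := by
        simp only [hg, abs_of_nonneg hx]
        field_simp
        ring
      rw [this, Real.norm_eq_abs, abs_of_nonneg (by positivity)]
      refine mul_le_of_le_one_right hε.le ((div_le_one (by positivity)).2 (by linarith))
    have hA : ‖T ∘L R‖ ≤ 1 := by
      refine ContinuousLinearMap.opNorm_le_bound _ zero_le_one fun v => ?_
      rw [ContinuousLinearMap.comp_apply, ← norm_cfcAbs_apply]
      exact (P * R).le_of_opNorm_le hPR v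
    have hXA := hX.comp_right (T ∘L R)
    have e3 : P * P = ContinuousLinearMap.adjoint T ∘L T := CFC.abs_mul_abs T
    have hi : ∀ i, (⟪b i, P (b i)⟫_ℂ).re ≤
        ‖(X ∘L (T ∘L R)) (b i)‖ * ‖Y (b i)‖ + ε := by
      intro i
      have h1 : ⟪b i, (R * (P * P)) (b i)⟫_ℂ = ⟪(X ∘L (T ∘L R)) (b i), Y (b i)⟫_ℂ := by
        have h3 : (R * (P * P)) (b i) = R (ContinuousLinearMap.adjoint T (T (b i))) := by
          rw [e3]; rfl
        have h4 : ⟪T (R (b i)), T (b i)⟫_ℂ = ⟪X (T (R (b i))), Y (b i)⟫_ℂ :=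
          ContinuousLinearMap.adjoint_inner_right X _ _
        have h5 : ∀ x y : H, ⟪x, R y⟫_ℂ = ⟪R x, y⟫_ℂ := fun x y => by
          conv_lhs => rw [← hRs.star_eq, ContinuousLinearMap.star_eq_adjoint,
            ContinuousLinearMap.adjoint_inner_right]
        rw [h3, h5, ContinuousLinearMap.adjoint_inner_right]
        exact h4
      have h2 : ⟪b i, P (b i)⟫_ℂ = ⟪b i, (R * (P * P)) (b i)⟫_ℂ +
          ⟪b i, (P - R * (P * P)) (b i)⟫_ℂ := by
        rw [← inner_add_right, sub_apply, add_sub_cancel]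
      rw [h2, h1, Complex.add_re]
      refine add_le_add ((Complex.re_le_norm _).trans (norm_inner_le_norm _ _)) ?_
      refine (Complex.re_le_norm _).trans ((norm_inner_le_norm _ _).trans ?_)
      rw [b.orthonormal.1 i, one_mul]
      refine ((P - R * (P * P)).le_of_opNorm_le hPRP _).trans ?_
      rw [b.orthonormal.1 i, mul_one]
    calc ∑ i ∈ s, (⟪b i, P (b i)⟫_ℂ).re ≤
        ∑ i ∈ s, (‖(X ∘L (T ∘L R)) (b i)‖ * ‖Y (b i)‖ + ε) := Finset.sum_le_sum fun i _ => hi i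
      _ = (∑ i ∈ s, ‖(X ∘L (T ∘L R)) (b i)‖ * ‖Y (b i)‖) + s.card * ε := by
        rw [Finset.sum_add_distrib, Finset.sum_const, nsmul_eq_mul]
      _ ≤ C * C' + s.card * ε := by
        gcongr
        have h1 := (hXA.mono (mul_le_of_le_one_left hX.nonneg hA)).sum_sq_le b.orthonormal s
        have h2 := hY.sum_sq_le b.orthonormal s
        have h3 := Finset.sum_mul_sq_le_sq_mul_sq s (fun i => ‖(X ∘L (T ∘L R)) (b i)‖)
          (fun i => ‖Y (b i)‖)
        refine abs_le_of_sq_le_sq' ?_ (mul_nonneg hX.nonneg hY.nonneg) |>.2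
        rw [mul_pow]
        exact h3.trans (mul_le_mul h1 h2 (Finset.sum_nonneg fun _ _ => sq_nonneg _) (sq_nonneg _))
  refine le_of_forall_pos_le_add fun ε hε => ?_
  -- The error is proportional to the number of summands; the + 1 keeps the quotient defined for the
  -- empty set.
  refine (key (ε / (s.card + 1)) (by positivity)).trans ?_
  gcongr
  rw [mul_div_assoc', div_le_iff₀ (by positivity)]
  nlinarith

end TraceClass

end DiracEntropy

end

noncomputable section

namespace DiracEntropy

open Filter Topology

/-! ### Iterated antiperiodic primitives of the thermal functions -/

/-- The solution of `∂ₜ φₙ₊₁ = -x φₙ₊₁ + φₙ`, `φₙ₊₁(β) = -φₙ₊₁(0)`, starting with the thermal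
function `φ₀`. -/
def thermalIter (β : ℝ) : ℕ → ℝ → ℝ → ℝ
  | 0, t, x => thermal β t x
  | n + 1, t, x => thermal β t x * ((∫ s in (0 : ℝ)..t, Real.exp (s * x) * thermalIter β n s x)
      - Real.exp (-β * x) * ∫ s in t..β, Real.exp (s * x) * thermalIter β n s x)

theorem continuous_thermalIter_uncurry (β : ℝ) (n : ℕ) :
    Continuous fun z : ℝ × ℝ => thermalIter β n z.1 z.2 := by
  induction n with
  | zero => exact continuous_thermal_uncurry β
  | succ n ih =>
    have h1 : Continuous (Function.uncurry fun (z : ℝ × ℝ) (s : ℝ) =>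
        Real.exp (s * z.2) * thermalIter β n s z.2) :=
      (by fun_prop : Continuous fun w : (ℝ × ℝ) × ℝ => Real.exp (w.2 * w.1.2)).mul
        (ih.comp (by fun_prop : Continuous fun w : (ℝ × ℝ) × ℝ => (w.2, w.1.2)))
    have h2 : ∀ a : ℝ, Continuous fun z : ℝ × ℝ =>
        ∫ s in a..z.1, Real.exp (s * z.2) * thermalIter β n s z.2 := fun a =>
      intervalIntegral.continuous_parametric_intervalIntegral_of_continuous h1 continuous_fst
    refine (continuous_thermal_uncurry β).mul ((h2 0).sub (Continuous.mul (by fun_prop) ?_))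
    refine (h2 β).neg.congr fun z => ?_
    exact (intervalIntegral.integral_symm _ _).symm

theorem continuous_thermalIter (β : ℝ) (n : ℕ) (t : ℝ) : Continuous (thermalIter β n t) :=
  (continuous_thermalIter_uncurry β n).comp (by fun_prop : Continuous fun x : ℝ => (t, x))

theorem continuous_exp_mul_thermalIter (β : ℝ) (n : ℕ) (x : ℝ) :
    Continuous fun s => Real.exp (s * x) * thermalIter β n s x :=
  (by fun_prop : Continuous fun s : ℝ => Real.exp (s * x)).mul
    ((continuous_thermalIter_uncurry β n).comp (by fun_prop : Continuous fun s : ℝ => (s, x)))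

theorem hasDerivAt_thermalIter_succ (β : ℝ) (n : ℕ) (t x : ℝ) :
    HasDerivAt (fun t => thermalIter β (n + 1) t x)
      (-(x * thermalIter β (n + 1) t x) + thermalIter β n t x) t := by
  have hc := continuous_exp_mul_thermalIter β n x
  have h1 := intervalIntegral.integral_hasDerivAt_right (hc.intervalIntegrable 0 t)
    (hc.stronglyMeasurableAtFilter _ _) hc.continuousAt
  have h2 := intervalIntegral.integral_hasDerivAt_left (hc.intervalIntegrable t β)
    (hc.stronglyMeasurableAtFilter _ _) hc.continuousAt
  refine ((hasDerivAt_thermal β t x).mul (h1.sub (h2.const_mul (Real.exp (-β * x))))).congr_deriv ?_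
  -- Differentiating the two integration limits adds φₙ(t) multiplied by this expression; its value
  -- 1 makes the source term exactly φₙ.
  have e : thermal β t x * Real.exp (t * x) * (1 + Real.exp (-β * x)) = 1 := by
    unfold thermal
    rw [div_mul_eq_mul_div, ← Real.exp_add]
    have : -t * x + t * x = 0 := by ring
    rw [this, Real.exp_zero]
    field_simp
  simp only [thermalIter, Pi.sub_apply]
  linear_combination thermalIter β n t x * e

theorem thermalIter_antiperiodic (β : ℝ) (n : ℕ) (x : ℝ) :
    thermalIter β (n + 1) β x = -thermalIter β (n + 1) 0 x := by
  simp only [thermalIter, intervalIntegral.integral_same, thermal]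
  simp only [neg_zero, zero_mul, Real.exp_zero]
  ring

theorem thermal_mul_exp_le {β t s : ℝ} (x : ℝ) (hs : 0 ≤ s) (hst : s ≤ t) (ht : t ≤ β) :
    thermal β t x * Real.exp (s * x) ≤ 1 := by
  have : thermal β t x * Real.exp (s * x) = thermal β (t - s) x := by
    unfold thermal
    rw [div_mul_eq_mul_div, ← Real.exp_add]
    ring_nf
  rw [this]
  exact thermal_le_one (by linarith) (by linarith) x

theorem thermal_mul_exp_le' {β t s : ℝ} (x : ℝ) (h0 : 0 ≤ t) (hst : t ≤ s) (hs : s ≤ β) :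
    thermal β t x * (Real.exp (-β * x) * Real.exp (s * x)) ≤ 1 := by
  have : thermal β t x * (Real.exp (-β * x) * Real.exp (s * x)) = thermal β (β - s + t) x := by
    unfold thermal
    rw [div_mul_eq_mul_div, ← Real.exp_add, ← Real.exp_add]
    ring_nf
  rw [this]
  exact thermal_le_one (by linarith) (by linarith) x

/-- Since e^{sx} p(s, x) = p(0, x) does not depend on s, the induction hypothesis bounds both
integrands by a constant, and the lengths t and β - t add up to the new factor β. Keeping p(t, x) on
the right, instead of 1, is what gives exponential decay at t = 0. -/
theorem abs_thermalIter_le_thermal {β : ℝ} (n : ℕ) {t : ℝ} (ht : t ∈ Icc 0 β) (x : ℝ) :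
    |thermalIter β n t x| ≤ β ^ n * thermal β t x := by
  induction n generalizing t with
  | zero => rw [pow_zero, one_mul, thermalIter, abs_of_pos (thermal_pos _ _ _)]
  | succ n ih =>
    have hβ : 0 ≤ β := ht.1.trans ht.2
    have hF : thermal β 0 x ≤ 1 := thermal_le_one le_rfl hβ x
    have hF' : Real.exp (-β * x) * thermal β 0 x ≤ 1 := by
      have := thermal_le_one hβ le_rfl x
      simp only [thermal, neg_zero, zero_mul, Real.exp_zero] at this ⊢
      rwa [mul_one_div]
    have hb : ∀ s ∈ Icc 0 β, ‖Real.exp (s * x) * thermalIter β n s x‖ ≤ β ^ n * thermal β 0 x := by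
      intro s hs
      rw [norm_mul, Real.norm_eq_abs, Real.norm_eq_abs, abs_of_pos (Real.exp_pos _)]
      refine (mul_le_mul_of_nonneg_left (ih hs) (Real.exp_pos _).le).trans (le_of_eq ?_)
      have : Real.exp (s * x) * thermal β s x = thermal β 0 x := by
        unfold thermal
        rw [mul_div_assoc', ← Real.exp_add]
        ring_nf
      rw [← this]
      ring
    have h1 : |∫ s in (0 : ℝ)..t, Real.exp (s * x) * thermalIter β n s x| ≤
        β ^ n * thermal β 0 x * t := by
      have := intervalIntegral.norm_integral_le_of_norm_le_const (a := 0) (b := t)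
        (C := β ^ n * thermal β 0 x) (f := fun s => Real.exp (s * x) * thermalIter β n s x)
        fun s hs => by
          rw [uIoc_of_le ht.1] at hs
          exact hb s ⟨hs.1.le, hs.2.trans ht.2⟩
      rwa [sub_zero, abs_of_nonneg ht.1] at this
    have h2 : |∫ s in t..β, Real.exp (s * x) * thermalIter β n s x| ≤
        β ^ n * thermal β 0 x * (β - t) := by
      have := intervalIntegral.norm_integral_le_of_norm_le_const (a := t) (b := β)
        (C := β ^ n * thermal β 0 x) (f := fun s => Real.exp (s * x) * thermalIter β n s x)
        fun s hs => by
          rw [uIoc_of_le ht.2] at hs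
          exact hb s ⟨ht.1.trans hs.1.le, hs.2⟩
      rwa [abs_of_nonneg (sub_nonneg.2 ht.2)] at this
    rw [thermalIter, abs_mul, abs_of_pos (thermal_pos _ _ _), mul_comm]
    refine mul_le_mul_of_nonneg_right ?_ (thermal_pos _ _ _).le
    refine (abs_sub _ _).trans ?_
    rw [abs_mul, abs_of_pos (Real.exp_pos _)]
    calc _ ≤ β ^ n * thermal β 0 x * t +
          Real.exp (-β * x) * (β ^ n * thermal β 0 x * (β - t)) := by gcongr
      _ = β ^ n * (thermal β 0 x * t) +
          β ^ n * (Real.exp (-β * x) * thermal β 0 x * (β - t)) := by ring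
      _ ≤ β ^ n * (1 * t) + β ^ n * (1 * (β - t)) := by
        have := sub_nonneg.2 ht.2
        have := ht.1
        gcongr
      _ = β ^ (n + 1) := by ring

theorem abs_thermalIter_le {β : ℝ} (n : ℕ) {t : ℝ} (ht : t ∈ Icc 0 β) (x : ℝ) :
    |thermalIter β n t x| ≤ β ^ n := by
  have hβ : 0 ≤ β := ht.1.trans ht.2
  exact (abs_thermalIter_le_thermal n ht x).trans
    (mul_le_of_le_one_right (by positivity) (thermal_le_one ht.1 ht.2 x))

/-- By antiperiodicity the values at 0 and at β have the same modulus, which is therefore controlled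
by both p(0, x) and p(β, x). The first is small for x < 0 and the second for x > 0. -/
theorem abs_thermalIter_zero_le {β : ℝ} (hβ : 0 ≤ β) (n : ℕ) (x : ℝ) :
    |thermalIter β (n + 1) 0 x| ≤ β ^ (n + 1) * Real.exp (-(β * |x|)) := by
  have h0 := abs_thermalIter_le_thermal (n + 1) ⟨le_rfl, hβ⟩ x
  have h1 := abs_thermalIter_le_thermal (n + 1) ⟨hβ, le_rfl⟩ x
  rw [thermalIter_antiperiodic, abs_neg] at h1
  rcases le_total 0 x with hx | hx
  · refine h1.trans (mul_le_mul_of_nonneg_left ?_ (by positivity))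
    rw [abs_of_nonneg hx, thermal, neg_mul]
    exact div_le_self (Real.exp_pos _).le (by linarith [Real.exp_pos (-(β * x))])
  · refine h0.trans (mul_le_mul_of_nonneg_left ?_ (by positivity))
    rw [abs_of_nonpos hx, thermal, neg_zero, zero_mul, Real.exp_zero, mul_neg, neg_neg,
      div_le_iff₀ (by positivity), mul_add, ← Real.exp_add]
    have : β * x + -β * x = 0 := by ring
    rw [this, Real.exp_zero]
    linarith [Real.exp_pos (β * x)]

/-- The φ-independent factor J is the total mass of the kernel that inverts ∂ₜ + x with antiperiodic
boundary condition. It satisfies J ≤ β, and x J = (1 - e^{-βx})/(1 + e^{-βx}) has modulus at most 1,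
so each iteration gains one factor (1 + |x|)⁻¹. -/
theorem one_add_abs_mul_thermalIter_le {β : ℝ} (n : ℕ) {M : ℝ} (x : ℝ)
    (hM : ∀ t ∈ Icc 0 β, |thermalIter β n t x| ≤ M) {t : ℝ} (ht : t ∈ Icc 0 β) :
    (1 + |x|) * |thermalIter β (n + 1) t x| ≤ (1 + β) * M := by
  have hβ : 0 ≤ β := ht.1.trans ht.2
  have hM0 : 0 ≤ M := (abs_nonneg _).trans (hM t ht)
  set p := thermal β t x with hp
  have hp0 : 0 < p := thermal_pos _ _ _
  set I₁ := ∫ s in (0 : ℝ)..t, Real.exp (s * x) with hI₁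
  set I₂ := ∫ s in t..β, Real.exp (s * x) with hI₂
  have hI₁0 : 0 ≤ I₁ := intervalIntegral.integral_nonneg ht.1 fun s _ => (Real.exp_pos _).le
  have hI₂0 : 0 ≤ I₂ := intervalIntegral.integral_nonneg ht.2 fun s _ => (Real.exp_pos _).le
  have hexp : Continuous fun s : ℝ => Real.exp (s * x) := by fun_prop
  have h1 : |∫ s in (0 : ℝ)..t, Real.exp (s * x) * thermalIter β n s x| ≤ M * I₁ := by
    rw [hI₁, ← intervalIntegral.integral_const_mul, ← Real.norm_eq_abs]
    refine intervalIntegral.norm_integral_le_of_norm_le ht.1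
      (Eventually.of_forall fun s hs => ?_) ((hexp.const_mul M).intervalIntegrable _ _)
    rw [norm_mul, Real.norm_eq_abs, Real.norm_eq_abs, abs_of_pos (Real.exp_pos _), mul_comm]
    exact mul_le_mul_of_nonneg_right (hM s ⟨hs.1.le, hs.2.trans ht.2⟩) (Real.exp_pos _).le
  have h2 : |∫ s in t..β, Real.exp (s * x) * thermalIter β n s x| ≤ M * I₂ := by
    rw [hI₂, ← intervalIntegral.integral_const_mul, ← Real.norm_eq_abs]
    refine intervalIntegral.norm_integral_le_of_norm_le ht.2
      (Eventually.of_forall fun s hs => ?_) ((hexp.const_mul M).intervalIntegrable _ _)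
    rw [norm_mul, Real.norm_eq_abs, Real.norm_eq_abs, abs_of_pos (Real.exp_pos _), mul_comm]
    exact mul_le_mul_of_nonneg_right (hM s ⟨ht.1.trans hs.1.le, hs.2⟩) (Real.exp_pos _).le
  set J := p * (I₁ + Real.exp (-β * x) * I₂) with hJ
  have hJ0 : 0 ≤ J := by positivity
  have key : |thermalIter β (n + 1) t x| ≤ M * J := by
    rw [thermalIter, abs_mul, abs_of_pos hp0, hJ]
    calc _ ≤ p * (M * I₁ + Real.exp (-β * x) * (M * I₂)) := by
          refine mul_le_mul_of_nonneg_left ((abs_sub _ _).trans ?_) hp0.le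
          rw [abs_mul, abs_of_pos (Real.exp_pos _)]
          gcongr
      _ = _ := by ring
  have hJβ : J ≤ β := by
    have h3 : p * I₁ ≤ t := by
      rw [hI₁, ← intervalIntegral.integral_const_mul]
      refine (Real.le_norm_self _).trans ((intervalIntegral.norm_integral_le_of_norm_le_const (C := 1)
        fun s hs => ?_).trans (le_of_eq ?_))
      · rw [uIoc_of_le ht.1] at hs
        rw [Real.norm_eq_abs, abs_of_pos (by positivity)]
        exact thermal_mul_exp_le x hs.1.le hs.2 ht.2
      · rw [one_mul, sub_zero, abs_of_nonneg ht.1]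
    have h4 : p * (Real.exp (-β * x) * I₂) ≤ β - t := by
      rw [hI₂, ← intervalIntegral.integral_const_mul, ← intervalIntegral.integral_const_mul]
      refine (Real.le_norm_self _).trans ((intervalIntegral.norm_integral_le_of_norm_le_const (C := 1)
        fun s hs => ?_).trans (le_of_eq ?_))
      · rw [uIoc_of_le ht.2] at hs
        rw [Real.norm_eq_abs, abs_of_pos (by positivity)]
        exact thermal_mul_exp_le' x ht.1 hs.1.le hs.2
      · rw [one_mul, abs_of_nonneg (sub_nonneg.2 ht.2)]
    rw [hJ, mul_add]
    linarith
  have hxJ : |x| * J ≤ 1 := by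
    have d : ∀ a b : ℝ, x * ∫ s in a..b, Real.exp (s * x) = Real.exp (b * x) - Real.exp (a * x) := by
      intro a b
      rw [← intervalIntegral.integral_const_mul]
      refine intervalIntegral.integral_eq_sub_of_hasDerivAt (f := fun s => Real.exp (s * x))
        (fun s _ => ?_) ((hexp.const_mul x).intervalIntegrable _ _)
      exact (((hasDerivAt_id s).mul_const x).exp).congr_deriv (by simp only [id]; ring)
    have e : x * J = (1 - Real.exp (-β * x)) / (1 + Real.exp (-β * x)) := by
      have e1 : x * J = p * (x * I₁ + Real.exp (-β * x) * (x * I₂)) := by rw [hJ]; ring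
      have e2 : Real.exp (-t * x) * Real.exp (t * x) = 1 := by rw [← Real.exp_add]; simp
      have e3 : Real.exp (-β * x) * Real.exp (β * x) = 1 := by rw [← Real.exp_add]; simp
      rw [e1, hI₁, hI₂, d, d, hp, thermal, div_mul_eq_mul_div]
      congr 1
      rw [zero_mul, Real.exp_zero]
      linear_combination (1 - Real.exp (-β * x)) * e2 + Real.exp (-t * x) * e3
    rw [← abs_of_nonneg hJ0, ← abs_mul, e, abs_div, abs_of_pos (by positivity : 0 < 1 + Real.exp (-β * x)),
      div_le_one (by positivity), abs_le]
    constructor <;> linarith [Real.exp_pos (-β * x)]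
  calc (1 + |x|) * |thermalIter β (n + 1) t x| ≤ (1 + |x|) * (M * J) := by gcongr
    _ = M * (J + |x| * J) := by ring
    _ ≤ M * (β + 1) := by gcongr
    _ = (1 + β) * M := by ring

theorem one_add_abs_pow_mul_thermalIter_le {β : ℝ} (n : ℕ) (x : ℝ) {t : ℝ} (ht : t ∈ Icc 0 β) :
    (1 + |x|) ^ n * |thermalIter β n t x| ≤ (1 + β) ^ n := by
  induction n generalizing t with
  | zero => simpa [thermalIter] using abs_thermal_le_one ht x
  | succ n ih =>
    -- The bound M may depend on x, because the estimate is made separately for each x.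
    have h := one_add_abs_mul_thermalIter_le n (M := (1 + β) ^ n / (1 + |x|) ^ n) x
      (fun s hs => by rw [le_div_iff₀' (by positivity)]; exact ih hs) ht
    rw [mul_div_assoc', le_div_iff₀' (by positivity)] at h
    calc _ = (1 + |x|) ^ n * ((1 + |x|) * |thermalIter β (n + 1) t x|) := by ring
      _ ≤ _ := h
      _ = _ := by ring

theorem hasEndLimits_thermalIter {β : ℝ} (hβ : 0 < β) (n : ℕ) {t : ℝ} (ht : t ∈ Icc 0 β) :
    HasEndLimits (thermalIter β n t) := by
  cases n with
  | zero => exact hasEndLimits_thermal hβ ht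
  | succ n =>
    refine HasEndLimits.of_decay (C := (1 + β) * β ^ n) (continuous_thermalIter β _ t) fun x => ?_
    refine le_trans ?_ (one_add_abs_mul_thermalIter_le n x
      (fun t ht => abs_thermalIter_le n ht x) ht)
    gcongr
    linarith

theorem abs_mul_thermalIter_succ_le {β : ℝ} (n : ℕ) {t : ℝ} (ht : t ∈ Icc 0 β) (x : ℝ) :
    |x * thermalIter β (n + 1) t x| ≤ (1 + β) * β ^ n := by
  rw [abs_mul]
  refine le_trans ?_ (one_add_abs_mul_thermalIter_le n x (fun t ht => abs_thermalIter_le n ht x) ht)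
  gcongr
  linarith

theorem exists_one_add_abs_pow_mul_exp_le {β : ℝ} (hβ : 0 < β) (k : ℕ) :
    ∃ C, ∀ x : ℝ, (1 + |x|) ^ k * Real.exp (-(β * |x|)) ≤ C := by
  -- From y^k / k! ≤ e^y at y = β(1 + |x|).
  refine ⟨k.factorial * Real.exp β / β ^ k, fun x => ?_⟩
  have h := Real.pow_div_factorial_le_exp (β * (1 + |x|)) (by positivity) k
  rw [div_le_iff₀ (by positivity), mul_pow] at h
  rw [le_div_iff₀ (by positivity)]
  have e : Real.exp (β * (1 + |x|)) = Real.exp β * Real.exp (β * |x|) := by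
    rw [← Real.exp_add]; ring_nf
  have e2 : Real.exp (β * |x|) * Real.exp (-(β * |x|)) = 1 := by rw [← Real.exp_add]; simp
  calc _ = (β ^ k * (1 + |x|) ^ k) * Real.exp (-(β * |x|)) := by ring
    _ ≤ (Real.exp (β * (1 + |x|)) * k.factorial) * Real.exp (-(β * |x|)) := by gcongr
    _ = k.factorial * Real.exp β * (Real.exp (β * |x|) * Real.exp (-(β * |x|))) := by rw [e]; ring
    _ = _ := by rw [e2, mul_one]

theorem abs_mul_sq_one_add_sq_le (x : ℝ) : |x| * (1 + x ^ 2) ^ 2 ≤ (1 + |x|) ^ 5 := by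
  have h1 : 1 + x ^ 2 ≤ (1 + |x|) ^ 2 := by
    nlinarith [abs_nonneg x, sq_abs x]
  calc |x| * (1 + x ^ 2) ^ 2 ≤ (1 + |x|) * ((1 + |x|) ^ 2) ^ 2 := by
        gcongr
        linarith
    _ = _ := by ring

theorem sq_one_add_sq_le (x : ℝ) : (1 + x ^ 2) ^ 2 ≤ (1 + |x|) ^ 5 := by
  have h1 : 1 + x ^ 2 ≤ (1 + |x|) ^ 2 := by
    nlinarith [abs_nonneg x, sq_abs x]
  calc (1 + x ^ 2) ^ 2 ≤ 1 * ((1 + |x|) ^ 2) ^ 2 := by rw [one_mul]; gcongr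
    _ ≤ (1 + |x|) * ((1 + |x|) ^ 2) ^ 2 := by
        gcongr
        linarith [abs_nonneg x]
    _ = _ := by ring

/-- Four powers of 1 + |x| pay for the weight (1 + x²)², and the fifth gives the decay required by
`of_decay`. This fixes the number of integrations by parts at five. -/
theorem hasEndLimits_weighted {f : ℝ → ℝ} {C : ℝ} (hf : Continuous f)
    (h : ∀ x, (1 + |x|) ^ 5 * |f x| ≤ C) : HasEndLimits fun x => (1 + x ^ 2) ^ 2 * f x := by
  refine HasEndLimits.of_decay (C := C) (by fun_prop) fun x => le_trans ?_ (h x)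
  rw [abs_mul, abs_of_nonneg (by positivity : 0 ≤ (1 + x ^ 2) ^ 2), ← mul_assoc]
  gcongr
  exact abs_mul_sq_one_add_sq_le x

theorem abs_weighted_le {f : ℝ → ℝ} {C : ℝ} (h : ∀ x, (1 + |x|) ^ 5 * |f x| ≤ C) (x : ℝ) :
    |(1 + x ^ 2) ^ 2 * f x| ≤ C := by
  refine le_trans ?_ (h x)
  rw [abs_mul, abs_of_nonneg (by positivity : 0 ≤ (1 + x ^ 2) ^ 2)]
  gcongr
  exact sq_one_add_sq_le x

/-! ### The iterated primitives in the functional calculus, and integration by parts -/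

section Hilbert

variable {H : Type*} [NormedAddCommGroup H] [InnerProductSpace ℂ H] [CompleteSpace H]

theorem fc_eq_lorentz_mul_mul (S : H →ₗ.[ℂ] H) {f : ℝ → ℝ} {C : ℝ} (hf : Continuous f)
    (h : ∀ x, (1 + |x|) ^ 5 * |f x| ≤ C) :
    fc S f = fc S lorentz * fc S (fun x => (1 + x ^ 2) ^ 2 * f x) * fc S lorentz := by
  rw [← fc_mul S hasEndLimits_lorentz (hasEndLimits_weighted hf h),
    ← fc_mul S (hasEndLimits_lorentz.mul (hasEndLimits_weighted hf h)) hasEndLimits_lorentz]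
  congr 1
  funext x
  unfold lorentz
  have : 1 + x ^ 2 ≠ 0 := by positivity
  field_simp

theorem continuousOn_fc_thermalIter {β : ℝ} (S : H →ₗ.[ℂ] H) (n : ℕ) :
    ContinuousOn (fun t => fc S (thermalIter β n t)) (Ioo 0 β) := by
  cases n with
  | zero => exact continuousOn_thermalOp β S
  | succ n =>
    rcases le_or_gt β 0 with hβ | hβ
    · rw [Ioo_eq_empty (not_lt.2 hβ)]; exact continuousOn_empty _
    refine (continuousOn_fc S (φ := thermalIter β (n + 1))
      (ψ := fun t x => -(x * thermalIter β (n + 1) t x) + thermalIter β n t x)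
      (a := 0) (b := β) (C := (1 + β) * β ^ n + β ^ n) (by positivity)
      (fun t ht => hasEndLimits_thermalIter hβ _ ht)
      (fun t _ x => hasDerivAt_thermalIter_succ β n t x) fun t ht x => ?_).mono Ioo_subset_Icc_self
    refine (abs_add_le _ _).trans (add_le_add ?_ (abs_thermalIter_le n ht x))
    rw [abs_neg]
    exact abs_mul_thermalIter_succ_le n ht x

theorem norm_fc_thermalIter_le {β : ℝ} (hβ : 0 < β) (S : H →ₗ.[ℂ] H) (n : ℕ) {t : ℝ}
    (ht : t ∈ Icc 0 β) : ‖fc S (thermalIter β n t)‖ ≤ β ^ n :=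
  norm_fc_le S (hasEndLimits_thermalIter hβ n ht) (by positivity) (abs_thermalIter_le n ht)

theorem hasEndLimits_mul_lorentz_mul_thermalIter {β : ℝ} (hβ : 0 < β) (n : ℕ) {t : ℝ}
    (ht : t ∈ Icc 0 β) : HasEndLimits fun x => x * (lorentz x * thermalIter β n t x) := by
  have := hasEndLimits_mul_lorentz.mul (hasEndLimits_thermalIter hβ n ht)
  simpa only [mul_assoc] using this

/-- A bound for the derivative of `φₙ`. -/
theorem hasDerivAt_thermalIter {β : ℝ} (hβ : 0 < β) (n : ℕ) :
    ∃ (ψ : ℝ → ℝ → ℝ) (C : ℝ), 0 ≤ C ∧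
      (∀ t x, HasDerivAt (fun t => thermalIter β n t x) (ψ t x) t) ∧
      ∀ t ∈ Icc 0 β, ∀ x, |lorentz x * ψ t x| ≤ C := by
  cases n with
  | zero =>
    refine ⟨fun t x => -(x * thermal β t x), 1, zero_le_one, hasDerivAt_thermal β, fun t ht x => ?_⟩
    rw [mul_neg, abs_neg, ← mul_assoc, abs_mul, abs_mul, abs_of_pos (lorentz_pos x), mul_comm _ |x|]
    exact mul_le_one₀ (abs_mul_lorentz_le x) (abs_nonneg _) (abs_thermal_le_one ht x)
  | succ n =>
    refine ⟨fun t x => -(x * thermalIter β (n + 1) t x) + thermalIter β n t x,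
      (1 + β) * β ^ n + β ^ n, by positivity, hasDerivAt_thermalIter_succ β n, fun t ht x => ?_⟩
    rw [abs_mul, abs_of_pos (lorentz_pos x)]
    refine (mul_le_of_le_one_left (abs_nonneg _) (lorentz_le_one x)).trans ?_
    refine (abs_add_le _ _).trans (add_le_add ?_ (abs_thermalIter_le n ht x))
    rw [abs_neg]
    exact abs_mul_thermalIter_succ_le n ht x

theorem hasDerivWithinAt_fc_thermalIter {β t : ℝ} (hβ : 0 < β) (S : H →ₗ.[ℂ] H) (n : ℕ)
    (ht : t ∈ Icc 0 β) :
    HasDerivWithinAt (fun t => fc S (fun x => lorentz x * thermalIter β (n + 1) t x))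
      (-fc S (fun x => x * (lorentz x * thermalIter β (n + 1) t x)) +
        fc S (fun x => lorentz x * thermalIter β n t x)) (Icc 0 β) t := by
  have hl : ∀ n, ∀ t ∈ Icc 0 β, HasEndLimits fun x => lorentz x * thermalIter β n t x :=
    fun n t ht => hasEndLimits_lorentz.mul (hasEndLimits_thermalIter hβ n ht)
  have hxl := fun t ht => hasEndLimits_mul_lorentz_mul_thermalIter hβ (n + 1) (t := t) ht
  obtain ⟨ψ, C, hC, hψ, hb⟩ := hasDerivAt_thermalIter hβ n
  rw [← fc_neg S (hxl t ht), ← fc_add S (hxl t ht).neg (hl n t ht)]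
  refine hasDerivWithinAt_fc S (φ := fun t x => lorentz x * thermalIter β (n + 1) t x)
    (ψ := fun t x => -(x * (lorentz x * thermalIter β (n + 1) t x)) +
      lorentz x * thermalIter β n t x)
    (χ := fun t x => -(x * (lorentz x * (-(x * thermalIter β (n + 1) t x) + thermalIter β n t x)))
      + lorentz x * ψ t x)
    (C := β ^ (n + 1) + β ^ n + C) (by positivity)
    (hl (n + 1)) (fun t ht => (hxl t ht).neg.add (hl n t ht)) (fun t _ x => ?_) (fun t _ x => ?_)
    (fun t ht x => ?_) ht
  · exact ((hasDerivAt_thermalIter_succ β n t x).const_mul (lorentz x)).congr_deriv (by ring)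
  · exact ((((hasDerivAt_thermalIter_succ β n t x).const_mul (lorentz x)).const_mul x).neg).add
      ((hψ t x).const_mul (lorentz x))
  · refine (abs_add_le _ _).trans (add_le_add ?_ (hb t ht x))
    have e : -(x * (lorentz x * (-(x * thermalIter β (n + 1) t x) + thermalIter β n t x))) =
        (x ^ 2 * lorentz x) * thermalIter β (n + 1) t x -
        (x * lorentz x) * thermalIter β n t x := by ring
    rw [e]
    refine (abs_sub _ _).trans (add_le_add ?_ ?_)
    · rw [abs_mul, abs_of_nonneg (mul_nonneg (sq_nonneg x) (lorentz_pos x).le)]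
      exact (mul_le_of_le_one_left (abs_nonneg _) (sq_mul_lorentz_le x)).trans
        (abs_thermalIter_le _ ht x)
    · rw [abs_mul, abs_mul, abs_of_pos (lorentz_pos x)]
      exact (mul_le_of_le_one_left (abs_nonneg _) (abs_mul_lorentz_le x)).trans
        (abs_thermalIter_le _ ht x)

/-- `∫ φₙ(t, D) X p(β - t, S) dt`, where `p` is the thermal function. -/
def thermalMoment (β : ℝ) (n : ℕ) (D S : H →ₗ.[ℂ] H) (X : H →L[ℂ] H) : H →L[ℂ] H :=
  ∫ t in (0 : ℝ)..β, fc D (thermalIter β n t) * X * thermalOp β S (β - t)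

theorem intervalIntegrable_thermalMoment {β : ℝ} (hβ : 0 < β) (n : ℕ) (D S : H →ₗ.[ℂ] H)
    (X : H →L[ℂ] H) : IntervalIntegrable
      (fun t => fc D (thermalIter β n t) * X * thermalOp β S (β - t)) volume 0 β := by
  refine intervalIntegrable_of_norm_le (C := β ^ n * ‖X‖ * 1) hβ.le ?_ fun t ht => ?_
  · refine ((continuousOn_fc_thermalIter D n).mul continuousOn_const).mul ?_
    refine (continuousOn_thermalOp β S).comp (by fun_prop) fun t ht => ?_
    exact ⟨by linarith [ht.2], by linarith [ht.1]⟩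
  · refine (norm_mul_le _ _).trans (mul_le_mul ((norm_mul_le _ _).trans ?_)
      (norm_thermalOp_le hβ S ⟨by linarith [ht.2], by linarith [ht.1]⟩) (norm_nonneg _)
      (by positivity))
    gcongr
    exact norm_fc_thermalIter_le hβ D n (Ioo_subset_Icc_self ht)

/-- Integration by parts. -/
theorem Intertwines.thermalMoment_eq {β : ℝ} (hβ : 0 < β) {D S : H →ₗ.[ℂ] H} {X X' : H →L[ℂ] H}
    (hD : HasBoundedTransform D) (hS : HasBoundedTransform S) (hX : Intertwines D S X X') (n : ℕ) :
    thermalMoment β n D S X =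
      thermalMoment β (n + 1) D S X' - fc D (thermalIter β (n + 1) 0) * X := by
  apply eq_of_lorentz_mul_mul_lorentz hD hS
  set A := fun (n : ℕ) (t : ℝ) => fc D (fun x => lorentz x * thermalIter β n t x) with hAdef
  set B := fun t => fc S (regThermal β (β - t)) with hBdef
  have m2 : ∀ t ∈ Icc 0 β, β - t ∈ Icc 0 β := fun t ht => ⟨by linarith [ht.2], by linarith [ht.1]⟩
  have hB : ∀ t ∈ Icc 0 β, HasDerivWithinAt B (fc S (fun x => x * regThermal β (β - t) x))
      (Icc 0 β) t := by
    intro t ht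
    have := (hasDerivWithinAt_fc_regThermal hβ S (m2 t ht)).scomp t
      ((hasDerivAt_id t).const_sub β).hasDerivWithinAt (fun r hr => m2 r hr)
    simpa [Function.comp_def] using this
  have hl : ∀ n, ∀ t ∈ Icc 0 β, HasEndLimits fun x => lorentz x * thermalIter β n t x :=
    fun n t ht => hasEndLimits_lorentz.mul (hasEndLimits_thermalIter hβ n ht)
  have hAB : ∀ t ∈ Icc 0 β, HasDerivWithinAt (fun t => A (n + 1) t * X * B t)
      (A n t * X * B t - A (n + 1) t * X' * B t) (Icc 0 β) t := by
    intro t ht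
    refine (((hasDerivWithinAt_fc_thermalIter hβ D n ht).mul_const X).mul (hB t ht)).congr_deriv ?_
    simp only [A, B]
    rw [← hX.fc_mul_sub hD hS (hl (n + 1) t ht)
      (hasEndLimits_mul_lorentz_mul_thermalIter hβ (n + 1) ht) (hasEndLimits_regThermal hβ (m2 t ht))
      (hasEndLimits_mul_regThermal hβ (m2 t ht))]
    noncomm_ring
  have hcomm : ∀ n, ∀ s ∈ Icc 0 β, ∀ Y : H →L[ℂ] H, A n s * Y * B s =
      fc D lorentz * (fc D (thermalIter β n s) * Y * thermalOp β S (β - s)) * fc S lorentz := by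
    intro n s hs Y
    simp only [A, B]
    rw [fc_mul D hasEndLimits_lorentz (hasEndLimits_thermalIter hβ n hs),
      fc_regThermal' hβ S (m2 s hs)]
    noncomm_ring
  let L : (H →L[ℂ] H) →L[ℂ] (H →L[ℂ] H) :=
    (ContinuousLinearMap.mul ℂ (H →L[ℂ] H)).flip (fc S lorentz) ∘L
      ContinuousLinearMap.mul ℂ (H →L[ℂ] H) (fc D lorentz)
  have hL : ∀ Y, L Y = fc D lorentz * Y * fc S lorentz := fun Y => rfl
  have hint : ∀ n Y, IntervalIntegrable (fun t => A n t * Y * B t) volume 0 β := by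
    intro n Y
    have h := intervalIntegrable_thermalMoment hβ n D S Y
    have h2 : IntervalIntegrable (fun t => L (fc D (thermalIter β n t) * Y * thermalOp β S (β - t)))
        volume 0 β := ⟨L.integrable_comp h.1, L.integrable_comp h.2⟩
    refine h2.congr fun t ht => ?_
    rw [uIoc_of_le hβ.le] at ht
    exact (hcomm n t ⟨ht.1.le, ht.2⟩ Y).symm
  have hmom : ∀ n Y, fc D lorentz * thermalMoment β n D S Y * fc S lorentz =
      ∫ t in (0 : ℝ)..β, A n t * Y * B t := by
    intro n Y
    rw [← hL, thermalMoment,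
      ← L.intervalIntegral_comp_comm (intervalIntegrable_thermalMoment hβ n D S Y)]
    refine intervalIntegral.integral_congr fun t ht => ?_
    rw [uIcc_of_le hβ.le] at ht
    exact (hcomm n t ht Y).symm
  have ftc := intervalIntegral.integral_eq_sub_of_hasDerivAt_of_le hβ.le
    (f := fun t => A (n + 1) t * X * B t)
    (f' := fun t => A n t * X * B t - A (n + 1) t * X' * B t)
    (fun t ht => (hAB t ht).continuousWithinAt)
    (fun t ht => (hAB t (Ioo_subset_Icc_self ht)).hasDerivAt (Icc_mem_nhds ht.1 ht.2))
    ((hint n X).sub (hint (n + 1) X'))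
  rw [intervalIntegral.integral_sub (hint n X) (hint (n + 1) X'), ← hmom, ← hmom,
    hcomm _ β ⟨hβ.le, le_rfl⟩, hcomm _ 0 ⟨le_rfl, hβ.le⟩, sub_self, sub_zero] at ftc
  -- The boundary term is φ(β) X p(0, S) - φ(0) X p(β, S). With φ(β) = -φ(0) and p(0, S) + p(β, S) =
  -- 1 it becomes -φ(0) X, from which S has disappeared.
  have hanti : fc D (thermalIter β (n + 1) β) = -fc D (thermalIter β (n + 1) 0) := by
    rw [← fc_neg D (hasEndLimits_thermalIter hβ _ ⟨le_rfl, hβ.le⟩)]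
    congr 1
    funext x
    exact thermalIter_antiperiodic β n x
  rw [hanti, eq_sub_of_add_eq (thermalOp_zero_add hβ S)] at ftc
  rw [eq_add_of_sub_eq ftc]
  noncomm_ring

end Hilbert

end DiracEntropy

end

noncomputable section

namespace DiracEntropy

open Filter Topology

section Hilbert

variable {H : Type*} [NormedAddCommGroup H] [InnerProductSpace ℂ H] [CompleteSpace H]

/-! ### The entropy operator as a product of Hilbert–Schmidt operators -/

theorem perturb_perturb_smul (D : H →ₗ.[ℂ] H) (K : H →L[ℂ] H) (u v : ℝ) :
    perturb (perturb D ((v : ℂ) • K)) (((u - v : ℝ) : ℂ) • K) = perturb D ((u : ℂ) • K) := by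
  refine LinearPMap.eq_of_eq_graph (Submodule.ext fun z => ?_)
  obtain ⟨x, y⟩ := z
  rw [mem_graph_perturb_iff, mem_graph_perturb_iff, mem_graph_perturb_iff]
  have : y - (((u - v : ℝ) : ℂ) • K) x - ((v : ℂ) • K) x = y - ((u : ℂ) • K) x := by
    simp only [smul_apply]
    push_cast
    module
  rw [this]

theorem norm_thermalOp_perturb_sub_le {β : ℝ} (hβ : 0 < β) {D : H →ₗ.[ℂ] H} {K : H →L[ℂ] H}
    (hD : IsSelfAdjoint D) (hK : IsSelfAdjoint K) (u v : ℝ) {t : ℝ} (ht : t ∈ Ioc 0 β) :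
    ‖thermalOp β (perturb D ((u : ℂ) • K)) t - thermalOp β (perturb D ((v : ℂ) • K)) t‖ ≤
      |u - v| * (β * ‖K‖) := by
  have hS := isSelfAdjoint_perturb hD (isSelfAdjoint_real_smul hK v)
  -- The Dyson equation is used with D + vK as the free operator and u - v as the coupling.
  have h := dyson_equation hβ hS hK (u - v) (s := β - t) ⟨by linarith [ht.2], by linarith [ht.1]⟩
  rw [perturb_perturb_smul, sub_sub_cancel] at h
  rw [h, sub_sub_cancel_left, norm_neg, norm_smul, Real.norm_eq_abs]
  refine mul_le_mul_of_nonneg_left ?_ (abs_nonneg _)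
  have hm : IsBoundedMeasurable
      (fun t => cutThermal β (perturb D ((u : ℂ) • K)) (β - t)) 1 :=
    ⟨(stronglyMeasurable_cutThermal β _).comp_measurable (measurable_const.sub measurable_id),
      fun t => norm_cutThermal_le hβ _ _⟩
  have := (hm.greenConv hβ (perturb D ((v : ℂ) • K)) K).bound (β - t)
  rwa [mul_one] at this

theorem continuous_thermalOp_perturb {β : ℝ} (hβ : 0 < β) {D : H →ₗ.[ℂ] H} {K : H →L[ℂ] H}
    (hD : IsSelfAdjoint D) (hK : IsSelfAdjoint K) {t : ℝ} (ht : t ∈ Ioc 0 β) :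
    Continuous fun u : ℝ => thermalOp β (perturb D ((u : ℂ) • K)) t := by
  refine LipschitzWith.continuous (K := (β * ‖K‖).toNNReal) (LipschitzWith.of_dist_le_mul ?_)
  intro u v
  rw [dist_eq_norm, Real.dist_eq, Real.coe_toNNReal _ (by positivity), mul_comm]
  exact norm_thermalOp_perturb_sub_le hβ hD hK u v ht

/-- A continuous family of operators `X(u)`, `0 ≤ u ≤ 1`, with `(1 + D²)⁻¹ X(u)` uniformly
bounded in the Hilbert–Schmidt norm. -/
def IsHSFamily (D : H →ₗ.[ℂ] H) (X : ℝ → H →L[ℂ] H) : Prop :=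
  Continuous X ∧ ∃ C, ∀ u ∈ Icc (0 : ℝ) 1, HSBound (fc D lorentz ∘L X u) C

/-- The `n`-fold commutators with `D` exist, and form Hilbert–Schmidt families. -/
def HasHSCommutators (D : H →ₗ.[ℂ] H) : ℕ → (ℝ → H →L[ℂ] H) → Prop
  | 0, X => IsHSFamily D X
  | n + 1, X => IsHSFamily D X ∧ ∃ X' : ℝ → H →L[ℂ] H,
      (∀ u, Intertwines D D (X u) (X' u)) ∧ HasHSCommutators D n X'

theorem HasHSCommutators.isHSFamily {D : H →ₗ.[ℂ] H} {n : ℕ} {X : ℝ → H →L[ℂ] H}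
    (h : HasHSCommutators D n X) : IsHSFamily D X := by
  cases n with
  | zero => exact h
  | succ n => exact h.1

theorem HasHSCommutators.of_succ {D : H →ₗ.[ℂ] H} {n : ℕ} {X : ℝ → H →L[ℂ] H}
    (h : HasHSCommutators D (n + 1) X) : HasHSCommutators D n X := by
  induction n generalizing X with
  | zero => exact h.1
  | succ n ih =>
    obtain ⟨h0, X', hX, h'⟩ := h
    exact ⟨h0, X', hX, ih h'⟩

theorem IsHSFamily.add {D : H →ₗ.[ℂ] H} {X Y : ℝ → H →L[ℂ] H} (hX : IsHSFamily D X)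
    (hY : IsHSFamily D Y) : IsHSFamily D fun u => X u + Y u := by
  obtain ⟨cX, C, hC⟩ := hX
  obtain ⟨cY, C', hC'⟩ := hY
  refine ⟨cX.add cY, C + C', fun u hu => ?_⟩
  rw [ContinuousLinearMap.comp_add]
  exact (hC u hu).add (hC' u hu)

theorem IsHSFamily.smul {D : H →ₗ.[ℂ] H} {X : ℝ → H →L[ℂ] H} (hX : IsHSFamily D X) (c : ℝ) :
    IsHSFamily D fun u => ((c * u : ℝ) : ℂ) • X u := by
  obtain ⟨cX, C, hC⟩ := hX
  refine ⟨(by fun_prop : Continuous fun u : ℝ => ((c * u : ℝ) : ℂ)).smul cX, |c| * C, fun u hu => ?_⟩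
  rw [ContinuousLinearMap.comp_smul]
  refine ((hC u hu).smul _).mono (mul_le_mul_of_nonneg_right ?_ (hC u hu).nonneg)
  rw [Complex.norm_real, Real.norm_eq_abs, abs_mul, abs_of_nonneg hu.1]
  exact mul_le_of_le_one_right (abs_nonneg c) hu.2

theorem IsHSFamily.mul_const {D : H →ₗ.[ℂ] H} {X : ℝ → H →L[ℂ] H} (hX : IsHSFamily D X)
    (A : H →L[ℂ] H) : IsHSFamily D fun u => X u * A := by
  obtain ⟨cX, C, hC⟩ := hX
  exact ⟨cX.mul continuous_const, ‖A‖ * C, fun u hu => (hC u hu).comp_right A⟩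

theorem HasHSCommutators.add {D : H →ₗ.[ℂ] H} {n : ℕ} {X Y : ℝ → H →L[ℂ] H}
    (hX : HasHSCommutators D n X) (hY : HasHSCommutators D n Y) :
    HasHSCommutators D n fun u => X u + Y u := by
  induction n generalizing X Y with
  | zero => exact IsHSFamily.add hX hY
  | succ n ih =>
    obtain ⟨h0, X', hX', h'⟩ := hX
    obtain ⟨k0, Y', hY', k'⟩ := hY
    exact ⟨h0.add k0, _, fun u => (hX' u).add (hY' u), ih h' k'⟩

theorem HasHSCommutators.smul {D : H →ₗ.[ℂ] H} {n : ℕ} {X : ℝ → H →L[ℂ] H}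
    (hX : HasHSCommutators D n X) (c : ℝ) :
    HasHSCommutators D n fun u => ((c * u : ℝ) : ℂ) • X u := by
  induction n generalizing X with
  | zero => exact IsHSFamily.smul hX c
  | succ n ih =>
    obtain ⟨h0, X', hX', h'⟩ := hX
    exact ⟨h0.smul c, _, fun u => (hX' u).smul _, ih h'⟩

/-- Leibniz rule: the commutator of D with X Kⱼ is X' Kⱼ + X Kⱼ₊₁. The Hilbert–Schmidt property is
carried by the left factor X, so the Kⱼ need only be bounded here. -/
theorem HasHSCommutators.mul_const {D : H →ₗ.[ℂ] H} {n : ℕ} {X : ℝ → H →L[ℂ] H}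
    (hX : HasHSCommutators D n X) {K : ℕ → H →L[ℂ] H}
    (hK : ∀ j, Intertwines D D (K j) (K (j + 1))) (j : ℕ) :
    HasHSCommutators D n fun u => X u * K j := by
  induction n generalizing X j with
  | zero => exact IsHSFamily.mul_const hX _
  | succ n ih =>
    have hX1 := hX.of_succ
    obtain ⟨h0, X', hX', h'⟩ := hX
    exact ⟨h0.mul_const _, _, fun u => (hX' u).mul (hK j), (ih h' j).add (ih hX1 (j + 1))⟩

theorem hasHSCommutators_const {D : H →ₗ.[ℂ] H} {K : ℕ → H →L[ℂ] H}
    (hK : ∀ j, Intertwines D D (K j) (K (j + 1)))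
    (hHS : ∀ j, ∃ C, HSBound (fc D lorentz ∘L K j) C) (n j : ℕ) :
    HasHSCommutators D n fun _ => K j := by
  have h0 : ∀ j, IsHSFamily D fun _ => K j := fun j => by
    obtain ⟨C, hC⟩ := hHS j
    exact ⟨continuous_const, C, fun _ _ => hC⟩
  induction n generalizing j with
  | zero => exact h0 j
  | succ n ih => exact ⟨h0 j, _, fun _ => hK j, ih (j + 1)⟩

/-- D X - X (D + uK) = [D, X] - u X K. Both terms stay in the class, at the price of one commutator,
so the commutators needed for integration by parts against the perturbed operator are controlled by
those with D alone. -/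
theorem HasHSCommutators.exists_perturb {D : H →ₗ.[ℂ] H} {n : ℕ} {X : ℝ → H →L[ℂ] H}
    (hX : HasHSCommutators D (n + 1) X) {K : ℕ → H →L[ℂ] H}
    (hK : ∀ j, Intertwines D D (K j) (K (j + 1))) :
    ∃ X₁ : ℝ → H →L[ℂ] H, (∀ u : ℝ, Intertwines D (perturb D ((u : ℂ) • K 0)) (X u) (X₁ u)) ∧
      HasHSCommutators D n X₁ := by
  have hX1 := hX.of_succ
  obtain ⟨h0, X', hX', h'⟩ := hX
  refine ⟨fun u => X' u + (((-1) * u : ℝ) : ℂ) • (X u * K 0), fun u => ?_,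
    h'.add ((hX1.mul_const hK 0).smul (-1))⟩
  have h := (hX' u).perturb_right ((u : ℂ) • K 0)
  have e : X' u - X u * ((u : ℂ) • K 0) =
      X' u + (((-1) * u : ℝ) : ℂ) • (X u * K 0) := by
    rw [mul_smul_comm, neg_one_mul, Complex.ofReal_neg, neg_smul, sub_eq_add_neg]
  rwa [e] at h

/-- The family is `(1 + D²)⁻¹` times a continuous Hilbert–Schmidt family, on `[0, 1]`. -/
def IsRegularHSFamily (D : H →ₗ.[ℂ] H) (X : ℝ → H →L[ℂ] H) : Prop :=
  ∃ Y : ℝ → H →L[ℂ] H, Continuous Y ∧ (∃ C, ∀ u ∈ Icc (0 : ℝ) 1, HSBound (Y u) C) ∧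
    ∀ u, X u = fc D lorentz * Y u

/-- Five powers of decay split f(D) into (1 + D²)⁻¹ · bounded · (1 + D²)⁻¹. The right regularizer
makes X Hilbert–Schmidt, and the left one is the factor to be extracted. -/
theorem IsHSFamily.fc_mul {D : H →ₗ.[ℂ] H} {X : ℝ → H →L[ℂ] H} (hX : IsHSFamily D X) {f : ℝ → ℝ}
    {C : ℝ} (hf : Continuous f) (h : ∀ x, (1 + |x|) ^ 5 * |f x| ≤ C) :
    IsRegularHSFamily D fun u => fc D f * X u := by
  obtain ⟨cX, C', hC'⟩ := hX
  refine ⟨fun u => fc D (fun x => (1 + x ^ 2) ^ 2 * f x) * (fc D lorentz * X u), by fun_prop,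
    ⟨_, fun u hu => (hC' u hu).comp_left _⟩, fun u => ?_⟩
  simp only [fc_eq_lorentz_mul_mul D hf h, mul_assoc]

/-- Now φ₅(t, D) = Q E(t) Q with Q = (1 + D²)⁻¹ and E(t) bounded uniformly in t. The integrand
E(t)(Q X) p(β - t, S) is Hilbert–Schmidt with a uniform bound, and integration over t preserves the
bound. -/
theorem IsHSFamily.thermalMoment_five {β : ℝ} (hβ : 0 < β) {D : H →ₗ.[ℂ] H} {K : H →L[ℂ] H}
    (hD : IsSelfAdjoint D) (hK : IsSelfAdjoint K) {X : ℝ → H →L[ℂ] H} (hX : IsHSFamily D X) :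
    IsRegularHSFamily D fun u => thermalMoment β 5 D (perturb D ((u : ℂ) • K)) (X u) := by
  obtain ⟨cX, C, hC⟩ := hX
  set Q := fc D lorentz with hQ
  set E : ℝ → H →L[ℂ] H := fun t => fc D fun x => (1 + x ^ 2) ^ 2 * thermalIter β 5 t x with hE
  set p : ℝ → ℝ → H →L[ℂ] H := fun u t => thermalOp β (perturb D ((u : ℂ) • K)) (β - t) with hp
  have hlim : ∀ t ∈ Icc 0 β, HasEndLimits fun x => (1 + x ^ 2) ^ 2 * thermalIter β 5 t x :=
    fun t ht => hasEndLimits_weighted (continuous_thermalIter β 5 t)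
      fun x => one_add_abs_pow_mul_thermalIter_le 5 x ht
  have hEn : ∀ t ∈ Icc 0 β, ‖E t‖ ≤ (1 + β) ^ 5 := fun t ht =>
    norm_fc_le D (hlim t ht) (by positivity)
      (abs_weighted_le fun x => one_add_abs_pow_mul_thermalIter_le 5 x ht)
  have hpn : ∀ u, ∀ t ∈ Icc 0 β, ‖p u t‖ ≤ 1 := fun u t ht =>
    norm_thermalOp_le hβ _ ⟨by linarith [ht.2], by linarith [ht.1]⟩
  have hfac : ∀ t ∈ Icc 0 β, fc D (thermalIter β 5 t) = Q * E t * Q := fun t ht =>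
    fc_eq_lorentz_mul_mul D (continuous_thermalIter β 5 t)
      fun x => one_add_abs_pow_mul_thermalIter_le 5 x ht
  have hEc : ContinuousOn E (Icc 0 β) := by
    refine continuousOn_fc D (ψ := fun t x => (1 + x ^ 2) ^ 2 *
      (-(x * thermalIter β 5 t x) + thermalIter β 4 t x)) (C := (1 + β) ^ 5 + (1 + β) ^ 4)
      (by positivity) hlim (fun t _ x => (hasDerivAt_thermalIter_succ β 4 t x).const_mul _)
      fun t ht x => ?_
    have e : (1 + x ^ 2) ^ 2 * (-(x * thermalIter β 5 t x) + thermalIter β 4 t x) =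
      -(x * (1 + x ^ 2) ^ 2 * thermalIter β 5 t x) + (1 + x ^ 2) ^ 2 * thermalIter β 4 t x := by ring
    rw [e]
    refine (abs_add_le _ _).trans (add_le_add ?_ ?_)
    · refine le_trans ?_ (one_add_abs_pow_mul_thermalIter_le 5 x ht)
      rw [abs_neg, abs_mul, abs_mul, abs_of_nonneg (by positivity : 0 ≤ (1 + x ^ 2) ^ 2)]
      gcongr
      exact abs_mul_sq_one_add_sq_le x
    · refine le_trans ?_ (one_add_abs_pow_mul_thermalIter_le 4 x ht)
      rw [abs_mul, abs_of_nonneg (by positivity : 0 ≤ (1 + x ^ 2) ^ 2)]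
      gcongr
      calc (1 + x ^ 2) ^ 2 ≤ ((1 + |x|) ^ 2) ^ 2 := by
            gcongr
            nlinarith [abs_nonneg x, sq_abs x]
        _ = (1 + |x|) ^ 4 := by ring
  set G : ℝ → ℝ → H →L[ℂ] H := fun u t => E t * (Q * X u) * p u t with hG
  have hGn : ∀ u, ∀ t ∈ Icc 0 β, ‖G u t‖ ≤ (1 + β) ^ 5 * ‖Q * X u‖ := by
    intro u t ht
    calc ‖G u t‖ ≤ ‖E t‖ * ‖Q * X u‖ * ‖p u t‖ :=
          (norm_mul_le _ _).trans (mul_le_mul_of_nonneg_right (norm_mul_le _ _) (norm_nonneg _))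
      _ ≤ (1 + β) ^ 5 * ‖Q * X u‖ * 1 := by
          gcongr
          · exact hEn t ht
          · exact hpn u t ht
      _ = _ := mul_one _
  have hGc : ∀ u, ContinuousOn (G u) (Ioo 0 β) := fun u => by
    refine ((hEc.mono Ioo_subset_Icc_self).mul continuousOn_const).mul ?_
    refine (continuousOn_thermalOp β _).comp (by fun_prop) fun t ht => ?_
    exact ⟨by linarith [ht.2], by linarith [ht.1]⟩
  have hGi : ∀ u, IntervalIntegrable (G u) volume 0 β := fun u =>
    intervalIntegrable_of_norm_le hβ.le (hGc u) fun t ht => hGn u t (Ioo_subset_Icc_self ht)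
  refine ⟨fun u => ∫ t in (0 : ℝ)..β, G u t, continuous_iff_continuousAt.2 fun u₀ => ?_,
    ⟨(1 + β) ^ 5 * C * (volume.restrict (Ioc (0 : ℝ) β)).real univ, fun u hu => ?_⟩, fun u => ?_⟩
  · refine intervalIntegral.continuousAt_of_dominated_interval
      (bound := fun _ => (1 + β) ^ 5 * (‖Q * X u₀‖ + 1)) ?_ ?_ intervalIntegrable_const ?_
    · exact Eventually.of_forall fun u => by
        rw [uIoc_of_le hβ.le]; exact (hGi u).1.aestronglyMeasurable
    · have hev : ∀ᶠ u in 𝓝 u₀, ‖Q * X u‖ < ‖Q * X u₀‖ + 1 :=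
        (continuous_const.mul cX).norm.continuousAt.eventually_lt_const (lt_add_one _)
      filter_upwards [hev] with u hu
      refine Eventually.of_forall fun t ht => ?_
      rw [uIoc_of_le hβ.le] at ht
      refine (hGn u t (Ioc_subset_Icc_self ht)).trans ?_
      gcongr
    · have hne : ∀ᵐ t : ℝ, t ≠ β := by simp [ae_iff, measure_singleton]
      filter_upwards [hne] with t htβ ht
      rw [uIoc_of_le hβ.le] at ht
      refine ((continuous_const.mul (continuous_const.mul cX)).mul
        (continuous_thermalOp_perturb hβ hD hK ?_)).continuousAt
      exact ⟨sub_pos.2 (lt_of_le_of_ne ht.2 htβ), by linarith [ht.1]⟩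
  · beta_reduce
    rw [intervalIntegral.integral_of_le hβ.le]
    refine HSBound.integral (hGi u).1 (ae_restrict_of_forall_mem measurableSet_Ioc fun t ht => ?_)
    have ht' := Ioc_subset_Icc_self ht
    refine (((hC u hu).comp_left (E t)).comp_right (p u t)).mono ?_
    have hC0 := (hC u hu).nonneg
    calc ‖p u t‖ * (‖E t‖ * C) ≤ 1 * ((1 + β) ^ 5 * C) := by
          gcongr
          · exact hpn u t ht'
          · exact hEn t ht'
      _ = _ := one_mul _
  · have := (ContinuousLinearMap.mul ℂ (H →L[ℂ] H) Q).intervalIntegral_comp_comm (hGi u)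
    refine Eq.trans (intervalIntegral.integral_congr fun t ht => ?_) this
    rw [uIcc_of_le hβ.le] at ht
    simp only [ContinuousLinearMap.mul_apply', hG, hfac t ht, mul_assoc]
    rfl

/-- Each integration by parts uses up one of the n available commutators and raises k by one, so k +
n = 5 is preserved and the recursion ends at φ₅. The boundary term φ_{k+1}(0, D) X decays
exponentially in D and is regular by itself. -/
theorem HasHSCommutators.thermalMoment {β : ℝ} (hβ : 0 < β) {D : H →ₗ.[ℂ] H} {K : ℕ → H →L[ℂ] H}
    (hD : IsSelfAdjoint D) (hK0 : IsSelfAdjoint (K 0))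
    (hK : ∀ j, Intertwines D D (K j) (K (j + 1))) {n k : ℕ} (hnk : k + n = 5)
    {X : ℝ → H →L[ℂ] H} (hX : HasHSCommutators D n X) :
    IsRegularHSFamily D fun u => thermalMoment β k D (perturb D ((u : ℂ) • K 0)) (X u) := by
  induction n generalizing k X with
  | zero =>
    obtain rfl : k = 5 := hnk
    exact IsHSFamily.thermalMoment_five hβ hD hK0 hX
  | succ n ih =>
    obtain ⟨X₁, hX₁, h₁⟩ := hX.exists_perturb hK
    obtain ⟨Y, cY, ⟨C, hC⟩, hY⟩ := ih (k := k + 1) (by omega) h₁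
    obtain ⟨C₀, hC₀⟩ := exists_one_add_abs_pow_mul_exp_le hβ 5
    obtain ⟨Z, cZ, ⟨C', hC'⟩, hZ⟩ := hX.isHSFamily.fc_mul (C := β ^ (k + 1) * C₀)
      (continuous_thermalIter β (k + 1) 0) fun x => by
        calc (1 + |x|) ^ 5 * |thermalIter β (k + 1) 0 x| ≤
            (1 + |x|) ^ 5 * (β ^ (k + 1) * Real.exp (-(β * |x|))) := by
              gcongr
              exact abs_thermalIter_zero_le hβ.le k x
          _ = β ^ (k + 1) * ((1 + |x|) ^ 5 * Real.exp (-(β * |x|))) := by ring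
          _ ≤ _ := by gcongr; exact hC₀ x
    refine ⟨fun u => Y u - Z u, cY.sub cZ, ⟨C + C', fun u hu => ?_⟩, fun u => ?_⟩
    · beta_reduce
      rw [sub_eq_add_neg]
      exact (hC u hu).add (hC' u hu).neg
    · beta_reduce at hY hZ ⊢
      rw [(hX₁ u).thermalMoment_eq hβ (hasBoundedTransform_of_isSelfAdjoint hD)
        (hasBoundedTransform_of_isSelfAdjoint
          (isSelfAdjoint_perturb hD (isSelfAdjoint_real_smul hK0 u))), hY, hZ, mul_sub]

theorem fermiOp_sub_eq_thermalMoment {β : ℝ} (hβ : 0 < β) {D : H →ₗ.[ℂ] H} {K : H →L[ℂ] H}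
    (hD : IsSelfAdjoint D) (hK : IsSelfAdjoint K) (u : ℝ) :
    fermiOp β D - fermiOp β (perturb D ((u : ℂ) • K)) =
      thermalMoment β 0 D (perturb D ((u : ℂ) • K)) ((u : ℂ) • K) := by
  have h := (intertwines_one_perturb D ((u : ℂ) • K)).fermi_commutator hβ
    (hasBoundedTransform_of_isSelfAdjoint hD)
    (hasBoundedTransform_of_isSelfAdjoint (isSelfAdjoint_perturb hD (isSelfAdjoint_real_smul hK u)))
  rw [mul_one, one_mul] at h
  rw [h, ← intervalIntegral.integral_neg]
  refine intervalIntegral.integral_congr fun t _ => ?_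
  simp only [mul_neg, neg_mul, neg_neg]
  rfl

/-- The entropy operator is a product of two Hilbert–Schmidt operators, if the iterated commutators
of `K` with `D` are bounded and `(1 + D²)⁻¹`-Hilbert–Schmidt. -/
theorem exists_entropyOp_eq_adjoint_comp {β : ℝ} (hβ : 0 < β) {D : H →ₗ.[ℂ] H} {K : ℕ → H →L[ℂ] H}
    (hD : IsSelfAdjoint D) (hK0 : IsSelfAdjoint (K 0))
    (hK : ∀ j, Intertwines D D (K j) (K (j + 1)))
    (hHS : ∀ j, ∃ C, HSBound (fc D lorentz ∘L K j) C) :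
    ∃ (X Y : H →L[ℂ] H) (C C' : ℝ), HSBound X C ∧ HSBound Y C' ∧
      entropyOp β D (K 0) = ContinuousLinearMap.adjoint X ∘L Y := by
  have h0 : HasHSCommutators D 5 fun u => ((1 * u : ℝ) : ℂ) • K 0 :=
    (hasHSCommutators_const hK hHS 5 0).smul 1
  simp only [one_mul] at h0
  obtain ⟨Y, cY, ⟨C, hC⟩, hY⟩ := h0.thermalMoment hβ hD hK0 hK (k := 0) rfl
  obtain ⟨C₀, hC₀⟩ := hHS 0
  have hYi : Integrable Y (volume.restrict (Ioc (0 : ℝ) 1)) :=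
    (cY.integrableOn_Icc (a := 0) (b := 1)).mono_set Ioc_subset_Icc_self
  have hYHS := HSBound.integral hYi (ae_restrict_of_forall_mem measurableSet_Ioc
    fun u hu => hC u (Ioc_subset_Icc_self hu))
  -- The left factor of the entropy operator is K (1 + D²)⁻¹, which is the adjoint of (1 + D²)⁻¹ K
  -- because both operators are self-adjoint.
  refine ⟨fc D lorentz ∘L K 0, (β : ℂ) • ∫ u in Ioc (0 : ℝ) 1, Y u, _, _, hC₀, hYHS.smul _, ?_⟩
  rw [entropyOp_eq hβ hD hK0, ContinuousLinearMap.adjoint_comp,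
    ← ContinuousLinearMap.star_eq_adjoint, ← ContinuousLinearMap.star_eq_adjoint, hK0.star_eq,
    (isSelfAdjoint_fc D lorentz).star_eq]
  have e : ∫ u in (0 : ℝ)..1, (fermiOp β D - fermiOp β (perturb D ((u : ℂ) • K 0))) =
      fc D lorentz * ∫ u in Ioc (0 : ℝ) 1, Y u := by
    rw [intervalIntegral.integral_of_le zero_le_one]
    have := (ContinuousLinearMap.mul ℂ (H →L[ℂ] H) (fc D lorentz)).integral_comp_comm hYi
    refine Eq.trans (integral_congr_ae (Eventually.of_forall fun u => ?_)) this
    simp only [fermiOp_sub_eq_thermalMoment hβ hD hK0, hY, ContinuousLinearMap.mul_apply']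
  rw [e, ContinuousLinearMap.comp_smul]
  rfl

end Hilbert

end DiracEntropy

end

noncomputable section

namespace DiracEntropy

open Filter Topology

section Hilbert

variable {H : Type*} [NormedAddCommGroup H] [InnerProductSpace ℂ H] [CompleteSpace H]

/-! ### Bounded operators as everywhere defined partial operators -/

theorem isSelfAdjoint_toPMap {T : H →L[ℂ] H} (hT : IsSelfAdjoint T) :
    IsSelfAdjoint (T.toLinearMap.toPMap ⊤) := by
  rw [LinearPMap.isSelfAdjoint_def,
    ContinuousLinearMap.toPMap_adjoint_eq_adjoint_toPMap_of_dense _ dense_univ,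
    ← ContinuousLinearMap.star_eq_adjoint, hT.star_eq]

theorem mem_graph_toPMap {T : H →L[ℂ] H} {x y : H} :
    (x, y) ∈ (T.toLinearMap.toPMap ⊤).graph ↔ y = T x := by
  rw [LinearPMap.mem_graph_iff]
  constructor
  · rintro ⟨z, rfl, h⟩
    exact h.symm
  · rintro rfl
    exact ⟨⟨x, trivial⟩, rfl, rfl⟩

theorem perturb_toPMap (T K : H →L[ℂ] H) :
    perturb (T.toLinearMap.toPMap ⊤) K = (T + K).toLinearMap.toPMap ⊤ := by
  refine LinearPMap.eq_of_eq_graph (Submodule.ext fun z => ?_)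
  obtain ⟨x, y⟩ := z
  rw [mem_graph_perturb_iff, mem_graph_toPMap, mem_graph_toPMap, sub_eq_iff_eq_add, add_apply]

/-- The graph criterion gives Z = wT = Tw, so w²(1 + T²) = 1. Thus w and (1 + T²)^(-1/2) are
nonnegative square roots of the same operator and coincide. -/
theorem boundedTransform_toPMap {T : H →L[ℂ] H} (hT : IsSelfAdjoint T) :
    boundedTransform (T.toLinearMap.toPMap ⊤) = cfc (fun x : ℝ => x / √(1 + x ^ 2)) T := by
  set S := T.toLinearMap.toPMap ⊤ with hS
  have hbt := hasBoundedTransform_of_isSelfAdjoint (isSelfAdjoint_toPMap hT)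
  set w := rootResolvent S with hw
  set Z := boundedTransform S with hZ
  have hZw : Z = w * T := by
    ext x
    exact (hbt.mem_graph_iff_eq x (T x)).1 (mem_graph_toPMap.2 rfl)
  have hwZ : Z = T * w := by
    have := congrArg star hZw
    rwa [star_mul, (isSelfAdjoint_boundedTransform S).star_eq, (isSelfAdjoint_rootResolvent S).star_eq,
      hT.star_eq] at this
  set r := cfc (fun x : ℝ => (√(1 + x ^ 2))⁻¹) T with hr
  have hc : Continuous fun x : ℝ => (√(1 + x ^ 2))⁻¹ :=
    Continuous.inv₀ (by fun_prop) fun x => by positivity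
  have hid : cfc (fun x : ℝ => x) T = T := cfc_id' ℝ T
  have hww : w * w = r * r := by
    have h1 : w * w * (1 + T * T) = 1 := by
      have h2 := rootResolvent_sq_add S
      have h3 : Z * Z = w * w * (T * T) := by
        conv_lhs => rw [hZw]
        rw [mul_assoc, ← mul_assoc T w, ← hwZ, hZw]
        noncomm_ring
      rw [mul_add, mul_one, ← h3]
      simpa [pow_two] using h2
    have h2 : (1 + T * T) * (r * r) = 1 := by
      have e : (1 + T * T) * (r * r) = cfc (fun x : ℝ => (1 + x * x) *
          ((√(1 + x ^ 2))⁻¹ * (√(1 + x ^ 2))⁻¹)) T := by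
        rw [cfc_mul _ _ T (by fun_prop) (by exact (hc.mul hc).continuousOn),
          cfc_mul _ _ T hc.continuousOn hc.continuousOn,
          cfc_add _ _ _ (by fun_prop) (by fun_prop), cfc_mul _ _ T (by fun_prop) (by fun_prop), hid,
          cfc_const_one ℝ T]
      rw [e, ← cfc_const_one ℝ T]
      congr 1
      funext x
      rw [← mul_inv, Real.mul_self_sqrt (by positivity), ← pow_two]
      exact mul_inv_cancel₀ (by positivity)
    calc w * w = w * w * ((1 + T * T) * (r * r)) := by rw [h2, mul_one]
      _ = w * w * (1 + T * T) * (r * r) := by rw [mul_assoc (w * w)]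
      _ = r * r := by rw [h1, one_mul]
  have hw0 : 0 ≤ w := cfc_nonneg fun x _ => Real.sqrt_nonneg _
  have hr0 : 0 ≤ r := cfc_nonneg fun x _ => by positivity
  have hwr : w = r := (CFC.sqrt_unique rfl hw0).symm.trans (CFC.sqrt_unique hww.symm hr0)
  rw [hwZ, hwr]
  conv_lhs => rw [← hid, hr]
  rw [← cfc_mul _ _ T (by fun_prop) hc.continuousOn]
  rfl

theorem fc_toPMap {T : H →L[ℂ] H} (hT : IsSelfAdjoint T) {g : ℝ → ℝ} (hg : HasEndLimits g) :
    fc (T.toLinearMap.toPMap ⊤) g = cfc g T := by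
  have hsq : ∀ x : ℝ, 0 < 1 + x ^ 2 := fun x => by positivity
  have hb : Continuous fun x : ℝ => x / √(1 + x ^ 2) :=
    Continuous.div (by fun_prop) (by fun_prop) fun x => (Real.sqrt_pos.2 (hsq x)).ne'
  have hmem : ∀ x : ℝ, x / √(1 + x ^ 2) ∈ Ioo (-1 : ℝ) 1 := by
    intro x
    have h1 : |x| < √(1 + x ^ 2) := by
      rw [← Real.sqrt_sq_eq_abs]
      exact Real.sqrt_lt_sqrt (sq_nonneg x) (by linarith)
    rw [mem_Ioo, ← abs_lt, abs_div, abs_of_pos (Real.sqrt_pos.2 (hsq x)),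
      div_lt_one (Real.sqrt_pos.2 (hsq x))]
    exact h1
  rw [fc, boundedTransform_toPMap hT, ← cfc_comp' _ (fun x : ℝ => x / √(1 + x ^ 2)) T
    (hg.continuousOn_extend.mono (by
      rintro _ ⟨x, -, rfl⟩
      exact Ioo_subset_Icc_self (hmem x))) hb.continuousOn]
  congr 1
  funext x
  rw [hg.extend_apply (hmem x)]
  congr 1
  have h1 : 1 - (x / √(1 + x ^ 2)) ^ 2 = (1 + x ^ 2)⁻¹ := by
    rw [div_pow, Real.sq_sqrt (hsq x).le]
    field_simp
    ring
  rw [h1, Real.sqrt_inv, div_inv_eq_mul, div_mul_cancel₀ _ (Real.sqrt_pos.2 (hsq x)).ne']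

theorem fermiOp_toPMap {β : ℝ} (hβ : 0 < β) {T : H →L[ℂ] H} (hT : IsSelfAdjoint T) :
    fermiOp β (T.toLinearMap.toPMap ⊤) = cfc (fun x : ℝ => (1 + Real.exp (β * x))⁻¹) T := by
  rw [fermiOp_eq_thermalOp, thermalOp, fc_toPMap hT (hasEndLimits_thermal hβ ⟨hβ.le, le_rfl⟩)]
  congr 1
  funext x
  have : Real.exp (-β * x) * Real.exp (β * x) = 1 := by rw [← Real.exp_add]; simp
  unfold thermal
  rw [div_eq_iff (by positivity), inv_mul_eq_div, eq_div_iff (by positivity)]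
  linear_combination this

end Hilbert

section FiniteDimensional

variable {H : Type*} [NormedAddCommGroup H] [InnerProductSpace ℂ H] [CompleteSpace H]
  [FiniteDimensional ℂ H]

/-! ### Traces in finite dimension -/

/-- The trace on a finite-dimensional space. -/
def finTrace : (H →L[ℂ] H) →L[ℂ] ℂ :=
  LinearMap.toContinuousLinearMap (LinearMap.trace ℂ H ∘ₗ ContinuousLinearMap.coeLM ℂ)

theorem finTrace_apply (T : H →L[ℂ] H) : finTrace T = LinearMap.trace ℂ H T.toLinearMap := rfl

theorem finTrace_mul_comm (S T : H →L[ℂ] H) : finTrace (S * T) = finTrace (T * S) :=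
  LinearMap.trace_mul_comm ℂ S.toLinearMap T.toLinearMap

theorem trace_eq_finTrace (T : H →L[ℂ] H) : trace T = finTrace T := by
  have key : ∀ (w : Set H) (b : HilbertBasis w ℂ H),
      ∑' i, ⟪b i, T (b i)⟫_ℂ = LinearMap.trace ℂ H T.toLinearMap := by
    intro w b
    have : Finite w := b.orthonormal.linearIndependent.finite
    have := Fintype.ofFinite w
    rw [tsum_fintype, LinearMap.trace_eq_sum_inner _ b.toOrthonormalBasis]
    simp
  exact key _ _

theorem finTrace_eq_sum (T : H →L[ℂ] H) :
    finTrace T = ∑ i, ⟪stdOrthonormalBasis ℂ H i, T (stdOrthonormalBasis ℂ H i)⟫_ℂ :=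
  LinearMap.trace_eq_sum_inner _ _

theorem finTrace_star (T : H →L[ℂ] H) : finTrace (star T) = starRingEnd ℂ (finTrace T) := by
  rw [finTrace_eq_sum, finTrace_eq_sum, map_sum]
  refine Finset.sum_congr rfl fun i _ => ?_
  rw [ContinuousLinearMap.star_eq_adjoint, ContinuousLinearMap.adjoint_inner_right, inner_conj_symm]

theorem im_finTrace_mul {S T : H →L[ℂ] H} (hS : IsSelfAdjoint S) (hT : IsSelfAdjoint T) :
    (finTrace (S * T)).im = 0 := by
  have h := finTrace_star (S * T)
  rw [star_mul, hS.star_eq, hT.star_eq, finTrace_mul_comm] at h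
  exact Complex.conj_eq_iff_im.1 h.symm

theorem im_finTrace {T : H →L[ℂ] H} (hT : IsSelfAdjoint T) : (finTrace T).im = 0 := by
  have := im_finTrace_mul hT (IsSelfAdjoint.one _)
  rwa [mul_one] at this

/-- For projections, Tr(PQ) = Tr((QP)*(QP)). -/
theorem re_finTrace_mul_nonneg {P Q : H →L[ℂ] H} (hP : IsSelfAdjoint P) (hQ : IsSelfAdjoint Q)
    (hP2 : P * P = P) (hQ2 : Q * Q = Q) : 0 ≤ (finTrace (P * Q)).re := by
  have h : finTrace (P * Q) = finTrace (P * (Q * (Q * P))) := by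
    rw [← mul_assoc Q, hQ2, ← mul_assoc, finTrace_mul_comm (P * Q) P, ← mul_assoc, hP2]
  rw [h, finTrace_eq_sum, Complex.re_sum]
  refine Finset.sum_nonneg fun i _ => ?_
  set v := stdOrthonormalBasis ℂ H i
  have e : ⟪v, (P * (Q * (Q * P))) v⟫_ℂ = ⟪Q (P v), Q (P v)⟫_ℂ := by
    have hP' : ∀ x y : H, ⟪x, P y⟫_ℂ = ⟪P x, y⟫_ℂ := fun x y => by
      conv_lhs => rw [← hP.star_eq, ContinuousLinearMap.star_eq_adjoint,
        ContinuousLinearMap.adjoint_inner_right]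
    have hQ' : ∀ x y : H, ⟪x, Q y⟫_ℂ = ⟪Q x, y⟫_ℂ := fun x y => by
      conv_lhs => rw [← hQ.star_eq, ContinuousLinearMap.star_eq_adjoint,
        ContinuousLinearMap.adjoint_inner_right]
    rw [← hQ', ← hP']
    rfl
  rw [e]
  exact inner_self_nonneg (𝕜 := ℂ)

theorem finite_spectrum_real (T : H →L[ℂ] H) : (spectrum ℝ T).Finite := by
  have h1 : (spectrum ℂ T).Finite := by
    have := Module.End.finite_spectrum (K := ℂ) T.toLinearMap
    rwa [← AlgEquiv.spectrum_eq (Module.End.toContinuousLinearMap (𝕜 := ℂ) H)] at this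
  rw [← spectrum.preimage_algebraMap ℂ]
  exact h1.preimage (FaithfulSMul.algebraMap_injective ℝ ℂ).injOn

/-! ### Double spectral sums and Klein's inequality -/

/-- The spectral projection of `T` at `a`. -/
def spectralProj (T : H →L[ℂ] H) (a : ℝ) : H →L[ℂ] H := cfc (fun x => if x = a then 1 else 0) T

theorem cfc_eq_sum_spectralProj {T : H →L[ℂ] H} (hT : IsSelfAdjoint T) (f : ℝ → ℝ) :
    cfc f T = ∑ a ∈ (finite_spectrum_real T).toFinset, f a • spectralProj T a := by
  have hc : ∀ g : ℝ → ℝ, ContinuousOn g (spectrum ℝ T) := fun g =>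
    (finite_spectrum_real T).continuousOn g
  have e : ∀ a ∈ (finite_spectrum_real T).toFinset, f a • spectralProj T a =
      cfc (fun x => f a * if x = a then 1 else 0) T := fun a _ =>
    (cfc_const_mul _ _ _ (hc _)).symm
  rw [Finset.sum_congr rfl e, ← cfc_sum _ _ _ fun i _ => hc _]
  refine cfc_congr fun x hx => ?_
  rw [Finset.sum_apply, Finset.sum_eq_single x]
  · simp
  · intro b _ hb
    rw [if_neg hb.symm, mul_zero]
  · intro h
    exact absurd ((finite_spectrum_real T).mem_toFinset.2 hx) h

theorem isSelfAdjoint_spectralProj (T : H →L[ℂ] H) (a : ℝ) : IsSelfAdjoint (spectralProj T a) :=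
  cfc_predicate _ _

theorem spectralProj_mul_self (T : H →L[ℂ] H) (a : ℝ) :
    spectralProj T a * spectralProj T a = spectralProj T a := by
  rw [spectralProj, ← cfc_mul _ _ _ ((finite_spectrum_real T).continuousOn _)
    ((finite_spectrum_real T).continuousOn _)]
  congr 1
  funext x
  split_ifs <;> simp

/-- For non-commuting S and T the trace of f(S) g(T) is still a sum of scalar values f(a) g(b), with
the nonnegative weights Tr(P_a Q_b). Trace inequalities thereby reduce to inequalities between
numbers. -/
theorem re_finTrace_cfc_mul_cfc {S T : H →L[ℂ] H} (hS : IsSelfAdjoint S) (hT : IsSelfAdjoint T)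
    (f g : ℝ → ℝ) : (finTrace (cfc f S * cfc g T)).re =
      ∑ a ∈ (finite_spectrum_real S).toFinset, ∑ b ∈ (finite_spectrum_real T).toFinset,
        f a * g b * (finTrace (spectralProj S a * spectralProj T b)).re := by
  rw [cfc_eq_sum_spectralProj hS f, cfc_eq_sum_spectralProj hT g, Finset.sum_mul_sum, map_sum,
    Complex.re_sum]
  refine Finset.sum_congr rfl fun a _ => ?_
  rw [map_sum, Complex.re_sum]
  refine Finset.sum_congr rfl fun b _ => ?_
  rw [smul_mul_smul_comm, ← Complex.coe_smul, map_smul, smul_eq_mul, Complex.re_ofReal_mul]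

/-- Klein's inequality. -/
theorem klein_inequality {S T : H →L[ℂ] H} (hS : IsSelfAdjoint S) (hT : IsSelfAdjoint T)
    {φ φ' : ℝ → ℝ} (h : ∀ a b, (b - a) * φ' a ≤ φ b - φ a) :
    (finTrace ((T - S) * cfc φ' S)).re ≤ (finTrace (cfc φ T - cfc φ S)).re := by
  -- Inserting 1 as a function of the other operator puts every term over the same weights.
  have h1 : ∀ (f : ℝ → ℝ), cfc f S = cfc f S * cfc (fun _ => (1 : ℝ)) T := fun f => by
    rw [cfc_const_one ℝ T, mul_one]
  have h2 : ∀ (f : ℝ → ℝ), cfc f T = cfc (fun _ => (1 : ℝ)) S * cfc f T := fun f => by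
    rw [cfc_const_one ℝ S, one_mul]
  have hid : ∀ {R : H →L[ℂ] H}, IsSelfAdjoint R → cfc (fun x : ℝ => x) R = R := fun hR =>
    cfc_id' ℝ _ hR
  have e1 : finTrace ((T - S) * cfc φ' S) = finTrace (cfc φ' S * cfc (fun x : ℝ => x) T)
      - finTrace (cfc (fun x => φ' x * x) S * cfc (fun _ => (1 : ℝ)) T) := by
    have hc : ContinuousOn φ' (spectrum ℝ S) := (finite_spectrum_real S).continuousOn φ'
    rw [← h1, cfc_mul _ _ _ hc (by fun_prop), hid hT, hid hS, ← map_sub, ← mul_sub,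
      finTrace_mul_comm]
  have e2 : finTrace (cfc φ T - cfc φ S) = finTrace (cfc (fun _ => (1 : ℝ)) S * cfc φ T) -
      finTrace (cfc φ S * cfc (fun _ => (1 : ℝ)) T) := by
    rw [← h1, ← h2, map_sub]
  rw [e1, e2, Complex.sub_re, Complex.sub_re]
  simp only [re_finTrace_cfc_mul_cfc hS hT, ← Finset.sum_sub_distrib]
  refine Finset.sum_le_sum fun a _ => Finset.sum_le_sum fun b _ => ?_
  have hp := re_finTrace_mul_nonneg (isSelfAdjoint_spectralProj S a)
    (isSelfAdjoint_spectralProj T b) (spectralProj_mul_self S a) (spectralProj_mul_self T b)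
  nlinarith [mul_le_mul_of_nonneg_right (h a b) hp]

/-! ### The free energy and its derivative -/

/-- The function `log (1 + e^{-βx})`. -/
def logPartition (β x : ℝ) : ℝ := Real.log (1 + Real.exp (-β * x))

/-- Convexity of exp at the points 0 and -β(b - a), with weights 1 - n and n for the Fermi factor n
at a: the weighted mean of the exponentials is (1 + e^{-βb})/(1 + e^{-βa}). Taking logarithms gives
the tangent line bound. -/
theorem logPartition_convex (β a b : ℝ) :
    (b - a) * (-β * (1 + Real.exp (β * a))⁻¹) ≤ logPartition β b - logPartition β a := by
  set n := (1 + Real.exp (β * a))⁻¹ with hn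
  have hn0 : 0 ≤ n := by positivity
  have hn1 : n ≤ 1 := inv_le_one_of_one_le₀ (by linarith [Real.exp_pos (β * a)])
  have h := convexOn_exp.2 (mem_univ 0) (mem_univ (-β * (b - a))) (sub_nonneg.2 hn1) hn0
    (sub_add_cancel 1 n)
  simp only [smul_eq_mul, mul_zero, zero_add, Real.exp_zero, mul_one] at h
  have e : 1 - n + n * Real.exp (-β * (b - a)) =
      (1 + Real.exp (-β * b)) / (1 + Real.exp (-β * a)) := by
    have h1 : Real.exp (-β * b) = Real.exp (-β * a) * Real.exp (-β * (b - a)) := by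
      rw [← Real.exp_add]; ring_nf
    have h2 : Real.exp (β * a) * Real.exp (-β * a) = 1 := by rw [← Real.exp_add]; simp
    rw [h1, hn, eq_div_iff (by positivity)]
    have h3 : 1 + Real.exp (β * a) ≠ 0 := by positivity
    generalize Real.exp (β * a) = x at *
    generalize Real.exp (-β * (b - a)) = y at *
    generalize Real.exp (-β * a) = z at *
    field_simp
    linear_combination (1 - y) * h2
  rw [e] at h
  unfold logPartition
  rw [← Real.log_div (by positivity) (by positivity)]
  have := Real.log_le_log (Real.exp_pos _) h
  rw [Real.log_exp] at this
  linarith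

/-- Exchanging u and v gives (v - u) g(u) ≤ G(v) - G(u) ≤ (v - u) g(v), and g is continuous. No
derivative of the functional calculus itself is then needed. -/
theorem hasDerivAt_of_sandwich {G g : ℝ → ℝ} (hg : Continuous g)
    (h : ∀ u v, (v - u) * g u ≤ G v - G u) (u : ℝ) : HasDerivAt G (g u) u := by
  rw [hasDerivAt_iff_isLittleO]
  have h1 : (fun v => G v - G u - (v - u) • g u) =O[𝓝 u] fun v => (v - u) * (g v - g u) := by
    refine Asymptotics.IsBigO.of_bound 1 (Eventually.of_forall fun v => ?_)
    rw [one_mul, Real.norm_eq_abs, Real.norm_eq_abs, smul_eq_mul]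
    have h2 := h u v
    have h3 := h v u
    rw [abs_of_nonneg (by linarith)]
    refine le_trans ?_ (le_abs_self _)
    nlinarith
  refine h1.trans_isLittleO ?_
  have h4 : (fun v => g v - g u) =o[𝓝 u] fun _ => (1 : ℝ) := by
    rw [Asymptotics.isLittleO_one_iff]
    have := (hg.tendsto u).sub_const (g u)
    rwa [sub_self] at this
  simpa using (Asymptotics.isBigO_refl (fun v => v - u) (𝓝 u)).mul_isLittleO h4

/-- Klein's inequality for the convex function log(1 + e^{-βx}) is the sandwich hypothesis for G(u)
= Tr log(1 + e^{-β(D + uK)}), with slope -β Tr(K n(D + uK)). Integrating over [0, 1] converts the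
u-integral in 𝔖₁ into G(1) - G(0). -/
theorem finTrace_entropyOp {β : ℝ} (hβ : 0 < β) {D K : H →L[ℂ] H} (hD : IsSelfAdjoint D)
    (hK : IsSelfAdjoint K) : finTrace (entropyOp β (D.toLinearMap.toPMap ⊤) K) =
      finTrace ((β : ℂ) • (K * cfc (fun x : ℝ => (1 + Real.exp (β * x))⁻¹) D)
        + cfc (logPartition β) (D + K) - cfc (logPartition β) D) := by
  set n : ℝ → ℝ := fun x => (1 + Real.exp (β * x))⁻¹ with hn
  set S : ℝ → H →L[ℂ] H := fun u => D + (u : ℂ) • K with hSdef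
  have hS : ∀ u, IsSelfAdjoint (S u) := fun u => hD.add (isSelfAdjoint_real_smul hK u)
  have hDS := isSelfAdjoint_toPMap hD
  have hF : ∀ u : ℝ, fermiOp β (perturb (D.toLinearMap.toPMap ⊤) ((u : ℂ) • K)) = cfc n (S u) :=
    fun u => by rw [perturb_toPMap, fermiOp_toPMap hβ (hS u)]
  have hc : Continuous fun u => cfc n (S u) := by
    simpa only [hF] using continuous_fermiOp_perturb hβ hDS hK
  have him : ∀ u, (finTrace (K * cfc n (S u))).im = 0 := fun u =>
    im_finTrace_mul hK (cfc_predicate n (S u))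
  set r : ℝ → ℝ := fun u => (finTrace (K * cfc n (S u))).re with hr
  have hrc : Continuous r := Complex.continuous_re.comp
    (finTrace.continuous.comp (continuous_const.mul hc))
  have hrK : ∀ u, finTrace (K * cfc n (S u)) = (r u : ℂ) := fun u =>
    Complex.ext rfl (by rw [him, Complex.ofReal_im])
  set G : ℝ → ℝ := fun u => (finTrace (cfc (logPartition β) (S u))).re with hG
  have hGd : ∀ u, HasDerivAt G (-β * r u) u := by
    refine hasDerivAt_of_sandwich (hrc.const_mul (-β)) fun u v => ?_
    have h := klein_inequality (hS u) (hS v) (φ := logPartition β) (φ' := fun x => -β * n x)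
      (logPartition_convex β)
    have e1 : S v - S u = ((v - u : ℝ) : ℂ) • K := by
      simp only [S]
      push_cast
      module
    rw [e1, cfc_const_mul _ _ _ ((finite_spectrum_real _).continuousOn _), map_sub, Complex.sub_re,
      smul_mul_assoc, mul_smul_comm, map_smul, smul_eq_mul, Complex.re_ofReal_mul,
      ← Complex.coe_smul, map_smul, smul_eq_mul, Complex.re_ofReal_mul] at h
    exact h
  have hint := intervalIntegral.integral_eq_sub_of_hasDerivAt (a := 0) (b := 1)
    (fun u _ => hGd u) ((hrc.const_mul (-β)).intervalIntegrable _ _)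
  rw [intervalIntegral.integral_const_mul] at hint
  have hGS : ∀ u, finTrace (cfc (logPartition β) (S u)) = (G u : ℂ) := fun u =>
    Complex.ext rfl (by rw [im_finTrace (cfc_predicate _ (S u)), Complex.ofReal_im])
  have hS0 : S 0 = D := by simp [S]
  have hS1 : S 1 = D + K := by simp [S]
  rw [entropyOp_eq hβ hDS hK, map_smul, smul_eq_mul, map_sub, map_add, map_smul, smul_eq_mul, ← hS1,
    hGS 1]
  conv_rhs => rw [← hS0, hrK 0, hGS 0]
  have h0 : fermiOp β (D.toLinearMap.toPMap ⊤) = cfc n (S 0) := by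
    rw [fermiOp_toPMap hβ hD, hS0]
  have hI : finTrace (K * ∫ u in (0 : ℝ)..1, (fermiOp β (D.toLinearMap.toPMap ⊤) -
      fermiOp β (perturb (D.toLinearMap.toPMap ⊤) ((u : ℂ) • K)))) =
      ((∫ u in (0 : ℝ)..1, (r 0 - r u) : ℝ) : ℂ) := by
    have hcont : Continuous fun u : ℝ => fermiOp β (D.toLinearMap.toPMap ⊤) -
      fermiOp β (perturb (D.toLinearMap.toPMap ⊤) ((u : ℂ) • K)) :=
      continuous_const.sub (continuous_fermiOp_perturb hβ hDS hK)
    have h1 := (finTrace ∘L ContinuousLinearMap.mul ℂ (H →L[ℂ] H) K).intervalIntegral_comp_comm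
      (hcont.intervalIntegrable (μ := volume) 0 1)
    refine h1.symm.trans ?_
    rw [← intervalIntegral.integral_ofReal]
    refine intervalIntegral.integral_congr fun u _ => ?_
    simp only [ContinuousLinearMap.comp_apply, ContinuousLinearMap.mul_apply']
    rw [hF, h0, mul_sub, map_sub, hrK, hrK, Complex.ofReal_sub]
  rw [hI, intervalIntegral.integral_sub intervalIntegrable_const (hrc.intervalIntegrable _ _),
    intervalIntegral.integral_const, sub_zero, one_smul]
  have : (β : ℂ) * ((r 0 - ∫ u in (0 : ℝ)..1, r u : ℝ) : ℂ) =
      ((β * r 0 + (-β * ∫ u in (0 : ℝ)..1, r u) : ℝ) : ℂ) := by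
    push_cast
    ring
  rw [this, hint]
  push_cast
  ring

theorem cfc_log_fermi {β : ℝ} {T A : H →L[ℂ] H} (hT : IsSelfAdjoint T)
    (hA : A = cfc (fun x : ℝ => (1 + Real.exp (-β * x))⁻¹) T) :
    CFC.log A = -cfc (logPartition β) T ∧
      CFC.log (1 - A) = -((β : ℂ) • T) - cfc (logPartition β) T ∧
      1 - A = cfc (fun x : ℝ => (1 + Real.exp (β * x))⁻¹) T := by
  have hc : ∀ f : ℝ → ℝ, ContinuousOn f (spectrum ℝ T) := fun f =>
    (finite_spectrum_real T).continuousOn f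
  have hc' : ∀ f g : ℝ → ℝ, ContinuousOn g (f '' spectrum ℝ T) := fun f g =>
    ((finite_spectrum_real T).image f).continuousOn g
  have h1 : 1 - A = cfc (fun x : ℝ => (1 + Real.exp (β * x))⁻¹) T := by
    rw [hA, ← cfc_const_one ℝ T, ← cfc_sub _ _ _ (hc _) (hc _)]
    congr 1
    funext x
    have : Real.exp (-β * x) * Real.exp (β * x) = 1 := by rw [← Real.exp_add]; simp
    have h2 : 1 + Real.exp (-β * x) ≠ 0 := by positivity
    have h3 : 1 + Real.exp (β * x) ≠ 0 := by positivity
    rw [sub_eq_iff_eq_add, inv_add_inv h3 h2, eq_div_iff (mul_ne_zero h3 h2)]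
    linear_combination this
  refine ⟨?_, ?_, h1⟩
  · rw [CFC.log, hA, ← cfc_comp' _ _ _ (hc' _ _) (hc _), ← cfc_neg]
    congr 1
    funext x
    rw [Real.log_inv, logPartition]
  · have e : (β : ℂ) • T = cfc (fun x : ℝ => β * x) T := by
      rw [cfc_const_mul _ _ _ (hc _), cfc_id' ℝ T, Complex.coe_smul]
    rw [CFC.log, h1, ← cfc_comp' _ _ _ (hc' _ _) (hc _), e, ← cfc_neg, ← cfc_sub _ _ _ (hc _) (hc _)]
    congr 1
    funext x
    have h2 : 1 + Real.exp (β * x) = Real.exp (β * x) * (1 + Real.exp (-β * x)) := by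
      rw [mul_add, ← Real.exp_add]
      simp [add_comm]
    rw [Real.log_inv, h2, Real.log_mul (by positivity) (by positivity), Real.log_exp, logPartition]
    ring

/-- The formulas for the trace of the entropy operator in finite dimension. -/
theorem trace_entropyOp_of_finiteDimensional {D K A B : H →L[ℂ] H} {β : ℝ} (hD : IsSelfAdjoint D)
    (hK : IsSelfAdjoint K) (hβ : 0 < β)
    (hA : A = cfc (fun x : ℝ => (1 + Real.exp (-β * x))⁻¹) D)
    (hB : B = cfc (fun x : ℝ => (1 + Real.exp (-β * x))⁻¹) (D + K)) :
    trace (entropyOp β (D.toLinearMap.toPMap ⊤) K) =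
      LinearMap.trace ℂ H (((β : ℂ) • (K * cfc (fun x : ℝ => (1 + Real.exp (β * x))⁻¹) D)
        + cfc (fun x : ℝ => Real.log (1 + Real.exp (-β * x))) (D + K)
        - cfc (fun x : ℝ => Real.log (1 + Real.exp (-β * x))) D : H →L[ℂ] H)).toLinearMap ∧
    trace (entropyOp β (D.toLinearMap.toPMap ⊤) K) =
      LinearMap.trace ℂ H ((A * (CFC.log A - CFC.log B)
        + (1 - A) * (CFC.log (1 - A) - CFC.log (1 - B)) : H →L[ℂ] H)).toLinearMap := by
  have h := (trace_eq_finTrace _).trans (finTrace_entropyOp hβ hD hK)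
  refine ⟨h, h.trans ?_⟩
  rw [← finTrace_apply]
  obtain ⟨a1, a2, a3⟩ := cfc_log_fermi hD hA
  obtain ⟨b1, b2, -⟩ := cfc_log_fermi (hD.add hK) hB
  -- The differences of log(1 + e^{-βx}) appear with total weight A + (1 - A) = 1, and the linear
  -- parts of log(1 - A) and log(1 - B) leave β(1 - A)K.
  have e : A * (CFC.log A - CFC.log B) + (1 - A) * (CFC.log (1 - A) - CFC.log (1 - B)) =
      (β : ℂ) • ((1 - A) * K) + cfc (logPartition β) (D + K) - cfc (logPartition β) D := by
    rw [a1, a2, b1, b2, smul_add, ← mul_smul_comm]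
    noncomm_ring
  rw [e, map_sub, map_add, map_smul, map_sub, map_add, map_smul, a3, finTrace_mul_comm]

end FiniteDimensional

end DiracEntropy

end

noncomputable section

namespace DiracEntropy

open Filter Topology

/-! ### Multiplication operators -/

theorem mulOp_ae {M : Space → Spinor →L[ℂ] Spinor} (hM : MemLp M ∞ (volume : Measure Space))
    (f : OneParticle) : mulOp M f =ᵐ[volume] fun x => M x (f x) := by
  rw [mulOp, dif_pos hM]
  have h := (ContinuousLinearMap.id ℂ (Spinor →L[ℂ] Spinor)).coeFn_holder
    (μ := (volume : Measure Space)) (r := 2) (hM.toLp M) f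
  refine EventuallyEq.trans h ?_
  filter_upwards [hM.coeFn_toLp] with x hx
  rw [hx]
  rfl

theorem memLp_top_of_norm_le {M : Space → Spinor →L[ℂ] Spinor}
    (hM : AEStronglyMeasurable M (volume : Measure Space)) {C : ℝ} (h : ∀ x, ‖M x‖ ≤ C) :
    MemLp M ∞ (volume : Measure Space) :=
  memLp_top_of_bound hM C (Eventually.of_forall h)

theorem norm_mulOp_le {M : Space → Spinor →L[ℂ] Spinor} {C : ℝ} (hC : 0 ≤ C)
    (h : ∀ x, ‖M x‖ ≤ C) : ‖mulOp M‖ ≤ C := by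
  by_cases hM : MemLp M ∞ (volume : Measure Space)
  · refine ContinuousLinearMap.opNorm_le_bound _ hC fun f => ?_
    refine Lp.norm_le_mul_norm_of_ae_le_mul ?_
    filter_upwards [mulOp_ae hM f] with x hx
    rw [hx]
    exact (M x).le_of_opNorm_le (h x) _
  · rw [mulOp, dif_neg hM, norm_zero]
    exact hC

theorem mulOp_congr {M N : Space → Spinor →L[ℂ] Spinor} (h : ∀ x, M x = N x) :
    mulOp M = mulOp N := by
  rw [funext h]

theorem mulOp_mul {M N : Space → Spinor →L[ℂ] Spinor} (hM : MemLp M ∞ (volume : Measure Space))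
    (hN : MemLp N ∞ (volume : Measure Space))
    (hMN : MemLp (fun x => M x * N x) ∞ (volume : Measure Space)) :
    mulOp (fun x => M x * N x) = mulOp M * mulOp N := by
  ext1 f
  refine Lp.ext ?_
  filter_upwards [mulOp_ae hMN f, mulOp_ae hM (mulOp N f), mulOp_ae hN f] with x h1 h2 h3
  refine h1.trans (Eq.trans ?_ h2.symm)
  rw [h3, mul_apply_eq_comp]

theorem memLp_fun_add {α E : Type*} [MeasurableSpace α] {μ : Measure α} [NormedAddCommGroup E]
    {p : ℝ≥0∞} {f g : α → E} (hf : MemLp f p μ) (hg : MemLp g p μ) :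
    MemLp (fun x => f x + g x) p μ := hf.add hg

theorem memLp_fun_sub {α E : Type*} [MeasurableSpace α] {μ : Measure α} [NormedAddCommGroup E]
    {p : ℝ≥0∞} {f g : α → E} (hf : MemLp f p μ) (hg : MemLp g p μ) :
    MemLp (fun x => f x - g x) p μ := hf.sub hg

theorem memLp_fun_smul {α E : Type*} [MeasurableSpace α] {μ : Measure α} [NormedAddCommGroup E]
    [NormedSpace ℂ E] {p : ℝ≥0∞} {f : α → E} (hf : MemLp f p μ) (c : ℂ) :
    MemLp (fun x => c • f x) p μ := hf.const_smul c

theorem mulOp_add {M N : Space → Spinor →L[ℂ] Spinor} (hM : MemLp M ∞ (volume : Measure Space))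
    (hN : MemLp N ∞ (volume : Measure Space)) :
    mulOp (fun x => M x + N x) = mulOp M + mulOp N := by
  have hMN : MemLp (fun x => M x + N x) ∞ (volume : Measure Space) := memLp_fun_add hM hN
  ext1 f
  refine Lp.ext ?_
  filter_upwards [mulOp_ae hMN f, mulOp_ae hM f, mulOp_ae hN f,
    Lp.coeFn_add (mulOp M f) (mulOp N f)] with x h1 h2 h3 h4
  rw [add_apply, h4, Pi.add_apply, h2, h3]
  exact h1

theorem mulOp_smul {M : Space → Spinor →L[ℂ] Spinor} (hM : MemLp M ∞ (volume : Measure Space))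
    (c : ℂ) : mulOp (fun x => c • M x) = c • mulOp M := by
  have hcM : MemLp (fun x => c • M x) ∞ (volume : Measure Space) := memLp_fun_smul hM c
  ext1 f
  refine Lp.ext ?_
  filter_upwards [mulOp_ae hcM f, mulOp_ae hM f,
    Lp.coeFn_smul c (mulOp M f)] with x h1 h2 h3
  rw [smul_apply, h3, Pi.smul_apply, h2]
  exact h1

theorem mulOp_sub {M N : Space → Spinor →L[ℂ] Spinor} (hM : MemLp M ∞ (volume : Measure Space))
    (hN : MemLp N ∞ (volume : Measure Space)) :
    mulOp (fun x => M x - N x) = mulOp M - mulOp N := by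
  have hMN : MemLp (fun x => M x - N x) ∞ (volume : Measure Space) := memLp_fun_sub hM hN
  ext1 f
  refine Lp.ext ?_
  filter_upwards [mulOp_ae hMN f, mulOp_ae hM f, mulOp_ae hN f,
    Lp.coeFn_sub (mulOp M f) (mulOp N f)] with x h1 h2 h3 h4
  rw [sub_apply, h4, Pi.sub_apply, h2, h3]
  exact h1

theorem mulOp_one : mulOp (fun _ => 1) = 1 := by
  ext1 f
  refine Lp.ext ?_
  filter_upwards [mulOp_ae (memLp_top_const (1 : Spinor →L[ℂ] Spinor)) f] with x h1
  rw [h1]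
  rfl

theorem star_mulOp {M : Space → Spinor →L[ℂ] Spinor} (hM : MemLp M ∞ (volume : Measure Space)) :
    star (mulOp M) = mulOp (fun x => star (M x)) := by
  have hM' : MemLp (fun x => star (M x)) ∞ (volume : Measure Space) := hM.star
  rw [ContinuousLinearMap.star_eq_adjoint]
  refine ((ContinuousLinearMap.eq_adjoint_iff _ _).2 fun f g => ?_).symm
  rw [L2.inner_def, L2.inner_def]
  refine integral_congr_ae ?_
  filter_upwards [mulOp_ae hM' f, mulOp_ae hM g] with x h1 h2
  rw [h1, h2, ContinuousLinearMap.star_eq_adjoint, ContinuousLinearMap.adjoint_inner_left]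

theorem isSelfAdjoint_mulOp {M : Space → Spinor →L[ℂ] Spinor} (h : ∀ x, IsSelfAdjoint (M x)) :
    IsSelfAdjoint (mulOp M) := by
  by_cases hM : MemLp M ∞ (volume : Measure Space)
  · rw [IsSelfAdjoint, star_mulOp hM]
    exact mulOp_congr fun x => (h x).star_eq
  · rw [mulOp, dif_neg hM]
    exact IsSelfAdjoint.zero _

/-! ### Fourier multipliers -/

/-- The Fourier transform as a unitary operator. -/
def fourierL : OneParticle ≃L[ℂ] OneParticle :=
  (Lp.fourierTransformₗᵢ Space Spinor).toContinuousLinearEquiv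

theorem fourierL_apply (f : OneParticle) : fourierL f = 𝓕 f := rfl

theorem inner_fourierL_symm (f g : OneParticle) : ⟪f, fourierL.symm g⟫_ℂ = ⟪fourierL f, g⟫_ℂ := by
  have h : ⟪fourierL f, fourierL (fourierL.symm g)⟫_ℂ = ⟪f, fourierL.symm g⟫_ℂ :=
    (Lp.fourierTransformₗᵢ Space Spinor).inner_map_map f _
  rw [← h, ContinuousLinearEquiv.apply_symm_apply]

theorem norm_fourierL (f : OneParticle) : ‖fourierL f‖ = ‖f‖ :=
  (Lp.fourierTransformₗᵢ Space Spinor).norm_map f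

theorem norm_fourierL_symm (f : OneParticle) : ‖fourierL.symm f‖ = ‖f‖ :=
  (Lp.fourierTransformₗᵢ Space Spinor).symm.norm_map f

/-- The Fourier multiplier with symbol `M`. -/
def fourierMul (M : Space → Spinor →L[ℂ] Spinor) : OneParticle →L[ℂ] OneParticle :=
  (fourierL.symm : OneParticle →L[ℂ] OneParticle) ∘L mulOp M ∘L
    (fourierL : OneParticle →L[ℂ] OneParticle)

theorem fourierMul_apply (M : Space → Spinor →L[ℂ] Spinor) (f : OneParticle) :
    fourierMul M f = fourierL.symm (mulOp M (fourierL f)) := rfl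

theorem fourierL_fourierMul (M : Space → Spinor →L[ℂ] Spinor) (f : OneParticle) :
    fourierL (fourierMul M f) = mulOp M (fourierL f) :=
  fourierL.apply_symm_apply _

theorem norm_fourierMul_le {M : Space → Spinor →L[ℂ] Spinor} {C : ℝ} (hC : 0 ≤ C)
    (h : ∀ x, ‖M x‖ ≤ C) : ‖fourierMul M‖ ≤ C := by
  refine ContinuousLinearMap.opNorm_le_bound _ hC fun f => ?_
  rw [fourierMul_apply, norm_fourierL_symm, ← norm_fourierL f]
  exact (mulOp M).le_of_opNorm_le (norm_mulOp_le hC h) _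

theorem fourierMul_mul {M N : Space → Spinor →L[ℂ] Spinor} (hM : MemLp M ∞ (volume : Measure Space))
    (hN : MemLp N ∞ (volume : Measure Space))
    (hMN : MemLp (fun x => M x * N x) ∞ (volume : Measure Space)) :
    fourierMul (fun x => M x * N x) = fourierMul M * fourierMul N := by
  ext1 f
  rw [mul_apply_eq_comp, fourierMul_apply, mulOp_mul hM hN hMN, fourierMul_apply M,
    fourierL_fourierMul]
  rfl

theorem fourierMul_sub {M N : Space → Spinor →L[ℂ] Spinor} (hM : MemLp M ∞ (volume : Measure Space))
    (hN : MemLp N ∞ (volume : Measure Space)) :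
    fourierMul (fun x => M x - N x) = fourierMul M - fourierMul N := by
  ext1 f
  simp only [fourierMul_apply, mulOp_sub hM hN, sub_apply, map_sub]

theorem fourierMul_smul {M : Space → Spinor →L[ℂ] Spinor} (hM : MemLp M ∞ (volume : Measure Space))
    (c : ℂ) : fourierMul (fun x => c • M x) = c • fourierMul M := by
  ext1 f
  simp only [fourierMul_apply, mulOp_smul hM, smul_apply, map_smul]

theorem fourierMul_one : fourierMul (fun _ => 1) = 1 := by
  ext1 f
  rw [fourierMul_apply, mulOp_one]
  exact fourierL.symm_apply_apply f

theorem star_fourierMul {M : Space → Spinor →L[ℂ] Spinor} (hM : MemLp M ∞ (volume : Measure Space)) :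
    star (fourierMul M) = fourierMul (fun x => star (M x)) := by
  rw [ContinuousLinearMap.star_eq_adjoint]
  refine ((ContinuousLinearMap.eq_adjoint_iff _ _).2 fun f g => ?_).symm
  rw [fourierMul_apply M, inner_fourierL_symm, ← ContinuousLinearMap.adjoint_inner_left,
    ← ContinuousLinearMap.star_eq_adjoint, star_mulOp hM, ← fourierL_fourierMul]
  exact ((Lp.fourierTransformₗᵢ Space Spinor).inner_map_map _ g).symm

/-! ### The symbol of the Dirac operator -/

theorem star_spinorOp (M : Matrix (Fin 4) (Fin 4) ℂ) : star (spinorOp M) = spinorOp (star M) :=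
  (map_star (Matrix.toEuclideanCLM (n := Fin 4) (𝕜 := ℂ)) M).symm

theorem spinorOp_mul (M N : Matrix (Fin 4) (Fin 4) ℂ) :
    spinorOp (M * N) = spinorOp M * spinorOp N :=
  map_mul (Matrix.toEuclideanCLM (n := Fin 4) (𝕜 := ℂ)) M N

theorem spinorOp_add (M N : Matrix (Fin 4) (Fin 4) ℂ) :
    spinorOp (M + N) = spinorOp M + spinorOp N :=
  map_add (Matrix.toEuclideanCLM (n := Fin 4) (𝕜 := ℂ)) M N

theorem spinorOp_smul (c : ℂ) (M : Matrix (Fin 4) (Fin 4) ℂ) :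
    spinorOp (c • M) = c • spinorOp M :=
  map_smul (Matrix.toEuclideanCLM (n := Fin 4) (𝕜 := ℂ)) c M

theorem spinorOp_one : spinorOp 1 = 1 := map_one (Matrix.toEuclideanCLM (n := Fin 4) (𝕜 := ℂ))

theorem continuous_spinorOp : Continuous spinorOp :=
  (Matrix.toEuclideanCLM (n := Fin 4) (𝕜 := ℂ)).toAlgEquiv.toLinearMap.continuous_of_finiteDimensional

theorem star_diracAlpha (j : Fin 3) : star (diracAlpha j) = diracAlpha j := by
  ext a b
  fin_cases j <;> fin_cases a <;> fin_cases b <;> simp [diracAlpha, Matrix.star_apply]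

theorem star_diracGamma0 : star diracGamma0 = diracGamma0 := by
  ext a b
  fin_cases a <;> fin_cases b <;> simp [diracGamma0, Matrix.star_apply]

theorem isSelfAdjoint_diracSymbol (m : ℝ) (p : Space) : IsSelfAdjoint (diracSymbol m p) := by
  rw [IsSelfAdjoint, diracSymbol, star_spinorOp]
  congr 1
  simp [star_sum, star_smul, star_diracAlpha, star_diracGamma0]

/-- The matrices α¹, α², α³, γ⁰ anticommute and square to 1, so the mixed terms cancel; here this is
checked entry by entry. -/
theorem diracSymbol_mul_self (m : ℝ) (p : Space) :
    diracSymbol m p * diracSymbol m p = ((‖p‖ ^ 2 + m ^ 2 : ℝ) : ℂ) • 1 := by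
  rw [diracSymbol, ← spinorOp_mul, ← spinorOp_one, ← spinorOp_smul]
  congr 1
  rw [EuclideanSpace.real_norm_sq_eq, Fin.sum_univ_three, Fin.sum_univ_three]
  ext a b
  rw [Matrix.mul_apply, Fin.sum_univ_four]
  fin_cases a <;> fin_cases b <;>
    simp [diracAlpha, diracGamma0, Matrix.add_apply, Matrix.smul_apply] <;> ring_nf <;>
    simp

end DiracEntropy

end

noncomputable section

set_option maxSynthPendingDepth 3

namespace DiracEntropy

open Filter Topology

/-! ### The free Dirac operator as a self-adjoint operator -/

theorem memLp_top_of_continuous {M : Space → Spinor →L[ℂ] Spinor} (hM : Continuous M) {C : ℝ}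
    (h : ∀ x, ‖M x‖ ≤ C) : MemLp M ∞ (volume : Measure Space) :=
  memLp_top_of_norm_le hM.aestronglyMeasurable h

/-- The symbol of the Dirac operator in the variable of Mathlib's Fourier transform. -/
def momSymbol (m : ℝ) (ξ : Space) : Spinor →L[ℂ] Spinor := diracSymbol m ((2 * Real.pi) • ξ)

/-- The squared energy `|p|² + m²` at `p = 2πξ`. -/
def energySq (m : ℝ) (ξ : Space) : ℝ := ‖(2 * Real.pi) • ξ‖ ^ 2 + m ^ 2

/-- The function `(1 + |p|² + m²)⁻¹` at `p = 2πξ`. -/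
def damping (m : ℝ) (ξ : Space) : ℝ := (1 + energySq m ξ)⁻¹

theorem energySq_nonneg (m : ℝ) (ξ : Space) : 0 ≤ energySq m ξ := by unfold energySq; positivity

theorem damping_pos (m : ℝ) (ξ : Space) : 0 < damping m ξ := by
  have := energySq_nonneg m ξ
  unfold damping
  positivity

theorem damping_mul (m : ℝ) (ξ : Space) : damping m ξ * (1 + energySq m ξ) = 1 :=
  inv_mul_cancel₀ (by have := energySq_nonneg m ξ; positivity)

theorem damping_le_one (m : ℝ) (ξ : Space) : damping m ξ ≤ 1 := by
  nlinarith [damping_mul m ξ, damping_pos m ξ, energySq_nonneg m ξ]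

theorem damping_mul_energySq_le (m : ℝ) (ξ : Space) : damping m ξ * energySq m ξ ≤ 1 := by
  nlinarith [damping_mul m ξ, damping_pos m ξ]

theorem continuous_energySq (m : ℝ) : Continuous (energySq m) := by
  unfold energySq
  fun_prop

theorem continuous_damping (m : ℝ) : Continuous (damping m) :=
  (continuous_const.add (continuous_energySq m)).inv₀ fun ξ => by
    have := energySq_nonneg m ξ
    exact (show (0 : ℝ) < 1 + energySq m ξ by positivity).ne'

theorem continuous_momSymbol (m : ℝ) : Continuous (momSymbol m) := by
  unfold momSymbol diracSymbol
  refine continuous_spinorOp.comp ?_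
  fun_prop

theorem isSelfAdjoint_momSymbol (m : ℝ) (ξ : Space) : IsSelfAdjoint (momSymbol m ξ) :=
  isSelfAdjoint_diracSymbol m _

theorem momSymbol_mul_self (m : ℝ) (ξ : Space) :
    momSymbol m ξ * momSymbol m ξ = ((energySq m ξ : ℝ) : ℂ) • 1 :=
  diracSymbol_mul_self m _

theorem norm_momSymbol_sq (m : ℝ) (ξ : Space) : ‖momSymbol m ξ‖ ^ 2 = energySq m ξ := by
  have h := CStarRing.norm_star_mul_self (x := momSymbol m ξ)
  rw [(isSelfAdjoint_momSymbol m ξ).star_eq, momSymbol_mul_self, norm_smul, norm_one, mul_one,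
    Complex.norm_real, Real.norm_of_nonneg (energySq_nonneg m ξ)] at h
  rw [sq, h]

theorem damping_mul_norm_le (m : ℝ) (ξ : Space) : damping m ξ * ‖momSymbol m ξ‖ ≤ 1 := by
  nlinarith [damping_mul m ξ, damping_pos m ξ, norm_momSymbol_sq m ξ, norm_nonneg (momSymbol m ξ),
    mul_nonneg (damping_pos m ξ).le (sq_nonneg (‖momSymbol m ξ‖ - 1))]

theorem mem_graph_diracOp {m : ℝ} {f g : OneParticle} :
    (f, g) ∈ (diracOp m).graph ↔ ∀ᵐ ξ, fourierL g ξ = momSymbol m ξ (fourierL f ξ) := by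
  rw [graph_diracOp]
  rfl

theorem fourierMul_mem_graph {m : ℝ} {N M : Space → Spinor →L[ℂ] Spinor}
    (hN : MemLp N ∞ (volume : Measure Space)) (hM : MemLp M ∞ (volume : Measure Space))
    (h : ∀ ξ, M ξ = momSymbol m ξ * N ξ) (v : OneParticle) :
    (fourierMul N v, fourierMul M v) ∈ (diracOp m).graph := by
  rw [mem_graph_diracOp, fourierL_fourierMul, fourierL_fourierMul]
  filter_upwards [mulOp_ae hN (fourierL v), mulOp_ae hM (fourierL v)] with ξ h1 h2
  rw [h1, h2, h, mul_apply_eq_comp]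

theorem isSymmetricGraph_diracOp (m : ℝ) : IsSymmetricGraph (diracOp m) := by
  intro x x' y y' hx hy
  rw [mem_graph_diracOp] at hx hy
  have h1 : ⟪fourierL x', fourierL y⟫_ℂ = ⟪x', y⟫_ℂ :=
    (Lp.fourierTransformₗᵢ Space Spinor).inner_map_map _ _
  have h2 : ⟪fourierL x, fourierL y'⟫_ℂ = ⟪x, y'⟫_ℂ :=
    (Lp.fourierTransformₗᵢ Space Spinor).inner_map_map _ _
  rw [← h1, ← h2, L2.inner_def, L2.inner_def]
  refine integral_congr_ae ?_
  filter_upwards [hx, hy] with ξ e1 e2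
  rw [e1, e2, ← ContinuousLinearMap.adjoint_inner_right, ← ContinuousLinearMap.star_eq_adjoint,
    (isSelfAdjoint_momSymbol m ξ).star_eq]

theorem norm_real_smul_one_le {r : ℝ} (hr : 0 ≤ r) : ‖((r : ℝ) : ℂ) • (1 : Spinor →L[ℂ] Spinor)‖ = r := by
  rw [norm_smul, norm_one, mul_one, Complex.norm_real, Real.norm_of_nonneg hr]

theorem memLp_damping (m : ℝ) : MemLp (fun ξ => ((damping m ξ : ℝ) : ℂ) • (1 : Spinor →L[ℂ] Spinor)) ∞
    (volume : Measure Space) :=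
  memLp_top_of_continuous (C := 1)
    ((Complex.continuous_ofReal.comp (continuous_damping m)).smul continuous_const) fun ξ => by
      rw [norm_real_smul_one_le (damping_pos m ξ).le]
      exact damping_le_one m ξ

theorem memLp_damping_momSymbol (m : ℝ) : MemLp (fun ξ => ((damping m ξ : ℝ) : ℂ) • momSymbol m ξ) ∞
    (volume : Measure Space) :=
  memLp_top_of_continuous (C := 1)
    ((Complex.continuous_ofReal.comp (continuous_damping m)).smul (continuous_momSymbol m)) fun ξ => by
      rw [norm_smul, Complex.norm_real, Real.norm_of_nonneg (damping_pos m ξ).le]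
      exact damping_mul_norm_le m ξ

/-- The operator `(1 + D²)⁻¹` as a Fourier multiplier. -/
def dampingOp (m : ℝ) : OneParticle →L[ℂ] OneParticle :=
  fourierMul fun ξ => ((damping m ξ : ℝ) : ℂ) • 1

/-- The operator `D (1 + D²)⁻¹` as a Fourier multiplier. -/
def dampedDirac (m : ℝ) : OneParticle →L[ℂ] OneParticle :=
  fourierMul fun ξ => ((damping m ξ : ℝ) : ℂ) • momSymbol m ξ

theorem dampingOp_mem_graph (m : ℝ) (v : OneParticle) :
    (dampingOp m v, dampedDirac m v) ∈ (diracOp m).graph :=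
  fourierMul_mem_graph (memLp_damping m) (memLp_damping_momSymbol m)
    (fun ξ => by rw [mul_smul_comm, mul_one]) v

theorem dampedDirac_mem_graph (m : ℝ) (v : OneParticle) :
    (dampedDirac m v, v - dampingOp m v) ∈ (diracOp m).graph := by
  have h1 : MemLp (fun _ : Space => (1 : Spinor →L[ℂ] Spinor)) ∞ (volume : Measure Space) :=
    memLp_top_const 1
  have h := fourierMul_mem_graph (m := m) (memLp_damping_momSymbol m)
    (memLp_fun_sub h1 (memLp_damping m)) (fun ξ => ?_) v
  · rw [fourierMul_sub h1 (memLp_damping m), fourierMul_one, sub_apply] at h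
    exact h
  · rw [mul_smul_comm, momSymbol_mul_self, smul_smul, ← Complex.ofReal_mul]
    have e : damping m ξ * energySq m ξ = 1 - damping m ξ := by
      linear_combination damping_mul m ξ
    rw [e, Complex.ofReal_sub, sub_smul, Complex.ofReal_one, one_smul]

theorem isSelfAdjoint_diracOp (m : ℝ) : IsSelfAdjoint (diracOp m) := by
  have key : ∀ c : ℂ, c * c = -1 → ∀ v : OneParticle,
      ∃ x x', (x, x') ∈ (diracOp m).graph ∧ x' + c • x = v := by
    intro c hc v
    -- The solution of (D + c)x = v is (D - c)(1 + D²)⁻¹ v, because c² = -1.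
    refine ⟨dampedDirac m v - c • dampingOp m v, v - dampingOp m v - c • dampedDirac m v, ?_, ?_⟩
    · exact Submodule.sub_mem _ (dampedDirac_mem_graph m v)
        (Submodule.smul_mem _ c (dampingOp_mem_graph m v))
    · rw [smul_sub, smul_smul, hc, neg_one_smul]
      abel
  exact isSelfAdjoint_of_surjective (isSymmetricGraph_diracOp m) (key _ Complex.I_mul_I)
    (key _ (by rw [neg_mul_neg, Complex.I_mul_I]))

/-- Here S d = e and S e = -d, so symmetry gives ‖e‖² = ⟨S d, e⟩ = ⟨d, S e⟩ = -‖d‖². It expresses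
that S² = -1 has no solution. -/
theorem IsSymmetricGraph.eq_zero_of_rotation {H : Type*} [NormedAddCommGroup H]
    [InnerProductSpace ℂ H] {S : H →ₗ.[ℂ] H} (hS : IsSymmetricGraph S) {d e : H}
    (h1 : (d, e) ∈ S.graph) (h2 : (e, -d) ∈ S.graph) : d = 0 ∧ e = 0 := by
  have h3 := hS _ _ _ _ h1 h2
  rw [inner_neg_right, inner_self_eq_norm_sq_to_K, inner_self_eq_norm_sq_to_K] at h3
  have h5 : ‖e‖ ^ 2 = -‖d‖ ^ 2 := by exact_mod_cast h3
  have h6 : ‖d‖ ^ 2 = 0 := le_antisymm (by nlinarith [sq_nonneg ‖e‖]) (sq_nonneg _)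
  rw [h6, neg_zero] at h5
  exact ⟨norm_eq_zero.1 (pow_eq_zero_iff two_ne_zero |>.1 h6),
    norm_eq_zero.1 (pow_eq_zero_iff two_ne_zero |>.1 h5)⟩

/-- Both constructions of f = (1 + D²)⁻¹ v and g = D(1 + D²)⁻¹ v solve D f = g, D g = v - f. The
difference of two solutions is rotated by D as in `eq_zero_of_rotation`, hence zero. -/
theorem fc_lorentz_diracOp (m : ℝ) : fc (diracOp m) lorentz = dampingOp m ∧
    fc (diracOp m) (fun x => x * lorentz x) = dampedDirac m := by
  have hS := hasBoundedTransform_of_isSelfAdjoint (isSelfAdjoint_diracOp m)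
  have e2 : (fun x => x * (x * lorentz x)) = fun x => 1 - lorentz x := by
    funext x
    have : (0 : ℝ) < 1 + x ^ 2 := by positivity
    unfold lorentz
    field_simp
    ring
  have hE : HasEndLimits fun x => 1 - lorentz x := (HasEndLimits.const 1).sub hasEndLimits_lorentz
  have key : ∀ v : OneParticle, fc (diracOp m) lorentz v - dampingOp m v = 0 ∧
      fc (diracOp m) (fun x => x * lorentz x) v - dampedDirac m v = 0 := by
    intro v
    have h1 := hS.fc_mem_graph hasEndLimits_lorentz hasEndLimits_mul_lorentz v
    have h2 := hS.fc_mem_graph hasEndLimits_mul_lorentz (by rw [e2]; exact hE) v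
    rw [e2, fc_sub _ (HasEndLimits.const 1) hasEndLimits_lorentz, fc_one] at h2
    refine (isSymmetricGraph_diracOp m).eq_zero_of_rotation
      (Submodule.sub_mem _ h1 (dampingOp_mem_graph m v)) ?_
    have h3 := Submodule.sub_mem _ h2 (dampedDirac_mem_graph m v)
    rw [Prod.mk_sub_mk, sub_apply, one_apply_eq_self] at h3
    convert h3 using 2
    abel
  exact ⟨ContinuousLinearMap.ext fun v => sub_eq_zero.1 (key v).1,
    ContinuousLinearMap.ext fun v => sub_eq_zero.1 (key v).2⟩

/-! ### The unitary group -/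

/-- The symbol `e^{itM}` of the unitary group. -/
def expSymbol (m t : ℝ) (ξ : Space) : Spinor →L[ℂ] Spinor :=
  NormedSpace.exp ((Complex.I * (t : ℂ)) • momSymbol m ξ)

theorem diracUnitary_eq (m t : ℝ) : diracUnitary m t = fourierMul (expSymbol m t) := rfl

theorem star_expSymbol (m t : ℝ) (ξ : Space) : star (expSymbol m t ξ) = expSymbol m (-t) ξ := by
  unfold expSymbol
  rw [NormedSpace.star_exp, star_smul, (isSelfAdjoint_momSymbol m ξ).star_eq]
  simp

theorem expSymbol_add (m s t : ℝ) (ξ : Space) :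
    expSymbol m (s + t) ξ = expSymbol m s ξ * expSymbol m t ξ := by
  unfold expSymbol
  let _ : NormedAlgebra ℚ (Spinor →L[ℂ] Spinor) := NormedAlgebra.restrictScalars ℚ ℂ _
  rw [← NormedSpace.exp_add_of_commute ((Commute.refl _).smul_left _ |>.smul_right _), ← add_smul,
    ← mul_add, Complex.ofReal_add]

theorem expSymbol_zero (m : ℝ) (ξ : Space) : expSymbol m 0 ξ = 1 := by
  unfold expSymbol
  rw [Complex.ofReal_zero, mul_zero, zero_smul, NormedSpace.exp_zero]

theorem norm_expSymbol_le (m t : ℝ) (ξ : Space) : ‖expSymbol m t ξ‖ ≤ 1 := by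
  have h := CStarRing.norm_star_mul_self (x := expSymbol m t ξ)
  rw [star_expSymbol, ← expSymbol_add, neg_add_cancel, expSymbol_zero, norm_one] at h
  nlinarith [norm_nonneg (expSymbol m t ξ)]

theorem continuous_expSymbol (m t : ℝ) : Continuous (expSymbol m t) := by
  let _ : NormedAlgebra ℚ (Spinor →L[ℂ] Spinor) := NormedAlgebra.restrictScalars ℚ ℂ _
  have h : Continuous ((Complex.I * (t : ℂ)) • momSymbol m) :=
    (continuous_momSymbol m).const_smul _
  exact NormedSpace.exp_continuous.comp h

theorem memLp_expSymbol (m t : ℝ) : MemLp (expSymbol m t) ∞ (volume : Measure Space) :=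
  memLp_top_of_continuous (continuous_expSymbol m t) (norm_expSymbol_le m t)

theorem diracUnitary_zero (m : ℝ) : diracUnitary m 0 = 1 := by
  rw [diracUnitary_eq, ← fourierMul_one, funext (expSymbol_zero m)]

theorem diracUnitary_add (m s t : ℝ) :
    diracUnitary m (s + t) = diracUnitary m s * diracUnitary m t := by
  rw [diracUnitary_eq, diracUnitary_eq, diracUnitary_eq, ← fourierMul_mul (memLp_expSymbol m s)
    (memLp_expSymbol m t), funext (expSymbol_add m s t)]
  rw [← funext (expSymbol_add m s t)]
  exact memLp_expSymbol m _

theorem star_diracUnitary (m t : ℝ) : star (diracUnitary m t) = diracUnitary m (-t) := by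
  rw [diracUnitary_eq, star_fourierMul (memLp_expSymbol m t), funext (star_expSymbol m t)]
  rfl

theorem norm_diracUnitary_le (m t : ℝ) : ‖diracUnitary m t‖ ≤ 1 :=
  norm_fourierMul_le zero_le_one (norm_expSymbol_le m t)

theorem hasDerivAt_expSymbol (m t : ℝ) (ξ : Space) :
    HasDerivAt (fun s => expSymbol m s ξ) (expSymbol m t ξ * (Complex.I • momSymbol m ξ)) t := by
  have h := hasDerivAt_exp_smul_const (𝕂 := ℝ) (Complex.I • momSymbol m ξ) t
  refine h.congr_of_eventuallyEq (Eventually.of_forall fun s => ?_) |>.congr_deriv ?_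
  · beta_reduce
    rw [expSymbol, mul_comm, mul_smul, Complex.coe_smul]
  · rw [expSymbol, mul_comm, mul_smul, Complex.coe_smul]

theorem norm_expSymbol_sub_one_le (m t : ℝ) (ξ : Space) :
    ‖expSymbol m t ξ - 1‖ ≤ ‖momSymbol m ξ‖ * |t| := by
  have h := Convex.norm_image_sub_le_of_norm_hasDerivWithin_le (s := univ) (x := 0) (y := t)
    (C := ‖momSymbol m ξ‖) (fun s _ => (hasDerivAt_expSymbol m s ξ).hasDerivWithinAt) (fun s _ => ?_)
    convex_univ (mem_univ _) (mem_univ _)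
  · rwa [expSymbol_zero, sub_zero, Real.norm_eq_abs] at h
  · refine (norm_mul_le _ _).trans ?_
    rw [norm_smul, Complex.norm_I, one_mul]
    exact mul_le_of_le_one_left (norm_nonneg _) (norm_expSymbol_le m s ξ)

theorem norm_expSymbol_sub_le (m t : ℝ) (ξ : Space) :
    ‖expSymbol m t ξ - 1 - (Complex.I * (t : ℂ)) • momSymbol m ξ‖ ≤ energySq m ξ * t ^ 2 := by
  have h := Convex.norm_image_sub_le_of_norm_hasDerivWithin_le (s := uIcc 0 t) (x := 0) (y := t)
    (f := fun s : ℝ => expSymbol m s ξ - s • (Complex.I • momSymbol m ξ))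
    (f' := fun s => expSymbol m s ξ * (Complex.I • momSymbol m ξ)
      - (1 : ℝ) • (Complex.I • momSymbol m ξ))
    (C := energySq m ξ * |t|) (fun s _ => ((hasDerivAt_expSymbol m s ξ).sub
      ((hasDerivAt_id s).smul_const (Complex.I • momSymbol m ξ))).hasDerivWithinAt)
    (fun s hs => ?_) (convex_uIcc _ _) left_mem_uIcc right_mem_uIcc
  · beta_reduce at h
    rw [expSymbol_zero, zero_smul, sub_zero, sub_zero, Real.norm_eq_abs, mul_assoc, ← sq, sq_abs] at h
    refine le_trans (le_of_eq ?_) h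
    congr 1
    rw [mul_comm, mul_smul, Complex.coe_smul]
    abel
  · have hs' : |s| ≤ |t| := by simpa using abs_sub_left_of_mem_uIcc hs
    have e : expSymbol m s ξ * (Complex.I • momSymbol m ξ) - (1 : ℝ) • (Complex.I • momSymbol m ξ)
        = (expSymbol m s ξ - 1) * (Complex.I • momSymbol m ξ) := by
      rw [sub_mul, one_mul, one_smul]
    rw [e]
    refine (norm_mul_le _ _).trans ?_
    rw [norm_smul, Complex.norm_I, one_mul, ← norm_momSymbol_sq]
    have := norm_expSymbol_sub_one_le m s ξ
    have h0 := norm_nonneg (momSymbol m ξ)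
    calc _ ≤ ‖momSymbol m ξ‖ * |s| * ‖momSymbol m ξ‖ := by gcongr
      _ ≤ ‖momSymbol m ξ‖ * |t| * ‖momSymbol m ξ‖ := by gcongr
      _ = _ := by ring

/-- The Taylor remainder of e^{itM} is at most |M|² t² for each momentum, and the weight (1 +
|M|²)⁻¹ absorbs the factor |M|². This is how D is recovered in norm from its unitary group. -/
theorem norm_diracUnitary_mul_damping_sub_le (m t : ℝ) :
    ‖diracUnitary m t * dampingOp m - dampingOp m - (Complex.I * (t : ℂ)) • dampedDirac m‖ ≤ t ^ 2 := by
  have hM := memLp_damping m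
  have hN := memLp_fun_smul (memLp_damping_momSymbol m) (Complex.I * (t : ℂ))
  have hP : MemLp (fun ξ => expSymbol m t ξ * (((damping m ξ : ℝ) : ℂ) • 1)) ∞
      (volume : Measure Space) := by
    refine memLp_top_of_continuous (C := 1) ((continuous_expSymbol m t).mul
      ((Complex.continuous_ofReal.comp (continuous_damping m)).smul continuous_const)) fun ξ => ?_
    refine (norm_mul_le _ _).trans ?_
    rw [norm_real_smul_one_le (damping_pos m ξ).le]
    exact mul_le_one₀ (norm_expSymbol_le m t ξ) (damping_pos m ξ).le (damping_le_one m ξ)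
  rw [dampedDirac, ← fourierMul_smul (memLp_damping_momSymbol m), dampingOp, diracUnitary_eq,
    ← fourierMul_mul (memLp_expSymbol m t) hM hP, ← fourierMul_sub hP hM,
    ← fourierMul_sub (memLp_fun_sub hP hM) hN]
  refine norm_fourierMul_le (sq_nonneg t) fun ξ => ?_
  have e : expSymbol m t ξ * (((damping m ξ : ℝ) : ℂ) • 1) - ((damping m ξ : ℝ) : ℂ) • 1
      - (Complex.I * (t : ℂ)) • ((damping m ξ : ℝ) : ℂ) • momSymbol m ξ
      = ((damping m ξ : ℝ) : ℂ) • (expSymbol m t ξ - 1 - (Complex.I * (t : ℂ)) • momSymbol m ξ) := by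
    rw [mul_smul_comm, mul_one, smul_sub, smul_sub, smul_comm ((damping m ξ : ℝ) : ℂ)]
  rw [e, norm_smul, Complex.norm_real, Real.norm_of_nonneg (damping_pos m ξ).le]
  have h1 := norm_expSymbol_sub_le m t ξ
  have h2 := damping_mul_energySq_le m ξ
  calc _ ≤ damping m ξ * (energySq m ξ * t ^ 2) :=
        mul_le_mul_of_nonneg_left h1 (damping_pos m ξ).le
    _ = damping m ξ * energySq m ξ * t ^ 2 := by ring
    _ ≤ 1 * t ^ 2 := by gcongr
    _ = t ^ 2 := one_mul _

theorem commute_diracUnitary_damping (m t : ℝ) :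
    diracUnitary m t * dampingOp m = dampingOp m * diracUnitary m t := by
  have hP : MemLp (fun ξ => expSymbol m t ξ * (((damping m ξ : ℝ) : ℂ) • 1)) ∞
      (volume : Measure Space) := by
    refine memLp_top_of_continuous (C := 1) ((continuous_expSymbol m t).mul
      ((Complex.continuous_ofReal.comp (continuous_damping m)).smul continuous_const)) fun ξ => ?_
    refine (norm_mul_le _ _).trans ?_
    rw [norm_real_smul_one_le (damping_pos m ξ).le]
    exact mul_le_one₀ (norm_expSymbol_le m t ξ) (damping_pos m ξ).le (damping_le_one m ξ)
  have e : (fun ξ => expSymbol m t ξ * (((damping m ξ : ℝ) : ℂ) • 1))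
      = fun ξ => (((damping m ξ : ℝ) : ℂ) • 1) * expSymbol m t ξ := by
    funext ξ
    rw [mul_smul_comm, smul_mul_assoc, one_mul, mul_one]
  rw [dampingOp, diracUnitary_eq, ← fourierMul_mul (memLp_expSymbol m t) (memLp_damping m) hP,
    ← fourierMul_mul (memLp_damping m) (memLp_expSymbol m t) (by rw [← e]; exact hP), e]

theorem isSelfAdjoint_dampingOp (m : ℝ) : IsSelfAdjoint (dampingOp m) := by
  rw [← (fc_lorentz_diracOp m).1]
  exact isSelfAdjoint_fc _ _

end DiracEntropy

end

noncomputable section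

set_option maxSynthPendingDepth 3

namespace DiracEntropy

open Filter Topology

section Evolution

variable {H : Type*} [NormedAddCommGroup H] [InnerProductSpace ℂ H] [CompleteSpace H]

/-! ### Strong derivatives of operator families -/

/-- The family `F` is strongly differentiable at `t`, with derivative `F'`. -/
def HasStrongDeriv (F : ℝ → H →L[ℂ] H) (F' : H →L[ℂ] H) (t : ℝ) : Prop :=
  ∀ v, HasDerivAt (fun s => F s v) (F' v) t

/-- The family `F` is bounded on every half-line `t ≤ T`. -/
def IsLocallyBounded (F : ℝ → H →L[ℂ] H) : Prop := ∀ T, ∃ C, ∀ t ≤ T, ‖F t‖ ≤ C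

theorem IsLocallyBounded.exists_nonneg {F : ℝ → H →L[ℂ] H} (hF : IsLocallyBounded F) (T : ℝ) :
    ∃ C, 0 ≤ C ∧ ∀ t ≤ T, ‖F t‖ ≤ C := by
  obtain ⟨C, hC⟩ := hF T
  exact ⟨C, (norm_nonneg _).trans (hC T le_rfl), hC⟩

theorem IsLocallyBounded.mul {F G : ℝ → H →L[ℂ] H} (hF : IsLocallyBounded F)
    (hG : IsLocallyBounded G) : IsLocallyBounded fun t => F t * G t := by
  intro T
  obtain ⟨C, hC, h1⟩ := hF.exists_nonneg T
  obtain ⟨C', hC', h2⟩ := hG.exists_nonneg T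
  exact ⟨C * C', fun t ht => (norm_mul_le _ _).trans
    (mul_le_mul (h1 t ht) (h2 t ht) (norm_nonneg _) hC)⟩

theorem IsLocallyBounded.add {F G : ℝ → H →L[ℂ] H} (hF : IsLocallyBounded F)
    (hG : IsLocallyBounded G) : IsLocallyBounded fun t => F t + G t := by
  intro T
  obtain ⟨C, h1⟩ := hF T
  obtain ⟨C', h2⟩ := hG T
  exact ⟨C + C', fun t ht => (norm_add_le _ _).trans (add_le_add (h1 t ht) (h2 t ht))⟩

theorem IsLocallyBounded.smul {F : ℝ → H →L[ℂ] H} (hF : IsLocallyBounded F) (c : ℂ) :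
    IsLocallyBounded fun t => c • F t := by
  intro T
  obtain ⟨C, h1⟩ := hF T
  exact ⟨‖c‖ * C, fun t ht => (norm_smul c (F t)).le.trans
    (mul_le_mul_of_nonneg_left (h1 t ht) (norm_nonneg _))⟩

theorem IsLocallyBounded.star {F : ℝ → H →L[ℂ] H} (hF : IsLocallyBounded F) :
    IsLocallyBounded fun t => star (F t) := by
  intro T
  obtain ⟨C, h1⟩ := hF T
  exact ⟨C, fun t ht => (norm_star _).le.trans (h1 t ht)⟩

theorem isLocallyBounded_of_le {F : ℝ → H →L[ℂ] H} {C : ℝ} (h : ∀ t, ‖F t‖ ≤ C) :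
    IsLocallyBounded F := fun _ => ⟨C, fun t _ => h t⟩

theorem continuous_mul_apply {F G : ℝ → H →L[ℂ] H} (hb : IsLocallyBounded F)
    (hF : ∀ v, Continuous fun t => F t v) (hG : ∀ v, Continuous fun t => G t v) (v : H) :
    Continuous fun t => (F t * G t) v := by
  rw [continuous_iff_continuousAt]
  intro t
  obtain ⟨C, hC, h1⟩ := hb.exists_nonneg (t + 1)
  have h2 : Tendsto (fun s => C * ‖G s v - G t v‖ + ‖F s (G t v) - F t (G t v)‖) (𝓝 t) (𝓝 0) := by
    have e : (0 : ℝ) = C * ‖G t v - G t v‖ + ‖F t (G t v) - F t (G t v)‖ := by simp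
    rw [e]
    exact (((hG v).sub continuous_const).norm.const_mul C |>.add
      ((hF (G t v)).sub continuous_const).norm).tendsto t
  rw [ContinuousAt, tendsto_iff_norm_sub_tendsto_zero]
  refine squeeze_zero' (Eventually.of_forall fun _ => norm_nonneg _) ?_ h2
  filter_upwards [Iio_mem_nhds (show t < t + 1 by linarith)] with s hs
  have e : (F s * G s) v - (F t * G t) v = F s (G s v - G t v) + (F s (G t v) - F t (G t v)) := by
    rw [mul_apply_eq_comp, mul_apply_eq_comp, map_sub]
    abel
  rw [e]
  refine (norm_add_le _ _).trans (add_le_add_left ?_ _)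
  exact (F s).le_of_opNorm_le (h1 s (le_of_lt hs)) _

/-- In the difference quotient F(s) acts on the moving vector (G(s)v - G(t)v)/(s - t); norm
continuity of the left factor is a convenient way to pass to the limit. -/
theorem HasStrongDeriv.mul {F G : ℝ → H →L[ℂ] H} {F' G' : H →L[ℂ] H} {t : ℝ}
    (hF : HasStrongDeriv F F' t) (hG : HasStrongDeriv G G' t) (hc : ContinuousAt F t) :
    HasStrongDeriv (fun s => F s * G s) (F' * G t + F t * G') t := by
  intro v
  have h1 := hF (G t v)
  have h2 := hG v
  rw [hasDerivAt_iff_tendsto_slope] at h1 h2 ⊢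
  have h3 : Tendsto (fun s => F s (slope (fun s => G s v) t s)) (𝓝[≠] t) (𝓝 (F t (G' v))) :=
    
    ((isBoundedBilinearMap_apply (𝕜 := ℂ) (E := H) (F := H)).continuous.tendsto (F t, G' v)).comp
      ((hc.tendsto.mono_left nhdsWithin_le_nhds).prodMk_nhds h2)
  have h4 := h1.add h3
  rw [add_apply, mul_apply_eq_comp, mul_apply_eq_comp]
  refine h4.congr fun s => ?_
  simp only [slope_def_module, mul_apply_eq_comp, (F s).map_smul_of_tower, map_sub]
  rw [← smul_add]
  congr 1
  abel

theorem HasStrongDeriv.add {F G : ℝ → H →L[ℂ] H} {F' G' : H →L[ℂ] H} {t : ℝ}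
    (hF : HasStrongDeriv F F' t) (hG : HasStrongDeriv G G' t) :
    HasStrongDeriv (fun s => F s + G s) (F' + G') t := fun v => (hF v).add (hG v)

theorem HasStrongDeriv.sub {F G : ℝ → H →L[ℂ] H} {F' G' : H →L[ℂ] H} {t : ℝ}
    (hF : HasStrongDeriv F F' t) (hG : HasStrongDeriv G G' t) :
    HasStrongDeriv (fun s => F s - G s) (F' - G') t := fun v => (hF v).sub (hG v)

theorem HasStrongDeriv.smul {F : ℝ → H →L[ℂ] H} {F' : H →L[ℂ] H} {t : ℝ}
    (hF : HasStrongDeriv F F' t) (c : ℂ) : HasStrongDeriv (fun s => c • F s) (c • F') t :=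
  fun v => (hF v).const_smul c

theorem hasStrongDeriv_const (A : H →L[ℂ] H) (t : ℝ) : HasStrongDeriv (fun _ => A) 0 t :=
  fun v => hasDerivAt_const t (A v)

theorem HasStrongDeriv.conj_shift {F : ℝ → H →L[ℂ] H} {F' : H →L[ℂ] H} {t h : ℝ} (A B : H →L[ℂ] H)
    (hF : HasStrongDeriv F F' (t - h)) :
    HasStrongDeriv (fun s => A * F (s - h) * B) (A * F' * B) t := by
  intro v
  have h1 := (hF (B v)).comp_sub_const t h
  exact (A.restrictScalars ℝ).hasFDerivAt.comp_hasDerivAt t h1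

theorem norm_sub_le_of_hasStrongDeriv {F F' : ℝ → H →L[ℂ] H} (hF : ∀ t, HasStrongDeriv F (F' t) t)
    {a b C : ℝ} (hab : a ≤ b) (hC : ∀ t ∈ Icc a b, ‖F' t‖ ≤ C) : ‖F b - F a‖ ≤ C * (b - a) := by
  have hC0 : 0 ≤ C := (norm_nonneg _).trans (hC a ⟨le_rfl, hab⟩)
  refine ContinuousLinearMap.opNorm_le_bound _ (mul_nonneg hC0 (sub_nonneg.2 hab)) fun v => ?_
  have h := norm_image_sub_le_of_norm_deriv_le_segment' (f := fun t => F t v) (C := C * ‖v‖)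
    (fun t _ => (hF t v).hasDerivWithinAt)
    (fun t ht => (F' t).le_of_opNorm_le (hC t ⟨ht.1, ht.2.le⟩) v) b ⟨hab, le_rfl⟩
  rw [sub_apply]
  linarith

theorem continuous_of_hasStrongDeriv {F F' : ℝ → H →L[ℂ] H} (hF : ∀ t, HasStrongDeriv F (F' t) t)
    (hb : IsLocallyBounded F') : Continuous F := by
  rw [continuous_iff_continuousAt]
  intro t
  obtain ⟨C, hC, h1⟩ := hb.exists_nonneg (t + 1)
  rw [ContinuousAt, tendsto_iff_norm_sub_tendsto_zero]
  have h2 : Tendsto (fun s => C * |s - t|) (𝓝 t) (𝓝 0) := by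
    have e : (0 : ℝ) = C * |t - t| := by simp
    rw [e]
    exact Continuous.tendsto (by fun_prop) t
  refine squeeze_zero' (Eventually.of_forall fun _ => norm_nonneg _) ?_ h2
  filter_upwards [Iio_mem_nhds (show t < t + 1 by linarith)] with s hs
  rcases le_total t s with hst | hst
  · rw [abs_of_nonneg (by linarith)]
    exact norm_sub_le_of_hasStrongDeriv hF hst fun r hr => h1 r (hr.2.trans hs.le)
  · rw [abs_of_nonpos (by linarith), norm_sub_rev, neg_sub]
    exact norm_sub_le_of_hasStrongDeriv hF hst fun r hr => h1 r (by linarith [hr.2])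

theorem eq_of_hasStrongDeriv_zero {F : ℝ → H →L[ℂ] H} {a b : ℝ} (hab : a ≤ b) {F' : ℝ → H →L[ℂ] H}
    (hF : ∀ t, HasStrongDeriv F (F' t) t) (h0 : ∀ t ∈ Icc a b, F' t = 0) : F b = F a := by
  have h := norm_sub_le_of_hasStrongDeriv hF hab (C := 0) fun t ht => by rw [h0 t ht, norm_zero]
  rw [zero_mul] at h
  exact sub_eq_zero.1 (norm_le_zero_iff.1 h)

/-! ### Primitives -/

theorem integrableOn_Iio_of_past {G : ℝ → H →L[ℂ] H} {a : ℝ} (hG : ∀ v, Continuous fun t => G t v)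
    (h0 : ∀ t < a, G t = 0) (t : ℝ) (v : H) : IntegrableOn (fun s => G s v) (Iio t) := by
  have h1 : IntegrableOn (fun s => G s v) (Icc a t) := (hG v).continuousOn.integrableOn_Icc
  refine h1.of_forall_sdiff_eq_zero measurableSet_Iio fun s hs => ?_
  have hs' : s < a := by
    by_contra h
    exact hs.2 ⟨not_lt.1 h, le_of_lt hs.1⟩
  rw [h0 s hs', zero_apply]

/-- The family vanishes before a, so the base point a - 1 replaces -∞, and calculus on compact
intervals applies. -/
theorem integral_Iio_eq_of_past {G : ℝ → H →L[ℂ] H} {a : ℝ}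
    (h0 : ∀ t < a, G t = 0) (t : ℝ) (v : H) :
    ∫ s in Iio t, G s v = ∫ s in (a - 1)..t, G s v := by
  rcases le_total (a - 1) t with h | h
  · rw [intervalIntegral.integral_of_le h, ← integral_Iic_eq_integral_Iio]
    refine setIntegral_eq_of_subset_of_forall_sdiff_eq_zero measurableSet_Iic Ioc_subset_Iic_self
      fun s hs => ?_
    have hs' : s < a := by
      by_contra h'
      exact hs.2 ⟨by linarith [not_lt.1 h'], hs.1⟩
    rw [h0 s hs', zero_apply]
  · rw [setIntegral_eq_zero_of_forall_eq_zero fun s hs => ?_, intervalIntegral.integral_symm,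
      intervalIntegral.integral_of_le h, setIntegral_eq_zero_of_forall_eq_zero fun s hs => ?_, neg_zero]
    · rw [h0 s (by linarith [hs.2]), zero_apply]
    · rw [h0 s (by linarith [mem_Iio.1 hs]), zero_apply]

/-- The strong primitive `∫_{s < t} G(s) ds`. -/
def strongPrimitive (G : ℝ → H →L[ℂ] H) (t : ℝ) : H →L[ℂ] H :=
  strongIntegral (volume.restrict (Iio t)) G

theorem strongPrimitive_apply {G : ℝ → H →L[ℂ] H} {a : ℝ} (hG : ∀ v, Continuous fun t => G t v)
    (h0 : ∀ t < a, G t = 0) (hb : IsLocallyBounded G) (t : ℝ) (v : H) :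
    strongPrimitive G t v = ∫ s in Iio t, G s v := by
  obtain ⟨C, hC, h1⟩ := hb.exists_nonneg (max (a - 1) t)
  have hlin : ∃ T : H →L[ℂ] H, ∀ v, T v = ∫ s in Iio t, G s v := by
    refine ⟨LinearMap.mkContinuous ⟨⟨fun v => ∫ s in Iio t, G s v, fun v w => ?_⟩, fun c v => ?_⟩
      (C * |t - (a - 1)|) fun v => ?_, fun v => rfl⟩
    · simp only [map_add]
      exact integral_add (integrableOn_Iio_of_past hG h0 t v) (integrableOn_Iio_of_past hG h0 t w)
    · simp only [map_smul, RingHom.id_apply]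
      exact integral_smul c _
    · change ‖∫ s in Iio t, G s v‖ ≤ _
      rw [integral_Iio_eq_of_past h0]
      refine (intervalIntegral.norm_integral_le_of_norm_le_const (C := C * ‖v‖)
        fun s hs => ?_).trans (le_of_eq (by ring))
      exact (G s).le_of_opNorm_le (h1 s hs.2) v
  obtain ⟨T, hT⟩ := hlin
  rw [strongPrimitive, strongIntegral_eq (T := T) fun v =>
    ⟨integrableOn_Iio_of_past hG h0 t v, hT v⟩, hT]

theorem hasStrongDeriv_strongPrimitive {G : ℝ → H →L[ℂ] H} {a : ℝ}
    (hG : ∀ v, Continuous fun t => G t v) (h0 : ∀ t < a, G t = 0) (hb : IsLocallyBounded G) (t : ℝ) :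
    HasStrongDeriv (strongPrimitive G) (G t) t := by
  intro v
  have e : (fun s => strongPrimitive G s v) = fun s => ∫ r in (a - 1)..s, G r v := by
    funext s
    rw [strongPrimitive_apply hG h0 hb, integral_Iio_eq_of_past h0]
  rw [e]
  exact ((hG v).integral_hasStrictDerivAt (a - 1) t).hasDerivAt

theorem strongPrimitive_past {G : ℝ → H →L[ℂ] H} {a : ℝ}
    (hG : ∀ v, Continuous fun t => G t v) (h0 : ∀ t < a, G t = 0) (hb : IsLocallyBounded G) {t : ℝ}
    (ht : t ≤ a) : strongPrimitive G t = 0 := by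
  ext v
  rw [strongPrimitive_apply hG h0 hb, zero_apply]
  exact setIntegral_eq_zero_of_forall_eq_zero fun s hs => by
    rw [h0 s (lt_of_lt_of_le hs ht), zero_apply]

theorem isLocallyBounded_of_hasStrongDeriv {F F' : ℝ → H →L[ℂ] H} {a : ℝ}
    (hF : ∀ t, HasStrongDeriv F (F' t) t) (h0 : ∀ t < a, F t = 0) (hb : IsLocallyBounded F') :
    IsLocallyBounded F := by
  intro T
  obtain ⟨C, hC, h1⟩ := hb.exists_nonneg T
  refine ⟨C * (|T| + |a| + 1), fun t ht => ?_⟩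
  rcases lt_or_ge t a with h | h
  · rw [h0 t h, norm_zero]
    positivity
  · have h2 := norm_sub_le_of_hasStrongDeriv hF (show a - 1 ≤ t by linarith)
      fun s hs => h1 s (hs.2.trans ht)
    rw [h0 (a - 1) (by linarith), sub_zero] at h2
    refine h2.trans (mul_le_mul_of_nonneg_left ?_ hC)
    have := neg_abs_le a
    have := le_abs_self T
    linarith

/-- The adjoint of a strong primitive is the strong primitive of the adjoint, as soon as the
latter is strongly continuous. -/
theorem HasStrongDeriv.star {F F' : ℝ → H →L[ℂ] H} {a : ℝ} (hF : ∀ t, HasStrongDeriv F (F' t) t)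
    (h0 : ∀ t < a, F t = 0) (h0' : ∀ t < a, F' t = 0) (hb : IsLocallyBounded F')
    (hc : ∀ v, Continuous fun t => star (F' t) v) (t : ℝ) :
    HasStrongDeriv (fun s => star (F s)) (star (F' t)) t := by
  have h0s : ∀ t < a, Star.star (F' t) = 0 := fun t ht => by rw [h0' t ht, star_zero]
  have hG := hasStrongDeriv_strongPrimitive hc h0s hb.star
  have key : (fun s => Star.star (F s)) = strongPrimitive fun s => Star.star (F' s) := by
    funext s
    ext v
    refine ext_inner_left ℂ fun w => ?_
    -- Matrix elements of F* and of the primitive of F'* have the same derivative and both vanish in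
    -- the past.
    have e : ∀ r, HasDerivAt (fun r => ⟪F r w, v⟫_ℂ
        - ⟪w, strongPrimitive (fun s => Star.star (F' s)) r v⟫_ℂ) 0 r := by
      intro r
      have h1 := ((hF r w).inner ℂ (hasDerivAt_const r v)).sub
        ((hasDerivAt_const r w).inner ℂ (hG r v))
      refine h1.congr_deriv ?_
      rw [inner_zero_right, inner_zero_left, ContinuousLinearMap.star_eq_adjoint,
        ContinuousLinearMap.adjoint_inner_right]
      ring
    have h1 := is_const_of_deriv_eq_zero (fun r => (e r).differentiableAt) (fun r => (e r).deriv)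
      s (a - 1)
    beta_reduce at h1
    rw [h0 (a - 1) (by linarith), strongPrimitive_past hc h0s hb.star (by linarith : a - 1 ≤ a),
      zero_apply, zero_apply, inner_zero_left, inner_zero_right, sub_zero, sub_eq_zero] at h1
    rw [ContinuousLinearMap.star_eq_adjoint, ContinuousLinearMap.adjoint_inner_right, h1]
  rw [key]
  exact hG t

/-! ### Second order expansion along a one-parameter group -/

/-- `U` is a strongly continuous one-parameter unitary group. -/
structure IsUnitaryGroup (U : ℝ → H →L[ℂ] H) : Prop where
  zero : U 0 = 1
  add : ∀ s t, U (s + t) = U s * U t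
  star : ∀ t, star (U t) = U (-t)
  norm_le : ∀ t, ‖U t‖ ≤ 1
  continuous : ∀ v, Continuous fun t => U t v

variable {U : ℝ → H →L[ℂ] H}

theorem IsUnitaryGroup.neg_mul (hU : IsUnitaryGroup U) (t : ℝ) : U (-t) * U t = 1 := by
  rw [← hU.add, neg_add_cancel, hU.zero]

theorem IsUnitaryGroup.norm_conj_le (hU : IsUnitaryGroup U) (h : ℝ) (A : H →L[ℂ] H) :
    ‖U h * A * U (-h)‖ ≤ ‖A‖ := by
  refine (norm_mul_le _ _).trans ((mul_le_of_le_one_right (norm_nonneg _) (hU.norm_le _)).trans ?_)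
  exact (norm_mul_le _ _).trans (mul_le_of_le_one_left (norm_nonneg _) (hU.norm_le _))

/-- The family `Z`, translated in time and conjugated by `U`, has the first order expansion
`U(h) Z(t-h) U(-h) = Z(t) + h Z'(t) + O(h²)`. -/
def FlowDeriv (U : ℝ → H →L[ℂ] H) (Z Z' : ℝ → H →L[ℂ] H) : Prop :=
  ∀ T, ∃ C, ∀ t ≤ T, ∀ h : ℝ, |h| ≤ 1 →
    ‖U h * Z (t - h) * U (-h) - Z t - (h : ℂ) • Z' t‖ ≤ C * h ^ 2

theorem FlowDeriv.mul (hU : IsUnitaryGroup U) {Z Z' W W' : ℝ → H →L[ℂ] H} (hZ : FlowDeriv U Z Z')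
    (hW : FlowDeriv U W W') (bZ : IsLocallyBounded Z) (bZ' : IsLocallyBounded Z')
    (bW : IsLocallyBounded W) (bW' : IsLocallyBounded W') :
    FlowDeriv U (fun t => Z t * W t) (fun t => Z' t * W t + Z t * W' t) := by
  intro T
  obtain ⟨A, hA⟩ := hZ T
  obtain ⟨B, hB⟩ := hW T
  obtain ⟨C1, hC1, c1⟩ := bZ.exists_nonneg T
  obtain ⟨C2, hC2, c2⟩ := bZ'.exists_nonneg T
  obtain ⟨C3, hC3, c3⟩ := bW.exists_nonneg (T + 1)
  obtain ⟨C4, hC4, c4⟩ := bW'.exists_nonneg T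
  refine ⟨A * C3 + (C1 + C2) * B + C2 * C4, fun t ht h hh => ?_⟩
  have hA' := hA t ht h hh
  have hB' := hB t ht h hh
  have hT : t - h ≤ T + 1 := by linarith [(abs_le.1 hh).1]
  have e : U h * (Z (t - h) * W (t - h)) * U (-h) - Z t * W t
        - (h : ℂ) • (Z' t * W t + Z t * W' t)
      = (U h * Z (t - h) * U (-h) - Z t - (h : ℂ) • Z' t) * (U h * W (t - h) * U (-h))
        + (Z t + (h : ℂ) • Z' t) * (U h * W (t - h) * U (-h) - W t - (h : ℂ) • W' t)
        + ((h : ℂ) * (h : ℂ)) • (Z' t * W' t) := by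
    have e1 : U h * (Z (t - h) * W (t - h)) * U (-h)
        = (U h * Z (t - h) * U (-h)) * (U h * W (t - h) * U (-h)) := by
      calc _ = U h * Z (t - h) * 1 * (W (t - h) * U (-h)) := by rw [mul_one]; simp only [mul_assoc]
        _ = _ := by rw [← hU.neg_mul h]; simp only [mul_assoc]
    rw [e1]
    generalize U h * Z (t - h) * U (-h) = X
    generalize U h * W (t - h) * U (-h) = Y
    simp only [sub_mul, add_mul, mul_sub, smul_mul_assoc, mul_smul_comm, smul_add, smul_smul]
    abel
  have hh0 : ‖(h : ℂ)‖ ≤ 1 := by rwa [Complex.norm_real, Real.norm_eq_abs]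
  have hhh : ‖(h : ℂ) * (h : ℂ)‖ = h ^ 2 := by
    rw [norm_mul, Complex.norm_real, Real.norm_eq_abs, abs_mul_abs_self, sq]
  have n1 : ‖U h * W (t - h) * U (-h)‖ ≤ C3 := (hU.norm_conj_le h _).trans (c3 _ hT)
  have n2 : ‖Z t + (h : ℂ) • Z' t‖ ≤ C1 + C2 := by
    refine (norm_add_le _ _).trans (add_le_add (c1 t ht) ?_)
    rw [norm_smul]
    exact (mul_le_of_le_one_left (norm_nonneg (Z' t)) hh0).trans (c2 t ht)
  have n3 : ‖Z' t * W' t‖ ≤ C2 * C4 :=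
    (norm_mul_le _ _).trans (mul_le_mul (c2 t ht) (c4 t ht) (norm_nonneg _) hC2)
  have n4 := (norm_mul_le (U h * Z (t - h) * U (-h) - Z t - (h : ℂ) • Z' t)
    (U h * W (t - h) * U (-h))).trans (mul_le_mul hA' n1 (norm_nonneg _) ((norm_nonneg _).trans hA'))
  have n5 := (norm_mul_le (Z t + (h : ℂ) • Z' t)
    (U h * W (t - h) * U (-h) - W t - (h : ℂ) • W' t)).trans
    (mul_le_mul n2 hB' (norm_nonneg _) (by positivity))
  have n6 : ‖((h : ℂ) * (h : ℂ)) • (Z' t * W' t)‖ ≤ h ^ 2 * (C2 * C4) := by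
    rw [norm_smul, hhh]
    exact mul_le_mul_of_nonneg_left n3 (sq_nonneg h)
  rw [e]
  refine (norm_add_le _ _).trans ((add_le_add ((norm_add_le _ _).trans (add_le_add n4 n5)) n6).trans
    (le_of_eq (by ring)))

theorem FlowDeriv.add {Z Z' W W' : ℝ → H →L[ℂ] H} (hZ : FlowDeriv U Z Z')
    (hW : FlowDeriv U W W') : FlowDeriv U (fun t => Z t + W t) (fun t => Z' t + W' t) := by
  intro T
  obtain ⟨A, hA⟩ := hZ T
  obtain ⟨B, hB⟩ := hW T
  refine ⟨A + B, fun t ht h hh => ?_⟩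
  have e : U h * (Z (t - h) + W (t - h)) * U (-h) - (Z t + W t) - (h : ℂ) • (Z' t + W' t)
      = (U h * Z (t - h) * U (-h) - Z t - (h : ℂ) • Z' t)
        + (U h * W (t - h) * U (-h) - W t - (h : ℂ) • W' t) := by
    rw [mul_add, add_mul, smul_add]
    abel
  rw [e, add_mul]
  exact (norm_add_le _ _).trans (add_le_add (hA t ht h hh) (hB t ht h hh))

theorem FlowDeriv.smul {Z Z' : ℝ → H →L[ℂ] H} (hZ : FlowDeriv U Z Z') (c : ℂ) :
    FlowDeriv U (fun t => c • Z t) (fun t => c • Z' t) := by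
  intro T
  obtain ⟨A, hA⟩ := hZ T
  refine ⟨‖c‖ * A, fun t ht h hh => ?_⟩
  have e : U h * (c • Z (t - h)) * U (-h) - c • Z t - (h : ℂ) • c • Z' t
      = c • (U h * Z (t - h) * U (-h) - Z t - (h : ℂ) • Z' t) := by
    rw [mul_smul_comm, smul_mul_assoc, smul_sub, smul_sub, smul_comm c (h : ℂ)]
  rw [e, norm_smul, mul_assoc ‖c‖]
  exact mul_le_mul_of_nonneg_left (hA t ht h hh) (norm_nonneg c)

theorem FlowDeriv.star (hU : IsUnitaryGroup U) {Z Z' : ℝ → H →L[ℂ] H} (hZ : FlowDeriv U Z Z') :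
    FlowDeriv U (fun t => star (Z t)) (fun t => star (Z' t)) := by
  intro T
  obtain ⟨A, hA⟩ := hZ T
  refine ⟨A, fun t ht h hh => ?_⟩
  have e : U h * Star.star (Z (t - h)) * U (-h) - Star.star (Z t) - (h : ℂ) • Star.star (Z' t)
      = Star.star (U h * Z (t - h) * U (-h) - Z t - (h : ℂ) • Z' t) := by
    rw [star_sub, star_sub, star_mul, star_mul, star_smul, hU.star, hU.star, neg_neg, mul_assoc]
    congr 2
    simp
  rw [e, norm_star]
  exact hA t ht h hh

theorem FlowDeriv.primitive {Z Z' F F' : ℝ → H →L[ℂ] H} {a : ℝ}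
    (hZ : FlowDeriv U Z Z') (hF : ∀ t, HasStrongDeriv F (Z t) t)
    (hF' : ∀ t, HasStrongDeriv F' (Z' t) t) (h0 : ∀ t < a, F t = 0) (h0' : ∀ t < a, F' t = 0) :
    FlowDeriv U F F' := by
  intro T
  obtain ⟨A, hA⟩ := hZ T
  have hA0 : 0 ≤ A := by
    have := (norm_nonneg _).trans (hA T le_rfl 1 (by simp))
    simpa using this
  refine ⟨A * (|T| + |a| + 2), fun t ht h hh => ?_⟩
  -- The remainder of the primitive is the primitive of the remainder, so a quadratic bound
  -- integrates to a quadratic bound. The shift by |h| ≤ 1 may switch it on as early as a - 1, hence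
  -- the base point a - 2.
  set R : ℝ → H →L[ℂ] H := fun t => U h * F (t - h) * U (-h) - F t - (h : ℂ) • F' t with hR
  have hd : ∀ t, HasStrongDeriv R (U h * Z (t - h) * U (-h) - Z t - (h : ℂ) • Z' t) t := fun t =>
    (((hF (t - h)).conj_shift _ _).sub (hF t)).sub ((hF' t).smul _)
  have hz : ∀ s < a - 1, R s = 0 := by
    intro s hs
    have := (abs_le.1 hh).1
    simp only [hR]
    rw [h0 _ (by linarith), h0 s (by linarith), h0' s (by linarith)]
    simp
  change ‖R t‖ ≤ _
  rcases lt_or_ge t (a - 1) with hta | hta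
  · rw [hz t hta, norm_zero]
    positivity
  · have h1 := norm_sub_le_of_hasStrongDeriv hd (show a - 2 ≤ t by linarith)
      fun s hs => hA s (hs.2.trans ht) h hh
    rw [hz (a - 2) (by linarith), sub_zero] at h1
    refine h1.trans ?_
    have := neg_abs_le a
    have := le_abs_self T
    calc A * h ^ 2 * (t - (a - 2)) ≤ A * h ^ 2 * (|T| + |a| + 2) := by
          apply mul_le_mul_of_nonneg_left _ (by positivity)
          linarith
      _ = _ := by ring

end Evolution

end DiracEntropy

end

noncomputable section

set_option maxSynthPendingDepth 3

namespace DiracEntropy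

open Filter Topology

section Evolution

variable {H : Type*} [NormedAddCommGroup H] [InnerProductSpace ℂ H] [CompleteSpace H]

/-! ### Controlled families -/

theorem hasDerivAt_toLp {n : ℕ} {f : ℝ → Fin n → H} {f' : Fin n → H} {t : ℝ}
    (h : ∀ i, HasDerivAt (fun s => f s i) (f' i) t) :
    HasDerivAt (fun s => (WithLp.toLp 2 (f s) : PiLp 2 fun _ : Fin n => H)) (WithLp.toLp 2 f') t :=
  (PiLp.continuousLinearEquiv 2 ℝ (fun _ : Fin n => H)).symm.toContinuousLinearMap.hasFDerivAt
    |>.comp_hasDerivAt t (hasDerivAt_pi.2 h)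

/-- The mean value inequality for the ℓ²-valued curve (F(t) Q vᵢ)ᵢ, with a bound that does not
depend on the orthonormal family. -/
theorem HSBound.of_hasStrongDeriv {F F' : ℝ → H →L[ℂ] H} {Q : H →L[ℂ] H} {a T C t : ℝ}
    (hF : ∀ t, HasStrongDeriv F (F' t) t) (h0 : ∀ t < a, F t = 0)
    (h : ∀ t ≤ T, HSBound (F' t * Q) C) (ht : t ≤ T) :
    HSBound (F t * Q) (C * (|T| + |a| + 1)) := by
  have hC : 0 ≤ C := (h T le_rfl).nonneg
  intro n v hv
  have hd : ∀ s, HasDerivAt (fun s => (WithLp.toLp 2 (fun i => F s (Q (v i))) :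
      PiLp 2 fun _ : Fin n => H)) (WithLp.toLp 2 fun i => F' s (Q (v i))) s :=
    fun s => hasDerivAt_toLp fun i => hF s (Q (v i))
  have hz : ∀ s < a, (WithLp.toLp 2 (fun i => F s (Q (v i))) : PiLp 2 fun _ : Fin n => H) = 0 := by
    intro s hs
    rw [h0 s hs]
    rfl
  change ‖(WithLp.toLp 2 (fun i => F t (Q (v i))) : PiLp 2 fun _ : Fin n => H)‖ ≤ _
  rcases lt_or_ge t a with hta | hta
  · rw [hz t hta, norm_zero]
    positivity
  · have h1 := norm_image_sub_le_of_norm_deriv_le_segment' (C := C) (a := a - 1) (b := t)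
      (fun s _ => (hd s).hasDerivWithinAt) (fun s hs => h s (hs.2.le.trans ht) n v hv) t
      ⟨by linarith, le_rfl⟩
    rw [hz (a - 1) (by linarith), sub_zero] at h1
    refine h1.trans (mul_le_mul_of_nonneg_left ?_ hC)
    have := neg_abs_le a
    have := le_abs_self T
    linarith

/-- A strongly continuous, locally bounded family which vanishes in the past, and which is
Hilbert-Schmidt, locally uniformly, after multiplication by `Q`. -/
structure IsControlled (a : ℝ) (Q : H →L[ℂ] H) (Z : ℝ → H →L[ℂ] H) : Prop where
  past : ∀ t < a, Z t = 0
  bound : IsLocallyBounded Z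
  continuous : ∀ v, Continuous fun t => Z t v
  hs : ∀ T, ∃ C, ∀ t ≤ T, HSBound (Z t * Q) C

/-- The families obtained from `C₀, C₁, …` by sums, products and primitives. -/
inductive DysonAlgebra (a : ℝ) (C : ℕ → ℝ → H →L[ℂ] H) : (ℝ → H →L[ℂ] H) → Prop
  | base (j : ℕ) : DysonAlgebra a C (C j)
  | mul {Z W : ℝ → H →L[ℂ] H} : DysonAlgebra a C Z → DysonAlgebra a C W →
      DysonAlgebra a C fun t => Z t * W t
  | add {Z W : ℝ → H →L[ℂ] H} : DysonAlgebra a C Z → DysonAlgebra a C W →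
      DysonAlgebra a C fun t => Z t + W t
  | smul {Z : ℝ → H →L[ℂ] H} (c : ℂ) : DysonAlgebra a C Z → DysonAlgebra a C fun t => c • Z t
  | primitive {Z F : ℝ → H →L[ℂ] H} : DysonAlgebra a C Z → (∀ t, HasStrongDeriv F (Z t) t) →
      (∀ t < a, F t = 0) → DysonAlgebra a C F

theorem DysonAlgebra.isControlled {a : ℝ} {C : ℕ → ℝ → H →L[ℂ] H} {Q : H →L[ℂ] H}
    (hC : ∀ j, IsControlled a Q (C j)) {Z : ℝ → H →L[ℂ] H} (hZ : DysonAlgebra a C Z) :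
    IsControlled a Q Z := by
  induction hZ with
  | base j => exact hC j
  | @mul Z W _ _ h1 h2 =>
    refine ⟨fun t ht => by rw [h1.past t ht, zero_mul], h1.bound.mul h2.bound,
      continuous_mul_apply h1.bound h1.continuous h2.continuous, fun T => ?_⟩
    obtain ⟨A, hA0, hA⟩ := h1.bound.exists_nonneg T
    obtain ⟨B, hB⟩ := h2.hs T
    refine ⟨A * B, fun t ht => ?_⟩
    rw [mul_assoc]
    exact ((hB t ht).comp_left (Z t)).mono
      (mul_le_mul_of_nonneg_right (hA t ht) (hB t ht).nonneg)
  | @add Z W _ _ h1 h2 =>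
    refine ⟨fun t ht => by rw [h1.past t ht, h2.past t ht, zero_add], h1.bound.add h2.bound,
      fun v => (h1.continuous v).add (h2.continuous v), fun T => ?_⟩
    obtain ⟨A, hA⟩ := h1.hs T
    obtain ⟨B, hB⟩ := h2.hs T
    refine ⟨A + B, fun t ht => ?_⟩
    rw [add_mul]
    exact (hA t ht).add (hB t ht)
  | @smul Z c _ h1 =>
    refine ⟨fun t ht => by rw [h1.past t ht, smul_zero], h1.bound.smul c,
      fun v => (h1.continuous v).const_smul c, fun T => ?_⟩
    obtain ⟨A, hA⟩ := h1.hs T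
    refine ⟨‖c‖ * A, fun t ht => ?_⟩
    rw [smul_mul_assoc]
    exact (hA t ht).smul c
  | @primitive Z F _ hF h0 h1 =>
    refine ⟨h0, isLocallyBounded_of_hasStrongDeriv hF h0 h1.bound,
      fun v => continuous_iff_continuousAt.2 fun t => (hF t v).continuousAt, fun T => ?_⟩
    obtain ⟨A, hA⟩ := h1.hs T
    exact ⟨_, fun t ht => HSBound.of_hasStrongDeriv hF h0 hA ht⟩

/-- The flow derivative obeys the Leibniz rule and commutes with primitives, so it maps the algebra
into itself once it does so on the generators. Arbitrarily many derivatives are then available. -/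
theorem DysonAlgebra.exists_flowDeriv {U : ℝ → H →L[ℂ] H} (hU : IsUnitaryGroup U) {a : ℝ}
    {C : ℕ → ℝ → H →L[ℂ] H} {Q : H →L[ℂ] H} (hC : ∀ j, IsControlled a Q (C j))
    (hC' : ∀ j, ∃ C', DysonAlgebra a C C' ∧ FlowDeriv U (C j) C') {Z : ℝ → H →L[ℂ] H}
    (hZ : DysonAlgebra a C Z) : ∃ Z', DysonAlgebra a C Z' ∧ FlowDeriv U Z Z' := by
  induction hZ with
  | base j => exact hC' j
  | @mul Z W hZ hW h1 h2 =>
    obtain ⟨Z', hZ', f1⟩ := h1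
    obtain ⟨W', hW', f2⟩ := h2
    exact ⟨_, (hZ'.mul hW).add (hZ.mul hW'), f1.mul hU f2 (hZ.isControlled hC).bound
      (hZ'.isControlled hC).bound (hW.isControlled hC).bound (hW'.isControlled hC).bound⟩
  | add _ _ h1 h2 =>
    obtain ⟨Z', hZ', f1⟩ := h1
    obtain ⟨W', hW', f2⟩ := h2
    exact ⟨_, hZ'.add hW', f1.add f2⟩
  | smul c _ h1 =>
    obtain ⟨Z', hZ', f1⟩ := h1
    exact ⟨_, hZ'.smul c, f1.smul c⟩
  | primitive _ hF h0 h1 =>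
    obtain ⟨Z', hZ', f1⟩ := h1
    have c := hZ'.isControlled hC
    have hF' := hasStrongDeriv_strongPrimitive c.continuous c.past c.bound
    have h0' : ∀ t < a, strongPrimitive Z' t = 0 := fun t ht =>
      strongPrimitive_past c.continuous c.past c.bound ht.le
    exact ⟨_, hZ'.primitive hF' h0', f1.primitive hF hF' h0 h0'⟩

/-! ### Solutions of the Dyson equation -/

/-- `V` solves `V' = i V B`, with `V = 1` in the past. -/
structure IsDyson (a : ℝ) (B V : ℝ → H →L[ℂ] H) : Prop where
  deriv : ∀ t, HasStrongDeriv V (Complex.I • (V t * B t)) t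
  past : ∀ t < a, V t = 1
  bound : IsLocallyBounded V

/-- A bounded, strongly continuous, self-adjoint family vanishing in the past. -/
structure IsDriving (a : ℝ) (B : ℝ → H →L[ℂ] H) : Prop where
  past : ∀ t < a, B t = 0
  bound : ∃ c, ∀ t, ‖B t‖ ≤ c
  continuous : ∀ v, Continuous fun t => B t v
  star : ∀ t, star (B t) = B t

variable {a : ℝ} {B V : ℝ → H →L[ℂ] H}

theorem IsDriving.isLocallyBounded (hB : IsDriving a B) : IsLocallyBounded B := by
  obtain ⟨c, hc⟩ := hB.bound
  exact isLocallyBounded_of_le hc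

theorem IsDyson.continuous (hV : IsDyson a B V) (hB : IsDriving a B) : Continuous V :=
  continuous_of_hasStrongDeriv hV.deriv ((hV.bound.mul hB.isLocallyBounded).smul _)

theorem IsDyson.star_deriv (hV : IsDyson a B V) (hB : IsDriving a B) (t : ℝ) :
    HasStrongDeriv (fun s => star (V s)) (-Complex.I • (B t * star (V t))) t := by
  have e : ∀ t, star (Complex.I • (V t * B t)) = -Complex.I • (B t * star (V t)) := fun t => by
    rw [star_smul, star_mul, hB.star]
    simp
  have hc := hV.continuous hB
  -- Subtracting 1 gives a family that vanishes in the past, as the adjoint rule requires.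
  have h := HasStrongDeriv.star (F := fun s => V s - 1) (F' := fun t => Complex.I • (V t * B t))
    (a := a) (fun t => ?_) (fun t ht => by rw [hV.past t ht, sub_self])
    (fun t ht => by rw [hB.past t ht, mul_zero, smul_zero])
    ((hV.bound.mul hB.isLocallyBounded).smul _) (fun v => ?_) t
  · rw [e] at h
    have h2 := h.add (hasStrongDeriv_const 1 t)
    simpa only [star_sub, star_one, sub_add_cancel, add_zero] using h2
  · have h1 := (hV.deriv t).sub (hasStrongDeriv_const 1 t)
    rwa [sub_zero] at h1
  · simp only [e]
    exact (continuous_mul_apply hB.isLocallyBounded hB.continuous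
      (fun v => hc.star.clm_apply continuous_const) v).const_smul _

theorem IsDyson.mul_star (hV : IsDyson a B V) (hB : IsDriving a B) (t : ℝ) :
    V t * star (V t) = 1 := by
  have hc := hV.continuous hB
  have h1 : ∀ t, HasStrongDeriv (fun s => V s * star (V s)) 0 t := by
    intro t
    have h := (hV.deriv t).mul (hV.star_deriv hB t) hc.continuousAt
    convert h using 1
    rw [smul_mul_assoc, mul_smul_comm, mul_assoc, neg_smul, add_neg_cancel]
  have h2 : V (min t (a - 1)) * star (V (min t (a - 1))) = 1 := by
    rw [hV.past _ (by have := min_le_right t (a - 1); linarith), star_one, mul_one]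
  rw [← h2]
  exact eq_of_hasStrongDeriv_zero (F := fun s => V s * star (V s)) (min_le_left t (a - 1)) h1
    fun _ _ => rfl

theorem IsDyson.norm_le (hV : IsDyson a B V) (hB : IsDriving a B) (t : ℝ) : ‖V t‖ ≤ 1 := by
  have h := CStarRing.norm_self_mul_star (x := V t)
  rw [hV.mul_star hB] at h
  have h1 : ‖(1 : H →L[ℂ] H)‖ ≤ 1 := ContinuousLinearMap.norm_id_le
  nlinarith [norm_nonneg (V t)]

/-- From V V* = 1, the operator 1 - V* V is idempotent at every time. It varies continuously in norm
and vanishes in the past, while the norm of an idempotent never equals 1/2, so it remains below 1/2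
and is therefore zero. -/
theorem IsDyson.star_mul (hV : IsDyson a B V) (hB : IsDriving a B) (t : ℝ) :
    star (V t) * V t = 1 := by
  have hc := hV.continuous hB
  set p : ℝ → H →L[ℂ] H := fun t => 1 - star (V t) * V t with hp
  have hpc : Continuous fun t => ‖p t‖ := (continuous_const.sub (hc.star.mul hc)).norm
  have hidem : ∀ t, p t * p t = p t := by
    intro t
    have e : star (V t) * V t * (star (V t) * V t) = star (V t) * V t := by
      rw [mul_assoc, ← mul_assoc (V t), hV.mul_star hB, one_mul]
    simp only [hp, sub_mul, mul_sub, one_mul, mul_one, e]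
    abel
  have hgap : ∀ t, ‖p t‖ ≠ 1 / 2 := by
    intro t ht
    have h := norm_mul_le (p t) (p t)
    rw [hidem, ht] at h
    norm_num at h
  have hsmall : ‖p t‖ < 1 / 2 := by
    by_contra h
    obtain ⟨s, hs⟩ := mem_range_of_exists_le_of_exists_ge hpc (c := 1 / 2)
      ⟨a - 1, by simp only [hp]; rw [hV.past _ (by linarith), star_one, mul_one, sub_self, norm_zero]; norm_num⟩
      ⟨t, not_lt.1 h⟩
    exact hgap s hs
  have h0 : ‖p t‖ = 0 := by
    have h := norm_mul_le (p t) (p t)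
    rw [hidem] at h
    nlinarith [norm_nonneg (p t)]
  exact (sub_eq_zero.1 (norm_eq_zero.1 h0)).symm

/-- W = V* - 1 solves W' = -i B W - i B. After multiplication by Q the inhomogeneous term is
Hilbert–Schmidt, and Grönwall's inequality for (W Q vᵢ)ᵢ gives a bound independent of the
orthonormal family. -/
theorem IsDyson.exists_hsBound (hV : IsDyson a B V) (hB : IsDriving a B) {Q : H →L[ℂ] H} {C : ℝ}
    (hQ : ∀ t, HSBound (B t * Q) C) (T : ℝ) :
    ∃ C', ∀ t ≤ T, HSBound ((star (V t) - 1) * Q) C' := by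
  obtain ⟨c, hc⟩ := hB.bound
  have hc0 : 0 ≤ c := (norm_nonneg _).trans (hc 0)
  have hC0 : 0 ≤ C := (hQ 0).nonneg
  refine ⟨gronwallBound 0 c C (|T| + |a| + 1), fun t ht n v hv => ?_⟩
  set y : ℝ → PiLp 2 fun _ : Fin n => H :=
    fun s => WithLp.toLp 2 fun i => (star (V s) - 1) (Q (v i)) with hy
  have hd : ∀ s, HasDerivAt y (WithLp.toLp 2 fun i => (-Complex.I • (B s * star (V s))) (Q (v i))) s := by
    intro s
    refine hasDerivAt_toLp fun i => ?_
    have h := ((hV.star_deriv hB s).sub (hasStrongDeriv_const 1 s)) (Q (v i))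
    rwa [sub_zero] at h
  have hz : ∀ s < a, y s = 0 := by
    intro s hs
    simp only [hy]
    rw [hV.past s hs, star_one, sub_self]
    rfl
  change ‖y t‖ ≤ _
  rcases lt_or_ge t a with hta | hta
  · rw [hz t hta, norm_zero]
    exact (gronwallBound_x0 0 c C).ge.trans (gronwallBound_mono le_rfl hC0 hc0 (by positivity))
  have hb : ∀ s, ‖(WithLp.toLp 2 (fun i => (-Complex.I • (B s * star (V s))) (Q (v i))) :
      PiLp 2 fun _ : Fin n => H)‖ ≤ c * ‖y s‖ + C := by
    intro s
    have e : (WithLp.toLp 2 (fun i => (-Complex.I • (B s * star (V s))) (Q (v i))) :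
        PiLp 2 fun _ : Fin n => H) = -Complex.I • ((WithLp.toLp 2 fun i => B s (y s i))
          + WithLp.toLp 2 fun i => (B s * Q) (v i)) := by
      ext i
      simp only [hy, smul_apply, mul_apply_eq_comp, PiLp.smul_apply, PiLp.add_apply, sub_apply,
        map_sub, one_apply_eq_self, sub_add_cancel]
    rw [e, norm_smul, norm_neg, Complex.norm_I, one_mul]
    refine (norm_add_le _ _).trans (add_le_add ?_ (hQ s n v hv))
    rw [PiLp.norm_eq_of_L2, PiLp.norm_eq_of_L2]
    refine Real.sqrt_le_iff.2 ⟨by positivity, ?_⟩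
    rw [mul_pow, Real.sq_sqrt (by positivity), Finset.mul_sum]
    refine Finset.sum_le_sum fun i _ => ?_
    rw [← mul_pow]
    exact pow_le_pow_left₀ (norm_nonneg _) ((B s).le_of_opNorm_le (hc s) _) 2
  have h := norm_le_gronwallBound_of_norm_deriv_right_le (f := y) (δ := 0) (K := c) (ε := C)
    (a := a - 1) (b := t) (fun s _ => (hd s).continuousAt.continuousWithinAt)
    (fun s _ => (hd s).hasDerivWithinAt) (by rw [hz (a - 1) (by linarith), norm_zero])
    (fun s _ => hb s) t ⟨by linarith, le_rfl⟩
  refine h.trans (gronwallBound_mono le_rfl hC0 hc0 ?_)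
  have := neg_abs_le a
  have := le_abs_self T
  linarith

/-- The first order expansion of a solution of the Dyson equation. -/
theorem IsDyson.flowDeriv {U : ℝ → H →L[ℂ] H} (hU : IsUnitaryGroup U) (hV : IsDyson a B V)
    (hB : IsDriving a B) {B' Y : ℝ → H →L[ℂ] H} (hB' : FlowDeriv U B (fun t => (-1 : ℂ) • B' t))
    {c' : ℝ} (hc' : ∀ t, ‖B' t‖ ≤ c')
    (hY : ∀ t, HasStrongDeriv Y (V t * B' t * star (V t)) t) (hY0 : ∀ t < a, Y t = 0) :
    FlowDeriv U V (fun t => (-Complex.I) • (Y t * V t)) := by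
  intro T
  obtain ⟨A, hA⟩ := hB' T
  have hA0 : 0 ≤ A := by
    have := (norm_nonneg _).trans (hA T le_rfl 1 (by simp))
    simpa using this
  have hc0 : 0 ≤ c' := (norm_nonneg _).trans (hc' 0)
  have hcV := hV.continuous hB
  set L : ℝ := |T| + |a| + 2 with hL
  have hL0 : 0 ≤ L := by positivity
  refine ⟨((A + c') * L * (A + c') + A) * L, fun t ht h hh => ?_⟩
  have hh2 := abs_le.1 hh
  have hsq : h ^ 2 ≤ |h| := by
    rw [← sq_abs]
    nlinarith [abs_nonneg h]
  set P : ℝ → H →L[ℂ] H := fun t => U h * V (t - h) * U (-h) with hP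
  set E : ℝ → H →L[ℂ] H := fun t => U h * B (t - h) * U (-h) with hE
  have hP1 : ∀ t, ‖P t‖ ≤ 1 := fun t => (hU.norm_conj_le _ _).trans (hV.norm_le hB _)
  have hV1 := hV.norm_le hB
  have hVs1 : ∀ t, ‖star (V t)‖ ≤ 1 := fun t => (norm_star _).le.trans (hV1 t)
  -- The shifted and conjugated P solves the Dyson equation driven by E, which is the equally
  -- shifted and conjugated B. So P V* - 1 has derivative i P (E - B) V*, which is O(h).
  have hPd : ∀ t, HasStrongDeriv P (Complex.I • (P t * E t)) t := by
    intro t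
    have h1 := (hV.deriv (t - h)).conj_shift (U h) (U (-h))
    convert h1 using 1
    have e1 : P t * E t = U h * (V (t - h) * B (t - h)) * U (-h) := by
      calc _ = U h * V (t - h) * (U (-h) * U h) * B (t - h) * U (-h) := by
            simp only [hP, hE, mul_assoc]
        _ = _ := by rw [hU.neg_mul]; simp only [mul_one, mul_assoc]
    rw [e1, mul_smul_comm, smul_mul_assoc]
  have hPc : Continuous P := (continuous_const.mul (hcV.comp (continuous_id.sub continuous_const))).mul
    continuous_const
  have hEB : ∀ t ≤ T, ‖E t - B t‖ ≤ (A + c') * |h| := by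
    intro t ht
    have h1 := hA t ht h hh
    have e : E t - B t = (E t - B t - (h : ℂ) • (-1 : ℂ) • B' t) + (h : ℂ) • (-1 : ℂ) • B' t := by
      abel
    rw [e, add_mul]
    refine (norm_add_le _ _).trans (add_le_add (h1.trans ?_) ?_)
    · exact mul_le_mul_of_nonneg_left hsq hA0
    · rw [norm_smul, norm_smul, Complex.norm_real, Real.norm_eq_abs, norm_neg, norm_one, one_mul,
        mul_comm]
      exact mul_le_mul_of_nonneg_right (hc' t) (abs_nonneg h)
  have hX : ∀ t, HasStrongDeriv (fun s => P s * star (V s))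
      (Complex.I • (P t * (E t - B t) * star (V t))) t := by
    intro t
    have h1 := (hPd t).mul (hV.star_deriv hB t) hPc.continuousAt
    convert h1 using 1
    rw [smul_mul_assoc, mul_smul_comm, neg_smul, ← sub_eq_add_neg, ← smul_sub, mul_sub, sub_mul,
      mul_assoc (P t) (B t)]
  have hpast : ∀ s < a - 1, P s = 1 ∧ V s = 1 := by
    intro s hs
    refine ⟨?_, hV.past s (by linarith)⟩
    simp only [hP]
    rw [hV.past _ (by linarith), mul_one, ← hU.add, add_neg_cancel, hU.zero]
  have hlen : ∀ t ≤ T, t - (a - 2) ≤ L := by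
    intro t ht
    have := neg_abs_le a
    have := le_abs_self T
    linarith
  have hPV : ∀ t ≤ T, ‖P t * star (V t) - 1‖ ≤ (A + c') * |h| * L := by
    intro t ht
    rcases lt_or_ge t (a - 1) with hta | hta
    · rw [(hpast t hta).1, (hpast t hta).2, star_one, mul_one, sub_self, norm_zero]
      positivity
    · have h1 := norm_sub_le_of_hasStrongDeriv hX (a := a - 2) (b := t) (by linarith)
        (C := (A + c') * |h|) fun s hs => ?_
      · rw [(hpast (a - 2) (by linarith)).1, (hpast (a - 2) (by linarith)).2, star_one, mul_one] at h1
        exact h1.trans (mul_le_mul_of_nonneg_left (hlen t ht) (by positivity))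
      · rw [norm_smul, Complex.norm_I, one_mul]
        refine (norm_mul_le _ _).trans ((mul_le_of_le_one_right (norm_nonneg _) (hVs1 s)).trans ?_)
        refine (norm_mul_le _ _).trans ((mul_le_of_le_one_left (norm_nonneg _) (hP1 s)).trans ?_)
        exact hEB s (hs.2.trans ht)
  have hPV' : ∀ t ≤ T, ‖P t - V t‖ ≤ (A + c') * |h| * L := by
    intro t ht
    have e : P t - V t = (P t * star (V t) - 1) * V t := by
      rw [sub_mul, mul_assoc, hV.star_mul hB, mul_one, one_mul]
    rw [e]
    exact (norm_mul_le _ _).trans ((mul_le_of_le_one_right (norm_nonneg _) (hV1 t)).trans (hPV t ht))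
  -- Adding i h Y leaves only second-order terms: (P - V)(E - B) is a product of two O(h) factors,
  -- and E - B + hB' is the Taylor remainder of the driving family.
  have hR : ∀ t, HasStrongDeriv (fun s => P s * star (V s) + (Complex.I * (h : ℂ)) • Y s)
      (Complex.I • ((P t - V t) * (E t - B t) * star (V t)
        + V t * (E t - B t - (h : ℂ) • (-1 : ℂ) • B' t) * star (V t))) t := by
    intro t
    have h1 := (hX t).add ((hY t).smul (Complex.I * (h : ℂ)))
    convert h1 using 1
    rw [mul_smul, ← smul_add]
    congr 1
    simp only [sub_mul, mul_sub, smul_mul_assoc, mul_smul_comm, neg_smul, one_smul, smul_neg, mul_neg,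
      neg_mul]
    abel
  have hfin : ‖P t * star (V t) + (Complex.I * (h : ℂ)) • Y t - 1‖
      ≤ ((A + c') * L * (A + c') + A) * L * h ^ 2 := by
    rcases lt_or_ge t (a - 1) with hta | hta
    · rw [(hpast t hta).1, (hpast t hta).2, star_one, mul_one, hY0 t (by linarith), smul_zero, add_zero,
        sub_self, norm_zero]
      positivity
    · have h1 := norm_sub_le_of_hasStrongDeriv hR (a := a - 2) (b := t) (by linarith)
        (C := ((A + c') * L * (A + c') + A) * h ^ 2) fun s hs => ?_
      · rw [(hpast (a - 2) (by linarith)).1, (hpast (a - 2) (by linarith)).2, star_one, mul_one,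
          hY0 (a - 2) (by linarith), smul_zero, add_zero] at h1
        refine (h1.trans (mul_le_mul_of_nonneg_left (hlen t ht) (by positivity))).trans
          (le_of_eq (by ring))
      · have hs' := hs.2.trans ht
        rw [norm_smul, Complex.norm_I, one_mul, add_mul]
        refine (norm_add_le _ _).trans (add_le_add ?_ ?_)
        · refine (norm_mul_le _ _).trans ((mul_le_of_le_one_right (norm_nonneg _) (hVs1 s)).trans ?_)
          refine (norm_mul_le _ _).trans ((mul_le_mul (hPV' s hs') (hEB s hs') (norm_nonneg _)
            (by positivity)).trans (le_of_eq ?_))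
          rw [← sq_abs h]
          ring
        · refine (norm_mul_le _ _).trans ((mul_le_of_le_one_right (norm_nonneg _) (hVs1 s)).trans ?_)
          refine (norm_mul_le _ _).trans ((mul_le_of_le_one_left (norm_nonneg _) (hV1 s)).trans ?_)
          exact hA s hs' h hh
  have e : P t - V t - (h : ℂ) • (-Complex.I) • (Y t * V t)
      = (P t * star (V t) + (Complex.I * (h : ℂ)) • Y t - 1) * V t := by
    rw [sub_mul, add_mul, mul_assoc (P t), hV.star_mul hB, mul_one, one_mul, smul_mul_assoc, smul_smul,
      mul_neg, neg_smul, mul_comm (h : ℂ)]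
    abel
  change ‖P t - V t - (h : ℂ) • (-Complex.I) • (Y t * V t)‖ ≤ _
  rw [e]
  exact (norm_mul_le _ _).trans ((mul_le_of_le_one_right (norm_nonneg _) (hV1 t)).trans hfin)

end Evolution

end DiracEntropy

end

noncomputable section

set_option maxSynthPendingDepth 3

namespace DiracEntropy

open Filter Topology

section Evolution

variable {H : Type*} [NormedAddCommGroup H] [InnerProductSpace ℂ H] [CompleteSpace H]

/-! ### The Dyson series -/

/-- Continuity, the factorial bound and differentiability are proved together, since each
integration uses the first two for the preceding term and produces all three for the next one. -/
theorem dysonSeries_aux {a : ℝ} {B : ℝ → H →L[ℂ] H} (hB : IsDriving a B) {c : ℝ}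
    (hc : ∀ t, ‖B t‖ ≤ c) {d : ℕ → ℝ → H →L[ℂ] H} (h0 : ∀ t, d 0 t = 1)
    (hd : ∀ n t, d (n + 1) t = Complex.I • strongPrimitive (fun s => d n s * B s) t) (n : ℕ) :
    (∀ v, Continuous fun t => d n t v) ∧
      (∀ t, ‖d n t‖ ≤ (c * max (t - a) 0) ^ n / n.factorial) ∧
      ∀ t, HasStrongDeriv (d (n + 1)) (Complex.I • (d n t * B t)) t := by
  have hc0 : 0 ≤ c := (norm_nonneg _).trans (hc 0)
  have hpast : ∀ n, ∀ t < a, d n t * B t = 0 := fun n t ht => by rw [hB.past t ht, mul_zero]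
  have hlb : ∀ n, (∀ t, ‖d n t‖ ≤ (c * max (t - a) 0) ^ n / n.factorial) → IsLocallyBounded (d n) := by
    intro n hn T
    refine ⟨(c * max (T - a) 0) ^ n / n.factorial, fun t ht => (hn t).trans ?_⟩
    gcongr
  have hderiv : ∀ n, (∀ v, Continuous fun t => d n t v) →
      (∀ t, ‖d n t‖ ≤ (c * max (t - a) 0) ^ n / n.factorial) →
      ∀ t, HasStrongDeriv (d (n + 1)) (Complex.I • (d n t * B t)) t := by
    intro n h1 h2 t
    have h3 := (hasStrongDeriv_strongPrimitive (continuous_mul_apply (hlb n h2) h1 hB.continuous)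
      (hpast n) ((hlb n h2).mul hB.isLocallyBounded) t).smul Complex.I
    rwa [← funext (hd n)] at h3
  induction n with
  | zero =>
    have h1 : ∀ v, Continuous fun t => d 0 t v := fun v => by simp only [h0]; exact continuous_const
    have h2 : ∀ t, ‖d 0 t‖ ≤ (c * max (t - a) 0) ^ 0 / (Nat.factorial 0 : ℕ) := fun t => by
      rw [h0, pow_zero, Nat.factorial_zero, Nat.cast_one, div_one]
      exact ContinuousLinearMap.norm_id_le
    exact ⟨h1, h2, hderiv 0 h1 h2⟩
  | succ n ih =>
    obtain ⟨i1, i2, i3⟩ := ih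
    have h1 : ∀ v, Continuous fun t => d (n + 1) t v := fun v =>
      continuous_iff_continuousAt.2 fun t => (i3 t v).continuousAt
    have hz : ∀ t ≤ a, d (n + 1) t = 0 := fun t ht => by
      rw [hd, strongPrimitive_past (continuous_mul_apply (hlb n i2) i1 hB.continuous) (hpast n)
        ((hlb n i2).mul hB.isLocallyBounded) ht, smul_zero]
    have h2 : ∀ t, ‖d (n + 1) t‖ ≤ (c * max (t - a) 0) ^ (n + 1) / (n + 1).factorial := by
      intro t
      rcases le_total t a with hta | hta
      · rw [hz t hta, norm_zero]
        positivity
      rw [max_eq_left (by linarith)]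
      refine ContinuousLinearMap.opNorm_le_bound _
        (by have : 0 ≤ t - a := by linarith
            positivity) fun v => ?_
      refine image_norm_le_of_norm_deriv_right_le_deriv_boundary (f := fun t => d (n + 1) t v)
        (f' := fun t => (Complex.I • (d n t * B t)) v) (a := a) (b := t)
        (B := fun x => (c * (x - a)) ^ (n + 1) / (n + 1).factorial * ‖v‖)
        (B' := fun x => (c * (x - a)) ^ n / n.factorial * (c * ‖v‖)) (h1 v).continuousOn
        (fun s _ => (i3 s v).hasDerivWithinAt) ?_ ?_ ?_ ⟨hta, le_rfl⟩
      · rw [hz a le_rfl, zero_apply, norm_zero, sub_self, mul_zero]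
        positivity
      · intro x
        have h3 := ((((hasDerivAt_id x).sub_const a).const_mul c).pow (n + 1)).div_const
          ((n + 1).factorial : ℝ) |>.mul_const ‖v‖
        refine h3.congr_deriv ?_
        rw [Nat.factorial_succ]
        push_cast
        have : (n.factorial : ℝ) ≠ 0 := by positivity
        have : (n : ℝ) + 1 ≠ 0 := by positivity
        simp only [id]
        field_simp
      · intro x hx
        rw [smul_apply, norm_smul, Complex.norm_I, one_mul, mul_apply_eq_comp]
        have h4 := i2 x
        rw [max_eq_left (by linarith [hx.1])] at h4
        exact ((d n x).le_of_opNorm_le h4 _).trans (mul_le_mul_of_nonneg_left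
          ((B x).le_of_opNorm_le (hc x) v) ((norm_nonneg _).trans h4))
    exact ⟨h1, h2, hderiv (n + 1) h1 h2⟩

theorem isDyson_tsum {a : ℝ} {B : ℝ → H →L[ℂ] H} (hB : IsDriving a B)
    {d : ℕ → ℝ → H →L[ℂ] H} (h0 : ∀ t, d 0 t = 1)
    (hd : ∀ n t, d (n + 1) t = Complex.I • strongPrimitive (fun s => d n s * B s) t) :
    IsDyson a B fun t => ∑' n, d n t := by
  obtain ⟨c, hc⟩ := hB.bound
  have hc0 : 0 ≤ c := (norm_nonneg _).trans (hc 0)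
  have aux := dysonSeries_aux hB hc h0 hd
  have hsum : ∀ t, Summable fun n => d n t := fun t =>
    Summable.of_norm_bounded (Real.summable_pow_div_factorial _) fun n => (aux n).2.1 t
  have happ : ∀ t v, (∑' n, d n t) v = ∑' n, d n t v := fun t v =>
    (ContinuousLinearMap.apply ℂ H v).map_tsum (hsum t)
  have hsumv : ∀ t v, Summable fun n => d n t v := fun t v =>
    (ContinuousLinearMap.apply ℂ H v).summable (hsum t)
  refine ⟨fun t v => ?_, fun t ht => ?_, fun T => ?_⟩
  · set L := max (t + 1 - a) 0 with hL
    have hL0 : 0 ≤ L := le_max_right _ _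
    let g' : ℕ → ℝ → H := fun n s => Nat.casesOn n 0 fun k => (Complex.I • (d k s * B s)) v
    -- The derivative of the n-th term is controlled by the term of order n - 1; for n = 0 the
    -- derivative is 0, so truncated subtraction is harmless.
    have hu : Summable fun n : ℕ => (c * L) ^ (n - 1) / (n - 1).factorial * (c * ‖v‖) :=
      (summable_nat_add_iff 1).1 ((Real.summable_pow_div_factorial (c * L)).mul_right _)
    have h1 := hasDerivAt_tsum_of_isPreconnected (g := fun n s => d n s v) (g' := g') hu
      (isOpen_Iio (a := t + 1)) isPreconnected_Iio (fun n s _ => ?_) (fun n s hs => ?_)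
      (show t ∈ Iio (t + 1) from by simp) (hsumv t v) (show t ∈ Iio (t + 1) from by simp)
    · have e : ∑' n, g' n t = (Complex.I • ((∑' n, d n t) * B t)) v := by
        have hs' : Summable fun n => g' n t := by
          refine (summable_nat_add_iff 1).1 ?_
          exact (hsumv t (B t v)).const_smul Complex.I
        rw [hs'.tsum_eq_zero_add, smul_apply, mul_apply_eq_comp, happ,
          ← (hsumv t (B t v)).tsum_const_smul]
        exact zero_add _
      rw [e] at h1
      refine h1.congr_of_eventuallyEq (Eventually.of_forall fun s => happ s v)
    · rcases n with _ | k
      · simp only [h0]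
        exact hasDerivAt_const s v
      · exact (aux k).2.2 s v
    · rcases n with _ | k
      · change ‖(0 : H)‖ ≤ _
        rw [norm_zero]
        positivity
      · change ‖(Complex.I • (d k s * B s)) v‖ ≤ _
        rw [smul_apply, norm_smul, Complex.norm_I, one_mul, mul_apply_eq_comp, Nat.add_sub_cancel]
        have h4 : ‖d k s‖ ≤ (c * L) ^ k / k.factorial := by
          refine ((aux k).2.1 s).trans ?_
          have : max (s - a) 0 ≤ L := max_le_max (by linarith [mem_Iio.1 hs]) le_rfl
          gcongr
        exact ((d k s).le_of_opNorm_le h4 _).trans (mul_le_mul_of_nonneg_left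
          ((B s).le_of_opNorm_le (hc s) v) ((norm_nonneg _).trans h4))
  · rw [tsum_eq_single 0 fun n hn => ?_, h0]
    have h4 := (aux n).2.1 t
    rw [max_eq_right (by linarith), mul_zero, zero_pow hn, zero_div] at h4
    exact norm_le_zero_iff.1 h4
  · refine ⟨Real.exp (c * max (T - a) 0), fun t ht => ?_⟩
    have h4 : HasSum (fun n : ℕ => (c * max (T - a) 0) ^ n / n.factorial)
        (Real.exp (c * max (T - a) 0)) := by
      rw [Real.exp_eq_exp_ℝ]
      exact NormedSpace.expSeries_div_hasSum_exp _
    refine tsum_of_norm_bounded h4 fun n => ((aux n).2.1 t).trans ?_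
    gcongr

/-! ### Smooth sources -/

/-- The functions `b₀, b₁, …`, each the time derivative of the preceding one, of a smooth source
which is switched on after `a` and constant after time `0`; their values are Hilbert-Schmidt after
multiplication by `Q`. -/
structure IsSource (a : ℝ) (Q : H →L[ℂ] H) (b : ℕ → ℝ → H →L[ℂ] H) : Prop where
  past : ∀ j, ∀ t < a, b j t = 0
  future : ∀ j, ∀ t > 0, b (j + 1) t = 0
  bound : ∀ j, ∃ C, ∀ t, ‖b j t‖ ≤ C
  taylor : ∀ j, ∃ C, ∀ t h : ℝ, |h| ≤ 1 → ‖b j (t - h) - b j t + (h : ℂ) • b (j + 1) t‖ ≤ C * h ^ 2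
  hs : ∀ j, ∃ C, ∀ t, HSBound (b j t * Q) C
  star : ∀ j t, star (b j t) = b j t

/-- A family in the interaction picture. -/
def interactionPicture (U : ℝ → H →L[ℂ] H) (b : ℝ → H →L[ℂ] H) (t : ℝ) : H →L[ℂ] H :=
  U t * b t * U (-t)

variable {U : ℝ → H →L[ℂ] H} {a : ℝ} {Q : H →L[ℂ] H} {b : ℕ → ℝ → H →L[ℂ] H}

theorem IsSource.continuous (hb : IsSource a Q b) (j : ℕ) : Continuous (b j) := by
  rw [continuous_iff_continuousAt]
  intro t
  obtain ⟨C, hC⟩ := hb.taylor j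
  rw [ContinuousAt, tendsto_iff_norm_sub_tendsto_zero]
  have h2 : Tendsto (fun s => C * (t - s) ^ 2 + |t - s| * ‖b (j + 1) t‖) (𝓝 t) (𝓝 0) := by
    have e : (0 : ℝ) = C * (t - t) ^ 2 + |t - t| * ‖b (j + 1) t‖ := by simp
    rw [e]
    exact Continuous.tendsto (by fun_prop) t
  refine squeeze_zero' (Eventually.of_forall fun _ => norm_nonneg _) ?_ h2
  filter_upwards [Metric.closedBall_mem_nhds t one_pos] with s hs
  rw [Metric.mem_closedBall, Real.dist_eq, abs_sub_comm] at hs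
  have h := hC t (t - s) hs
  rw [sub_sub_cancel] at h
  have e : b j s - b j t = (b j s - b j t + ((t - s : ℝ) : ℂ) • b (j + 1) t)
      - ((t - s : ℝ) : ℂ) • b (j + 1) t := by abel
  rw [e]
  refine (norm_sub_le _ _).trans (add_le_add h ?_)
  rw [norm_smul, Complex.norm_real, Real.norm_eq_abs]

theorem IsUnitaryGroup.isLocallyBounded (hU : IsUnitaryGroup U) : IsLocallyBounded U :=
  isLocallyBounded_of_le hU.norm_le

theorem IsSource.picture_continuous (hU : IsUnitaryGroup U) (hb : IsSource a Q b) (j : ℕ) (v : H) :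
    Continuous fun t => interactionPicture U (b j) t v := by
  obtain ⟨C, hC⟩ := hb.bound j
  exact continuous_mul_apply (hU.isLocallyBounded.mul (isLocallyBounded_of_le hC))
    (continuous_mul_apply hU.isLocallyBounded hU.continuous
      fun v => (hb.continuous j).clm_apply continuous_const)
    (fun v => (hU.continuous v).comp continuous_neg) v

theorem IsSource.picture_bound (hU : IsUnitaryGroup U) (hb : IsSource a Q b) (j : ℕ) :
    ∃ C, ∀ t, ‖interactionPicture U (b j) t‖ ≤ C := by
  obtain ⟨C, hC⟩ := hb.bound j
  exact ⟨C, fun t => (hU.norm_conj_le t _).trans (hC t)⟩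

theorem IsSource.isDriving (hU : IsUnitaryGroup U) (hb : IsSource a Q b) :
    IsDriving a (interactionPicture U (b 0)) where
  past t ht := by rw [interactionPicture, hb.past 0 t ht, mul_zero, zero_mul]
  bound := hb.picture_bound hU 0
  continuous := hb.picture_continuous hU 0
  star t := by
    rw [interactionPicture, star_mul, star_mul, hU.star, hU.star, neg_neg, hb.star, mul_assoc]

theorem IsSource.picture_hs (hU : IsUnitaryGroup U) (hQ : ∀ t, U t * Q = Q * U t)
    (hb : IsSource a Q b) (j : ℕ) :
    ∃ C, ∀ t, HSBound (interactionPicture U (b j) t * Q) C := by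
  obtain ⟨C, hC⟩ := hb.hs j
  refine ⟨C, fun t => ?_⟩
  have e : interactionPicture U (b j) t * Q = U t * ((b j t * Q) * U (-t)) := by
    rw [interactionPicture, mul_assoc, hQ]
    simp only [mul_assoc]
  rw [e]
  have h0 := (hC 0).nonneg
  refine (((hC t).comp_right (U (-t))).comp_left (U t)).mono ?_
  calc ‖U t‖ * (‖U (-t)‖ * C) ≤ 1 * (1 * C) := by
        gcongr
        · exact hU.norm_le _
        · exact hU.norm_le _
    _ = C := by ring

/-- Since U(h) U(t - h) = U(t), conjugation by U(h) undoes the time shift in the unitary factors and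
leaves it only in the source. Smoothness of the source in time therefore replaces any commutator of
the generator with b_j. -/
theorem IsSource.picture_flowDeriv (hU : IsUnitaryGroup U) (hb : IsSource a Q b) (j : ℕ) :
    FlowDeriv U (interactionPicture U (b j)) fun t => (-1 : ℂ) • interactionPicture U (b (j + 1)) t := by
  obtain ⟨C, hC⟩ := hb.taylor j
  refine fun T => ⟨C, fun t _ h hh => ?_⟩
  have e1 : U h * interactionPicture U (b j) (t - h) * U (-h) = U t * b j (t - h) * U (-t) := by
    have e2 : U t = U h * U (t - h) := by rw [← hU.add, add_sub_cancel]
    have e3 : U (-t) = U (-(t - h)) * U (-h) := by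
      rw [← hU.add]
      congr 1
      ring
    rw [e2, e3, interactionPicture]
    simp only [mul_assoc]
  have e : U h * interactionPicture U (b j) (t - h) * U (-h) - interactionPicture U (b j) t
        - (h : ℂ) • (-1 : ℂ) • interactionPicture U (b (j + 1)) t
      = U t * (b j (t - h) - b j t + (h : ℂ) • b (j + 1) t) * U (-t) := by
    rw [e1, interactionPicture, interactionPicture]
    simp only [mul_add, mul_sub, add_mul, sub_mul, mul_smul_comm, smul_mul_assoc, neg_smul, one_smul,
      smul_neg, sub_neg_eq_add]
  rw [e]
  exact (hU.norm_conj_le t _).trans (hC t h hh)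

/-- The building blocks `V(t) (U(t) b_{j+1}(t) U(-t)) V(t)*`. -/
def scatteredSource (U V : ℝ → H →L[ℂ] H) (b : ℕ → ℝ → H →L[ℂ] H) (j : ℕ) (t : ℝ) : H →L[ℂ] H :=
  V t * interactionPicture U (b (j + 1)) t * star (V t)

variable {V : ℝ → H →L[ℂ] H}

/-- In V B V* Q write V* Q = Q + (V* - 1) Q. The first part is Hilbert–Schmidt through B Q, the
second through the Grönwall bound. -/
theorem isControlled_scatteredSource (hU : IsUnitaryGroup U) (hQ : ∀ t, U t * Q = Q * U t)
    (hb : IsSource a Q b) (hV : IsDyson a (interactionPicture U (b 0)) V) (j : ℕ) :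
    IsControlled a Q (scatteredSource U V b j) := by
  have hB := hb.isDriving hU
  have hVc := hV.continuous hB
  obtain ⟨c, hc⟩ := hb.picture_bound hU (j + 1)
  have hc0 : 0 ≤ c := (norm_nonneg _).trans (hc 0)
  refine ⟨fun t ht => ?_, (hV.bound.mul (isLocallyBounded_of_le hc)).mul hV.bound.star,
    continuous_mul_apply (hV.bound.mul (isLocallyBounded_of_le hc))
      (continuous_mul_apply hV.bound (fun v => hVc.clm_apply continuous_const)
        (hb.picture_continuous hU (j + 1)))
      (fun v => hVc.star.clm_apply continuous_const), fun T => ?_⟩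
  · rw [scatteredSource, interactionPicture, hb.past (j + 1) t ht]
    simp
  · obtain ⟨C0, hC0⟩ := hb.picture_hs hU hQ 0
    obtain ⟨C1, hC1⟩ := hb.picture_hs hU hQ (j + 1)
    obtain ⟨C2, hC2⟩ := hV.exists_hsBound hB hC0 T
    have h1 := (hC1 0).nonneg
    have h2 := (hC2 T le_rfl).nonneg
    refine ⟨C1 + c * C2, fun t ht => ?_⟩
    have e : scatteredSource U V b j t * Q = V t * (interactionPicture U (b (j + 1)) t * Q
        + interactionPicture U (b (j + 1)) t * ((star (V t) - 1) * Q)) := by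
      rw [scatteredSource, ← mul_add, sub_mul, one_mul, add_sub_cancel]
      simp only [mul_assoc]
    rw [e]
    refine (((hC1 t).add ((hC2 t ht).comp_left _)).comp_left (V t)).mono ?_
    calc _ ≤ 1 * (C1 + c * C2) := by
          gcongr
          · exact hV.norm_le hB t
          · exact hc t
      _ = _ := one_mul _

/-- Let C_j denote the scattered sources and Y the primitive of C₀. The flow derivatives of V and V*
are -iYV and iV*Y, so the product rule gives -i(Y C_j - C_j Y) - C_{j+1}, an element of the algebra.
-/
theorem exists_flowDeriv_scatteredSource (hU : IsUnitaryGroup U) (hQ : ∀ t, U t * Q = Q * U t)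
    (hb : IsSource a Q b) (hV : IsDyson a (interactionPicture U (b 0)) V) (j : ℕ) :
    ∃ C', DysonAlgebra a (scatteredSource U V b) C' ∧ FlowDeriv U (scatteredSource U V b j) C' := by
  have hB := hb.isDriving hU
  have hC := isControlled_scatteredSource hU hQ hb hV
  set Y := strongPrimitive (scatteredSource U V b 0)
  have hY : ∀ t, HasStrongDeriv Y (scatteredSource U V b 0 t) t :=
    hasStrongDeriv_strongPrimitive (hC 0).continuous (hC 0).past (hC 0).bound
  have hY0 : ∀ t < a, Y t = 0 := fun t ht =>
    strongPrimitive_past (hC 0).continuous (hC 0).past (hC 0).bound ht.le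
  have hYb := isLocallyBounded_of_hasStrongDeriv hY hY0 (hC 0).bound
  obtain ⟨c1, hc1⟩ := hb.picture_bound hU 1
  obtain ⟨cj, hcj⟩ := hb.picture_bound hU (j + 1)
  obtain ⟨ck, hck⟩ := hb.picture_bound hU (j + 2)
  have f1 := hV.flowDeriv hU hB (hb.picture_flowDeriv hU 0) hc1 hY hY0
  have f2 := hb.picture_flowDeriv hU (j + 1)
  have b1 : IsLocallyBounded fun t => (-Complex.I) • (Y t * V t) := (hYb.mul hV.bound).smul _
  have bj := isLocallyBounded_of_le hcj
  have bk := (isLocallyBounded_of_le hck).smul (-1)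
  have f3 := (f1.mul hU f2 hV.bound b1 bj bk).mul hU (f1.star hU) (hV.bound.mul bj)
    ((b1.mul bj).add (hV.bound.mul bk)) hV.bound.star b1.star
  have hYself : ∀ t, star (Y t) = Y t := by
    have hs : ∀ t, star (scatteredSource U V b 0 t) = scatteredSource U V b 0 t := by
      intro t
      rw [scatteredSource, star_mul, star_mul, star_star, interactionPicture, star_mul, star_mul,
        hU.star, hU.star, neg_neg, hb.star]
      simp only [mul_assoc]
    have h1 := HasStrongDeriv.star hY hY0 (hC 0).past (hC 0).bound fun v => by
      simp only [hs]
      exact (hC 0).continuous v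
    intro t
    have h2 := eq_of_hasStrongDeriv_zero (F := fun s => star (Y s) - Y s)
      (F' := fun s => star (scatteredSource U V b 0 s) - scatteredSource U V b 0 s)
      (min_le_left t (a - 1)) (fun s => (h1 s).sub (hY s)) fun s _ => by rw [hs, sub_self]
    beta_reduce at h2
    have h3 : Y (min t (a - 1)) = 0 := hY0 _ (by have := min_le_right t (a - 1); linarith)
    rw [h3, star_zero, sub_zero, sub_eq_zero] at h2
    exact h2
  have dY : DysonAlgebra a (scatteredSource U V b) Y := (DysonAlgebra.base 0).primitive hY hY0
  refine ⟨_, (((dY.mul (DysonAlgebra.base j)).smul (-Complex.I)).add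
    ((DysonAlgebra.base (j + 1)).smul (-1))).add
    (((DysonAlgebra.base j).mul dY).smul Complex.I), ?_⟩
  have e : (fun t => -Complex.I • (Y t * scatteredSource U V b j t)
      + (-1 : ℂ) • scatteredSource U V b (j + 1) t + Complex.I • (scatteredSource U V b j t * Y t))
      = fun t => (-Complex.I • (Y t * V t) * interactionPicture U (b (j + 1)) t
          + V t * (-1 : ℂ) • interactionPicture U (b (j + 1 + 1)) t) * star (V t)
        + V t * interactionPicture U (b (j + 1)) t * star (-Complex.I • (Y t * V t)) := by
    funext t
    have e1 : star (-Complex.I • (Y t * V t)) = Complex.I • (star (V t) * Y t) := by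
      rw [star_smul, star_mul, hYself]
      simp
    rw [e1]
    simp only [scatteredSource, add_mul, smul_mul_assoc, mul_smul_comm, mul_assoc]
  rw [e]
  exact f3

/-- The interaction operator is smooth with respect to the unitary group, and its derivatives
are Hilbert-Schmidt after multiplication by `Q`. -/
theorem exists_smooth_sequence (hU : IsUnitaryGroup U) (hQ : ∀ t, U t * Q = Q * U t)
    (hb : IsSource a Q b) (hV : IsDyson a (interactionPicture U (b 0)) V) :
    ∃ K : ℕ → H →L[ℂ] H,
      K 0 = strongIntegral (volume.restrict (Ioo a 0)) (scatteredSource U V b 0) ∧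
      ∀ n, (∃ C, HSBound (K n * Q) C) ∧ ∃ C, ∀ h : ℝ, |h| ≤ 1 →
        ‖U h * K n * U (-h) - K n - (h : ℂ) • K (n + 1)‖ ≤ C * h ^ 2 := by
  have hC := isControlled_scatteredSource hU hQ hb hV
  have hC' := exists_flowDeriv_scatteredSource hU hQ hb hV
  set Y := strongPrimitive (scatteredSource U V b 0)
  have hY : ∀ t, HasStrongDeriv Y (scatteredSource U V b 0 t) t :=
    hasStrongDeriv_strongPrimitive (hC 0).continuous (hC 0).past (hC 0).bound
  have hY0 : ∀ t < a, Y t = 0 := fun t ht =>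
    strongPrimitive_past (hC 0).continuous (hC 0).past (hC 0).bound ht.le
  have dY : DysonAlgebra a (scatteredSource U V b) Y := (DysonAlgebra.base 0).primitive hY hY0
  choose next hnext1 hnext2 using fun Z : {Z // DysonAlgebra a (scatteredSource U V b) Z} =>
    Z.2.exists_flowDeriv hU hC hC'
  let Z : ℕ → {Z // DysonAlgebra a (scatteredSource U V b) Z} := fun n =>
    Nat.rec ⟨Y, dY⟩ (fun _ z => ⟨next z, hnext1 z⟩) n
  have hZ0 : (Z 0).1 = Y := rfl
  have hZ : ∀ n, FlowDeriv U (Z n).1 (Z (n + 1)).1 := fun n => hnext2 (Z n)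
  have hfut : ∀ t > 0, scatteredSource U V b 0 t = 0 := fun t ht => by
    rw [scatteredSource, interactionPicture, hb.future 0 t ht]
    simp
  -- Constancy at positive times passes to the flow derivative: for small h > 0 the expansions at s
  -- and at t involve the same operators, so the two derivatives differ by O(h).
  have hconst : ∀ n, ∀ s > 0, ∀ t > 0, (Z n).1 s = (Z n).1 t := by
    intro n
    induction n with
    | zero =>
      have key : ∀ s t, 0 < s → s ≤ t → Y s = Y t := fun s t hs hst =>
        (eq_of_hasStrongDeriv_zero hst hY fun r hr => hfut r (lt_of_lt_of_le hs hr.1)).symm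
      intro s hs t ht
      rw [hZ0]
      rcases le_total s t with h | h
      · exact key s t hs h
      · exact (key t s ht h).symm
    | succ n ih =>
      intro s hs t ht
      obtain ⟨C, hCn⟩ := hZ n (max s t)
      have key : ∀ h : ℝ, 0 < h → h < min 1 (min s t) →
          ‖(Z (n + 1)).1 s - (Z (n + 1)).1 t‖ ≤ 2 * C * h := by
        intro h h0 h1
        have hh : |h| ≤ 1 := by
          rw [abs_of_pos h0]
          exact h1.le.trans (min_le_left _ _)
        have hs' : 0 < s - h := by
          have := h1.trans_le ((min_le_right _ _).trans (min_le_left _ _))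
          linarith
        have ht' : 0 < t - h := by
          have := h1.trans_le ((min_le_right _ _).trans (min_le_right _ _))
          linarith
        have e1 := hCn s (le_max_left _ _) h hh
        have e2 := hCn t (le_max_right _ _) h hh
        rw [ih (s - h) hs' (t - h) ht', ih s hs t ht] at e1
        have e3 : (h : ℂ) • ((Z (n + 1)).1 s - (Z (n + 1)).1 t)
            = (U h * (Z n).1 (t - h) * U (-h) - (Z n).1 t - (h : ℂ) • (Z (n + 1)).1 t)
              - (U h * (Z n).1 (t - h) * U (-h) - (Z n).1 t - (h : ℂ) • (Z (n + 1)).1 s) := by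
          rw [smul_sub]
          abel
        have e4 : h * ‖(Z (n + 1)).1 s - (Z (n + 1)).1 t‖ ≤ C * h ^ 2 + C * h ^ 2 := by
          rw [← Real.norm_of_nonneg h0.le, ← Complex.norm_real, ← norm_smul, e3, Complex.norm_real,
            Real.norm_of_nonneg h0.le]
          exact (norm_sub_le _ _).trans (add_le_add e2 e1)
        refine le_of_mul_le_mul_left (e4.trans (le_of_eq (by ring))) h0
      have hm : 0 < min 1 (min s t) := lt_min one_pos (lt_min hs ht)
      have h2 : Tendsto (fun h : ℝ => 2 * C * h) (𝓝[>] 0) (𝓝 0) := by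
        have : Tendsto (fun h : ℝ => 2 * C * h) (𝓝 0) (𝓝 (2 * C * 0)) :=
          Continuous.tendsto (by fun_prop) 0
        rw [mul_zero] at this
        exact this.mono_left nhdsWithin_le_nhds
      have h3 : ‖(Z (n + 1)).1 s - (Z (n + 1)).1 t‖ ≤ 0 := by
        refine ge_of_tendsto h2 ?_
        filter_upwards [Ioo_mem_nhdsGT hm] with h hh
        exact key h hh.1 hh.2
      exact sub_eq_zero.1 (norm_le_zero_iff.1 h3)
  -- At time 2 the shifted time 2 - h stays positive for |h| ≤ 1, where every family is constant.
  -- The shift drops out and the flow expansion becomes an expansion of U(h) K_n U(-h).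
  refine ⟨fun n => (Z n).1 2, ?_, fun n => ⟨?_, ?_⟩⟩
  · change Y 2 = _
    symm
    have hzero : ∀ v, ∀ s ∈ Iio (2 : ℝ) \ Ioo a 0, scatteredSource U V b 0 s v = 0 := by
      intro v s hs
      have hc := (hC 0).continuous v
      rcases le_or_gt s a with h | h
      · have : closure (Iio a) ⊆ {s | scatteredSource U V b 0 s v = 0} :=
          (isClosed_eq hc continuous_const).closure_subset_iff.2 fun r hr => by
            change scatteredSource U V b 0 r v = 0
            rw [(hC 0).past r hr, zero_apply]
        rw [closure_Iio] at this
        exact this h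
      · have h' : 0 ≤ s := by
          by_contra h''
          exact hs.2 ⟨h, not_le.1 h''⟩
        have : closure (Ioi (0 : ℝ)) ⊆ {s | scatteredSource U V b 0 s v = 0} :=
          (isClosed_eq hc continuous_const).closure_subset_iff.2 fun r hr => by
            change scatteredSource U V b 0 r v = 0
            rw [hfut r hr, zero_apply]
        rw [closure_Ioi] at this
        exact this h'
    have hsub : Ioo a 0 ⊆ Iio (2 : ℝ) := fun s hs => by
      have := hs.2
      simp only [mem_Iio]
      linarith
    refine strongIntegral_eq fun v => ⟨?_, ?_⟩
    · exact (integrableOn_Iio_of_past (hC 0).continuous (hC 0).past 2 v).mono_set hsub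
    · rw [strongPrimitive_apply (hC 0).continuous (hC 0).past (hC 0).bound]
      exact setIntegral_eq_of_subset_of_forall_sdiff_eq_zero measurableSet_Iio hsub (hzero v)
  · obtain ⟨C, h⟩ := ((Z n).2.isControlled hC).hs 2
    exact ⟨C, h 2 le_rfl⟩
  · obtain ⟨C, h⟩ := hZ n 2
    refine ⟨C, fun r hr => ?_⟩
    have h1 := h 2 le_rfl r hr
    rwa [hconst n (2 - r) (by have := (abs_le.1 hr).2; linarith) 2 two_pos] at h1

end Evolution

end DiracEntropy

end

noncomputable section

set_option maxSynthPendingDepth 3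

namespace DiracEntropy

open Filter Topology

/-! ### The inverse Fourier transform on `L¹ ∩ L²` -/

/-- Both functions have the same integrals against smooth compactly supported test functions: one by
the duality that defines the Fourier transform of tempered distributions, the other by Fubini. It
makes point values of (1 + D²)⁻¹ v accessible. -/
theorem fourierL_symm_ae {w : OneParticle} (hw : Integrable w (volume : Measure Space)) :
    (fourierL.symm w : OneParticle) =ᵐ[volume] 𝓕⁻ (w : Space → Spinor) := by
  have hL : Continuous fun p : Space × Space => (-innerₗ Space) p.1 p.2 :=
    (continuous_fst.inner continuous_snd).neg
  have hc : Continuous (𝓕⁻ (w : Space → Spinor)) :=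
    VectorFourier.fourierIntegral_continuous Real.continuous_fourierChar hL hw
  refine ae_eq_of_integral_contDiff_smul_eq
    ((Lp.memLp _).locallyIntegrable one_le_two) hc.locallyIntegrable fun g hg hgc => ?_
  have hgc' : HasCompactSupport fun x => (g x : ℂ) := hgc.comp_left Complex.ofReal_zero
  set φ : SchwartzMap Space ℂ := hgc'.toSchwartzMap (Complex.ofRealCLM.contDiff.comp hg) with hφ
  have hφg : ∀ x, φ x = (g x : ℂ) := fun x => rfl
  have h1 : (𝓕⁻ (Lp.toTemperedDistribution w) : TemperedDistribution Space Spinor) φ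
      = Lp.toTemperedDistribution (𝓕⁻ w : OneParticle) φ := by
    rw [Lp.fourierInv_toTemperedDistribution_eq]
  rw [TemperedDistribution.fourierInv_apply, Lp.toTemperedDistribution_apply,
    Lp.toTemperedDistribution_apply] at h1
  have h2 := VectorFourier.integral_fourierIntegral_smul_eq_flip (μ := (volume : Measure Space))
    (ν := (volume : Measure Space)) (L := -innerₗ Space) (f := φ) (g := w)
    Real.continuous_fourierChar hL φ.integrable hw
  have h3 : (-innerₗ Space).flip = -innerₗ Space := by
    ext x y
    simp [real_inner_comm]
  rw [h3] at h2
  have e1 : ∀ x, g x • (fourierL.symm w : OneParticle) x = φ x • (𝓕⁻ w : OneParticle) x := fun x => by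
    rw [hφg, Complex.coe_smul]
    rfl
  have e2 : ∀ x, g x • 𝓕⁻ (w : Space → Spinor) x = φ x • 𝓕⁻ (w : Space → Spinor) x := fun x => by
    rw [hφg, Complex.coe_smul]
  simp only [e1, e2]
  rw [← h1, SchwartzMap.fourierInv_coe]
  exact h2

/-! ### Pointwise Bessel inequality for `(1 + D²)⁻¹` -/

theorem damping_le (m : ℝ) (ξ : Space) : damping m ξ ≤ (1 + ‖ξ‖ ^ 2)⁻¹ := by
  unfold damping energySq
  refine inv_anti₀ (by positivity) ?_
  rw [norm_smul, mul_pow, Real.norm_of_nonneg (by positivity)]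
  have h1 : 1 ≤ (2 * Real.pi) ^ 2 := by nlinarith [Real.pi_gt_three]
  nlinarith [sq_nonneg m, sq_nonneg ‖ξ‖]

/-- The square decays like |ξ|⁻⁴ in three dimensions, and 4 > 3. The dimension of space enters here.
-/
theorem integrable_damping_sq (m : ℝ) : Integrable (fun ξ => damping m ξ ^ 2) (volume : Measure Space) := by
  have h := integrable_rpow_neg_one_add_norm_sq (E := Space) (μ := volume) (r := 4)
    (by rw [finrank_euclideanSpace_fin]; norm_num)
  refine h.mono' ((continuous_damping m).pow 2).aestronglyMeasurable (Eventually.of_forall fun ξ => ?_)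
  rw [Real.norm_of_nonneg (sq_nonneg _)]
  have e : ((1 : ℝ) + ‖ξ‖ ^ 2) ^ (-4 / 2 : ℝ) = ((1 + ‖ξ‖ ^ 2)⁻¹) ^ 2 := by
    rw [show (-4 / 2 : ℝ) = -((2 : ℕ) : ℝ) by norm_num, Real.rpow_neg (by positivity), Real.rpow_natCast,
      inv_pow]
  rw [e]
  exact pow_le_pow_left₀ (damping_pos m ξ).le (damping_le m ξ) 2

theorem norm_sq_eq_integral (f : OneParticle) : ‖f‖ ^ 2 = ∫ x, ‖f x‖ ^ 2 := by
  have h : ((‖f‖ ^ 2 : ℝ) : ℂ) = ((∫ x, ‖f x‖ ^ 2 : ℝ) : ℂ) := by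
    refine Eq.trans ?_ (integral_ofReal (𝕜 := ℂ) (f := fun x => ‖f x‖ ^ 2))
    push_cast
    have h1 := inner_self_eq_norm_sq_to_K (𝕜 := ℂ) f
    rw [L2.inner_def] at h1
    refine h1.symm.trans (integral_congr_ae (Eventually.of_forall fun x => ?_))
    exact inner_self_eq_norm_sq_to_K (𝕜 := ℂ) (f x)
  exact_mod_cast h

theorem integrable_norm_sq (f : OneParticle) : Integrable (fun x => ‖f x‖ ^ 2) (volume : Measure Space) :=
  (Lp.memLp f).integrable_norm_pow two_ne_zero

/-- The function whose inner product with `v̂` is the `k`-th component of `(1 + D²)⁻¹ v` at `x`. -/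
def planeWave (m : ℝ) (x : Space) (k : Fin 4) (ξ : Space) : Spinor :=
  (((Real.fourierChar (-⟪ξ, x⟫_ℝ) : Circle) : ℂ) * (damping m ξ : ℂ)) • EuclideanSpace.single k (1 : ℂ)

theorem norm_planeWave (m : ℝ) (x : Space) (k : Fin 4) (ξ : Space) :
    ‖planeWave m x k ξ‖ = damping m ξ := by
  rw [planeWave, norm_smul, norm_mul, Circle.norm_coe, one_mul, Complex.norm_real,
    Real.norm_of_nonneg (damping_pos m ξ).le, PiLp.norm_single, norm_one, mul_one]

theorem memLp_planeWave (m : ℝ) (x : Space) (k : Fin 4) :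
    MemLp (planeWave m x k) 2 (volume : Measure Space) := by
  have hm : AEStronglyMeasurable (planeWave m x k) (volume : Measure Space) := by
    have h1 : Continuous fun ξ : Space => -⟪ξ, x⟫_ℝ := (continuous_id.inner continuous_const).neg
    have h2 : Continuous fun ξ : Space => ((Real.fourierChar (-⟪ξ, x⟫_ℝ) : Circle) : ℂ) :=
      continuous_subtype_val.comp (Real.continuous_fourierChar.comp h1)
    have h3 : Continuous fun ξ : Space => (damping m ξ : ℂ) :=
      Complex.continuous_ofReal.comp (continuous_damping m)
    exact ((h2.mul h3).smul continuous_const).aestronglyMeasurable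
  rw [memLp_two_iff_integrable_sq_norm hm]
  simp only [norm_planeWave]
  exact integrable_damping_sq m

theorem norm_sq_planeWave (m : ℝ) (x : Space) (k : Fin 4) :
    ‖(memLp_planeWave m x k).toLp‖ ^ 2 = ∫ ξ, damping m ξ ^ 2 := by
  rw [norm_sq_eq_integral]
  refine integral_congr_ae ?_
  filter_upwards [(memLp_planeWave m x k).coeFn_toLp] with ξ h
  rw [h, norm_planeWave]

theorem dampingOp_apply_ae (m : ℝ) (v : OneParticle) : ∀ᵐ x, ∀ k,
    (dampingOp m v) x k = ⟪(memLp_planeWave m x k).toLp, fourierL v⟫_ℂ := by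
  set w := mulOp (fun ξ => ((damping m ξ : ℝ) : ℂ) • 1) (fourierL v) with hw
  have hwae : w =ᵐ[volume] fun ξ => (damping m ξ : ℂ) • fourierL v ξ := by
    filter_upwards [mulOp_ae (memLp_damping m) (fourierL v)] with ξ h
    rw [hw, h]
    rfl
  have hint : Integrable w (volume : Measure Space) := by
    refine Integrable.congr ?_ hwae.symm
    have h2 : MemLp (fun ξ => ((damping m ξ : ℝ) : ℂ)) 2 (volume : Measure Space) := by
      have hm : AEStronglyMeasurable (fun ξ => ((damping m ξ : ℝ) : ℂ)) (volume : Measure Space) :=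
        (Complex.continuous_ofReal.comp (continuous_damping m)).aestronglyMeasurable
      rw [memLp_two_iff_integrable_sq_norm hm]
      simpa using integrable_damping_sq m
    exact memLp_one_iff_integrable.1 ((Lp.memLp (fourierL v)).smul h2)
  have h0 := fourierL_symm_ae hint
  filter_upwards [h0] with x hx k
  have e1 : (dampingOp m v) x = 𝓕⁻ (w : Space → Spinor) x := hx
  have e2 : ∀ y : Spinor, y k = ⟪EuclideanSpace.single k (1 : ℂ), y⟫_ℂ := fun y => by
    rw [EuclideanSpace.inner_single_left, map_one, one_mul]
  rw [e1, e2, Real.fourierInv_eq, ← integral_inner, L2.inner_def]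
  · refine integral_congr_ae ?_
    filter_upwards [hwae, (memLp_planeWave m x k).coeFn_toLp] with ξ h1 h2
    rw [h1, h2, planeWave, inner_smul_left, Circle.smul_def, inner_smul_right, inner_smul_right,
      map_mul, Complex.conj_ofReal, ← mul_assoc]
    congr 2
    rw [AddChar.map_neg_eq_inv, Circle.coe_inv_eq_conj, Complex.conj_conj]
  · simpa only [LinearMap.neg_apply, neg_neg, innerₗ_apply_apply] using
      (VectorFourier.fourierIntegral_convergent_iff (L := -innerₗ Space)
      Real.continuous_fourierChar ((continuous_fst.inner continuous_snd).neg) x).2 hint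

theorem orthonormal_fourierL {n : ℕ} {v : Fin n → OneParticle} (hv : Orthonormal ℂ v) :
    Orthonormal ℂ fun i => fourierL (v i) :=
  hv.comp_linearIsometry (Lp.fourierTransformₗᵢ Space Spinor).toLinearIsometry

theorem sum_norm_sq_inner_le {E : Type*} [NormedAddCommGroup E] [InnerProductSpace ℂ E] {n : ℕ}
    {v : Fin n → E} (hv : Orthonormal ℂ v) (x : E) : ∑ i, ‖⟪x, v i⟫_ℂ‖ ^ 2 ≤ ‖x‖ ^ 2 := by
  have h := hv.sum_inner_products_le x (s := Finset.univ)
  refine le_trans (le_of_eq (Finset.sum_congr rfl fun i _ => ?_)) h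
  rw [norm_inner_symm]

/-- Each spinor component of (1 + D²)⁻¹ v at x is the inner product of v̂ with a vector whose L²
norm does not depend on x. Bessel's inequality bounds the sum over the orthonormal family, and the
four components give the factor 4. -/
theorem sum_norm_dampingOp_sq_le (m : ℝ) {n : ℕ} {v : Fin n → OneParticle} (hv : Orthonormal ℂ v) :
    ∀ᵐ x, ∑ i, ‖(dampingOp m (v i)) x‖ ^ 2 ≤ 4 * ∫ ξ, damping m ξ ^ 2 := by
  have h : ∀ᵐ x, ∀ i, ∀ k, (dampingOp m (v i)) x k
      = ⟪(memLp_planeWave m x k).toLp, fourierL (v i)⟫_ℂ :=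
    ae_all_iff.2 fun i => dampingOp_apply_ae m (v i)
  have hF : Orthonormal ℂ fun i => fourierL (v i) := orthonormal_fourierL hv
  filter_upwards [h] with x hx
  simp only [EuclideanSpace.norm_sq_eq, hx]
  rw [Finset.sum_comm]
  calc _ ≤ ∑ _k : Fin 4, ∫ ξ, damping m ξ ^ 2 := by
        refine Finset.sum_le_sum fun k _ => ?_
        rw [← norm_sq_planeWave m x k]
        exact sum_norm_sq_inner_le hF _
    _ = _ := by simp

/-- The pointwise Bessel bound is integrated over the compact support of M. -/
theorem hsBound_mulOp_dampingOp (m : ℝ) {M : Space → Spinor →L[ℂ] Spinor}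
    (hM : MemLp M ∞ (volume : Measure Space)) {c : ℝ} (hc : ∀ x, ‖M x‖ ≤ c) {C : Set Space}
    (hC : IsCompact C) (hMC : ∀ x ∉ C, M x = 0) :
    HSBound (mulOp M * dampingOp m)
      (√(c ^ 2 * (4 * ∫ ξ, damping m ξ ^ 2) * (volume : Measure Space).real C)) := by
  rw [hsBound_iff (Real.sqrt_nonneg _)]
  intro n v hv
  rw [Real.sq_sqrt (mul_nonneg (mul_nonneg (sq_nonneg c) (mul_nonneg (by norm_num)
    (integral_nonneg fun ξ => sq_nonneg _))) measureReal_nonneg)]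
  simp only [norm_sq_eq_integral]
  rw [← integral_finsetSum _ fun i _ => integrable_norm_sq _]
  set N := ∫ ξ, damping m ξ ^ 2
  have hb : ∀ᵐ x, ∑ i, ‖((mulOp M * dampingOp m) (v i)) x‖ ^ 2
      ≤ C.indicator (fun _ => c ^ 2 * (4 * N)) x := by
    have h1 : ∀ᵐ x, ∀ i, ((mulOp M * dampingOp m) (v i)) x = M x ((dampingOp m (v i)) x) :=
      ae_all_iff.2 fun i => mulOp_ae hM (dampingOp m (v i))
    filter_upwards [h1, sum_norm_dampingOp_sq_le m hv] with x hx hN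
    simp only [hx]
    by_cases hxC : x ∈ C
    · rw [indicator_of_mem hxC]
      calc _ ≤ ∑ i, c ^ 2 * ‖(dampingOp m (v i)) x‖ ^ 2 := by
            refine Finset.sum_le_sum fun i _ => ?_
            rw [← mul_pow]
            exact pow_le_pow_left₀ (norm_nonneg _) ((M x).le_of_opNorm_le (hc x) _) 2
        _ ≤ _ := by
            rw [← Finset.mul_sum]
            exact mul_le_mul_of_nonneg_left hN (sq_nonneg c)
    · rw [indicator_of_notMem hxC, hMC x hxC]
      simp
  refine (integral_mono_ae (integrable_finsetSum _ fun i _ => integrable_norm_sq _) ?_ hb).trans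
    (le_of_eq ?_)
  · exact (integrable_indicator_iff hC.measurableSet).2 (integrableOn_const hC.measure_lt_top.ne)
  · rw [integral_indicator hC.measurableSet, setIntegral_const, smul_eq_mul, mul_comm]

/-! ### The unitary group is strongly continuous -/

theorem isUnitaryGroup_diracUnitary (m : ℝ) : IsUnitaryGroup (diracUnitary m) where
  zero := diracUnitary_zero m
  add := diracUnitary_add m
  star := star_diracUnitary m
  norm_le := norm_diracUnitary_le m
  continuous v := by
    have hdense : DenseRange (dampingOp m) := by
      refine denseRange_of_isSelfAdjoint (isSelfAdjoint_dampingOp m) fun v hv => ?_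
      have h1 : mulOp (fun ξ => ((damping m ξ : ℝ) : ℂ) • 1) (fourierL v) = 0 := by
        have := fourierL_fourierMul (fun ξ => ((damping m ξ : ℝ) : ℂ) • 1) v
        rw [← this]
        change fourierL (dampingOp m v) = 0
        rw [hv, map_zero]
      have h2 : fourierL v = 0 := by
        refine Lp.ext ?_
        filter_upwards [mulOp_ae (memLp_damping m) (fourierL v),
          Lp.coeFn_zero Spinor 2 (volume : Measure Space)] with ξ e1 e2
        rw [h1, e2] at e1
        rw [e2]
        exact (smul_eq_zero.1 e1.symm).resolve_left
          (Complex.ofReal_ne_zero.2 (damping_pos m ξ).ne')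
      exact fourierL.injective (h2.trans (map_zero _).symm)
    have h0 : ∀ w : OneParticle, ContinuousAt (fun t => diracUnitary m t w) 0 := by
      intro w
      rw [Metric.continuousAt_iff']
      intro ε hε
      -- Approximation by the range of (1 + D²)⁻¹ costs twice ε/4, because the group is contractive;
      -- on that range the norm expansion at time 0 supplies the other ε/2.
      obtain ⟨u, hu⟩ := hdense.exists_dist_lt w (show 0 < ε / 4 by positivity)
      have h1 : Tendsto (fun t : ℝ => t ^ 2 * ‖u‖ + |t| * ‖dampedDirac m u‖) (𝓝 0) (𝓝 0) := by
        have e : (0 : ℝ) = 0 ^ 2 * ‖u‖ + |0| * ‖dampedDirac m u‖ := by simp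
        nth_rw 2 [e]
        exact Continuous.tendsto (by fun_prop) 0
      filter_upwards [h1.eventually (gt_mem_nhds (show 0 < ε / 2 by positivity))] with t ht
      rw [dist_eq_norm] at hu ⊢
      rw [diracUnitary_zero, one_apply_eq_self]
      have h2 := norm_diracUnitary_mul_damping_sub_le m t
      have h3 := (diracUnitary m t * dampingOp m - dampingOp m
        - (Complex.I * (t : ℂ)) • dampedDirac m).le_of_opNorm_le h2 u
      simp only [sub_apply, smul_apply, mul_apply_eq_comp] at h3
      have e : diracUnitary m t w - w = diracUnitary m t (w - dampingOp m u) - (w - dampingOp m u)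
          + (diracUnitary m t (dampingOp m u) - dampingOp m u
            - (Complex.I * (t : ℂ)) • dampedDirac m u)
          + (Complex.I * (t : ℂ)) • dampedDirac m u := by
        rw [map_sub]
        abel
      rw [e]
      have n1 := norm_add_le (diracUnitary m t (w - dampingOp m u) - (w - dampingOp m u)
          + (diracUnitary m t (dampingOp m u) - dampingOp m u
            - (Complex.I * (t : ℂ)) • dampedDirac m u)) ((Complex.I * (t : ℂ)) • dampedDirac m u)
      have n2 := norm_add_le (diracUnitary m t (w - dampingOp m u) - (w - dampingOp m u))
        (diracUnitary m t (dampingOp m u) - dampingOp m u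
            - (Complex.I * (t : ℂ)) • dampedDirac m u)
      have n3 := norm_sub_le (diracUnitary m t (w - dampingOp m u)) (w - dampingOp m u)
      have n4 := (diracUnitary m t).le_of_opNorm_le (norm_diracUnitary_le m t) (w - dampingOp m u)
      have n5 : ‖(Complex.I * (t : ℂ)) • dampedDirac m u‖ = |t| * ‖dampedDirac m u‖ := by
        rw [norm_smul, norm_mul, Complex.norm_I, one_mul, Complex.norm_real, Real.norm_eq_abs]
      linarith
    rw [continuous_iff_continuousAt]
    intro t
    have e : (fun s => diracUnitary m s v) = fun s => diracUnitary m (s - t) (diracUnitary m t v) := by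
      funext s
      rw [← mul_apply_eq_comp, ← diracUnitary_add, sub_add_cancel]
    rw [e]
    have h2 : Tendsto (fun s : ℝ => s - t) (𝓝 t) (𝓝 0) := by
      have : Tendsto (fun s : ℝ => s - t) (𝓝 t) (𝓝 (t - t)) := Continuous.tendsto (by fun_prop) t
      rwa [sub_self] at this
    have h3 := (h0 (diracUnitary m t v)).tendsto.comp h2
    rw [ContinuousAt, sub_self]
    exact h3

end DiracEntropy

end

noncomputable section

set_option maxSynthPendingDepth 3

namespace DiracEntropy

open Filter Topology

/-! ### Time derivatives of the potential -/

/-- The time derivatives of a potential, as functions on space-time. -/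
def timeDeriv (A : ℝ → Space → Fin 4 → ℝ) : ℕ → ℝ × Space → Fin 4 → ℝ
  | 0 => fun z => A z.1 z.2
  | j + 1 => fun z => fderiv ℝ (timeDeriv A j) z (1, 0)

variable {ε : ℝ} {A : ℝ → Space → Fin 4 → ℝ}

theorem IsPotential.contDiff_timeDeriv (hA : IsPotential ε A) (j : ℕ) :
    ContDiff ℝ ∞ (timeDeriv A j) := by
  induction j with
  | zero => exact hA.smooth
  | succ j ih => exact (ih.fderiv_right (m := ∞) (by simp)).clm_apply contDiff_const

theorem IsPotential.hasDerivAt_timeDeriv (hA : IsPotential ε A) (j : ℕ) (t : ℝ) (x : Space) :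
    HasDerivAt (fun s => timeDeriv A j (s, x)) (timeDeriv A (j + 1) (t, x)) t := by
  have h1 : HasFDerivAt (timeDeriv A j) (fderiv ℝ (timeDeriv A j) (t, x)) (t, x) :=
    ((hA.contDiff_timeDeriv j).differentiable (by simp) _).hasFDerivAt
  have h2 : HasDerivAt (fun s : ℝ => (s, x)) ((1 : ℝ), (0 : Space)) t :=
    (hasDerivAt_id t).prodMk (hasDerivAt_const t x)
  exact h1.comp_hasDerivAt t h2

theorem IsPotential.timeDeriv_past (hA : IsPotential ε A) (j : ℕ) {t : ℝ} (ht : t < -ε) (x : Space) :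
    timeDeriv A j (t, x) = 0 := by
  induction j generalizing t with
  | zero => exact hA.past t ht x
  | succ j ih =>
    refine (hA.hasDerivAt_timeDeriv j t x).unique ?_
    refine (hasDerivAt_const t (0 : Fin 4 → ℝ)).congr_of_eventuallyEq ?_
    filter_upwards [Iio_mem_nhds ht] with s hs
    exact ih hs

theorem IsPotential.timeDeriv_future (hA : IsPotential ε A) (j : ℕ) {t : ℝ} (ht : 0 < t) (x : Space) :
    timeDeriv A (j + 1) (t, x) = 0 := by
  induction j generalizing t with
  | zero =>
    refine (hA.hasDerivAt_timeDeriv 0 t x).unique ?_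
    refine (hasDerivAt_const t (A t x)).congr_of_eventuallyEq ?_
    filter_upwards [Ioi_mem_nhds ht] with s hs
    exact hA.future s hs t ht x
  | succ j ih =>
    refine (hA.hasDerivAt_timeDeriv (j + 1) t x).unique ?_
    refine (hasDerivAt_const t (0 : Fin 4 → ℝ)).congr_of_eventuallyEq ?_
    filter_upwards [Ioi_mem_nhds ht] with s hs
    exact ih hs

theorem IsPotential.timeDeriv_support (hA : IsPotential ε A) {C : Set Space}
    (hC : ∀ t, ∀ x ∉ C, A t x = 0) (j : ℕ) (t : ℝ) {x : Space} (hx : x ∉ C) :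
    timeDeriv A j (t, x) = 0 := by
  induction j generalizing t with
  | zero => exact hC t x hx
  | succ j ih =>
    refine (hA.hasDerivAt_timeDeriv j t x).unique ?_
    simp only [ih]
    exact hasDerivAt_const t _

theorem IsPotential.exists_bound (hA : IsPotential ε A) (j : ℕ) :
    ∃ C, ∀ t x, ‖timeDeriv A j (t, x)‖ ≤ C := by
  obtain ⟨K, hK, hK0⟩ := hA.compact_support
  -- Compactness bounds the function on the times from -ε to 1. Earlier values vanish, and later
  -- ones equal the value at time 1 or, for derivatives, vanish.
  obtain ⟨C, hC⟩ := (isCompact_Icc.prod hK).exists_bound_of_continuousOn (s := Icc (-ε) 1 ×ˢ K)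
    (hA.contDiff_timeDeriv j).continuous.continuousOn
  refine ⟨max C 0, fun t x => ?_⟩
  by_cases hx : x ∈ K
  · rcases lt_or_ge t (-ε) with h1 | h1
    · rw [hA.timeDeriv_past j h1, norm_zero]
      exact le_max_right _ _
    rcases le_or_gt t 1 with h2 | h2
    · exact (hC (t, x) ⟨⟨h1, h2⟩, hx⟩).trans (le_max_left _ _)
    · rcases j with _ | j
      · have e : timeDeriv A 0 (t, x) = timeDeriv A 0 (1, x) :=
          hA.future t (by linarith) 1 one_pos x
        rcases lt_or_ge 1 (-ε) with h3 | h3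
        · rw [e, hA.timeDeriv_past 0 h3, norm_zero]
          exact le_max_right _ _
        · rw [e]
          exact (hC (1, x) ⟨⟨h3, le_rfl⟩, hx⟩).trans (le_max_left _ _)
      · rw [hA.timeDeriv_future j (by linarith), norm_zero]
        exact le_max_right _ _
  · rw [hA.timeDeriv_support hK0 j t hx, norm_zero]
    exact le_max_right _ _

theorem norm_taylor_le {E : Type*} [NormedAddCommGroup E] [NormedSpace ℝ E] {f f' f'' : ℝ → E}
    (hf : ∀ t, HasDerivAt f (f' t) t) (hf' : ∀ t, HasDerivAt f' (f'' t) t) {C : ℝ}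
    (hC : ∀ t, ‖f'' t‖ ≤ C) (t h : ℝ) : ‖f (t - h) - f t + h • f' t‖ ≤ C * h ^ 2 := by
  have h1 : ∀ s, ‖f' s - f' t‖ ≤ C * |s - t| := fun s => by
    have := Convex.norm_image_sub_le_of_norm_hasDerivWithin_le (s := univ) (x := t) (y := s)
      (fun r _ => (hf' r).hasDerivWithinAt) (fun r _ => hC r) convex_univ (mem_univ _) (mem_univ _)
    rwa [Real.norm_eq_abs] at this
  have hC0 : 0 ≤ C := (norm_nonneg _).trans (hC 0)
  have h2 := Convex.norm_image_sub_le_of_norm_hasDerivWithin_le (s := uIcc t (t - h)) (x := t)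
    (y := t - h) (f := fun s => f s - (s - t) • f' t) (f' := fun s => f' s - (1 : ℝ) • f' t)
    (C := C * |h|)
    (fun s _ => ((hf s).sub (((hasDerivAt_id s).sub_const t).smul_const (f' t))).hasDerivWithinAt)
    (fun s hs => ?_) (convex_uIcc _ _) left_mem_uIcc right_mem_uIcc
  · beta_reduce at h2
    rw [sub_self, zero_smul, sub_zero, sub_sub_cancel_left, neg_smul, sub_neg_eq_add, Real.norm_eq_abs,
      abs_neg, mul_assoc, ← sq, sq_abs] at h2
    refine le_trans (le_of_eq ?_) h2
    congr 1
    abel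
  · rw [one_smul]
    refine (h1 s).trans (mul_le_mul_of_nonneg_left ?_ hC0)
    have := abs_sub_left_of_mem_uIcc hs
    rwa [sub_sub_cancel_left, abs_neg] at this

/-! ### The symbol of the interaction -/

/-- The matrix `v⁰ + α·v`. -/
def slashSymbol (v : Fin 4 → ℝ) : Spinor →L[ℂ] Spinor :=
  spinorOp (((v 0 : ℝ) : ℂ) • 1 + ∑ j : Fin 3, ((v j.succ : ℝ) : ℂ) • diracAlpha j)

theorem slashed_eq (a : Space → Fin 4 → ℝ) : slashed a = mulOp fun x => slashSymbol (a x) := rfl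

theorem slashSymbol_add (v w : Fin 4 → ℝ) : slashSymbol (v + w) = slashSymbol v + slashSymbol w := by
  rw [slashSymbol, slashSymbol, slashSymbol, ← spinorOp_add]
  congr 1
  simp only [Pi.add_apply, Complex.ofReal_add, add_smul, Finset.sum_add_distrib]
  abel

theorem slashSymbol_smul (c : ℝ) (v : Fin 4 → ℝ) : slashSymbol (c • v) = (c : ℂ) • slashSymbol v := by
  rw [slashSymbol, slashSymbol, ← spinorOp_smul]
  congr 1
  simp only [Pi.smul_apply, smul_eq_mul, Complex.ofReal_mul, mul_smul, smul_add, Finset.smul_sum]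

/-- The matrix `v⁰ + α·v`, as a linear function of `v`. -/
def slashLinear : (Fin 4 → ℝ) →ₗ[ℝ] Spinor →L[ℂ] Spinor where
  toFun := slashSymbol
  map_add' := slashSymbol_add
  map_smul' c v := by rw [slashSymbol_smul, Complex.coe_smul, RingHom.id_apply]

theorem continuous_slashSymbol : Continuous slashSymbol := slashLinear.continuous_of_finiteDimensional

theorem exists_norm_slashSymbol_le : ∃ κ : ℝ, 0 ≤ κ ∧ ∀ v, ‖slashSymbol v‖ ≤ κ * ‖v‖ :=
  ⟨‖slashLinear.toContinuousLinearMap‖, norm_nonneg _, slashLinear.toContinuousLinearMap.le_opNorm⟩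

theorem isSelfAdjoint_slashSymbol (v : Fin 4 → ℝ) : IsSelfAdjoint (slashSymbol v) := by
  rw [IsSelfAdjoint, slashSymbol, star_spinorOp]
  congr 1
  simp [star_sum, star_smul, star_diracAlpha]

theorem memLp_slashSymbol {a : Space → Fin 4 → ℝ} (ha : Continuous a) {C : ℝ} (hC : ∀ x, ‖a x‖ ≤ C) :
    MemLp (fun x => slashSymbol (a x)) ∞ (volume : Measure Space) := by
  obtain ⟨κ, hκ, h⟩ := exists_norm_slashSymbol_le
  exact memLp_top_of_continuous (continuous_slashSymbol.comp ha)
    fun x => (h _).trans (mul_le_mul_of_nonneg_left (hC x) hκ)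

theorem mulOp_sub_add_smul {M N P : Space → Spinor →L[ℂ] Spinor}
    (hM : MemLp M ∞ (volume : Measure Space)) (hN : MemLp N ∞ (volume : Measure Space))
    (hP : MemLp P ∞ (volume : Measure Space)) (c : ℂ) :
    mulOp (fun x => M x - N x + c • P x) = mulOp M - mulOp N + c • mulOp P := by
  have h1 : MemLp (fun x => M x - N x) ∞ (volume : Measure Space) := memLp_fun_sub hM hN
  have h2 : MemLp (fun x => c • P x) ∞ (volume : Measure Space) := memLp_fun_smul hP c
  have h3 := mulOp_add (M := fun x => M x - N x) (N := fun x => c • P x) h1 h2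
  have h4 := mulOp_sub (M := M) (N := N) hM hN
  have h5 := mulOp_smul (M := P) hP c
  rw [h3, h4, h5]

theorem norm_slashed_sub_add_smul_le {κ : ℝ} (hκ : 0 ≤ κ) (hslash : ∀ v, ‖slashSymbol v‖ ≤ κ * ‖v‖)
    {a b c : Space → Fin 4 → ℝ} (ha : MemLp (fun x => slashSymbol (a x)) ∞ (volume : Measure Space))
    (hb : MemLp (fun x => slashSymbol (b x)) ∞ (volume : Measure Space))
    (hc : MemLp (fun x => slashSymbol (c x)) ∞ (volume : Measure Space)) (h : ℝ) {C : ℝ} (hC : 0 ≤ C)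
    (hbound : ∀ x, ‖a x - b x + h • c x‖ ≤ C) :
    ‖slashed a - slashed b + (h : ℂ) • slashed c‖ ≤ κ * C := by
  have a1 := mulOp_sub_add_smul (M := fun x => slashSymbol (a x)) (N := fun x => slashSymbol (b x))
    (P := fun x => slashSymbol (c x)) ha hb hc (h : ℂ)
  rw [slashed_eq, slashed_eq, slashed_eq, ← a1]
  refine norm_mulOp_le (mul_nonneg hκ hC) fun x => ?_
  have e : slashSymbol (a x) - slashSymbol (b x) + (h : ℂ) • slashSymbol (c x)
      = slashSymbol (a x - b x + h • c x) := by
    rw [slashSymbol_add, slashSymbol_smul]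
    exact congrArg (· + _) (map_sub slashLinear _ _).symm
  rw [e]
  exact (hslash _).trans (mul_le_mul_of_nonneg_left (hbound x) hκ)

/-- The family of multiplication operators by the time derivatives of the potential. -/
def potentialOp (A : ℝ → Space → Fin 4 → ℝ) (j : ℕ) (t : ℝ) : OneParticle →L[ℂ] OneParticle :=
  slashed fun x => timeDeriv A j (t, x)

theorem IsPotential.isSource (hA : IsPotential ε A) (m : ℝ) :
    IsSource (-ε) (dampingOp m) (potentialOp A) := by
  obtain ⟨κ, hκ, hslash⟩ := exists_norm_slashSymbol_le
  have hzero : ∀ a : Space → Fin 4 → ℝ, (∀ x, a x = 0) → slashed a = 0 := by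
    intro a ha
    have h1 : ‖slashed a‖ ≤ 0 := norm_mulOp_le le_rfl fun x => by
      change ‖slashSymbol (a x)‖ ≤ 0
      have := hslash 0
      rw [norm_zero, mul_zero] at this
      rw [ha]
      exact this
    exact norm_le_zero_iff.1 h1
  have hcont : ∀ j t, Continuous fun x => timeDeriv A j (t, x) := fun j t =>
    (hA.contDiff_timeDeriv j).continuous.comp (by fun_prop)
  refine ⟨fun j t ht => hzero _ fun x => hA.timeDeriv_past j ht x,
    fun j t ht => hzero _ fun x => hA.timeDeriv_future j ht x, fun j => ?_, fun j => ?_, fun j => ?_,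
    fun j t => (isSelfAdjoint_mulOp fun x => isSelfAdjoint_slashSymbol _).star_eq⟩
  · obtain ⟨C, hC⟩ := hA.exists_bound j
    have hC0 : 0 ≤ C := (norm_nonneg _).trans (hC 0 0)
    exact ⟨κ * C, fun t => norm_mulOp_le (mul_nonneg hκ hC0) fun x =>
      (hslash _).trans (mul_le_mul_of_nonneg_left (hC t x) hκ)⟩
  · obtain ⟨C, hC⟩ := hA.exists_bound (j + 2)
    obtain ⟨C0, hC0⟩ := hA.exists_bound j
    obtain ⟨C1, hC1⟩ := hA.exists_bound (j + 1)
    have hCn : 0 ≤ C := (norm_nonneg _).trans (hC 0 0)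
    refine ⟨κ * C, fun t h _ => ?_⟩
    have m1 := memLp_slashSymbol (hcont j (t - h)) (hC0 (t - h))
    have m2 := memLp_slashSymbol (hcont j t) (hC0 t)
    have m3 := memLp_slashSymbol (hcont (j + 1) t) (hC1 t)
    have := norm_slashed_sub_add_smul_le hκ hslash (a := fun x => timeDeriv A j (t - h, x))
      (b := fun x => timeDeriv A j (t, x)) (c := fun x => timeDeriv A (j + 1) (t, x))
      m1 m2 m3 h (C := C * h ^ 2) (by positivity) fun x => norm_taylor_le
        (fun s => hA.hasDerivAt_timeDeriv j s x) (fun s => hA.hasDerivAt_timeDeriv (j + 1) s x)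
        (fun s => hC s x) t h
    rw [mul_assoc]
    exact this
  · obtain ⟨C, hC⟩ := hA.exists_bound j
    obtain ⟨K, hK, hK0⟩ := hA.compact_support
    refine ⟨_, fun t => hsBound_mulOp_dampingOp m (c := κ * C)
      (memLp_slashSymbol (hcont j t) (hC t))
      (fun x => (hslash _).trans (mul_le_mul_of_nonneg_left (hC t x) hκ)) hK fun x hx => ?_⟩
    have := hslash (timeDeriv A j (t, x))
    rw [hA.timeDeriv_support hK0 j t hx, norm_zero, mul_zero] at this
    rw [hA.timeDeriv_support hK0 j t hx]
    exact norm_le_zero_iff.1 this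

theorem IsPotential.isDyson (hA : IsPotential ε A) (m : ℝ) :
    IsDyson (-ε) (interactionPicture (diracUnitary m) (potentialOp A 0)) (dyson m A) :=
  isDyson_tsum ((hA.isSource m).isDriving (isUnitaryGroup_diracUnitary m)) (d := dysonTerm m A)
    (fun _ => rfl) fun _ _ => rfl

theorem IsPotential.interaction_eq (hA : IsPotential ε A) (m : ℝ) :
    interaction m ε A = strongIntegral (volume.restrict (Ioo (-ε) 0))
      (scatteredSource (diracUnitary m) (dyson m A) (potentialOp A) 0) := by
  refine congrArg (strongIntegral _) (funext fun s => ?_)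
  have e : (fun x => deriv (fun t => A t x) s) = fun x => timeDeriv A 1 (s, x) :=
    funext fun x => (hA.hasDerivAt_timeDeriv 0 s x).deriv
  rw [e]
  rfl

/-! ### Commutators with the Dirac operator -/

theorem eq_zero_of_norm_smul_le {E : Type*} [NormedAddCommGroup E] [NormedSpace ℂ E] {X : E} {C : ℝ}
    (h : ∀ r : ℝ, |r| ≤ 1 → ‖(r : ℂ) • X‖ ≤ C * r ^ 2) : X = 0 := by
  have h1 : Tendsto (fun r : ℝ => C * r) (𝓝[>] 0) (𝓝 0) := by
    have : Tendsto (fun r : ℝ => C * r) (𝓝 0) (𝓝 (C * 0)) := Continuous.tendsto (by fun_prop) 0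
    rw [mul_zero] at this
    exact this.mono_left nhdsWithin_le_nhds
  refine norm_le_zero_iff.1 (ge_of_tendsto h1 ?_)
  filter_upwards [Ioo_mem_nhdsGT one_pos] with r hr
  have h2 := h r (by rw [abs_of_pos hr.1]; exact hr.2.le)
  rw [norm_smul, Complex.norm_real, Real.norm_of_nonneg hr.1.le] at h2
  exact le_of_mul_le_mul_left (h2.trans (le_of_eq (by ring))) hr.1

section Abstract

variable {H : Type*} [NormedAddCommGroup H] [InnerProductSpace ℂ H] [CompleteSpace H]
  {U : ℝ → H →L[ℂ] H} {Q Z : H →L[ℂ] H}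

/-- With Q = (1 + D²)⁻¹ and Z = D(1 + D²)⁻¹, insert U(r)Q = Q + irZ + O(r²) and its adjoint around
K. To first order Q(U(r) K U(-r) - K)Q is ir(ZKQ - QKZ), to be compared with r Q K' Q; this is [D,
K] = -iK' in regularized form. -/
theorem commutator_of_expansion (hUs : ∀ r, star (U r) = U (-r)) (hcomm : ∀ r, U r * Q = Q * U r)
    (hexp : ∀ r : ℝ, ‖U r * Q - Q - (Complex.I * (r : ℂ)) • Z‖ ≤ r ^ 2)
    (hQs : star Q = Q) (hZs : star Z = Z) {K K' : H →L[ℂ] H} {C : ℝ}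
    (h : ∀ r : ℝ, |r| ≤ 1 → ‖U r * K * U (-r) - K - (r : ℂ) • K'‖ ≤ C * r ^ 2) :
    Z * K * Q - Q * K * Z = Q * ((-Complex.I) • K') * Q := by
  set k := ‖K‖
  have key : Complex.I • (Z * K * Q - Q * K * Z) - Q * K' * Q = 0 := by
    refine eq_zero_of_norm_smul_le
      (C := ‖Q‖ * C * ‖Q‖ + (‖Z‖ * k * ‖Z‖ + (‖Q‖ + ‖Z‖) * k + k * (‖Q‖ + ‖Z‖) + k)) fun r hr => ?_
    set T := U r * Q - Q - (Complex.I * (r : ℂ)) • Z with hT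
    have hTn : ‖T‖ ≤ r ^ 2 := hexp r
    have hr2 : r ^ 2 ≤ 1 := by
      rw [← sq_abs]
      nlinarith [abs_nonneg r]
    have e1 : U r * Q = Q + (Complex.I * (r : ℂ)) • Z + T := by
      rw [hT]
      abel
    have e2 : Q * U (-r) = Q - (Complex.I * (r : ℂ)) • Z + star T := by
      have : Q * U (-r) = star (U r * Q) := by
        rw [star_mul, hUs, hQs]
      rw [this, e1, star_add, star_add, star_smul, hQs, hZs]
      congr 1
      rw [sub_eq_add_neg, ← neg_smul]
      congr 2
      simp
    have e3 : Q * (U r * K * U (-r) - K - (r : ℂ) • K') * Q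
        = (U r * Q) * K * (Q * U (-r)) - Q * K * Q - (r : ℂ) • (Q * K' * Q) := by
      rw [hcomm r, ← hcomm (-r)]
      simp only [mul_sub, sub_mul, mul_smul_comm, smul_mul_assoc, mul_assoc]
    have hI : ((Complex.I * (r : ℂ)) * (Complex.I * (r : ℂ))) = -((r : ℂ) ^ 2) := by
      linear_combination (r : ℂ) ^ 2 * Complex.I_sq
    have e4 : (r : ℂ) • (Complex.I • (Z * K * Q - Q * K * Z) - Q * K' * Q)
        = Q * (U r * K * U (-r) - K - (r : ℂ) • K') * Q
          - (((r : ℂ) ^ 2) • (Z * K * Z) + (Q + (Complex.I * (r : ℂ)) • Z) * K * star T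
            + T * K * (Q - (Complex.I * (r : ℂ)) • Z) + T * K * star T) := by
      rw [e3, e1, e2]
      have h5 : ((r : ℂ) ^ 2) • (Z * K * Z)
          = -(((Complex.I * (r : ℂ)) • Z) * K * ((Complex.I * (r : ℂ)) • Z)) := by
        rw [smul_mul_assoc, smul_mul_assoc, mul_smul_comm, smul_smul, hI, neg_smul, neg_neg]
      rw [h5]
      have h6 : (r : ℂ) • (Complex.I • (Z * K * Q - Q * K * Z) - Q * K' * Q)
          = ((Complex.I * (r : ℂ)) • Z) * K * Q - Q * K * ((Complex.I * (r : ℂ)) • Z)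
            - (r : ℂ) • (Q * K' * Q) := by
        simp only [smul_sub, smul_mul_assoc, mul_smul_comm, smul_smul, mul_comm (r : ℂ)]
      rw [h6]
      generalize (Complex.I * (r : ℂ)) • Z = Y
      noncomm_ring
    have hW : ‖(Complex.I * (r : ℂ)) • Z‖ ≤ ‖Z‖ := by
      rw [norm_smul, norm_mul, Complex.norm_I, one_mul, Complex.norm_real, Real.norm_eq_abs]
      exact mul_le_of_le_one_left (norm_nonneg _) hr
    have n0 : ‖Q * (U r * K * U (-r) - K - (r : ℂ) • K') * Q‖
        ≤ ‖Q‖ * (C * r ^ 2) * ‖Q‖ :=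
      (norm_mul_le _ _).trans (mul_le_mul_of_nonneg_right ((norm_mul_le _ _).trans
        (mul_le_mul_of_nonneg_left (h r hr) (norm_nonneg _))) (norm_nonneg _))
    have n1 : ‖((r : ℂ) ^ 2) • (Z * K * Z)‖ ≤ r ^ 2 * (‖Z‖ * k * ‖Z‖) := by
      rw [norm_smul, norm_pow, Complex.norm_real, Real.norm_eq_abs, sq_abs]
      exact mul_le_mul_of_nonneg_left ((norm_mul_le _ _).trans (mul_le_mul_of_nonneg_right
        (norm_mul_le _ _) (norm_nonneg _))) (sq_nonneg r)
    have hTs : ‖star T‖ ≤ r ^ 2 := (norm_star T).le.trans hTn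
    have n2 : ‖(Q + (Complex.I * (r : ℂ)) • Z) * K * star T‖ ≤ (‖Q‖ + ‖Z‖) * k * r ^ 2 :=
      (norm_mul_le _ _).trans (mul_le_mul ((norm_mul_le _ _).trans (mul_le_mul_of_nonneg_right
        ((norm_add_le _ _).trans (add_le_add le_rfl hW)) (norm_nonneg _))) hTs (norm_nonneg _)
        (by positivity))
    have n3 : ‖T * K * (Q - (Complex.I * (r : ℂ)) • Z)‖ ≤ r ^ 2 * k * (‖Q‖ + ‖Z‖) :=
      (norm_mul_le _ _).trans (mul_le_mul ((norm_mul_le _ _).trans (mul_le_mul_of_nonneg_right hTn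
        (norm_nonneg _))) ((norm_sub_le _ _).trans (add_le_add le_rfl hW)) (norm_nonneg _)
        (by positivity))
    have n4 : ‖T * K * star T‖ ≤ r ^ 2 * k * 1 :=
      (norm_mul_le _ _).trans (mul_le_mul ((norm_mul_le _ _).trans (mul_le_mul_of_nonneg_right hTn
        (norm_nonneg _))) (hTs.trans hr2) (norm_nonneg _) (by positivity))
    rw [e4]
    refine (norm_sub_le _ _).trans ((add_le_add n0 ((norm_add_le _ _).trans (add_le_add
      ((norm_add_le _ _).trans (add_le_add ((norm_add_le _ _).trans (add_le_add n1 n2)) n3)) n4))).trans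
      (le_of_eq (by ring)))
  rw [mul_smul_comm, smul_mul_assoc, ← sub_eq_zero.1 key, smul_smul, neg_mul, Complex.I_mul_I, neg_neg,
    one_smul]

theorem star_eq_of_expansion (hUs : ∀ r, star (U r) = U (-r)) {K K' : H →L[ℂ] H} {C : ℝ}
    (h : ∀ r : ℝ, |r| ≤ 1 → ‖U r * K * U (-r) - K - (r : ℂ) • K'‖ ≤ C * r ^ 2) (hK : star K = K) :
    star K' = K' := by
  refine sub_eq_zero.1 (eq_zero_of_norm_smul_le (C := C + C) fun r hr => ?_)
  have h1 := h r hr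
  set X := U r * K * U (-r) - K - (r : ℂ) • K' with hX
  have e : (r : ℂ) • (star K' - K') = X - star X := by
    have : star (r : ℂ) = (r : ℂ) := by simp
    rw [hX, star_sub, star_sub, star_mul, star_mul, star_smul, hUs, hUs, neg_neg, hK, smul_sub,
      ← mul_assoc, this]
    abel
  rw [e, add_mul]
  exact (norm_sub_le _ _).trans (add_le_add h1 ((norm_star X).le.trans h1))

theorem exists_entropyOp_eq_of_smooth {D : H →ₗ.[ℂ] H} {β : ℝ} (hβ : 0 < β) (hD : IsSelfAdjoint D)
    (hQ : fc D lorentz = Q) (hZ : fc D (fun x => x * lorentz x) = Z)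
    (hUs : ∀ r, star (U r) = U (-r)) (hcomm : ∀ r, U r * Q = Q * U r)
    (hexp : ∀ r : ℝ, ‖U r * Q - Q - (Complex.I * (r : ℂ)) • Z‖ ≤ r ^ 2) {K : ℕ → H →L[ℂ] H}
    (hK : IsSelfAdjoint (K 0))
    (hKn : ∀ n, (∃ C, HSBound (K n * Q) C) ∧ ∃ C, ∀ h : ℝ, |h| ≤ 1 →
        ‖U h * K n * U (-h) - K n - (h : ℂ) • K (n + 1)‖ ≤ C * h ^ 2) :
    ∃ (X Y : H →L[ℂ] H) (C C' : ℝ), HSBound X C ∧ HSBound Y C' ∧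
      entropyOp β D (K 0) = ContinuousLinearMap.adjoint X ∘L Y := by
  have hQs : star Q = Q := by
    rw [← hQ]
    exact (isSelfAdjoint_fc _ _).star_eq
  have hZs : star Z = Z := by
    rw [← hZ]
    exact (isSelfAdjoint_fc _ _).star_eq
  have hself : ∀ n, star (K n) = K n := by
    intro n
    induction n with
    | zero => exact hK.star_eq
    | succ n ih =>
      obtain ⟨C, hC⟩ := (hKn n).2
      exact star_eq_of_expansion hUs hC ih
  -- Differentiating the conjugation gives i times the commutator with D, so the iterated
  -- commutators are (-i)ⁿ K_n.
  have h := exists_entropyOp_eq_adjoint_comp hβ (K := fun n => (-Complex.I) ^ n • K n)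
    hD (by simpa using hK) (fun n => ?_) fun n => ?_
  · simpa only [pow_zero, one_smul] using h
  · obtain ⟨C, hC⟩ := (hKn n).2
    have h0 : Intertwines D D (K n) ((-Complex.I) • K (n + 1)) := by
      refine intertwines_of_regularized (hasBoundedTransform_of_isSelfAdjoint hD) ?_
      rw [hQ, hZ]
      exact commutator_of_expansion hUs hcomm hexp hQs hZs hC
    have h1 := h0.smul ((-Complex.I) ^ n)
    rwa [smul_smul, ← pow_succ] at h1
  · obtain ⟨C, hC⟩ := (hKn n).1
    -- The evolution estimates put the regularizer on the right of K_n; the adjoint moves it to the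
    -- left, since K_n and Q are self-adjoint.
    have h1 := hC.adjoint.smul ((-Complex.I) ^ n)
    rw [← ContinuousLinearMap.star_eq_adjoint, star_mul, hself, hQs, ← mul_smul_comm] at h1
    rw [hQ]
    exact ⟨_, h1⟩

end Abstract

/-- In the Dirac setting, the relative entropy operator is a product of two Hilbert-Schmidt
operators, provided that the interaction operator is self-adjoint. -/
theorem IsPotential.exists_entropyOp_eq (hA : IsPotential ε A) (m : ℝ) {β : ℝ} (hβ : 0 < β)
    (hK : IsSelfAdjoint (interaction m ε A)) :
    ∃ (X Y : OneParticle →L[ℂ] OneParticle) (C C' : ℝ), HSBound X C ∧ HSBound Y C' ∧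
      entropyOp β (diracOp m) (interaction m ε A) = ContinuousLinearMap.adjoint X ∘L Y := by
  obtain ⟨K, hK0, hKn⟩ := exists_smooth_sequence (isUnitaryGroup_diracUnitary m)
    (commute_diracUnitary_damping m) (hA.isSource m) (hA.isDyson m)
  rw [← hA.interaction_eq m] at hK0
  rw [← hK0] at hK ⊢
  exact exists_entropyOp_eq_of_smooth hβ (isSelfAdjoint_diracOp m) (fc_lorentz_diracOp m).1
    (fc_lorentz_diracOp m).2 (star_diracUnitary m) (commute_diracUnitary_damping m)
    (norm_diracUnitary_mul_damping_sub_le m) hK hKn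

end DiracEntropy

end

noncomputable section

set_option maxSynthPendingDepth 3

namespace DiracEntropy

open Filter Topology

/-! ### Self-adjointness of the interaction operator -/

section SelfAdjoint

variable {H : Type*} [NormedAddCommGroup H] [InnerProductSpace ℂ H] [CompleteSpace H]

/-- A strong integral of self-adjoint operators is self-adjoint. -/
theorem isSelfAdjoint_strongIntegral {ι : Type*} [MeasurableSpace ι] {μ : Measure ι}
    {F : ι → H →L[ℂ] H} (hF : ∀ t, IsSelfAdjoint (F t)) : IsSelfAdjoint (strongIntegral μ F) := by
  by_cases h : ∃ T : H →L[ℂ] H, ∀ v, Integrable (fun t => F t v) μ ∧ T v = ∫ t, F t v ∂μ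
  · obtain ⟨T, hT⟩ := h
    rw [strongIntegral_eq hT, ContinuousLinearMap.isSelfAdjoint_iff_isSymmetric]
    intro v w
    change ⟪T v, w⟫_ℂ = ⟪v, T w⟫_ℂ
    rw [(hT v).2, (hT w).2, ← integral_inner (hT w).1 v, ← inner_conj_symm,
      ← integral_inner (hT v).1 w, ← integral_conj]
    refine integral_congr_ae (Eventually.of_forall fun t => ?_)
    change (starRingEnd ℂ) ⟪w, F t v⟫_ℂ = ⟪v, F t w⟫_ℂ
    rw [inner_conj_symm]
    exact (ContinuousLinearMap.isSelfAdjoint_iff_isSymmetric.1 (hF t)) v w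
  · rw [strongIntegral, dif_neg h]
    exact IsSelfAdjoint.zero _

end SelfAdjoint

theorem isSelfAdjoint_interaction (m ε : ℝ) (A : ℝ → Space → Fin 4 → ℝ) :
    IsSelfAdjoint (interaction m ε A) := by
  refine isSelfAdjoint_strongIntegral fun s => IsSelfAdjoint.conjugate ?_ _
  have h := IsSelfAdjoint.conjugate
    (x := slashed fun x => deriv (fun t => A t x) s)
    (isSelfAdjoint_mulOp fun x => isSelfAdjoint_slashSymbol _) (diracUnitary m s)
  rwa [star_diracUnitary] at h

/-! ### Young's inequality and Schur's bound -/

/-- The square of the `L²` case of Young's convolution inequality. -/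
theorem lintegral_sq_lintegral_sub_mul_le {w g : Space → ℝ≥0∞} (hw : AEMeasurable w volume)
    (hg : AEMeasurable g volume) :
    ∫⁻ x, (∫⁻ y, w (x - y) * g y) ^ 2 ≤ (∫⁻ x, w x) ^ 2 * ∫⁻ y, g y ^ 2 := by
  have hsqrt : ∀ a : ℝ≥0∞, (a ^ (1 / 2 : ℝ)) ^ (2 : ℝ) = a := fun a => by
    rw [← ENNReal.rpow_mul]; norm_num
  have hsqrt' : ∀ a : ℝ≥0∞, (a ^ (1 / 2 : ℝ)) ^ 2 = a := fun a => by
    rw [← ENNReal.rpow_two, hsqrt]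
  have hprod : AEMeasurable (fun z : Space × Space => w (z.1 - z.2)) (volume.prod volume) :=
    hw.comp_quasiMeasurePreserving (quasiMeasurePreserving_sub_of_right_invariant volume volume)
  have hpt : ∀ x, (∫⁻ y, w (x - y) * g y) ^ 2 ≤ (∫⁻ z, w z) * ∫⁻ y, w (x - y) * g y ^ 2 := by
    intro x
    have hwx : AEMeasurable (fun y => w (x - y)) volume :=
      hw.comp_quasiMeasurePreserving (quasiMeasurePreserving_sub_left_of_right_invariant volume x)
    -- Cauchy–Schwarz after splitting w g as √w · (√w g), so that only the integral of w, not of w²,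
    -- appears.
    have h := ENNReal.lintegral_mul_le_Lp_mul_Lq volume Real.HolderConjugate.two_two
      (f := fun y => w (x - y) ^ (1 / 2 : ℝ)) (g := fun y => w (x - y) ^ (1 / 2 : ℝ) * g y)
      (hwx.pow_const _) ((hwx.pow_const _).mul hg)
    have e1 : ∀ y, ((fun y => w (x - y) ^ (1 / 2 : ℝ)) * fun y => w (x - y) ^ (1 / 2 : ℝ) * g y) y
        = w (x - y) * g y := fun y => by
      rw [Pi.mul_apply, ← mul_assoc, ← pow_two, hsqrt']
    have e2 : ∀ y, (w (x - y) ^ (1 / 2 : ℝ) * g y) ^ (2 : ℝ) = w (x - y) * g y ^ 2 := fun y => by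
      rw [ENNReal.mul_rpow_of_nonneg _ _ (by norm_num), hsqrt, ENNReal.rpow_two]
    simp only [e1, e2, hsqrt] at h
    refine (pow_le_pow_left' h 2).trans_eq ?_
    rw [mul_pow, hsqrt', hsqrt', lintegral_sub_left_eq_self]
  calc ∫⁻ x, (∫⁻ y, w (x - y) * g y) ^ 2
      ≤ ∫⁻ x, (∫⁻ z, w z) * ∫⁻ y, w (x - y) * g y ^ 2 := lintegral_mono hpt
    _ = (∫⁻ z, w z) * ∫⁻ x, ∫⁻ y, w (x - y) * g y ^ 2 := by
      refine lintegral_const_mul'' _ (AEMeasurable.lintegral_prod_right' (f := fun z : Space × Space =>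
        w (z.1 - z.2) * g z.2 ^ 2) ?_)
      exact hprod.mul ((hg.comp_snd).pow_const 2)
    _ = (∫⁻ z, w z) * ∫⁻ y, ∫⁻ x, w (x - y) * g y ^ 2 := by
      congr 1
      exact lintegral_lintegral_swap (f := fun x y => w (x - y) * g y ^ 2)
        (hprod.mul ((hg.comp_snd).pow_const 2))
    _ = (∫⁻ x, w x) ^ 2 * ∫⁻ y, g y ^ 2 := by
      rw [pow_two, mul_assoc, ← lintegral_const_mul'' _ (hg.pow_const 2)]
      congr 1
      refine lintegral_congr fun y => ?_
      have hwy : AEMeasurable (fun x => w (x - y)) volume := hw.comp_quasiMeasurePreserving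
        (measurePreserving_sub_right volume y).quasiMeasurePreserving
      rw [lintegral_mul_const'' _ hwy, lintegral_sub_right_eq_self]

/-- With r = 2π this absorbs the factor (2π)³ that the kernel acquires when momenta are written as p
= 2πξ, so the L¹ norm of the dominating function enters unchanged. -/
theorem lintegral_rescale (r : ℝ) (hr : 0 < r) (w : Space → ℝ≥0∞) :
    ∫⁻ x, ENNReal.ofReal (r ^ 3) * w (r • x) = ∫⁻ x, w x := by
  have h := Measure.map_addHaar_smul (volume : Measure Space) hr.ne'
  have h1 : ∫⁻ x, w (r • x) = ENNReal.ofReal ((r ^ 3)⁻¹) * ∫⁻ x, w x := by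
    have e := (Homeomorph.smulOfNeZero r hr.ne' (α := Space)).measurableEmbedding.lintegral_map
      (μ := volume) w
    have h2 : Measure.map (⇑(Homeomorph.smulOfNeZero r hr.ne' (α := Space))) volume
        = ENNReal.ofReal ((r ^ 3)⁻¹) • (volume : Measure Space) := by
      refine Eq.trans h ?_
      rw [finrank_euclideanSpace_fin, abs_of_pos (by positivity)]
    rw [h2, lintegral_smul_measure] at e
    exact e.symm
  rw [lintegral_const_mul' _ _ ENNReal.ofReal_ne_top, h1, ← mul_assoc,
    ← ENNReal.ofReal_mul (by positivity), mul_inv_cancel₀ (by positivity), ENNReal.ofReal_one, one_mul]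

theorem enorm_sq_eq_lintegral (f : OneParticle) : ‖f‖ₑ ^ 2 = ∫⁻ x, ‖f x‖ₑ ^ 2 := by
  have h := eLpNorm_eq_lintegral_rpow_enorm_toReal (p := 2) (f := f) (μ := (volume : Measure Space))
    (by norm_num) (by norm_num)
  rw [Lp.enorm_def, h, ← ENNReal.rpow_two, ← ENNReal.rpow_mul]
  norm_num

/-- Schur's bound for an operator whose momentum space kernel is dominated by a convolution. -/
theorem enorm_le_of_isMomentumKernel {T : OneParticle →L[ℂ] OneParticle}
    {k : Space → Space → Spinor →L[ℂ] Spinor} {h : Space → ℝ} (hT : IsMomentumKernel T k)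
    (hk : ∀ᵐ z : Space × Space ∂(volume.prod volume), ‖k z.1 z.2‖ ≤ h (z.1 - z.2))
    (hh : MemLp h 1 volume) (f : OneParticle) :
    ‖T f‖ₑ ≤ eLpNorm h 1 volume * ‖f‖ₑ := by
  set r : ℝ := 2 * Real.pi with hr
  have hr0 : 0 < r := by positivity
  have hqmp : Measure.QuasiMeasurePreserving (fun x : Space => r • x) volume volume :=
    Measure.quasiMeasurePreserving_smul volume hr0.ne'
  have hk' : ∀ᵐ ξ : Space, ∀ᵐ η : Space, ‖k (r • ξ) (r • η)‖ ≤ h (r • ξ - r • η) := by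
    filter_upwards [hqmp.ae (Measure.ae_ae_of_ae_prod hk)] with ξ hξ
    exact hqmp.ae hξ
  set w : Space → ℝ≥0∞ := fun x => ENNReal.ofReal (r ^ 3) * ‖h (r • x)‖ₑ with hw
  have hwm : AEMeasurable w volume :=
    ((hh.1.comp_quasiMeasurePreserving hqmp).enorm).const_mul _
  have hgm : AEMeasurable (fun η => ‖(𝓕 f : OneParticle) η‖ₑ) volume :=
    (Lp.aestronglyMeasurable _).enorm
  have hpt : ∀ᵐ ξ, ‖(𝓕 (T f) : OneParticle) ξ‖ₑ
      ≤ ∫⁻ η, w (ξ - η) * ‖(𝓕 f : OneParticle) η‖ₑ := by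
    filter_upwards [hT.2 f, hk'] with ξ h1 h2
    rw [h1]
    refine (enorm_integral_le_lintegral_enorm _).trans (lintegral_mono_ae ?_)
    filter_upwards [h2] with η h3
    change _ ≤ ENNReal.ofReal (r ^ 3) * ‖h (r • (ξ - η))‖ₑ * _
    rw [enorm_smul, smul_sub, mul_assoc]
    refine mul_le_mul' (Real.enorm_of_nonneg (by positivity)).le ?_
    refine (ContinuousLinearMap.le_opENorm _ _).trans (mul_le_mul' ?_ le_rfl)
    rw [enorm_le_iff_norm_le]
    exact h3.trans (le_abs_self _)
  have hsq : ‖T f‖ₑ ^ 2 ≤ (eLpNorm h 1 volume * ‖f‖ₑ) ^ 2 := by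
    have e1 : ‖T f‖ₑ = ‖(𝓕 (T f) : OneParticle)‖ₑ := by
      rw [← ofReal_norm, ← ofReal_norm, ← norm_fourierL, fourierL_apply]
    have e2 : ‖f‖ₑ = ‖(𝓕 f : OneParticle)‖ₑ := by
      rw [← ofReal_norm, ← ofReal_norm, ← norm_fourierL, fourierL_apply]
    rw [e1, e2, mul_pow, enorm_sq_eq_lintegral, enorm_sq_eq_lintegral, eLpNorm_one_eq_lintegral_enorm,
      ← lintegral_rescale r hr0 fun x => ‖h x‖ₑ]
    exact (lintegral_mono_ae (hpt.mono fun ξ hξ => pow_le_pow_left' hξ 2)).trans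
      (lintegral_sq_lintegral_sub_mul_le hwm hgm)
  exact (ENNReal.pow_le_pow_left_iff two_ne_zero).1 hsq

theorem norm_lt_of_isMomentumKernel {T : OneParticle →L[ℂ] OneParticle}
    {k : Space → Space → Spinor →L[ℂ] Spinor} {h : Space → ℝ} {β : ℝ}
    (hT : IsMomentumKernel T k)
    (hk : ∀ᵐ z : Space × Space ∂(volume.prod volume), ‖k z.1 z.2‖ ≤ h (z.1 - z.2))
    (hh : MemLp h 1 volume) (hlt : eLpNorm h 1 volume < ENNReal.ofReal β⁻¹) : ‖T‖ < β⁻¹ := by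
  refine lt_of_le_of_lt (b := (eLpNorm h 1 volume).toReal) ?_ ?_
  · refine T.opNorm_le_bound ENNReal.toReal_nonneg fun f => ?_
    have h1 := ENNReal.toReal_mono (ENNReal.mul_ne_top hh.2.ne enorm_ne_top)
      (enorm_le_of_isMomentumKernel hT hk hh f)
    rwa [ENNReal.toReal_mul, toReal_enorm, toReal_enorm] at h1
  · exact (ENNReal.lt_ofReal_iff_toReal_lt hh.2.ne).1 hlt

end DiracEntropy

end

/-! ### Assembly of the theorem -/

theorem mainTheorem8 :
    -- the identity, for a self-adjoint operator and a bounded self-adjoint perturbation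
    (∀ (H : Type*) [NormedAddCommGroup H] [InnerProductSpace ℂ H] [CompleteSpace H]
      (D : H →ₗ.[ℂ] H) (K : H →L[ℂ] H) (β : ℝ),
      IsSelfAdjoint D → IsSelfAdjoint K → 0 < β → ‖K‖ < β⁻¹ →
        (Summable fun k => ‖seriesTerm β D K k‖) ∧
        (β : ℂ) • (K * ∑' k, seriesTerm β D K k) = entropyOp β D K ∧
        relativeEntropy β D K = trace (entropyOp β D K)) ∧
    -- the Dirac field in an external potential
    (∀ (m ε β : ℝ) (A : ℝ → Space → Fin 4 → ℝ),
      0 < m → 0 < ε → 0 < β → IsPotential ε A →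
        -- the identity
        (‖interaction m ε A‖ < β⁻¹ →
          (Summable fun k => ‖seriesTerm β (diracOp m) (interaction m ε A) k‖) ∧
          (β : ℂ) • (interaction m ε A * ∑' k, seriesTerm β (diracOp m) (interaction m ε A) k) =
            entropyOp β (diracOp m) (interaction m ε A) ∧
          relativeEntropy β (diracOp m) (interaction m ε A) =
            trace (entropyOp β (diracOp m) (interaction m ε A))) ∧
        -- finiteness of the trace
        (∀ (k : Space → Space → Spinor →L[ℂ] Spinor) (h : Space → ℝ),
          IsMomentumKernel (interaction m ε A) k →
          (∀ᵐ z : Space × Space ∂(volume.prod volume), ‖k z.1 z.2‖ ≤ h (z.1 - z.2)) →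
          MemLp h 1 volume → MemLp h 2 volume →
          eLpNorm h 1 volume < ENNReal.ofReal β⁻¹ → eLpNorm h 2 volume < ENNReal.ofReal β⁻¹ →
            IsTraceClass (entropyOp β (diracOp m) (interaction m ε A)) ∧
            ∀ (ι : Type*) (b : HilbertBasis ι ℂ OneParticle),
              HasSum (fun i => ⟪b i, entropyOp β (diracOp m) (interaction m ε A) (b i)⟫_ℂ)
                (relativeEntropy β (diracOp m) (interaction m ε A)))) ∧
    -- the finite-dimensional case
    (∀ (H : Type*) [NormedAddCommGroup H] [InnerProductSpace ℂ H] [CompleteSpace H]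
      [FiniteDimensional ℂ H] (D K A B : H →L[ℂ] H) (β : ℝ),
      IsSelfAdjoint D → IsSelfAdjoint K → 0 < β →
      A = cfc (fun x : ℝ => (1 + Real.exp (-β * x))⁻¹) D →
      B = cfc (fun x : ℝ => (1 + Real.exp (-β * x))⁻¹) (D + K) →
        trace (entropyOp β (D.toLinearMap.toPMap ⊤) K) =
          LinearMap.trace ℂ H (((β : ℂ) • (K * cfc (fun x : ℝ => (1 + Real.exp (β * x))⁻¹) D)
            + cfc (fun x : ℝ => Real.log (1 + Real.exp (-β * x))) (D + K)
            - cfc (fun x : ℝ => Real.log (1 + Real.exp (-β * x))) D : H →L[ℂ] H)).toLinearMap ∧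
        trace (entropyOp β (D.toLinearMap.toPMap ⊤) K) =
          LinearMap.trace ℂ H ((A * (CFC.log A - CFC.log B)
            + (1 - A) * (CFC.log (1 - A) - CFC.log (1 - B)) : H →L[ℂ] H)).toLinearMap) := by
  refine ⟨fun H _ _ _ D K β hD hK hβ hKβ => series_identity hβ hD hK hKβ,
    fun m ε β A _ _ hβ hA => ⟨fun hKβ => series_identity hβ (isSelfAdjoint_diracOp m)
      (isSelfAdjoint_interaction m ε A) hKβ, fun k h hk hle h1 _ hlt _ => ?_⟩,
    fun H _ _ _ _ D K A B β hD hK hβ hA hB => trace_entropyOp_of_finiteDimensional hD hK hβ hA hB⟩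
  obtain ⟨X, Y, C, C', hX, hY, hXY⟩ := hA.exists_entropyOp_eq m hβ (isSelfAdjoint_interaction m ε A)
  -- The kernel domination gives ‖𝒦‖ < β⁻¹, which identifies the entropy series with the trace of
  -- 𝔖₁; the factorization X* Y then gives both the trace class property and summability in every
  -- basis.
  rw [(series_identity hβ (isSelfAdjoint_diracOp m) (isSelfAdjoint_interaction m ε A)
    (norm_lt_of_isMomentumKernel hk hle h1 hlt)).2.2, hXY]
  exact ⟨hX.isTraceClass hY, fun ι b => hX.hasSum_trace hY b⟩
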